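/- Let $C=\{xy=0\}\subset\mathbb P^2_{\mathbb C}$ be the nodal curve with the two components $\{y=0\}$ and $\{x=0\}$, both isomorphic to $\mathbb P^1$ and meeting in the node. For $n\ge 0$ the functor which sends a $\mathbb C$-scheme $T$ to the set of closed subschemes of $C\times T$ that are finite and locally free of rank $n$ over $T$ is represented by a $\mathbb C$-scheme $C^{[n]}$, the Hilbert scheme of $n$ points on $C$. For $0\le k\le n$ let $M_{n,k}\subset C^{[n]}$ be the closure, with its reduced scheme structure, of the locus of the length $n$ subschemes of $C$ which do not contain the node and which have length $k$ on the component $\{y=0\}$ and length $n-k$ on the component $\{x=0\}$. Then: 1. For $0\le k\le n$, $M_{n,k}$ is an irreducible component of $C^{[n]}$, and as a $\mathbb C$-scheme $$M_{n,k}\cong \mathrm{Bl}_{\mathbb P^{k-1}\times\mathbb P^{n-k-1}}\bigl(\mathbb P^k\times\mathbb P^{n-k}\bigr),$$ the blowup along the product of a coordinate hyperplane of $\mathbb P^k$ and a coordinate hyperplane of $\mathbb P^{n-k}$ (where $\mathbb P^{-1}=\emptyset$). 2. For $0\le k<n$, the scheme-theoretic intersection $M_{n,k}\cap M_{n,k+1}$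 is isomorphic to $\mathbb P^{n-k-1}\times\mathbb P^k$ as a $\mathbb C$-scheme. 3. If $0\le k$, $k+1<l\le n$, then $M_{n,k}\cap M_{n,l}=\emptyset$. -/

import Mathlib

open CategoryTheory CategoryTheory.Limits AlgebraicGeometry

namespace NodalHilbert

/-- The base `Spec ℂ`. -/
noncomputable abbrev base : Scheme.{0} := Spec (.of ℂ)

/-- The standard grading of the polynomial ring in `N` variables. -/
abbrev grading (N : ℕ) : ℕ → Submodule ℂ (MvPolynomial (Fin N) ℂ) :=
  MvPolynomial.homogeneousSubmodule (Fin N) ℂ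

noncomputable instance (N : ℕ) : GradedAlgebra (grading N) := MvPolynomial.gradedAlgebra

/-- `projSpace N` is `Proj ℂ[X_0, …, X_{N-1}]`, i.e. the projective space `ℙ^{N-1}` with `N`
homogeneous coordinates, as a scheme over `ℂ`; it is empty for `N = 0`. -/
noncomputable def projSpace (N : ℕ) : Over base :=
  Over.mk (Proj.toSpecZero (grading N) ≫
    Spec.map (CommRingCat.ofHom (algebraMap ℂ (grading N 0))))

/-- The graded ring homomorphism `ℂ[X_0, …, X_N] → ℂ[X_0, …, X_{N-1}]` which sends `X_i` to `0`
and the other variables, in order, to `X_0, …, X_{N-1}`. -/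
noncomputable def restrictHom (N : ℕ) (i : Fin (N + 1)) : grading (N + 1) →+*ᵍ grading N where
  __ := (MvPolynomial.aeval (R := ℂ)
    (i.insertNth (α := fun _ => MvPolynomial (Fin N) ℂ) 0 MvPolynomial.X)).toRingHom
  map_mem {d x} hx := by
    have h := MvPolynomial.IsHomogeneous.aeval (n := 1) hx
      (g := i.insertNth (α := fun _ => MvPolynomial (Fin N) ℂ) 0 MvPolynomial.X) (fun j => by
        refine Fin.succAboveCases i ?_ (fun j => ?_) j
        · simpa using MvPolynomial.isHomogeneous_zero _ _ _
        · simpa using MvPolynomial.isHomogeneous_X _ _)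
    simpa using h

lemma restrictHom_rename (N : ℕ) (i : Fin (N + 1)) (x : MvPolynomial (Fin N) ℂ) :
    restrictHom N i (MvPolynomial.rename i.succAbove x) = x := by
  change MvPolynomial.aeval _ (MvPolynomial.rename i.succAbove x) = x
  rw [MvPolynomial.aeval_rename]
  have : (i.insertNth (α := fun _ => MvPolynomial (Fin N) ℂ) 0 MvPolynomial.X) ∘ i.succAbove
      = MvPolynomial.X := by
    ext1 j; simp
  rw [this]; simp

lemma irrelevant_le_map_restrictHom (N : ℕ) (i : Fin (N + 1)) :
    HomogeneousIdeal.irrelevant (grading N) ≤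
      (HomogeneousIdeal.irrelevant (grading (N + 1))).map (restrictHom N i) := by
  change (HomogeneousIdeal.irrelevant (grading N)).toIdeal ≤ _
  refine (HomogeneousIdeal.toIdeal_irrelevant_le _).mpr fun d hd x hx ↦ ?_
  have hx' : x ∈ grading N d := hx
  rw [← restrictHom_rename N i x]
  refine Ideal.mem_map_of_mem (restrictHom N i) ?_
  have := HomogeneousIdeal.mem_irrelevant_of_mem (𝒜 := grading (N+1)) hd
    (show MvPolynomial.rename i.succAbove x ∈ grading (N+1) d from
      MvPolynomial.IsHomogeneous.rename_isHomogeneous hx')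
  exact this

lemma map_restrictHom_structure (N : ℕ) (i : Fin (N + 1)) :
    Proj.map (restrictHom N i) (irrelevant_le_map_restrictHom N i) ≫ (projSpace (N + 1)).hom =
      (projSpace N).hom := by
  have key : ∀ (d : ℕ) (hd : 0 < d) (s : MvPolynomial (Fin (N + 1)) ℂ)
      (hs : s ∈ grading (N + 1) d) (hs' : restrictHom N i s ∈ grading N d),
      Proj.awayι (grading N) (restrictHom N i s) hs' hd ≫
        Proj.map (restrictHom N i) (irrelevant_le_map_restrictHom N i) ≫
          Proj.toSpecZero (grading (N + 1)) ≫
            Spec.map (CommRingCat.ofHom (algebraMap ℂ (grading (N + 1) 0))) =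
      Proj.awayι (grading N) (restrictHom N i s) hs' hd ≫
        Proj.toSpecZero (grading N) ≫
          Spec.map (CommRingCat.ofHom (algebraMap ℂ (grading N 0))) := by
    intro d hd s hs hs'
    rw [Proj.awayι_comp_map_assoc (restrictHom N i) (irrelevant_le_map_restrictHom N i) hd s hs,
      Proj.awayι_toSpecZero_assoc, Proj.awayι_toSpecZero_assoc]
    simp only [← Spec.map_comp, ← CommRingCat.ofHom_comp]
    congr 2
    ext z
    have hz : restrictHom N i (algebraMap ℂ _ z) = algebraMap ℂ _ z :=
      (MvPolynomial.aeval _).commutes z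
    change Localization.mk (restrictHom N i (algebraMap ℂ _ z)) ⟨restrictHom N i 1, _⟩ =
      Localization.mk (algebraMap ℂ _ z) ⟨1, _⟩
    simp only [hz, map_one]
  exact (Proj.mapAffineOpenCover _ (irrelevant_le_map_restrictHom N i)).openCover.hom_ext _ _
    fun s ↦ key s.1 s.1.2 s.2 s.2.2 _

/-- The inclusion of the coordinate hyperplane `X_i = 0` of `ℙ^N` as a `ℙ^{N-1}`. -/
noncomputable def hyperplane (N : ℕ) (i : Fin (N + 1)) : projSpace N ⟶ projSpace (N + 1) :=
  Over.homMk (Proj.map (restrictHom N i) (irrelevant_le_map_restrictHom N i))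
    (map_restrictHom_structure N i)

/-- The ideal sheaf of the curve `xy = 0` in `ℙ²` with coordinates `x = X_0`, `y = X_1`, `z = X_2`:
the product of the ideal sheaves of the lines `x = 0` and `y = 0`. -/
noncomputable def nodeIdeal : (projSpace 3).left.IdealSheafData :=
  (hyperplane 2 0).left.ker * (hyperplane 2 1).left.ker

/-- The nodal curve `C = {xy = 0} ⊆ ℙ²`, as a scheme over `ℂ`. -/
noncomputable def node : Over base :=
  Over.mk (nodeIdeal.subschemeι ≫ (projSpace 3).hom)

/-- The ideal sheaf on `C = {xy = 0}` of its irreducible component `y = 0`. -/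
noncomputable def xAxis : node.left.IdealSheafData :=
  (hyperplane 2 1).left.ker.comap nodeIdeal.subschemeι

/-- The ideal sheaf on `C = {xy = 0}` of its irreducible component `x = 0`. -/
noncomputable def yAxis : node.left.IdealSheafData :=
  (hyperplane 2 0).left.ker.comap nodeIdeal.subschemeι

/-- The fibre product over `Spec ℂ`. -/
noncomputable abbrev fiberProd (X Y : Over base) : Over base :=
  Over.mk (pullback.fst X.hom Y.hom ≫ X.hom)

/-- The morphism `f × g` of fibre products over `Spec ℂ`. -/
noncomputable abbrev fiberProdMap {X X' Y Y' : Over base} (f : X ⟶ X') (g : Y ⟶ Y') :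
    (fiberProd X Y).left ⟶ (fiberProd X' Y').left :=
  pullback.map X.hom Y.hom X'.hom Y'.hom f.left g.left (𝟙 base)
    (by simp) (by simp)

/-- The closed subscheme `Z` of `X ×_ℂ T` with ideal sheaf `J` is finite and locally free of
rank `n` over `T`, that is, `Z` is a flat family of length `n` subschemes of `X` parametrised
by `T`. -/
structure IsFamily (n : ℕ) {X T : Over base} (J : (fiberProd X T).left.IdealSheafData) : Prop where
  finite : IsFinite (J.subschemeι ≫ pullback.snd X.hom T.hom)
  flat : Flat (J.subschemeι ≫ pullback.snd X.hom T.hom)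
  locallyOfFinitePresentation :
    LocallyOfFinitePresentation (J.subschemeι ≫ pullback.snd X.hom T.hom)
  finrank_eq : ∀ t : T.left,
    Scheme.Hom.finrank (J.subschemeι ≫ pullback.snd X.hom T.hom) t = n

/-- `H` is the Hilbert scheme `X^{[n]}` of `n` points on `X`, with universal family `𝒵`: every
family over every `ℂ`-scheme `T` is the pullback of `𝒵` along a unique `ℂ`-morphism `T ⟶ H`. -/
structure IsHilbertScheme (X : Over base) (n : ℕ) (H : Over base)
    (𝒵 : (fiberProd X H).left.IdealSheafData) : Prop where
  isFamily : IsFamily n 𝒵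
  existsUnique : ∀ (T : Over base) (J : (fiberProd X T).left.IdealSheafData), IsFamily n J →
    ∃! f : T ⟶ H, J = 𝒵.comap (fiberProdMap (𝟙 X) f)

/-- The embedding `X ⟶ X ×_ℂ H` of `X` as the fibre over a `ℂ`-point `z` of `H`. -/
noncomputable def slice (X : Over base) {H : Over base} (z : Over.mk (𝟙 base) ⟶ H) :
    X.left ⟶ (fiberProd X H).left :=
  pullback.lift (𝟙 X.left) (X.hom ≫ z.left) (by simp)

/-- For a closed subscheme of `X` with ideal sheaf `I` which is finite over `Spec ℂ`: its length. -/
noncomputable def length (X : Over base) (I : X.left.IdealSheafData) : ℕ :=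
  Scheme.Hom.finrank (I.subschemeι ≫ X.hom) (IsLocalRing.closedPoint ℂ)

section Components

variable (n k : ℕ) (H : Over base) (𝒵 : (fiberProd node H).left.IdealSheafData)

/-- The locus of those `ℂ`-points of `C^{[n]}` that are subschemes of `C` which do not contain the
node, and which meet the component `y = 0` in length `k` and the component `x = 0` in length
`n - k`. -/
def genericLocus : Set H.left :=
  {p | ∃ z : Over.mk (𝟙 base) ⟶ H, z.left (IsLocalRing.closedPoint ℂ) = p ∧
    𝒵.comap (slice node z) ⊔ xAxis ⊔ yAxis = ⊤ ∧
    length node (𝒵.comap (slice node z) ⊔ xAxis) = k ∧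
    length node (𝒵.comap (slice node z) ⊔ yAxis) = n - k}

/-- The ideal sheaf of `M_{n,k}`, the closure of the generic locus with its reduced structure. -/
noncomputable def componentIdeal : H.left.IdealSheafData :=
  Scheme.IdealSheafData.vanishingIdeal (.closure (genericLocus n k H 𝒵))

/-- The closed subscheme `M_{n,k}` of `C^{[n]}`. -/
noncomputable def component : Over base :=
  Over.mk ((componentIdeal n k H 𝒵).subschemeι ≫ H.hom)

/-- The scheme-theoretic intersection `M_{n,k} ∩ M_{n,l}` in `C^{[n]}`. -/
noncomputable def intersection (l : ℕ) : Over base :=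
  Over.mk ((componentIdeal n k H 𝒵 ⊔ componentIdeal n l H 𝒵).subschemeι ≫ H.hom)

end Components

/-- The closed subscheme with ideal sheaf `I` is an effective Cartier divisor: locally, `I` is
generated by one element which is not a zero divisor. -/
def IsEffectiveCartier {X : Scheme.{0}} (I : X.IdealSheafData) : Prop :=
  ∀ x : X, ∃ U : X.affineOpens, x ∈ U.1 ∧
    ∃ f ∈ nonZeroDivisors Γ(X, U.1), I.ideal U = Ideal.span {f}

/-- `π : B ⟶ X` is the blowup of `X` along the closed subscheme with ideal sheaf `I`: it is
terminal among the morphisms to `X` for which the inverse image of this subscheme is an effective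
Cartier divisor. -/
structure IsBlowup {B X : Scheme.{0}} (π : B ⟶ X) (I : X.IdealSheafData) : Prop where
  isEffectiveCartier : IsEffectiveCartier (I.comap π)
  existsUnique : ∀ (T : Scheme.{0}) (f : T ⟶ X), IsEffectiveCartier (I.comap f) →
    ∃! g : T ⟶ B, g ≫ π = f

/-- The ideal sheaf of `ℙ^{k-1} × ℙ^{l-1}`, the product of two coordinate hyperplanes, in
`ℙ^k × ℙ^l`. -/
noncomputable def center (k l : ℕ) :
    (fiberProd (projSpace (k + 1)) (projSpace (l + 1))).left.IdealSheafData :=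
  (fiberProdMap (hyperplane k 0) (hyperplane l 0)).ker

end NodalHilbert

/-! Everything rests on an explicit description of the finite quotients of R[x,y]/(xy). Let B be
such a quotient, free over R with basis 1, x, …, x^a, y, …, y^b. Expanding x^(a+1) and y^(b+1) in
the basis and using xy = 0 gives relations x P(x) = u Q(y) and y Q(y) = v P(x) with P, Q monic of
degrees a, b and uv = 0 (`exists_param`). The data u, v, P, Q are unique (`Param.Rel.unique`), and
every such datum defines an algebra with this basis (`NodeAlg.linearIndependent`). Over a field
every nonzero finite quotient has a basis of this kind (`exists_nodeMonomial_basis`). So for fixed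
a, b with a + 1 + b = n these quotients are parametrised by the hypersurface uv = 0 in an affine
space.

The affine pieces z ≠ α(x + y) of C, for complex α, all contain the node, and a given point of C
lies in all but finitely many of them. Hence a finite subscheme lies in one of them. For n > 0 the
Hilbert functor, a Zariski sheaf because ideal sheaves glue, is therefore covered by open
subfunctors represented by the spectra of ℂ[u, v, coefficients of P and Q]/(uv), and it is
representable.

In such a chart a complex point avoids the node if and only if v P(0) ≠ 0 or u Q(0) ≠ 0. In the
first case u = 0 and the lengths on y = 0 and x = 0 are a and b + 1; in the second case v = 0 and
they are a + 1 and b. So the branch u = 0 is M_{n,a}, the branch v = 0 is M_{n,a+1}, and no other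
M_{n,k} meets the chart. This gives the irreducible components, the empty intersections, and the
equations u = v = 0 for the intersection of two neighbours.

The global description uses det(1 - T x) on B, the reversal of X P - u Q(0). Passing from α to β
replaces x by x/(1 - (β - α)(x + y)); because xy = 0, this only translates the polynomial in T, up
to a unit factor (`Param.Rel.ex_shift`). After a translation by α it becomes a binary form which is
independent of the chart up to a unit. On M_{n,k} the forms for x and for y have degrees at most k
and n - k, and their coefficients define a morphism to ℙ^k × ℙ^{n-k}. On the branch u = 0 their top
coefficients are P(0) and -v P(0), so the centre pulls back to the divisor P(0) = 0. Conversely,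
suppose that the top coefficients of two forms generate an ideal (g) with g regular, and write them
as eg and fg; then e and f are comaximal. Where e is invertible, v = -f/e and u = 0 complete the
forms to a unique family; where f is invertible, the axes change roles. This is the universal
property of the blowup (`IsHilbertScheme.IsFormMap.isBlowup`). On the intersection of two neighbours
u = v = 0, no condition links the forms, and the result is a product of projective spaces
(`IsHilbertScheme.nonempty_intersection_iso`). -/

namespace NodalHilbert

/-! ### Monic polynomials, parameters, and the span and independence of the monomials -/

section Algebra

open Polynomial TensorProduct

/-- The monic polynomial `X^a + ∑ c_i X^i`. -/
noncomputable def monicPoly {R : Type*} [CommRing R] {a : ℕ} (c : Fin a → R) : R[X] :=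
  X ^ a + ∑ i, C (c i) * X ^ (i : ℕ)

section

variable {R S : Type*} [CommRing R] [CommRing S] {a b : ℕ}

lemma degree_sum_fin_lt' (c : Fin a → R) : (∑ i, C (c i) * X ^ (i : ℕ)).degree < (a : WithBot ℕ) := by
  refine (degree_sum_le _ _).trans_lt ((Finset.sup_lt_iff (WithBot.bot_lt_coe a)).2 fun i _ ↦ ?_)
  exact (degree_C_mul_X_pow_le _ _).trans_lt (WithBot.coe_lt_coe.2 i.2)

lemma monicPoly_monic (c : Fin a → R) : (monicPoly c).Monic :=
  monic_X_pow_add (degree_sum_fin_lt' c)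

lemma natDegree_monicPoly [Nontrivial R] (c : Fin a → R) : (monicPoly c).natDegree = a :=
  natDegree_eq_of_degree_eq_some <| by
    rw [monicPoly, degree_add_eq_left_of_degree_lt, degree_X_pow]
    rw [degree_X_pow]; exact degree_sum_fin_lt' c

lemma natDegree_monicPoly_le (c : Fin a → R) : (monicPoly c).natDegree ≤ a := by
  nontriviality R
  exact (natDegree_monicPoly c).le

lemma map_monicPoly (g : R →+* S) (c : Fin a → R) :
    (monicPoly c).map g = monicPoly (fun i ↦ g (c i)) := by
  simp [monicPoly, Polynomial.map_sum]

lemma coeff_monicPoly (c : Fin a → R) (i : Fin a) : (monicPoly c).coeff i = c i := by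
  have : ∀ j : Fin a, (C (c j) * X ^ (j : ℕ) : R[X]).coeff i = if i = j then c j else 0 := by
    intro j; simp [coeff_C_mul, coeff_X_pow, Fin.ext_iff]
  rw [monicPoly, coeff_add, finsetSum_coeff]
  simp [this, coeff_X_pow, i.2.ne]

lemma coeff_monicPoly_self (c : Fin a → R) : (monicPoly c).coeff a = 1 := by
  have h := coeff_eq_zero_of_degree_lt (degree_sum_fin_lt' c)
  rw [monicPoly, coeff_add, h]; simp

lemma monicPoly_injective {c c' : Fin a → R} (h : monicPoly c = monicPoly c') : c = c' := by
  ext i; rw [← coeff_monicPoly c, h, coeff_monicPoly]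

lemma exists_eq_monicPoly {p : R[X]} (hp : p.natDegree ≤ a) (h1 : p.coeff a = 1) :
    p = monicPoly (fun i : Fin a ↦ p.coeff i) := by
  ext i
  rcases lt_trichotomy i a with h | rfl | h
  · rw [coeff_monicPoly _ ⟨i, h⟩]
  · rw [coeff_monicPoly_self, h1]
  · rw [coeff_eq_zero_of_natDegree_lt (hp.trans_lt h),
      coeff_eq_zero_of_natDegree_lt ((natDegree_monicPoly_le _).trans_lt h)]

lemma aeval_monicPoly {B : Type*} [CommRing B] [Algebra R B] (c : Fin a → R) (x : B) :
    aeval x (monicPoly c) = x ^ a + ∑ i, c i • x ^ (i : ℕ) := by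
  simp [monicPoly, Algebra.smul_def]

end

/-- The parameters `(u, v, P, Q)` with `u v = 0` of a quotient of `R[x, y]/(xy)` with basis
`1, x, …, x^a, y, …, y^b`. -/
@[ext] structure Param (R : Type*) [CommRing R] (a b : ℕ) where
  u : R
  v : R
  c : Fin a → R
  f : Fin b → R
  huv : u * v = 0

namespace Param

variable {R S : Type*} [CommRing R] [CommRing S] {a b : ℕ} (p : Param R a b)

noncomputable abbrev P : R[X] := monicPoly p.c
noncomputable abbrev Q : R[X] := monicPoly p.f

/-- The image of the parameters under a ring homomorphism. -/
@[simps] def map (g : R →+* S) : Param S a b where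
  u := g p.u
  v := g p.v
  c i := g (p.c i)
  f i := g (p.f i)
  huv := by rw [← map_mul, p.huv, map_zero]

/-- Exchange of the two axes. -/
@[simps] def swap : Param R b a where
  u := p.v
  v := p.u
  c := p.f
  f := p.c
  huv := by rw [mul_comm, p.huv]

lemma P_map (g : R →+* S) : (p.map g).P = p.P.map g := (map_monicPoly g p.c).symm
lemma Q_map (g : R →+* S) : (p.map g).Q = p.Q.map g := (map_monicPoly g p.f).symm

/-- The relations `xy = 0`, `x P(x) = u Q(y)`, `y Q(y) = v P(x)`. -/
structure Rel {B : Type*} [CommRing B] [Algebra R B] (x y : B) : Prop where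
  xy : x * y = 0
  hx : x * aeval x p.P = p.u • aeval y p.Q
  hy : y * aeval y p.Q = p.v • aeval x p.P

end Param

/-- The monomials `1, x, …, x^a, y, …, y^b`. -/
def nodeMonomial (a b : ℕ) {B : Type*} [CommRing B] (x y : B) : Fin (a + 1) ⊕ Fin b → B :=
  Sum.elim (fun i ↦ x ^ (i : ℕ)) (fun j ↦ y ^ (j + 1 : ℕ))

section

variable {R : Type*} [CommRing R] {a b : ℕ} {B : Type*} [CommRing B] [Algebra R B]

lemma Param.Rel.swap {p : Param R a b} {x y : B} (h : p.Rel x y) : p.swap.Rel y x :=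
  ⟨by rw [mul_comm, h.xy], h.hy, h.hx⟩

lemma Param.Rel.map_algHom {p : Param R a b} {x y : B} (h : p.Rel x y) {B' : Type*} [CommRing B']
    [Algebra R B'] (g : B →ₐ[R] B') : p.Rel (g x) (g y) := by
  refine ⟨by rw [← map_mul, h.xy, map_zero], ?_, ?_⟩
  · rw [Polynomial.aeval_algHom_apply, ← map_mul, h.hx, map_smul, Polynomial.aeval_algHom_apply]
  · rw [Polynomial.aeval_algHom_apply, ← map_mul, h.hy, map_smul, Polynomial.aeval_algHom_apply]

lemma x_pow_mem_span (x y : B) {i : ℕ} (hi : i ≤ a) :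
    x ^ i ∈ Submodule.span R (Set.range (nodeMonomial a b x y)) :=
  Submodule.subset_span ⟨Sum.inl ⟨i, by omega⟩, rfl⟩

lemma y_pow_mem_span (x y : B) {i : ℕ} (hi : i ≤ b) :
    y ^ i ∈ Submodule.span R (Set.range (nodeMonomial a b x y)) := by
  rcases i with _ | i
  · simpa using x_pow_mem_span (R := R) (b := b) x y (Nat.zero_le a)
  · exact Submodule.subset_span ⟨Sum.inr ⟨i, by omega⟩, rfl⟩

lemma aeval_x_mem_span (x y : B) {g : R[X]} (hg : g.natDegree ≤ a) :
    aeval x g ∈ Submodule.span R (Set.range (nodeMonomial a b x y)) := by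
  rw [aeval_eq_sum_range]
  exact Submodule.sum_mem _ fun i hi ↦ Submodule.smul_mem _ _
    (x_pow_mem_span x y ((Finset.mem_range_succ_iff.1 hi).trans hg))

lemma aeval_y_mem_span (x y : B) {g : R[X]} (hg : g.natDegree ≤ b) :
    aeval y g ∈ Submodule.span R (Set.range (nodeMonomial a b x y)) := by
  rw [aeval_eq_sum_range]
  exact Submodule.sum_mem _ fun i hi ↦ Submodule.smul_mem _ _
    (y_pow_mem_span x y ((Finset.mem_range_succ_iff.1 hi).trans hg))

/-- A submodule which contains `1` and is stable under generators of the algebra is everything. -/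
lemma eq_top_of_stable {s : Set B} (hs : Algebra.adjoin R s = ⊤) {M : Submodule R B}
    (h1 : (1 : B) ∈ M) (h : ∀ z ∈ s, ∀ m ∈ M, z * m ∈ M) : M = ⊤ := by
  have key : ∀ z ∈ Algebra.adjoin R s, ∀ m ∈ M, z * m ∈ M := by
    intro z hz
    induction hz using Algebra.adjoin_induction with
    | mem z hz => exact h z hz
    | algebraMap r => intro m hm; rw [← Algebra.smul_def]; exact M.smul_mem _ hm
    | add y z _ _ hy hz => intro m hm; rw [add_mul]; exact M.add_mem (hy m hm) (hz m hm)
    | mul y z _ _ hy hz => intro m hm; rw [mul_assoc]; exact hy _ (hz m hm)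
  rw [eq_top_iff]
  intro z _
  simpa using key z (by rw [hs]; trivial) 1 h1

/-- Multiplication by x or y moves a monomial to the next one or to 0, except at the ends x^a and
y^b, where the two hypotheses apply. So the span contains 1 and is stable under the generators. -/
lemma span_nodeMonomial_of_pow {x y : B} (hxy : x * y = 0)
    (hx : x ^ (a + 1) ∈ Submodule.span R (Set.range (nodeMonomial a b x y)))
    (hy : y ^ (b + 1) ∈ Submodule.span R (Set.range (nodeMonomial a b x y)))
    (hgen : Algebra.adjoin R {x, y} = ⊤) :
    Submodule.span R (Set.range (nodeMonomial a b x y)) = ⊤ := by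
  refine eq_top_of_stable hgen (by simpa using x_pow_mem_span (R := R) (b := b) x y a.zero_le) ?_
  have aux : ∀ z : B, (∀ i, z * nodeMonomial a b x y i ∈
      Submodule.span R (Set.range (nodeMonomial a b x y))) →
      ∀ m ∈ Submodule.span R (Set.range (nodeMonomial a b x y)),
        z * m ∈ Submodule.span R (Set.range (nodeMonomial a b x y)) := by
    intro z hz m hm
    induction hm using Submodule.span_induction with
    | mem m hm => obtain ⟨i, rfl⟩ := hm; exact hz i
    | zero => simp
    | add m m' _ _ h h' => rw [mul_add]; exact Submodule.add_mem _ h h'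
    | smul r m _ h => rw [mul_smul_comm]; exact Submodule.smul_mem _ _ h
  rintro z (rfl | rfl) <;> refine aux _ ?_ <;> rintro (i | i)
  · change z * z ^ (i : ℕ) ∈ _
    rw [← pow_succ']
    rcases (Nat.lt_succ_iff.1 i.2).lt_or_eq with h | h
    · exact x_pow_mem_span _ _ h
    · rw [h]; exact hx
  · change z * y ^ (i + 1 : ℕ) ∈ _
    rw [pow_succ', ← mul_assoc, hxy, zero_mul]; exact Submodule.zero_mem _
  · change z * x ^ (i : ℕ) ∈ _
    rcases Nat.eq_zero_or_pos (i : ℕ) with h | h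
    · rw [h, pow_zero, mul_one]
      -- y itself is in the list only for b > 0; for b = 0 the hypothesis on y^(b+1) supplies it.
      rcases Nat.eq_zero_or_pos b with rfl | hb
      · simpa using hy
      · simpa using y_pow_mem_span (R := R) (a := a) x z (show 1 ≤ b from hb)
    · obtain ⟨j, hj⟩ := Nat.exists_eq_succ_of_ne_zero h.ne'
      rw [hj, pow_succ', ← mul_assoc, mul_comm z x, hxy, zero_mul]; exact Submodule.zero_mem _
  · change z * z ^ (i + 1 : ℕ) ∈ _
    rw [← pow_succ']
    rcases (Nat.succ_le_iff.2 i.2).lt_or_eq with h | h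
    · exact y_pow_mem_span _ _ h
    · rw [show (i : ℕ) + 1 + 1 = b + 1 by omega]; exact hy

lemma natDegree_X_mul_sub_le {g : R[X]} (hg : g.natDegree ≤ a) (h1 : g.coeff a = 1) :
    (X ^ (a + 1) - X * g : R[X]).natDegree ≤ a := by
  rw [natDegree_le_iff_coeff_eq_zero]
  intro N hN
  obtain ⟨N, rfl⟩ := Nat.exists_eq_succ_of_ne_zero (show N ≠ 0 by omega)
  rw [coeff_sub, coeff_X_mul, coeff_X_pow]
  split_ifs with h
  · rw [show N = a by omega, h1, sub_self]
  · rw [coeff_eq_zero_of_natDegree_lt (show g.natDegree < N by omega), sub_zero]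

/-- X P is monic of degree a + 1, so the relation x P(x) = u Q(y) expresses x^(a+1) by monomials of
the list. -/
lemma Param.Rel.x_pow_mem {p : Param R a b} {x y : B} (h : p.Rel x y) :
    x ^ (a + 1) ∈ Submodule.span R (Set.range (nodeMonomial a b x y)) := by
  have : x ^ (a + 1) = aeval x (X ^ (a + 1) - X * p.P : R[X]) + p.u • aeval y p.Q := by
    rw [← h.hx]; simp
  rw [this]
  exact Submodule.add_mem _ (aeval_x_mem_span _ _
    (natDegree_X_mul_sub_le (natDegree_monicPoly_le _) (coeff_monicPoly_self _)))
    (Submodule.smul_mem _ _ (aeval_y_mem_span _ _ (natDegree_monicPoly_le _)))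

lemma Param.Rel.y_pow_mem {p : Param R a b} {x y : B} (h : p.Rel x y) :
    y ^ (b + 1) ∈ Submodule.span R (Set.range (nodeMonomial a b x y)) := by
  have : y ^ (b + 1) = aeval y (X ^ (b + 1) - X * p.Q : R[X]) + p.v • aeval x p.P := by
    rw [← h.hy]; simp
  rw [this]
  exact Submodule.add_mem _ (aeval_y_mem_span _ _
    (natDegree_X_mul_sub_le (natDegree_monicPoly_le _) (coeff_monicPoly_self _)))
    (Submodule.smul_mem _ _ (aeval_x_mem_span _ _ (natDegree_monicPoly_le _)))

lemma Param.Rel.span_eq_top {p : Param R a b} {x y : B} (h : p.Rel x y)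
    (hgen : Algebra.adjoin R {x, y} = ⊤) :
    Submodule.span R (Set.range (nodeMonomial a b x y)) = ⊤ :=
  span_nodeMonomial_of_pow h.xy h.x_pow_mem h.y_pow_mem hgen

/-- Linear combinations of the monomials, written with polynomials. -/
lemma exists_poly_of_mem_span {x y : B} {z : B}
    (hz : z ∈ Submodule.span R (Set.range (nodeMonomial a b x y))) :
    ∃ g h : R[X], g.natDegree ≤ a ∧ h.natDegree ≤ b ∧ h.coeff 0 = 0 ∧
      z = aeval x g + aeval y h := by
  induction hz using Submodule.span_induction with
  | mem m hm =>
    obtain ⟨i | i, rfl⟩ := hm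
    · exact ⟨X ^ (i : ℕ), 0, (natDegree_X_pow_le _).trans (by omega), by simp, by simp,
        by simp [nodeMonomial]⟩
    · exact ⟨0, X ^ (i + 1 : ℕ), by simp, (natDegree_X_pow_le _).trans (by omega), by simp,
        by simp [nodeMonomial]⟩
  | zero => exact ⟨0, 0, by simp⟩
  | add m m' _ _ h h' =>
    obtain ⟨g, h, h1, h2, h3, rfl⟩ := h
    obtain ⟨g', h', h1', h2', h3', rfl⟩ := h'
    exact ⟨g + g', h + h', natDegree_add_le_of_degree_le h1 h1',
      natDegree_add_le_of_degree_le h2 h2', by simp [h3, h3'], by simp only [map_add]; ring⟩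
  | smul r m _ h =>
    obtain ⟨g, h, h1, h2, h3, rfl⟩ := h
    exact ⟨r • g, r • h, (natDegree_smul_le _ _).trans h1, (natDegree_smul_le _ _).trans h2,
      by simp [h3], by simp⟩

/-- Linear independence of the monomials, written with polynomials. -/
lemma linearIndependent_nodeMonomial_iff {x y : B} :
    LinearIndependent R (nodeMonomial a b x y) ↔ ∀ g h : R[X], g.natDegree ≤ a → h.natDegree ≤ b →
      h.coeff 0 = 0 → aeval x g + aeval y h = 0 → g = 0 ∧ h = 0 := by
  have key : ∀ g h : R[X], g.natDegree ≤ a → h.natDegree ≤ b → h.coeff 0 = 0 →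
      aeval x g + aeval y h = ∑ i, (Sum.elim (fun i : Fin (a + 1) ↦ g.coeff i)
        (fun j : Fin b ↦ h.coeff (j + 1)) i) • nodeMonomial a b x y i := by
    intro g h hg hh h0
    rw [Fintype.sum_sum_type, aeval_eq_sum_range' (Nat.lt_succ_of_le hg),
      aeval_eq_sum_range' (Nat.lt_succ_of_le hh), Finset.sum_range, Finset.sum_range,
      Fin.sum_univ_succ (n := b)]
    simp [h0, nodeMonomial]
  rw [Fintype.linearIndependent_iff]
  constructor
  · intro H g h hg hh h0 e
    rw [key g h hg hh h0] at e
    have := H _ e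
    constructor
    · ext i
      rcases lt_or_ge i (a + 1) with hi | hi
      · simpa using this (Sum.inl ⟨i, hi⟩)
      · rw [coeff_eq_zero_of_natDegree_lt (by omega), coeff_zero]
    · ext i
      rcases i with _ | i
      · simpa using h0
      rcases lt_or_ge i b with hi | hi
      · simpa using this (Sum.inr ⟨i, hi⟩)
      · rw [coeff_eq_zero_of_natDegree_lt (by omega), coeff_zero]
  · intro H w hw
    let g : R[X] := ∑ i : Fin (a + 1), C (w (Sum.inl i)) * X ^ (i : ℕ)
    let h : R[X] := X * ∑ i : Fin b, C (w (Sum.inr i)) * X ^ (i : ℕ)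
    have hgc : ∀ i : Fin (a + 1), g.coeff i = w (Sum.inl i) := by
      intro i
      have : ∀ j : Fin (a + 1), (C (w (Sum.inl j)) * X ^ (j : ℕ) : R[X]).coeff i =
          if i = j then w (Sum.inl j) else 0 := by
        intro j; simp [coeff_C_mul, coeff_X_pow, Fin.ext_iff]
      simp [g, finsetSum_coeff, -coeff_C_mul, this]
    have hhc : ∀ i : Fin b, h.coeff (i + 1) = w (Sum.inr i) := by
      intro i
      have : ∀ j : Fin b, (C (w (Sum.inr j)) * X ^ (j : ℕ) : R[X]).coeff i =
          if i = j then w (Sum.inr j) else 0 := by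
        intro j; simp [coeff_C_mul, coeff_X_pow, Fin.ext_iff]
      simp [h, coeff_X_mul, finsetSum_coeff, -coeff_C_mul, this]
    have hg : g.natDegree ≤ a := Nat.lt_succ_iff.1 <| by
      by_cases h0 : g = 0
      · simp [h0]
      · exact (natDegree_lt_iff_degree_lt h0).2
          (degree_sum_fin_lt' (fun i : Fin (a + 1) ↦ w (Sum.inl i)))
    have hh : h.natDegree ≤ b := by
      by_cases h0 : (∑ i : Fin b, C (w (Sum.inr i)) * X ^ (i : ℕ) : R[X]) = 0
      · simp [h, h0]
      · have := (natDegree_lt_iff_degree_lt h0).2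
          (degree_sum_fin_lt' (fun i : Fin b ↦ w (Sum.inr i)))
        have h2 : h.natDegree ≤ 1 + _ := natDegree_mul_le_of_le natDegree_X_le le_rfl
        omega
    have e := key g h hg hh (by simp [h])
    obtain ⟨hg0, hh0⟩ := H g h hg hh (by simp [h]) (by
      rw [e, ← hw]
      refine Finset.sum_congr rfl fun i _ ↦ ?_
      rcases i with i | i
      · simp only [Sum.elim_inl, hgc]
      · simp only [Sum.elim_inr, hhc])
    rintro (i | i)
    · rw [← hgc, hg0, coeff_zero]
    · rw [← hhc, hh0, coeff_zero]

end

end Algebra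

/-! ### Existence and uniqueness of the parameters; the standard algebra and its basis -/

section Algebra

open Polynomial TensorProduct

section

variable {R : Type*} [CommRing R] {a b : ℕ} {B : Type*} [CommRing B] [Algebra R B]

lemma natDegree_sub_le' {p q : R[X]} {n : ℕ} (hp : p.natDegree ≤ n) (hq : q.natDegree ≤ n) :
    (p - q).natDegree ≤ n :=
  (natDegree_sub_le_of_le hp hq).trans (max_self n).le

lemma nodeMonomial_swap_range (x y : B) :
    Submodule.span R (Set.range (nodeMonomial a b x y)) =
      Submodule.span R (Set.range (nodeMonomial b a y x)) := by
  refine le_antisymm (Submodule.span_le.2 ?_) (Submodule.span_le.2 ?_) <;>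
  rintro _ ⟨i | i, rfl⟩
  · exact y_pow_mem_span _ _ (Nat.lt_succ_iff.1 i.2)
  · exact x_pow_mem_span _ _ i.2
  · exact y_pow_mem_span _ _ (Nat.lt_succ_iff.1 i.2)
  · exact x_pow_mem_span _ _ i.2

/-- The two lists have the same members, but 1 counts as a power of x in one and of y in the other.
In the criterion with polynomials the constant term is carried from one polynomial to the other. -/
lemma linearIndependent_nodeMonomial_swap {x y : B}
    (h : LinearIndependent R (nodeMonomial a b x y)) :
    LinearIndependent R (nodeMonomial b a y x) := by
  rw [linearIndependent_nodeMonomial_iff] at h ⊢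
  intro g k hg hk hk0 e
  have := h (k + C (g.coeff 0)) (g - C (g.coeff 0))
    ((natDegree_add_le_of_degree_le hk (by simp))) ((natDegree_sub_C).le.trans hg) (by simp)
    (by rw [← e]; simp only [map_add, map_sub, aeval_C]; ring)
  have hg0 : g.coeff 0 = 0 := by
    have h1 := congrArg (coeff · 0) this.1
    simpa [hk0] using h1
  simpa [hg0, and_comm] using this

/-- y D(y) has no constant term and degree at most b, so this is a relation between the monomials of
the list. -/
lemma eq_zero_of_relation {x y : B} (hli : LinearIndependent R (nodeMonomial a b x y))
    {D : R[X]} {E : R[X]} (hD : D.natDegree < b ∨ D = 0) (hE : E.natDegree ≤ a)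
    (h : y * aeval y D + aeval x E = 0) : D = 0 ∧ E = 0 := by
  have := (linearIndependent_nodeMonomial_iff.1 hli) E (X * D) hE
    (by
      rcases hD with hD | rfl
      · have : (X * D).natDegree ≤ 1 + D.natDegree := natDegree_mul_le_of_le natDegree_X_le le_rfl
        omega
      · simp) (by simp) (by rw [← h]; simp [add_comm])
  refine ⟨?_, this.1⟩
  ext i
  simpa using congrArg (coeff · (i + 1)) this.2

/-- For b = 0 the difference vanishes but its `natDegree` is 0, which is not below b; hence the
second alternative. -/
lemma natDegree_sub_lt_or {D Q : R[X]} (hD : D.natDegree ≤ b) (hQ : Q.natDegree ≤ b)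
    (h1 : Q.coeff b = 1) :
    (D - C (D.coeff b) * Q).natDegree < b ∨ D - C (D.coeff b) * Q = 0 := by
  rcases Nat.eq_zero_or_pos b with rfl | hb
  · right
    rw [eq_C_of_natDegree_le_zero hD, eq_C_of_natDegree_le_zero hQ]
    simp [h1]
  · left
    have h2 : (D - C (D.coeff b) * Q).natDegree ≤ b :=
      natDegree_sub_le' hD ((natDegree_C_mul_le _ _).trans hQ)
    refine h2.lt_of_ne fun h ↦ ?_
    have h3 : (D - C (D.coeff b) * Q).coeff b = 0 := by simp [h1]
    have h4 : D - C (D.coeff b) * Q = 0 := leadingCoeff_eq_zero.1 (by rwa [leadingCoeff, h])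
    rw [h4] at h; simp at h; omega

/-- An algebra with the basis `1, x, …, x^a, y, …, y^b` satisfies the standard relations. -/
theorem exists_param {x y : B} (hxy : x * y = 0)
    (hli : LinearIndependent R (nodeMonomial a b x y))
    (hsp : Submodule.span R (Set.range (nodeMonomial a b x y)) = ⊤) :
    ∃ p : Param R a b, p.Rel x y := by
  -- The nonconstant part of g is divisible by x and will be moved to the side of x^(a+1); its
  -- constant term joins the part in y. The expansion of y^(b+1) is treated in the same way.
  obtain ⟨g, D', hg, hD', hD0, e1⟩ := exists_poly_of_mem_span (hsp ▸ Submodule.mem_top :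
    x ^ (a + 1) ∈ _)
  obtain ⟨h, E', hh, hE', hE0, e2⟩ := exists_poly_of_mem_span ((nodeMonomial_swap_range (R := R)
    (a := a) (b := b) x y ▸ hsp ▸ Submodule.mem_top :
    y ^ (b + 1) ∈ Submodule.span R (Set.range (nodeMonomial b a y x))))
  -- `x P(x) = D(y)` and `y Q(y) = E(x)`
  let P : R[X] := X ^ a - divX g
  let Q : R[X] := X ^ b - divX h
  let D : R[X] := D' + C (g.coeff 0)
  let E : R[X] := E' + C (h.coeff 0)
  have divlt : ∀ {k : ℕ} {q : R[X]}, q.natDegree ≤ k → (divX q).degree < k := by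
    intro k q hq
    by_cases h0 : divX q = 0
    · simp [h0]
    · rw [← natDegree_lt_iff_degree_lt h0, natDegree_divX_eq_natDegree_tsub_one]
      have : q.natDegree ≠ 0 := fun h ↦ h0 <| by
        rw [eq_C_of_natDegree_eq_zero h]; simp
      omega
  have hP : P.natDegree ≤ a := natDegree_sub_le' (natDegree_X_pow_le _)
    (natDegree_le_of_degree_le (divlt hg).le)
  have hQ : Q.natDegree ≤ b := natDegree_sub_le' (natDegree_X_pow_le _)
    (natDegree_le_of_degree_le (divlt hh).le)
  have hP1 : P.coeff a = 1 := by
    simp only [P, coeff_sub, coeff_X_pow_self, coeff_eq_zero_of_degree_lt (divlt hg), sub_zero]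
  have hQ1 : Q.coeff b = 1 := by
    simp only [Q, coeff_sub, coeff_X_pow_self, coeff_eq_zero_of_degree_lt (divlt hh), sub_zero]
  have hD : D.natDegree ≤ b := natDegree_add_le_of_degree_le hD' (by simp)
  have hE : E.natDegree ≤ a := natDegree_add_le_of_degree_le hE' (by simp)
  have r1 : x * aeval x P = aeval y D := by
    have : aeval x g = x * aeval x (divX g) + algebraMap R B (g.coeff 0) := by
      conv_lhs => rw [← divX_mul_X_add g, map_add, map_mul, aeval_X, aeval_C, mul_comm]
    simp only [P, D, map_sub, map_pow, aeval_X, map_add, aeval_C, mul_sub, ← pow_succ', e1, this]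
    ring
  have r2 : y * aeval y Q = aeval x E := by
    have : aeval y h = y * aeval y (divX h) + algebraMap R B (h.coeff 0) := by
      conv_lhs => rw [← divX_mul_X_add h, map_add, map_mul, aeval_X, aeval_C, mul_comm]
    simp only [Q, E, map_sub, map_pow, aeval_X, map_add, aeval_C, mul_sub, ← pow_succ', e2, this]
    ring
  -- Since xy = 0, y annihilates x P(x) = D(y), and x annihilates y Q(y) = E(x).
  have hyD : y * aeval y D = 0 := by rw [← r1, ← mul_assoc, mul_comm y x, hxy, zero_mul]
  have hxE : x * aeval x E = 0 := by rw [← r2, ← mul_assoc, hxy, zero_mul]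
  -- With d the coefficient of degree b in D, the previous equations give y (D - dQ)(y) + d E(x) =
  -- 0. As D - dQ has degree below b or is zero, independence yields D = dQ and dE = 0.
  obtain ⟨d1, d2⟩ := eq_zero_of_relation hli (D := D - C (D.coeff b) * Q)
    (E := C (D.coeff b) * E) (natDegree_sub_lt_or hD hQ hQ1) ((natDegree_C_mul_le _ _).trans hE)
    (by
      simp only [map_sub, map_mul, aeval_C, mul_sub, hyD, ← r2]
      ring)
  obtain ⟨d3, d4⟩ := eq_zero_of_relation (linearIndependent_nodeMonomial_swap hli)
    (D := E - C (E.coeff a) * P)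
    (E := C (E.coeff a) * D) (natDegree_sub_lt_or hE hP hP1) ((natDegree_C_mul_le _ _).trans hD)
    (by
      simp only [map_sub, map_mul, aeval_C, mul_sub, hxE, ← r1]
      ring)
  -- The coefficient of degree a in dE = 0 is the relation uv = 0.
  have d5 : D.coeff b * E.coeff a = 0 := by simpa using congrArg (coeff · a) d2
  have hPe := exists_eq_monicPoly hP hP1
  have hQe := exists_eq_monicPoly hQ hQ1
  refine ⟨⟨D.coeff b, E.coeff a, fun i ↦ P.coeff i, fun i ↦ Q.coeff i, d5⟩, hxy, ?_, ?_⟩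
  · change x * aeval x (monicPoly _) = D.coeff b • aeval y (monicPoly _)
    rw [← hPe, ← hQe, r1, sub_eq_zero.1 d1, map_mul, aeval_C, Algebra.smul_def]
    simp [hQ1]
  · change y * aeval y (monicPoly _) = E.coeff a • aeval x (monicPoly _)
    rw [← hPe, ← hQe, r2, sub_eq_zero.1 d3, map_mul, aeval_C, Algebra.smul_def]
    simp [hP1]

/-- Subtracting the relations gives x (P - P')(x) = u Q(y) - u' Q'(y). As P - P' has degree below a,
only monomials of the list occur, so both sides vanish as polynomials; the top coefficient of the
right side is u - u'. -/
lemma Param.Rel.unique_aux {x y : B} (hli : LinearIndependent R (nodeMonomial a b x y))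
    {p p' : Param R a b} (h : p.Rel x y) (h' : p'.Rel x y) : p.c = p'.c ∧ p.u = p'.u := by
  nontriviality R
  -- `x (P - P') = u Q(y) - u' Q'(y)`
  have hdeg : (p.P - p'.P).degree < a := by
    have := degree_sub_lt_left (p := p.P) (q := p'.P) (by
      rw [degree_eq_natDegree (monicPoly_monic _).ne_zero,
        degree_eq_natDegree (monicPoly_monic _).ne_zero, natDegree_monicPoly, natDegree_monicPoly])
      (monicPoly_monic _).ne_zero (by rw [monicPoly_monic, monicPoly_monic])
    rwa [degree_eq_natDegree (monicPoly_monic _).ne_zero, natDegree_monicPoly] at this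
  obtain ⟨d1, d2⟩ := eq_zero_of_relation (linearIndependent_nodeMonomial_swap hli)
    (D := p.P - p'.P) (E := C p'.u * p'.Q - C p.u * p.Q)
    (by
      by_cases h0 : p.P - p'.P = 0
      · exact .inr h0
      · exact .inl ((natDegree_lt_iff_degree_lt h0).2 hdeg))
    (natDegree_sub_le' ((natDegree_C_mul_le _ _).trans (natDegree_monicPoly_le _))
      ((natDegree_C_mul_le _ _).trans (natDegree_monicPoly_le _)))
    (by
      simp only [map_sub, mul_sub, h.hx, h'.hx, map_mul, aeval_C, Algebra.smul_def]
      ring)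
  refine ⟨monicPoly_injective (sub_eq_zero.1 d1), ?_⟩
  have := congrArg (coeff · b) d2
  simp only [coeff_sub, coeff_C_mul, coeff_monicPoly_self, coeff_zero, mul_one] at this
  exact (sub_eq_zero.1 this).symm

lemma Param.Rel.unique {x y : B} (hli : LinearIndependent R (nodeMonomial a b x y))
    {p p' : Param R a b} (h : p.Rel x y) (h' : p'.Rel x y) : p = p' := by
  obtain ⟨h1, h2⟩ := Param.Rel.unique_aux hli h h'
  obtain ⟨h3, h4⟩ := Param.Rel.unique_aux (linearIndependent_nodeMonomial_swap hli) h.swap h'.swap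
  exact Param.ext h2 h4 h1 h3

end

section

variable {R : Type*} [CommRing R] {a b : ℕ} (p : Param R a b)

/-- The relations `xy`, `x P(x) - u Q(y)`, `y Q(y) - v P(x)`. -/
noncomputable def relIdeal : Ideal (MvPolynomial (Fin 2) R) :=
  Ideal.span {MvPolynomial.X 0 * MvPolynomial.X 1,
    MvPolynomial.X 0 * aeval (MvPolynomial.X 0) p.P - p.u • aeval (MvPolynomial.X 1) p.Q,
    MvPolynomial.X 1 * aeval (MvPolynomial.X 1) p.Q - p.v • aeval (MvPolynomial.X 0) p.P}

/-- The algebra `R[x, y]/(xy, x P(x) - u Q(y), y Q(y) - v P(x))`. -/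
abbrev NodeAlg : Type _ := MvPolynomial (Fin 2) R ⧸ relIdeal p

noncomputable def NodeAlg.x : NodeAlg p := Ideal.Quotient.mk _ (MvPolynomial.X 0)
noncomputable def NodeAlg.y : NodeAlg p := Ideal.Quotient.mk _ (MvPolynomial.X 1)

lemma NodeAlg.rel : p.Rel (NodeAlg.x p) (NodeAlg.y p) := by
  have hmk : ∀ (g : R[X]) (i : Fin 2), aeval (Ideal.Quotient.mk (relIdeal p) (MvPolynomial.X i)) g =
      Ideal.Quotient.mk (relIdeal p) (aeval (MvPolynomial.X i) g) := fun g i ↦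
    Polynomial.aeval_algHom_apply (Ideal.Quotient.mkₐ R (relIdeal p)) _ _
  have hs : ∀ (r : R) (z : MvPolynomial (Fin 2) R), r • Ideal.Quotient.mk (relIdeal p) z =
      Ideal.Quotient.mk (relIdeal p) (r • z) := fun _ _ ↦ rfl
  refine ⟨?_, ?_, ?_⟩
  · rw [NodeAlg.x, NodeAlg.y, ← map_mul, Ideal.Quotient.eq_zero_iff_mem]
    exact Ideal.subset_span (by simp)
  · rw [NodeAlg.x, NodeAlg.y, hmk, hmk, ← map_mul, hs, Ideal.Quotient.mk_eq_mk_iff_sub_mem]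
    exact Ideal.subset_span (by simp)
  · rw [NodeAlg.x, NodeAlg.y, hmk, hmk, ← map_mul, hs, Ideal.Quotient.mk_eq_mk_iff_sub_mem]
    exact Ideal.subset_span (by simp)

lemma NodeAlg.adjoin_eq_top : Algebra.adjoin R {NodeAlg.x p, NodeAlg.y p} = ⊤ := by
  rw [eq_top_iff]
  rintro z -
  obtain ⟨w, rfl⟩ := Ideal.Quotient.mk_surjective z
  induction w using MvPolynomial.induction_on with
  | C r => exact Subalgebra.algebraMap_mem _ r
  | add f g hf hg => rw [map_add]; exact Subalgebra.add_mem _ hf hg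
  | mul_X f i hf =>
    rw [map_mul]
    refine Subalgebra.mul_mem _ hf (Algebra.subset_adjoin ?_)
    fin_cases i
    · exact .inl rfl
    · exact .inr rfl

-- Elements of the relation ideal are controlled by their restrictions to the two axes. The
-- generators have restrictions of the stated shape, and multiplication by a polynomial preserves
-- the shape because uv = 0. In small degrees the shape forces A = E = 0, which is what linear
-- independence needs.
variable {p} in
lemma relIdeal_image {h : MvPolynomial (Fin 2) R} (hh : h ∈ relIdeal p) :
    ∃ A E : R[X],
      MvPolynomial.aeval ![X, 0] h = A * (X * p.P - C (p.u * p.Q.coeff 0)) - C (p.v * E.coeff 0) * p.P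
      ∧ MvPolynomial.aeval ![0, X] h =
        E * (X * p.Q - C (p.v * p.P.coeff 0)) - C (p.u * A.coeff 0) * p.Q := by
  have e1 : ∀ (g : R[X]), MvPolynomial.aeval ![X, (0 : R[X])]
      (aeval (MvPolynomial.X 0 : MvPolynomial (Fin 2) R) g) = g := by
    intro g
    rw [← Polynomial.aeval_algHom_apply]; simp
  have e2 : ∀ (g : R[X]), MvPolynomial.aeval ![X, (0 : R[X])] (aeval (MvPolynomial.X 1 : MvPolynomial (Fin 2) R) g)
      = C (g.coeff 0) := by
    intro g
    rw [← Polynomial.aeval_algHom_apply]; simp [← coeff_zero_eq_aeval_zero']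
  have e3 : ∀ (g : R[X]), MvPolynomial.aeval ![(0 : R[X]), X] (aeval (MvPolynomial.X 1 : MvPolynomial (Fin 2) R) g) = g := by
    intro g
    rw [← Polynomial.aeval_algHom_apply]; simp
  have e4 : ∀ (g : R[X]), MvPolynomial.aeval ![(0 : R[X]), X] (aeval (MvPolynomial.X 0 : MvPolynomial (Fin 2) R) g)
      = C (g.coeff 0) := by
    intro g
    rw [← Polynomial.aeval_algHom_apply]; simp [← coeff_zero_eq_aeval_zero']
  induction hh using Submodule.span_induction with
  | mem h hh =>
    rcases hh with rfl | rfl | rfl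
    · exact ⟨0, 0, by simp⟩
    · refine ⟨1, 0, ?_, ?_⟩
      · rw [map_sub, map_mul, map_smul, e1, e2]
        simp [smul_eq_C_mul]
      · rw [map_sub, map_mul, map_smul, e3, e4]
        simp [smul_eq_C_mul]
    · refine ⟨0, 1, ?_, ?_⟩
      · rw [map_sub, map_mul, map_smul, e1, e2]
        simp [smul_eq_C_mul]
      · rw [map_sub, map_mul, map_smul, e3, e4]
        simp [smul_eq_C_mul]
  | zero => exact ⟨0, 0, by simp⟩
  | add h h' _ _ H H' =>
    obtain ⟨A, E, h1, h2⟩ := H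
    obtain ⟨A', E', h1', h2'⟩ := H'
    refine ⟨A + A', E + E', ?_, ?_⟩
    · rw [map_add, h1, h1']; simp only [coeff_add, mul_add, C_add]; ring
    · rw [map_add, h2, h2']; simp only [coeff_add, mul_add, C_add]; ring
  | smul g h _ H =>
    obtain ⟨A, E, h1, h2⟩ := H
    set k := MvPolynomial.constantCoeff g
    have hk : ∀ w : Fin 2 → R[X], (∀ i, (w i).coeff 0 = 0) →
        (MvPolynomial.aeval w g).coeff 0 = k := by
      intro w hw
      have : (MvPolynomial.aeval w g).coeff 0 =
          (constantCoeff.comp (MvPolynomial.aeval w).toRingHom) g := rfl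
      rw [this]
      congr 1
      ext i
      · simp
      · simpa using hw i
    set f := MvPolynomial.aeval ![X, (0 : R[X])] g with hf
    set f' := MvPolynomial.aeval ![(0 : R[X]), X] g with hf'
    have hf0 : f = X * divX f + C k := by
      rw [← hk ![X, 0] (by simp [Fin.forall_fin_two]), ← hf, X_mul_divX_add]
    have hf0' : f' = X * divX f' + C k := by
      rw [← hk ![0, X] (by simp [Fin.forall_fin_two]), ← hf', X_mul_divX_add]
    have huv : C p.u * C p.v = (0 : R[X]) := by rw [← C_mul, p.huv, C_0]
    have hu : p.u * p.v = 0 := p.huv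
    -- Write f = X f₁ + k. In v E(0) f P the part v E(0) f₁ X P equals v E(0) f₁ (X P - u Q(0)),
    -- since uv = 0, and it is absorbed in A; the part with k keeps the old form. The second axis is
    -- symmetric.
    refine ⟨f * A - C (p.v * E.coeff 0) * divX f, f' * E - C (p.u * A.coeff 0) * divX f', ?_, ?_⟩
    · rw [smul_eq_mul, map_mul, h1, ← hf]
      have h3 : C (p.v * (f' * E - C (p.u * A.coeff 0) * divX f').coeff 0) =
          C p.v * C k * C (E.coeff 0) := by
        rw [← C_mul, ← C_mul]
        congr 1
        have : (f' * E).coeff 0 = k * E.coeff 0 := by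
          rw [mul_coeff_zero, hf', hk _ (by simp [Fin.forall_fin_two])]
        rw [coeff_sub, this, coeff_C_mul]
        linear_combination -(A.coeff 0 * (divX f').coeff 0) * hu
      rw [h3]
      simp only [C_mul]
      linear_combination (-(C p.v * C (E.coeff 0) * p.P)) * hf0 -
        (C (E.coeff 0) * divX f * C (p.Q.coeff 0)) * huv
    · rw [smul_eq_mul, map_mul, h2, ← hf']
      have h3 : C (p.u * (f * A - C (p.v * E.coeff 0) * divX f).coeff 0) =
          C p.u * C k * C (A.coeff 0) := by
        rw [← C_mul, ← C_mul]
        congr 1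
        have : (f * A).coeff 0 = k * A.coeff 0 := by
          rw [mul_coeff_zero, hf, hk _ (by simp [Fin.forall_fin_two])]
        rw [coeff_sub, this, coeff_C_mul]
        linear_combination -(E.coeff 0 * (divX f).coeff 0) * hu
      rw [h3]
      simp only [C_mul]
      linear_combination (-(C p.u * C (A.coeff 0) * p.Q)) * hf0' -
        (C (A.coeff 0) * divX f' * C (p.P.coeff 0)) * huv

/-- X P - r is monic of degree a + 1, so a nonzero A makes the product of degree at least a + 1, and
the term s P of degree at most a cannot cancel it. -/
lemma eq_zero_of_natDegree_mul_le [Nontrivial R] {A : R[X]} {c : Fin a → R} (r s : R)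
    (hg : (A * (X * monicPoly c - C r) - C s * monicPoly c).natDegree ≤ a) : A = 0 := by
  by_contra hA
  have hm : (X * monicPoly c - C r).Monic := by
    refine (monic_X.mul (monicPoly_monic c)).sub_of_left ?_
    refine degree_C_le.trans_lt ?_
    rw [(monicPoly_monic c).degree_mul, degree_X, degree_eq_natDegree (monicPoly_monic c).ne_zero]
    exact_mod_cast (by omega : 0 < 1 + (monicPoly c).natDegree)
  have hd : (X * monicPoly c - C r).natDegree = a + 1 := by
    rw [natDegree_sub_C, natDegree_X_mul (monicPoly_monic c).ne_zero, natDegree_monicPoly]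
  have h1 : (A * (X * monicPoly c - C r)).natDegree = A.natDegree + (a + 1) := by
    rw [mul_comm, hm.natDegree_mul' hA, hd, add_comm]
  have h2 : (C s * monicPoly c).natDegree ≤ a :=
    (natDegree_C_mul_le _ _).trans (natDegree_monicPoly_le _)
  rw [natDegree_sub_eq_left_of_natDegree_lt (by omega)] at hg
  omega

/-- A relation g(x) + h(y) = 0 lifts to an element of the ideal whose restrictions to the axes are g
and g(0) + h. Their degrees are at most a and b, so in `relIdeal_image` both A and E vanish, and
then g and h do. -/
theorem NodeAlg.linearIndependent :
    LinearIndependent R (nodeMonomial a b (NodeAlg.x p) (NodeAlg.y p)) := by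
  nontriviality R
  rw [linearIndependent_nodeMonomial_iff]
  intro g h hg hh h0 e
  have hmk : ∀ (g : R[X]) (i : Fin 2), aeval (Ideal.Quotient.mk (relIdeal p) (MvPolynomial.X i)) g =
      Ideal.Quotient.mk (relIdeal p) (aeval (MvPolynomial.X i) g) := fun g i ↦
    Polynomial.aeval_algHom_apply (Ideal.Quotient.mkₐ R (relIdeal p)) _ _
  rw [NodeAlg.x, NodeAlg.y, hmk, hmk, ← map_add, Ideal.Quotient.eq_zero_iff_mem] at e
  obtain ⟨A, E, e1, e2⟩ := relIdeal_image e
  have e1' : g = A * (X * p.P - C (p.u * p.Q.coeff 0)) - C (p.v * E.coeff 0) * p.P := by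
    rw [← e1, map_add, ← Polynomial.aeval_algHom_apply, ← Polynomial.aeval_algHom_apply]
    simp [← coeff_zero_eq_aeval_zero', h0]
  have e2' : C (g.coeff 0) + h =
      E * (X * p.Q - C (p.v * p.P.coeff 0)) - C (p.u * A.coeff 0) * p.Q := by
    rw [← e2, map_add, ← Polynomial.aeval_algHom_apply, ← Polynomial.aeval_algHom_apply]
    simp [← coeff_zero_eq_aeval_zero']
  have hA : A = 0 := eq_zero_of_natDegree_mul_le _ _ (e1' ▸ hg)
  have hE : E = 0 := eq_zero_of_natDegree_mul_le _ _
    (e2' ▸ natDegree_add_le_of_degree_le (by simp) hh)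
  have hg0 : g = 0 := by rw [e1', hA, hE]; simp
  refine ⟨hg0, ?_⟩
  rw [hA, hE, hg0] at e2'
  simpa using e2'

lemma NodeAlg.span_eq_top :
    Submodule.span R (Set.range (nodeMonomial a b (NodeAlg.x p) (NodeAlg.y p))) = ⊤ :=
  (NodeAlg.rel p).span_eq_top (NodeAlg.adjoin_eq_top p)

/-- The monomial basis. -/
noncomputable def NodeAlg.basis : Module.Basis (Fin (a + 1) ⊕ Fin b) R (NodeAlg p) :=
  .mk (NodeAlg.linearIndependent p) (NodeAlg.span_eq_top p).ge

lemma NodeAlg.basis_apply (i) :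
    NodeAlg.basis p i = nodeMonomial a b (NodeAlg.x p) (NodeAlg.y p) i := by
  simp [NodeAlg.basis]

variable {p} {B : Type*} [CommRing B] [Algebra R B]

/-- The universal property of `NodeAlg`. -/
noncomputable def NodeAlg.lift {x y : B} (h : p.Rel x y) : NodeAlg p →ₐ[R] B :=
  Ideal.Quotient.liftₐ (relIdeal p) (MvPolynomial.aeval ![x, y]) (by
    suffices relIdeal p ≤ RingHom.ker (MvPolynomial.aeval ![x, y] : _ →ₐ[R] B) from
      fun z hz ↦ this hz
    rw [relIdeal, Ideal.span_le]
    rintro _ (rfl | rfl | rfl)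
    · simp [h.xy, RingHom.mem_ker]
    · simp [RingHom.mem_ker, ← Polynomial.aeval_algHom_apply, h.hx]
    · simp [RingHom.mem_ker, ← Polynomial.aeval_algHom_apply, h.hy])

@[simp] lemma NodeAlg.lift_x {x y : B} (h : p.Rel x y) : NodeAlg.lift h (NodeAlg.x p) = x := by
  change MvPolynomial.aeval ![x, y] (MvPolynomial.X 0) = x
  simp

@[simp] lemma NodeAlg.lift_y {x y : B} (h : p.Rel x y) : NodeAlg.lift h (NodeAlg.y p) = y := by
  change MvPolynomial.aeval ![x, y] (MvPolynomial.X 1) = y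
  simp

lemma nodeMonomial_map {B' : Type*} [CommRing B'] {F : Type*} [FunLike F B B']
    [RingHomClass F B B'] (g : F) (x y : B) (i) :
    g (nodeMonomial a b x y i) = nodeMonomial a b (g x) (g y) i := by
  rcases i with i | i <;> simp [nodeMonomial]

lemma NodeAlg.lift_bijective {x y : B} (h : p.Rel x y)
    (hli : LinearIndependent R (nodeMonomial a b x y))
    (hsp : Submodule.span R (Set.range (nodeMonomial a b x y)) = ⊤) :
    Function.Bijective (NodeAlg.lift h) := by
  have h1 : (NodeAlg.lift h).toLinearMap =
      ((NodeAlg.basis p).equiv (Module.Basis.mk hli hsp.ge) (Equiv.refl _)).toLinearMap := by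
    refine (NodeAlg.basis p).ext fun i ↦ ?_
    rw [LinearEquiv.coe_coe, Module.Basis.equiv_apply]
    simp only [AlgHom.toLinearMap_apply, NodeAlg.basis_apply, nodeMonomial_map, lift_x, lift_y,
      Module.Basis.mk_apply, Equiv.refl_apply]
  have h2 : ⇑(NodeAlg.lift h) = ((NodeAlg.basis p).equiv (Module.Basis.mk hli hsp.ge)
    (Equiv.refl _)) := by
    ext z; exact congrArg (fun f ↦ f z) h1
  rw [h2]
  exact LinearEquiv.bijective _

/-- The isomorphism with the standard algebra. -/
noncomputable def NodeAlg.equiv {x y : B} (h : p.Rel x y)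
    (hli : LinearIndependent R (nodeMonomial a b x y))
    (hsp : Submodule.span R (Set.range (nodeMonomial a b x y)) = ⊤) : NodeAlg p ≃ₐ[R] B :=
  AlgEquiv.ofBijective _ (NodeAlg.lift_bijective h hli hsp)

end

/-- In a dependency of the longer list y^(b+1) must have a nonzero coefficient, as the shorter list
is independent; over a field it can be solved for. -/
lemma pow_mem_span_of_not_linearIndependent {K B : Type*} [Field K] [CommRing B] [Algebra K B]
    {x y : B} {a b : ℕ} (h : LinearIndependent K (nodeMonomial a b x y))
    (h' : ¬ LinearIndependent K (nodeMonomial a (b + 1) x y)) :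
    y ^ (b + 1) ∈ Submodule.span K (Set.range (nodeMonomial a b x y)) := by
  by_contra hmem
  refine h' ?_
  rw [linearIndependent_nodeMonomial_iff]
  intro g k hg hk hk0 e
  have hk1 : k = (k - C (k.coeff (b + 1)) * X ^ (b + 1)) + C (k.coeff (b + 1)) * X ^ (b + 1) := by
    ring
  have hk2 : (k - C (k.coeff (b + 1)) * X ^ (b + 1)).natDegree ≤ b := by
    rw [natDegree_le_iff_coeff_eq_zero]
    intro N hN
    rw [coeff_sub, coeff_C_mul, coeff_X_pow]
    split_ifs with h3
    · simp [h3]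
    · rw [coeff_eq_zero_of_natDegree_lt (by omega)]; simp
  by_cases h3 : k.coeff (b + 1) = 0
  · rw [h3] at hk1 hk2
    exact (linearIndependent_nodeMonomial_iff.1 h) g k hg (by simpa using hk2) hk0 e
  · exfalso
    refine hmem ?_
    have h4 : y ^ (b + 1) = (- (k.coeff (b + 1))⁻¹) • (aeval x g +
        aeval y (k - C (k.coeff (b + 1)) * X ^ (b + 1))) := by
      have : aeval x g + aeval y (k - C (k.coeff (b + 1)) * X ^ (b + 1)) =
          - (k.coeff (b + 1)) • y ^ (b + 1) := by
        rw [← sub_eq_zero, ← e]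
        simp [Algebra.smul_def]
        ring
      rw [this, smul_smul]
      simp [h3]
    rw [h4]
    exact Submodule.smul_mem _ _ (Submodule.add_mem _ (aeval_x_mem_span _ _ hg)
      (aeval_y_mem_span _ _ hk2))

/-- Over a field, every finite quotient of `K[x, y]/(xy)` has a basis of monomials. -/
theorem exists_nodeMonomial_basis {K B : Type*} [Field K] [CommRing B] [Algebra K B]
    [Module.Finite K B] [Nontrivial B] {x y : B} (hxy : x * y = 0)
    (hgen : Algebra.adjoin K {x, y} = ⊤) :
    ∃ a b : ℕ, a + b + 1 = Module.finrank K B ∧ LinearIndependent K (nodeMonomial a b x y) ∧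
      Submodule.span K (Set.range (nodeMonomial a b x y)) = ⊤ := by
  classical
  have hbd : ∀ a b, LinearIndependent K (nodeMonomial a b x y) → a + 1 + b ≤ Module.finrank K B := by
    intro a b h
    simpa using h.fintype_card_le_finrank
  have h00 : LinearIndependent K (nodeMonomial 0 0 x y) := by
    rw [linearIndependent_nodeMonomial_iff]
    intro g h hg hh h0 e
    rw [eq_C_of_natDegree_le_zero hg, eq_C_of_natDegree_le_zero hh, h0] at e ⊢
    simpa using e
  have hmax : ∀ (p : ℕ → Prop) (N : ℕ), p 0 → (∀ m, p m → m ≤ N) → ∃ m, p m ∧ ¬ p (m + 1) := by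
    intro p N h0 hN
    by_contra! H
    have : ∀ m, p m := fun m ↦ Nat.rec h0 (fun m ih ↦ H m ih) m
    exact absurd (hN _ (this (N + 1))) (by omega)
  -- Greedy choice: first a maximal for the powers of x, then b maximal for this a. The dimension
  -- bounds both, and maximality puts x^(a+1) and y^(b+1) in the span.
  obtain ⟨a, ha, ha'⟩ := hmax (fun a ↦ LinearIndependent K (nodeMonomial a 0 x y))
    (Module.finrank K B) h00 (fun m hm ↦ by have := hbd _ _ hm; omega)
  obtain ⟨b, hb, hb'⟩ := hmax (fun b ↦ LinearIndependent K (nodeMonomial a b x y))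
    (Module.finrank K B) ha (fun m hm ↦ by have := hbd _ _ hm; omega)
  have hx : x ^ (a + 1) ∈ Submodule.span K (Set.range (nodeMonomial a b x y)) := by
    have h2 := pow_mem_span_of_not_linearIndependent (linearIndependent_nodeMonomial_swap ha)
      (fun h ↦ ha' (linearIndependent_nodeMonomial_swap h))
    rw [← nodeMonomial_swap_range] at h2
    refine Submodule.span_mono ?_ h2
    rintro _ ⟨i | i, rfl⟩
    · exact ⟨Sum.inl i, rfl⟩
    · exact i.elim0
  have hs := span_nodeMonomial_of_pow hxy hx (pow_mem_span_of_not_linearIndependent hb hb') hgen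
  refine ⟨a, b, ?_, hb, hs⟩
  rw [Module.finrank_eq_card_basis (Module.Basis.mk hb hs.ge)]
  simp
  omega

end Algebra

/-! ### The polynomial det(1 - T x) and its behaviour under change of chart; base change -/

section Algebra

open Polynomial TensorProduct

section

variable {R : Type*} [CommRing R]

/-- The matrix of the multiplication by `X` on `R[X]/(F)` has characteristic polynomial `F`. -/
lemma charpoly_companion {F : R[X]} (hF : F.Monic) :
    (Matrix.of fun i j : Fin F.natDegree ↦ (X ^ (j + 1 : ℕ) %ₘ F).coeff i).charpoly = F := by
  nontriviality R
  -- This is multiplication by the root on R[X]/(F); its characteristic polynomial is the minimal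
  -- polynomial of the root, which is F.
  have h1 : (Matrix.of fun i j : Fin F.natDegree ↦ (X ^ (j + 1 : ℕ) %ₘ F).coeff i) =
      Algebra.leftMulMatrix (AdjoinRoot.powerBasisAux' hF) (AdjoinRoot.root F) := by
    ext i j
    have h2 : AdjoinRoot.powerBasisAux' hF j = AdjoinRoot.root F ^ (j : ℕ) :=
      (AdjoinRoot.powerBasis' hF).basis_eq_pow j
    rw [Algebra.leftMulMatrix_eq_repr_mul, h2, ← pow_succ',
      AdjoinRoot.powerBasisAux'_repr_apply_to_fun, ← AdjoinRoot.mk_X, ← map_pow,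
      AdjoinRoot.modByMonicHom_mk]
    rfl
  rw [h1]
  refine (charpoly_leftMulMatrix (AdjoinRoot.powerBasis' hF)).trans ?_
  rw [AdjoinRoot.powerBasis'_gen]
  symm
  refine minpoly.unique' R _ hF (by simp [AdjoinRoot.aeval_eq]) fun q hq ↦ ?_
  by_contra! h
  have := h.2
  rw [AdjoinRoot.aeval_eq, AdjoinRoot.mk_eq_zero] at this
  exact h.1 ((hF.not_dvd_of_degree_lt h.1 hq) this).elim

variable {a b : ℕ} (p : Param R a b)

/-- The monic polynomial `X P - u Q(0)`, the equation of the subscheme along the axis `y = 0`. -/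
noncomputable def Param.fx : R[X] := X * p.P - C (p.u * p.Q.coeff 0)

/-- The reversed polynomial `∑ F_i T^(a+1-i)` of `F = X P - u Q(0)`; it equals `det (1 - T x)`. -/
noncomputable def Param.ex : R[X] := reflect (a + 1) p.fx

lemma Param.fx_monic : p.fx.Monic := by
  nontriviality R
  refine (monic_X.mul (monicPoly_monic _)).sub_of_left (degree_C_le.trans_lt ?_)
  rw [(monicPoly_monic _).degree_mul, degree_X, degree_eq_natDegree (monicPoly_monic _).ne_zero]
  exact_mod_cast (by omega : 0 < 1 + p.P.natDegree)

lemma Param.natDegree_fx [Nontrivial R] : p.fx.natDegree = a + 1 := by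
  rw [Param.fx, natDegree_sub_C, natDegree_X_mul (monicPoly_monic _).ne_zero, natDegree_monicPoly]

lemma Param.fx_map {S : Type*} [CommRing S] (g : R →+* S) : (p.map g).fx = p.fx.map g := by
  simp [Param.fx, Param.P_map, Param.Q_map]

lemma Param.ex_map {S : Type*} [CommRing S] (g : R →+* S) : (p.map g).ex = p.ex.map g := by
  rw [Param.ex, Param.fx_map, Param.ex, reflect_map]

lemma Param.coeff_ex {i : ℕ} (hi : i ≤ a + 1) : p.ex.coeff i = p.fx.coeff (a + 1 - i) := by
  rw [Param.ex, coeff_reflect, revAt_le hi]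

lemma Param.coeff_ex_of_lt {i : ℕ} (hi : a + 1 < i) : p.ex.coeff i = 0 := by
  nontriviality R
  rw [Param.ex, coeff_reflect, revAt_eq_self_of_lt hi, coeff_eq_zero_of_natDegree_lt]
  rwa [p.natDegree_fx]

variable {B : Type*} [CommRing B] [Algebra R B]

lemma aeval_add_aeval_eq_sum {x y : B} {g h : R[X]} (hg : g.natDegree ≤ a) (hh : h.natDegree ≤ b)
    (h0 : h.coeff 0 = 0) :
    aeval x g + aeval y h = ∑ i, (Sum.elim (fun i : Fin (a + 1) ↦ g.coeff i)
      (fun j : Fin b ↦ h.coeff (j + 1)) i) • nodeMonomial a b x y i := by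
  rw [Fintype.sum_sum_type, aeval_eq_sum_range' (Nat.lt_succ_of_le hg),
    aeval_eq_sum_range' (Nat.lt_succ_of_le hh), Finset.sum_range, Finset.sum_range,
    Fin.sum_univ_succ (n := b)]
  simp [h0, nodeMonomial]

-- x annihilates the y^j with j > 0, so the matrix is block triangular with a zero block of size b,
-- which contributes X^b. The other diagonal block is the companion matrix of X P - u Q(0), because
-- the value of this polynomial at x lies in the span of those y^j.
variable {p} in
lemma Param.Rel.charpoly_leftMulMatrix {x y : B} (h : p.Rel x y)
    (e : Module.Basis (Fin (a + 1) ⊕ Fin b) R B) (he : ∀ i, e i = nodeMonomial a b x y i) :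
    (Algebra.leftMulMatrix e x).charpoly = X ^ b * p.fx := by
  nontriviality R
  have hd := p.natDegree_fx
  have hq : aeval x p.fx = p.u • aeval y (p.Q - C (p.Q.coeff 0)) := by
    simp only [Param.fx, map_sub, map_mul, aeval_X, aeval_C, h.hx, Algebra.smul_def]
    ring
  have hxw : ∀ k : R[X], aeval x k * aeval y (p.Q - C (p.Q.coeff 0)) =
      k.coeff 0 • aeval y (p.Q - C (p.Q.coeff 0)) := by
    intro k
    have h1 : p.Q - C (p.Q.coeff 0) = X * divX p.Q :=
      sub_eq_of_eq_add (X_mul_divX_add p.Q).symm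
    conv_lhs => rw [← X_mul_divX_add k, h1]
    rw [h1]
    simp only [map_add, map_mul, aeval_X, aeval_C, Algebra.smul_def, add_mul]
    linear_combination (aeval x k.divX * aeval y p.Q.divX) * h.xy
  -- In the division of X^(j+1) by X P - u Q(0) only the constant term of the quotient matters: x
  -- annihilates the value u (Q(y) - Q(0)) of the divisor.
  have hpow : ∀ j : ℕ, x ^ (j + 1) = aeval x (X ^ (j + 1) %ₘ p.fx) +
      aeval y (C (((X ^ (j + 1) : R[X]) /ₘ p.fx).coeff 0 * p.u) * (p.Q - C (p.Q.coeff 0))) := by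
    intro j
    have h1 := congrArg (aeval x) (modByMonic_add_div (X ^ (j + 1) : R[X]) p.fx)
    rw [map_add, map_mul, map_pow, aeval_X, mul_comm, hq, mul_smul_comm, hxw] at h1
    rw [← h1, map_mul, aeval_C, Algebra.smul_def, Algebra.smul_def, map_mul]
    ring
  have hrepr : ∀ (g k : R[X]), g.natDegree ≤ a → k.natDegree ≤ b → k.coeff 0 = 0 →
      ∀ i : Fin (a + 1), e.repr (aeval x g + aeval y k) (Sum.inl i) = g.coeff i := by
    intro g k hg hk hk0 i
    rw [aeval_add_aeval_eq_sum hg hk hk0]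
    simp only [← he]
    rw [e.repr_sum_self]
    rfl
  have hblock : Algebra.leftMulMatrix e x = Matrix.fromBlocks
      ((Matrix.of fun i j : Fin p.fx.natDegree ↦ (X ^ (j + 1 : ℕ) %ₘ p.fx).coeff i).reindex
        (finCongr hd) (finCongr hd)) 0
      (Matrix.of fun i j ↦ Algebra.leftMulMatrix e x (Sum.inr i) (Sum.inl j)) 0 := by
    ext i j
    rcases j with j | j
    · rcases i with i | i
      · rw [Algebra.leftMulMatrix_eq_repr_mul, he]
        change e.repr (x * x ^ (j : ℕ)) _ = _
        rw [← pow_succ', hpow, hrepr]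
        · simp
        · have := natDegree_modByMonic_lt (X ^ ((j : ℕ) + 1) : R[X]) p.fx_monic (by
            intro h1; rw [h1, natDegree_one] at hd; omega)
          omega
        · exact (natDegree_C_mul_le _ _).trans (natDegree_sub_C.le.trans (natDegree_monicPoly_le _))
        · simp
      · rfl
    · rw [Algebra.leftMulMatrix_eq_repr_mul, he]
      change e.repr (x * y ^ (j + 1 : ℕ)) _ = _
      rw [pow_succ', ← mul_assoc, h.xy, zero_mul, map_zero]
      rcases i with i | i <;> rfl
  rw [hblock, Matrix.charpoly_fromBlocks_zero₁₂, Matrix.charpoly_reindex,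
    charpoly_companion p.fx_monic, mul_comm]
  simp [Matrix.charpoly_zero]

-- The characteristic polynomial does not depend on the basis, and reversal removes the factor X^b.
-- So `ex` depends on B and x alone, and charts with different exponents can be compared.
variable {p} in
lemma Param.Rel.charpolyRev {x y : B} (h : p.Rel x y)
    (e : Module.Basis (Fin (a + 1) ⊕ Fin b) R B) (he : ∀ i, e i = nodeMonomial a b x y i)
    {ι : Type*} [Fintype ι] [DecidableEq ι] (e' : Module.Basis ι R B) :
    (Algebra.leftMulMatrix e' x).charpolyRev = p.ex := by
  nontriviality R
  have h1 : (Algebra.leftMulMatrix e' x).charpoly = X ^ b * p.fx := by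
    rw [← h.charpoly_leftMulMatrix e he]
    have : Module.Finite R B := Module.Finite.of_basis e
    have : Module.Free R B := Module.Free.of_basis e
    have h2 : ∀ {κ : Type _} [Fintype κ] [DecidableEq κ] (b : Module.Basis κ R B),
        (Algebra.leftMulMatrix b x).charpoly = (Algebra.lmul R B x).charpoly := fun b ↦
      LinearMap.charpoly_toMatrix _ b
    rw [h2 e, LinearMap.charpoly_toMatrix (Algebra.lmul R B x) e' |>.symm]
    rfl
  rw [← Matrix.reverse_charpoly, h1, reverse_X_pow_mul, reverse, p.natDegree_fx, Param.ex]

/-- The effect on `det (1 - T x)` of the change of coordinates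
`x' = x / (1 - γ (x + y))`, `y' = y / (1 - γ (x + y))`. -/
theorem Param.Rel.ex_shift {a' b' : ℕ} {p : Param R a b} {p' : Param R a' b'} {x y x' y' : B}
    (h : p.Rel x y) (h' : p'.Rel x' y')
    (hli : LinearIndependent R (nodeMonomial a b x y))
    (hsp : Submodule.span R (Set.range (nodeMonomial a b x y)) = ⊤)
    (hli' : LinearIndependent R (nodeMonomial a' b' x' y'))
    (hsp' : Submodule.span R (Set.range (nodeMonomial a' b' x' y')) = ⊤)
    (γ : R) (hunit : IsUnit (1 - γ • (x + y))) (hx' : x' * (1 - γ • (x + y)) = x) :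
    ∃ c : R, IsUnit c ∧ p'.ex * C c = p.ex.comp (X + C γ) := by
  classical
  let e := Module.Basis.mk hli hsp.ge
  let e' := Module.Basis.mk hli' hsp'.ge
  have r1 := h.charpolyRev e (fun i ↦ Module.Basis.mk_apply _ _ i) e
  have r2 := h'.charpolyRev e' (fun i ↦ Module.Basis.mk_apply _ _ i) e
  let m : B →+* Matrix (Fin (a + 1) ⊕ Fin b) (Fin (a + 1) ⊕ Fin b) R[X] :=
    (C : R →+* R[X]).mapMatrix.comp (Algebra.leftMulMatrix e).toRingHom
  have hm : ∀ z, m z = (Algebra.leftMulMatrix e z).map C := fun z ↦ rfl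
  have hsm : ∀ (r : R) (z : B), m (r • z) = (C r : R[X]) • m z := by
    intro r z
    ext i j : 2
    simp [hm]
  -- As xy = 0, the element 1 - t x - γ y is the product of 1 - t x and 1 - γ y, and its determinant
  -- factors accordingly.
  have hfac : ∀ t : R[X], (1 - t • m x - (C γ : R[X]) • m y) =
      (1 - t • m x) * (1 - (C γ : R[X]) • m y) := by
    intro t
    have : m x * m y = 0 := by rw [← map_mul, h.xy, map_zero]
    rw [sub_mul, mul_sub, mul_sub, smul_mul_smul_comm, this]
    simp only [mul_one, one_mul, smul_zero, sub_zero]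
    abel
  have hu : m (1 - γ • (x + y)) = 1 - (C γ : R[X]) • m x - (C γ : R[X]) • m y := by
    rw [map_sub, map_one, hsm, map_add, smul_add, sub_sub]
  have k1 : (1 - (X : R[X]) • m x') * m (1 - γ • (x + y)) =
      1 - (X + C γ) • m x - (C γ : R[X]) • m y := by
    rw [sub_mul, one_mul, smul_mul_assoc, ← map_mul, hx', hu, add_smul]
    abel
  have hdu : IsUnit (m (1 - γ • (x + y))).det :=
    (Matrix.isUnit_iff_isUnit_det _).1 (hunit.map m)
  rw [hu, hfac, Matrix.det_mul] at hdu
  have hdet : (1 - (C γ : R[X]) • m x).det = C ((1 - γ • Algebra.leftMulMatrix e x).det) := by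
    rw [RingHom.map_det]
    congr 1
    ext i j : 2
    simp [hm, Matrix.one_apply, apply_ite C]
  refine ⟨(1 - γ • Algebra.leftMulMatrix e x).det, ?_, ?_⟩
  · have := isUnit_of_mul_isUnit_left hdu
    rw [hdet] at this
    exact isUnit_C.1 this
  · have k2 := congrArg Matrix.det k1
    rw [Matrix.det_mul, hu, hfac, hfac, Matrix.det_mul, Matrix.det_mul, ← mul_assoc] at k2
    -- det(1 - γ y) divides the determinant of a unit and can be cancelled; the unit c is the
    -- remaining factor det(1 - γ x).
    have k3 := (isUnit_of_mul_isUnit_right hdu).mul_right_cancel k2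
    rw [hdet] at k3
    rw [← r2, Matrix.charpolyRev, ← hm, k3, ← r1, Matrix.charpolyRev,
      ← coe_compRingHom_apply, RingHom.map_det]
    congr 1
    ext i j : 2
    simp [hm, Matrix.one_apply, apply_ite (fun q : R[X] ↦ q.comp (X + C γ))]
    ring

end

section

variable {R : Type*} [CommRing R]

/-- A surjective endomorphism of a finite module is injective; this is applied to the map from the
basis to the generators. -/
lemma linearIndependent_of_span_eq_top {ι κ M : Type*} [AddCommGroup M] [Module R M] [Fintype ι]
    [Fintype κ] (e : Module.Basis κ R M) (hc : Fintype.card ι = Fintype.card κ) {v : ι → M}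
    (hv : Submodule.span R (Set.range v) = ⊤) : LinearIndependent R v := by
  have : Module.Finite R M := Module.Finite.of_basis e
  let σ : κ ≃ ι := (Fintype.equivOfCardEq hc).symm
  let f : M →ₗ[R] M := e.constr R (v ∘ σ)
  have hf : Function.Surjective f := by
    rw [← LinearMap.range_eq_top, Module.Basis.constr_range, σ.surjective.range_comp, hv]
  have hinj := OrzechProperty.injective_of_surjective_endomorphism f hf
  have h1 : LinearIndependent R (f ∘ e) := e.linearIndependent.map_injOn f hinj.injOn
  have h2 : (f ∘ e) = v ∘ σ := funext fun k ↦ e.constr_basis R _ k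
  rw [h2] at h1
  simpa [Function.comp_assoc] using h1.comp σ.symm σ.symm.injective

variable {a b : ℕ}

/-- If `v` is a unit, then the algebra also has the basis `1, x, …, x^(a-1), y, …, y^(b+1)`. -/
lemma Param.Rel.span_eq_top_of_isUnit {p : Param R (a + 1) b} {B : Type*} [CommRing B]
    [Algebra R B] {x y : B} (h : p.Rel x y) (hgen : Algebra.adjoin R {x, y} = ⊤)
    (hv : IsUnit p.v) :
    Submodule.span R (Set.range (nodeMonomial a (b + 1) x y)) = ⊤ := by
  obtain ⟨w, hw⟩ := hv.exists_left_inv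
  have key : x ^ (a + 1) ∈ Submodule.span R (Set.range (nodeMonomial a (b + 1) x y)) := by
    -- For invertible v the relation y Q(y) = v P(x) expresses the highest power of x by lower
    -- powers and by powers of y.
    have h1 : x ^ (a + 1) = w • aeval y (X * p.Q : R[X]) +
        aeval x (X ^ (a + 1) - p.P) := by
      rw [map_mul, aeval_X, h.hy, smul_smul, hw, one_smul]
      simp
    have h2 : (X ^ (a + 1) - p.P).natDegree ≤ a := by
      rw [natDegree_le_iff_coeff_eq_zero]
      intro N hN
      rcases (Nat.succ_le_iff.2 hN).lt_or_eq with h3 | rfl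
      · rw [coeff_sub, coeff_X_pow, if_neg (by omega), coeff_eq_zero_of_natDegree_lt
          ((natDegree_monicPoly_le _).trans_lt h3), sub_zero]
      · rw [coeff_sub, coeff_X_pow, coeff_monicPoly_self]; simp
    rw [h1]
    refine Submodule.add_mem _ (Submodule.smul_mem _ _ (aeval_y_mem_span _ _ ?_))
      (aeval_x_mem_span _ _ h2)
    exact (natDegree_mul_le_of_le natDegree_X_le (natDegree_monicPoly_le _)).trans (by omega)
  have hle : Submodule.span R (Set.range (nodeMonomial (a + 1) b x y)) ≤
      Submodule.span R (Set.range (nodeMonomial a (b + 1) x y)) := by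
    rw [Submodule.span_le]
    rintro _ ⟨i | i, rfl⟩
    · rcases (Nat.lt_succ_iff.1 i.2).lt_or_eq with h3 | h3
      · exact x_pow_mem_span x y (Nat.lt_succ_iff.1 h3)
      · change x ^ (i : ℕ) ∈ _
        rw [h3]; exact key
    · exact y_pow_mem_span x y (by omega : (i : ℕ) + 1 ≤ b + 1)
  exact top_le_iff.1 ((h.span_eq_top hgen).ge.trans hle)

lemma det_baseChange {R' M ι : Type*} [CommRing R'] [Algebra R R'] [AddCommGroup M] [Module R M]
    [Fintype ι] [DecidableEq ι] (e : Module.Basis ι R M) (v : ι → M) :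
    (e.baseChange R').det (fun i ↦ (1 : R') ⊗ₜ[R] v i) = algebraMap R R' (e.det v) := by
  rw [Module.Basis.det_apply, Module.Basis.det_apply, RingHom.map_det]
  congr 1
  ext i j
  simp [Module.Basis.toMatrix_apply, Module.Basis.baseChange_repr_tmul, Algebra.smul_def]

lemma nodeMonomial_tmul {R' B : Type*} [CommRing R'] [Algebra R R'] [CommRing B] [Algebra R B]
    (x y : B) (i) : nodeMonomial a b ((1 : R') ⊗ₜ[R] x) ((1 : R') ⊗ₜ[R] y) i =
      (1 : R') ⊗ₜ[R] nodeMonomial a b x y i :=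
  (nodeMonomial_map (Algebra.TensorProduct.includeRight : B →ₐ[R] R' ⊗[R] B) x y i).symm

/-- The monomials are a basis after a base change if and only if the determinant becomes a unit. -/
lemma isBasis_baseChange_iff {R' B : Type*} [CommRing R'] [Algebra R R'] [CommRing B] [Algebra R B]
    (e : Module.Basis (Fin (a + 1) ⊕ Fin b) R B) (x y : B) :
    (LinearIndependent R' (nodeMonomial a b ((1 : R') ⊗ₜ[R] x) ((1 : R') ⊗ₜ[R] y)) ∧
      Submodule.span R' (Set.range (nodeMonomial a b ((1 : R') ⊗ₜ[R] x) ((1 : R') ⊗ₜ[R] y))) = ⊤) ↔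
    IsUnit (algebraMap R R' (e.det (nodeMonomial a b x y))) := by
  rw [Module.Basis.is_basis_iff_det (e.baseChange R'), ← det_baseChange]
  have : nodeMonomial a b ((1 : R') ⊗ₜ[R] x) ((1 : R') ⊗ₜ[R] y) =
    fun i ↦ (1 : R') ⊗ₜ[R] nodeMonomial a b x y i := funext fun i ↦ nodeMonomial_tmul x y i
  rw [this]

lemma isBasis_baseChange {R' B : Type*} [CommRing R'] [Algebra R R'] [CommRing B] [Algebra R B]
    {x y : B} (hli : LinearIndependent R (nodeMonomial a b x y))
    (hsp : Submodule.span R (Set.range (nodeMonomial a b x y)) = ⊤) :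
    LinearIndependent R' (nodeMonomial a b ((1 : R') ⊗ₜ[R] x) ((1 : R') ⊗ₜ[R] y)) ∧
      Submodule.span R' (Set.range (nodeMonomial a b ((1 : R') ⊗ₜ[R] x) ((1 : R') ⊗ₜ[R] y))) = ⊤ :=
  (isBasis_baseChange_iff (Module.Basis.mk hli hsp.ge) x y).2
    (((Module.Basis.is_basis_iff_det (Module.Basis.mk hli hsp.ge)).1 ⟨hli, hsp⟩).map _)

lemma Param.Rel.baseChange {R' B : Type*} [CommRing R'] [Algebra R R'] [CommRing B] [Algebra R B]
    {p : Param R a b} {x y : B} (h : p.Rel x y) :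
    (p.map (algebraMap R R')).Rel ((1 : R') ⊗ₜ[R] x) ((1 : R') ⊗ₜ[R] y) := by
  have key : ∀ (g : R[X]) (z : B), aeval ((1 : R') ⊗ₜ[R] z) (g.map (algebraMap R R')) =
      (1 : R') ⊗ₜ[R] aeval z g := by
    intro g z
    rw [aeval_map_algebraMap]
    exact Polynomial.aeval_algHom_apply (Algebra.TensorProduct.includeRight : B →ₐ[R] R' ⊗[R] B) z g
  refine ⟨by simp [h.xy], ?_, ?_⟩
  · rw [Param.P_map, Param.Q_map, key, key, Algebra.TensorProduct.tmul_mul_tmul, h.hx,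
      Param.map_u, one_mul, ← TensorProduct.smul_tmul, TensorProduct.smul_tmul', Algebra.smul_def]
    rfl
  · rw [Param.P_map, Param.Q_map, key, key, Algebra.TensorProduct.tmul_mul_tmul, h.hy,
      Param.map_v, one_mul, ← TensorProduct.smul_tmul, TensorProduct.smul_tmul', Algebra.smul_def]
    rfl

end

end Algebra

/-! ### Ideal sheaves on affine schemes, restriction and kernels -/

section IdealSheaves

open Scheme TopologicalSpace

/-- `Spec` of a ring homomorphism. -/
noncomputable abbrev specMap {R S : Type} [CommRing R] [CommRing S] (φ : R →+* S) :
    Spec (.of S) ⟶ Spec (.of R) := Spec.map (CommRingCat.ofHom φ)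

lemma specMap_comp {R S T : Type} [CommRing R] [CommRing S] [CommRing T] (ψ : S →+* T)
    (φ : R →+* S) : specMap (ψ.comp φ) = specMap ψ ≫ specMap φ := by
  rw [← Spec.map_comp, ← CommRingCat.ofHom_comp]

lemma specMap_id {R : Type} [CommRing R] : specMap (RingHom.id R) = 𝟙 _ := Spec.map_id _

lemma specMap_injective {R S : Type} [CommRing R] [CommRing S] :
    Function.Injective (specMap (R := R) (S := S)) := fun φ φ' h ↦ by
  have h2 := Spec.map_injective h
  ext z
  exact congr($(h2).hom z)

lemma exists_specMap {R S : Type} [CommRing R] [CommRing S] (f : Spec (.of S) ⟶ Spec (.of R)) :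
    ∃ φ : R →+* S, f = specMap φ := by
  obtain ⟨ψ, hψ⟩ := Spec.map_surjective f
  exact ⟨ψ.hom, hψ.symm⟩

/-- The ideal sheaf on `Spec R` attached to an ideal of `R`. -/
noncomputable def idl {R : Type} [CommRing R] (I : Ideal R) : (Spec (.of R)).IdealSheafData :=
  IdealSheafData.ofIdealTop (I.comap (Scheme.ΓSpecIso (.of R)).hom.hom)

lemma idl_le_idl {R : Type} [CommRing R] {I J : Ideal R} : idl I ≤ idl J ↔ I ≤ J := by
  have h := (IdealSheafData.equivOfIsAffine (X := Spec (.of R))).symm.toOrderIso.le_iff_le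
    (x := I.comap (Scheme.ΓSpecIso (.of R)).hom.hom) (y := J.comap (Scheme.ΓSpecIso (.of R)).hom.hom)
  refine Iff.trans h ?_
  exact Ideal.comap_le_comap_iff_of_surjective _
    (ConcreteCategory.bijective_of_isIso (Scheme.ΓSpecIso (.of R)).hom).2 _ _

lemma idl_injective {R : Type} [CommRing R] : Function.Injective (idl (R := R)) :=
  fun _ _ h ↦ le_antisymm (idl_le_idl.mp h.le) (idl_le_idl.mp h.ge)

lemma exists_eq_idl {R : Type} [CommRing R] (J : (Spec (.of R)).IdealSheafData) :
    ∃ I : Ideal R, J = idl I := by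
  refine ⟨(IdealSheafData.equivOfIsAffine J).comap (Scheme.ΓSpecIso (.of R)).inv.hom, ?_⟩
  rw [idl, Ideal.comap_comap, ← CommRingCat.hom_comp]
  simpa using (IdealSheafData.equivOfIsAffine.symm_apply_apply J).symm

lemma ker_specMap {R S : Type} [CommRing R] [CommRing S] (φ : R →+* S) :
    (specMap φ).ker = idl (RingHom.ker φ) := by
  rw [ker_of_isAffine, idl]
  congr 1
  have h := Scheme.ΓSpecIso_naturality (CommRingCat.ofHom φ)
  have hinj := (ConcreteCategory.bijective_of_isIso (Scheme.ΓSpecIso (.of S)).hom).1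
  ext x
  have h' := congr($(h).hom x)
  simp only [CommRingCat.hom_comp, RingHom.comp_apply, CommRingCat.hom_ofHom] at h'
  rw [RingHom.mem_ker, Ideal.mem_comap, RingHom.mem_ker, ← h']
  exact (map_eq_zero_iff _ hinj).symm

lemma idl_eq_ker {R : Type} [CommRing R] (I : Ideal R) :
    idl I = (specMap (Ideal.Quotient.mk I)).ker := by
  rw [ker_specMap, Ideal.mk_ker]

lemma map_idl {R S : Type} [CommRing R] [CommRing S] (φ : R →+* S) (I : Ideal S) :
    (idl I).map (specMap φ) = idl (I.comap φ) := by
  rw [idl_eq_ker, IdealSheafData.map_ker, ← Spec.map_comp, ← CommRingCat.ofHom_comp, ker_specMap,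
    ← RingHom.comap_ker, Ideal.mk_ker]

lemma comap_idl {R S : Type} [CommRing R] [CommRing S] (φ : R →+* S) (I : Ideal R) :
    (idl I).comap (specMap φ) = idl (I.map φ) := by
  obtain ⟨K, hK⟩ := exists_eq_idl ((idl I).comap (specMap φ))
  apply le_antisymm
  · rw [← IdealSheafData.le_map_iff_comap_le, map_idl, idl_le_idl]
    exact Ideal.le_comap_map
  · rw [hK, idl_le_idl, Ideal.map_le_iff_le_comap, ← idl_le_idl, ← map_idl,
      IdealSheafData.le_map_iff_comap_le, hK]

lemma idl_top {R : Type} [CommRing R] : idl (⊤ : Ideal R) = ⊤ := by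
  obtain ⟨K, hK⟩ := exists_eq_idl (⊤ : (Spec (.of R)).IdealSheafData)
  rw [hK]; congr 1
  exact (top_le_iff.mp (idl_le_idl.mp (hK ▸ le_top))).symm

lemma idl_sup {R : Type} [CommRing R] (I J : Ideal R) : idl (I ⊔ J) = idl I ⊔ idl J := by
  obtain ⟨K, hK⟩ := exists_eq_idl (idl I ⊔ idl J)
  apply le_antisymm
  · rw [hK, idl_le_idl, sup_le_iff, ← idl_le_idl, ← idl_le_idl, ← hK]
    exact ⟨le_sup_left, le_sup_right⟩
  · exact sup_le (idl_le_idl.mpr le_sup_left) (idl_le_idl.mpr le_sup_right)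

lemma coe_support_idl {R : Type} [CommRing R] (I : Ideal R) :
    ((idl I).support : Set (Spec (.of R))) = PrimeSpectrum.zeroLocus I := by
  have : IsClosedImmersion (specMap (Ideal.Quotient.mk I)) :=
    IsClosedImmersion.spec_of_surjective _ Ideal.Quotient.mk_surjective
  rw [idl_eq_ker, Hom.support_ker]
  rw [IsClosed.closure_eq (IsClosedImmersion.isClosedEmbedding _).isClosed_range]
  refine (range_comap_of_surjective _ (Ideal.Quotient.mk I)
    Ideal.Quotient.mk_surjective).trans ?_
  rw [Ideal.mk_ker]

lemma comap_mul_of_isOpenImmersion {X Y : Scheme.{0}} (f : X ⟶ Y) [IsOpenImmersion f]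
    (I J : Y.IdealSheafData) : (I * J).comap f = I.comap f * J.comap f := by
  ext U : 2
  rw [IdealSheafData.ideal_mul, Pi.mul_apply]
  simp only [IdealSheafData.ideal_comap_of_isOpenImmersion, IdealSheafData.ideal_mul, Pi.mul_apply]
  have h := fun K : Ideal Γ(Y, f ''ᵁ U) ↦
    Ideal.comap_symm (I := K) (f.appIso U).commRingCatIsoToRingEquiv
  have h' : ∀ K : Ideal Γ(Y, f ''ᵁ U), K.comap (f.appIso U).inv.hom =
      K.map (f.appIso U).hom.hom := h
  rw [h', h', h', Ideal.map_mul]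

lemma idl_mul {R : Type} [CommRing R] (I J : Ideal R) : idl (I * J) = idl I * idl J := by
  have h := map_mul (IdealSheafData.equivOfIsAffine (X := Spec (.of R))).symm
    (I.comap (Scheme.ΓSpecIso (.of R)).hom.hom) (J.comap (Scheme.ΓSpecIso (.of R)).hom.hom)
  refine Eq.trans ?_ h
  have h' : ∀ K : Ideal R, K.comap (Scheme.ΓSpecIso (.of R)).hom.hom =
      K.map (Scheme.ΓSpecIso (.of R)).inv.hom := fun K ↦
    Ideal.comap_symm (I := K) (Scheme.ΓSpecIso (.of R)).symm.commRingCatIsoToRingEquiv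
  rw [idl, h', h', h', Ideal.map_mul]
  rfl

lemma radical_comap_of_isOpenImmersion {X Y : Scheme.{0}} (f : X ⟶ Y) [IsOpenImmersion f]
    (I : Y.IdealSheafData) : I.radical.comap f = (I.comap f).radical := by
  ext U : 2
  simp only [IdealSheafData.ideal_comap_of_isOpenImmersion, IdealSheafData.radical_ideal]
  exact Ideal.comap_radical _ _

/-- The ideal sheaf of a reduced structure equals its radical, and radicals commute with restriction
to open subschemes. -/
lemma vanishingIdeal_comap_of_isOpenImmersion {X Y : Scheme.{0}} (f : X ⟶ Y) [IsOpenImmersion f]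
    (Z : Closeds Y) : (IdealSheafData.vanishingIdeal Z).comap f =
      IdealSheafData.vanishingIdeal (Z.preimage f.continuous) := by
  have hZ : (IdealSheafData.vanishingIdeal Z).support = Z := by
    ext1; simp
  have h : (IdealSheafData.vanishingIdeal Z).radical = IdealSheafData.vanishingIdeal Z := by
    rw [← IdealSheafData.vanishingIdeal_support, hZ]
  nth_rw 1 [← h]
  rw [radical_comap_of_isOpenImmersion, ← IdealSheafData.vanishingIdeal_support,
    IdealSheafData.support_comap, hZ]

lemma radical_idl {R : Type} [CommRing R] (I : Ideal R) : (idl I).radical = idl I.radical := by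
  rw [← IdealSheafData.vanishingIdeal_support]
  apply le_antisymm
  · obtain ⟨K, hK⟩ := exists_eq_idl (IdealSheafData.vanishingIdeal (idl I).support)
    rw [hK, idl_le_idl]
    have h : (PrimeSpectrum.zeroLocus (I : Set R)) ⊆ ((idl K).support : Set (Spec (.of R))) := by
      rw [← coe_support_idl, ← hK]; simp; rfl
    rw [coe_support_idl] at h
    exact (PrimeSpectrum.zeroLocus_subset_zeroLocus_iff I K).mp h
  · rw [← IdealSheafData.le_support_iff_le_vanishingIdeal]
    change ((idl I).support : Set (Spec (.of R))) ⊆ (idl I.radical).support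
    rw [coe_support_idl, coe_support_idl, PrimeSpectrum.zeroLocus_radical]
    rfl

/-- For a closed immersion `i`, the ideal sheaf `ker i ⊔ J` is pushed forward from the source. -/
lemma map_comap_of_isClosedImmersion {X Y : Scheme.{0}} (i : X ⟶ Y) [IsClosedImmersion i]
    (J : Y.IdealSheafData) : (J.comap i).map i = i.ker ⊔ J := by
  have h1 : (J.comap i).map i ≤ i.ker ⊔ J := by
    have hle : i.ker ≤ (i.ker ⊔ J).subschemeι.ker := by simp
    have hfac := IsClosedImmersion.lift_fac i (i.ker ⊔ J).subschemeι hle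
    conv_rhs => rw [← (i.ker ⊔ J).ker_subschemeι, ← hfac, ← IdealSheafData.map_ker]
    apply IdealSheafData.map_mono
    rw [← IdealSheafData.le_map_iff_comap_le, IdealSheafData.map_ker, hfac,
      IdealSheafData.ker_subschemeι]
    exact le_sup_right
  refine le_antisymm h1 (sup_le ?_ (IdealSheafData.le_map_comap _ _))
  rw [← IdealSheafData.map_bot]
  exact IdealSheafData.map_mono _ bot_le

lemma ker_eq_of_isPullback {Z' Z X Y : Scheme.{0}} {i' : Z' ⟶ X} {g : Z' ⟶ Z} {f : X ⟶ Y}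
    {i : Z ⟶ Y} [IsClosedImmersion i] (h : IsPullback i' g f i) : i'.ker = i.ker.comap f := by
  rw [← IdealSheafData.ker_fst_of_isClosedImmersion, ← Hom.ker_comp_of_isIso h.isoPullback.inv]
  simp

/-- Factoring a morphism to `Y` through a closed immersion, on the level of kernels. -/
lemma ker_le_ker_iff {X Y Z : Scheme.{0}} (i : X ⟶ Y) [IsClosedImmersion i] (f : Z ⟶ Y) :
    i.ker ≤ f.ker ↔ ∃ g, g ≫ i = f :=
  ⟨fun h ↦ ⟨_, IsClosedImmersion.lift_fac i f h⟩, fun ⟨_, hg⟩ ↦ hg ▸ Hom.le_ker_comp _ _⟩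

lemma comap_ker_eq_bot_iff {X Y Z : Scheme.{0}} (i : X ⟶ Y) [IsClosedImmersion i] (f : Z ⟶ Y) :
    i.ker.comap f = ⊥ ↔ ∃ g, g ≫ i = f := by
  rw [← ker_le_ker_iff, ← IdealSheafData.map_bot f, IdealSheafData.le_map_iff_comap_le, le_bot_iff]

end IdealSheaves
-- Points of projective space with values in a ring
section ProjPoints

open MvPolynomial HomogeneousLocalization

variable {R R' : Type} [CommRing R] [Algebra ℂ R] [CommRing R'] [Algebra ℂ R'] {N : ℕ}

lemma aeval_smul_of_isHomogeneous {s : MvPolynomial (Fin N) ℂ} {n : ℕ} (hs : s.IsHomogeneous n)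
    (c : R) (w : Fin N → R) : aeval (c • w) s = c ^ n * aeval w s := by
  rw [aeval_def, aeval_def, eval₂_eq, eval₂_eq, Finset.mul_sum]
  refine Finset.sum_congr rfl fun d hd ↦ ?_
  have h : ∑ i ∈ d.support, d i = n := by
    have := hs (mem_support_iff.mp hd)
    rwa [Finsupp.weight_apply, Finsupp.sum, Finset.sum_congr rfl (fun i _ ↦ by
      rw [Pi.one_apply, smul_eq_mul, mul_one])] at this
  simp only [Pi.smul_apply, smul_eq_mul, mul_pow, Finset.prod_mul_distrib, Finset.prod_pow_eq_pow_sum, h]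
  ring

/-- Evaluation at a vector `w` of quotients of polynomials by powers of `ℓ`, for invertible
`ℓ(w)`. -/
noncomputable def awayEval (w : Fin N → R) (ℓ : MvPolynomial (Fin N) ℂ) (h : IsUnit (aeval w ℓ)) :
    Away (grading N) ℓ →+* R :=
  (Localization.awayLift (aeval w).toRingHom ℓ h).comp
    (algebraMap (Away (grading N) ℓ) (Localization.Away ℓ))

lemma awayEval_mk (w : Fin N → R) {ℓ : MvPolynomial (Fin N) ℂ} (h : IsUnit (aeval w ℓ)) {d : ℕ}
    (hd : ℓ ∈ grading N d) (n : ℕ) (s : MvPolynomial (Fin N) ℂ) (hs : s ∈ grading N (n • d)) :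
    awayEval w ℓ h (Away.mk (grading N) hd n s hs) * aeval w ℓ ^ n = aeval w s := by
  have : (algebraMap (Away (grading N) ℓ) (Localization.Away ℓ))
      (Away.mk (grading N) hd n s hs) * algebraMap _ _ ℓ ^ n = algebraMap _ _ s := by
    rw [HomogeneousLocalization.algebraMap_apply, Away.val_mk, Localization.mk_eq_mk', ← map_pow]
    exact IsLocalization.mk'_spec _ _ _
  have := congrArg (Localization.awayLift (aeval w).toRingHom ℓ h) this
  rw [map_mul, map_pow] at this
  simp only [Localization.awayLift, IsLocalization.Away.lift_eq] at this
  exact this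

lemma awayEval_mk_of_eq_one (w : Fin N → R) {ℓ : MvPolynomial (Fin N) ℂ} (h : IsUnit (aeval w ℓ))
    (h1 : aeval w ℓ = 1) {d : ℕ}
    (hd : ℓ ∈ grading N d) (n : ℕ) (s : MvPolynomial (Fin N) ℂ) (hs : s ∈ grading N (n • d)) :
    awayEval w ℓ h (Away.mk (grading N) hd n s hs) = aeval w s := by
  rw [← awayEval_mk w h hd, h1, one_pow, mul_one]

lemma awayEval_unique (w : Fin N → R) {ℓ : MvPolynomial (Fin N) ℂ} (h : IsUnit (aeval w ℓ)) {d : ℕ}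
    (hd : ℓ ∈ grading N d) (g : Away (grading N) ℓ →+* R)
    (hg : ∀ n s hs, g (Away.mk (grading N) hd n s hs) * aeval w ℓ ^ n = aeval w s) :
    g = awayEval w ℓ h := by
  ext z
  obtain ⟨n, s, hs, rfl⟩ := Away.mk_surjective (grading N) hd z
  apply (h.pow n).mul_right_cancel
  rw [hg, awayEval_mk]

lemma comp_awayEval (φ : R →ₐ[ℂ] R') (w : Fin N → R) {ℓ : MvPolynomial (Fin N) ℂ}
    (h : IsUnit (aeval w ℓ)) (h' : IsUnit (aeval (φ ∘ w) ℓ)) {d : ℕ} (hd : ℓ ∈ grading N d) :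
    (φ : R →+* R').comp (awayEval w ℓ h) = awayEval (φ ∘ w) ℓ h' := by
  have hφ : ∀ s, aeval (φ ∘ w) s = φ (aeval w s) := fun s ↦ by
    rw [← AlgHom.comp_apply]; congr 1; ext; simp
  refine awayEval_unique _ h' hd _ fun n s hs ↦ ?_
  rw [hφ, hφ, ← awayEval_mk w h hd n s hs, map_mul, map_pow]
  rfl

lemma awayEval_awayMap (w : Fin N → R) {ℓ ℓ' : MvPolynomial (Fin N) ℂ} (h : IsUnit (aeval w ℓ))
    (h'' : IsUnit (aeval w (ℓ * ℓ'))) {d d' : ℕ} (hd : ℓ ∈ grading N d) (hd' : ℓ' ∈ grading N d') :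
    (awayEval w (ℓ * ℓ') h'').comp (awayMap (grading N) hd' rfl) = awayEval w ℓ h := by
  refine awayEval_unique _ h hd _ fun n s hs ↦ ?_
  have h' : IsUnit (aeval w ℓ') := isUnit_of_mul_isUnit_right (by simpa using h'')
  rw [RingHom.comp_apply, awayMap_mk]
  apply (h'.pow n).mul_right_cancel
  rw [mul_assoc, ← mul_pow, ← map_mul, awayEval_mk, map_mul, map_pow]

lemma awayEval_smul (c : R) (w : Fin N → R) {ℓ : MvPolynomial (Fin N) ℂ} (h : IsUnit (aeval w ℓ))
    (h' : IsUnit (aeval (c • w) ℓ)) {d : ℕ} (hd : ℓ ∈ grading N d) :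
    awayEval w ℓ h = awayEval (c • w) ℓ h' := by
  refine awayEval_unique _ h' hd _ fun n s hs ↦ ?_
  rw [aeval_smul_of_isHomogeneous hs, aeval_smul_of_isHomogeneous hd, ← awayEval_mk w h hd n s hs]
  rw [mul_pow, ← pow_mul, smul_eq_mul, mul_comm n d]
  ring

/-- A point of the chart ℓ ≠ 0 is given by the images w_j of the fractions X_j/ℓ, which are
normalised by ℓ(w) = 1. Since s is homogeneous, s/ℓ^n is the value of s at these fractions. -/
lemma eq_awayEval {ℓ : MvPolynomial (Fin N) ℂ} (hd : ℓ ∈ grading N 1)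
    (g : Away (grading N) ℓ →+* R)
    (hg : ∀ z : ℂ, g (fromZeroRingHom (grading N) _ (algebraMap ℂ _ z)) = algebraMap ℂ R z) :
    ∃ w : Fin N → R, ∃ h1 : aeval w ℓ = 1, g = awayEval w ℓ (h1 ▸ isUnit_one) := by
  let X' : Fin N → Away (grading N) ℓ := fun j ↦
    Away.mk (grading N) hd 1 (X j) (by simp [isHomogeneous_X])
  let κ : ℂ →+* Away (grading N) ℓ :=
    (fromZeroRingHom (grading N) _).comp (algebraMap ℂ (grading N 0))
  have key : ∀ n s hs, eval₂Hom κ X' s = Away.mk (grading N) hd n s hs := by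
    intro n s hs
    apply val_injective
    rw [Away.val_mk, Localization.mk_eq_mk', IsLocalization.eq_mk'_iff_mul_eq]
    have e1 : ((algebraMap (Away (grading N) ℓ) (Localization.Away ℓ)).comp (eval₂Hom κ X')) s =
        aeval (fun j ↦ (algebraMap (Away (grading N) ℓ) (Localization.Away ℓ)) (X' j)) s := by
      rw [aeval_def, ← coe_eval₂Hom]
      congr 1
      apply ringHom_ext
      · intro z
        simp only [RingHom.comp_apply, coe_eval₂Hom, eval₂_C]
        rw [HomogeneousLocalization.algebraMap_apply]
        change Localization.mk _ _ = _
        rw [IsScalarTower.algebraMap_apply ℂ (MvPolynomial (Fin N) ℂ) (Localization.Away ℓ)]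
        exact Localization.mk_one_eq_algebraMap _
      · intro i; simp
    change ((algebraMap (Away (grading N) ℓ) (Localization.Away ℓ)).comp (eval₂Hom κ X')) s * _ = _
    rw [e1]
    have e2 : aeval (algebraMap (MvPolynomial (Fin N) ℂ) (Localization.Away ℓ) ℓ • fun j ↦
        (algebraMap (Away (grading N) ℓ) (Localization.Away ℓ)) (X' j)) s =
        algebraMap _ _ s := by
      have : (algebraMap (MvPolynomial (Fin N) ℂ) (Localization.Away ℓ) ℓ • fun j ↦
        (algebraMap (Away (grading N) ℓ) (Localization.Away ℓ)) (X' j)) =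
          fun j ↦ algebraMap (MvPolynomial (Fin N) ℂ) (Localization.Away ℓ) (X j) := by
        ext j
        rw [Pi.smul_apply, smul_eq_mul, HomogeneousLocalization.algebraMap_apply, Away.val_mk,
          Localization.mk_eq_mk', mul_comm]
        have := IsLocalization.mk'_spec (M := Submonoid.powers ℓ) (Localization.Away ℓ)
          (X j : MvPolynomial (Fin N) ℂ) ⟨ℓ ^ 1, 1, rfl⟩
        simpa using this
      rw [this]
      have h3 := aeval_algebraMap_apply (Localization.Away ℓ) (X : Fin N → MvPolynomial (Fin N) ℂ) s
      rw [aeval_X_left_apply] at h3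
      exact h3
    rw [aeval_smul_of_isHomogeneous (n := n) (by simpa using hs)] at e2
    rw [← e2, map_pow, mul_comm]
  let w : Fin N → R := fun j ↦ g (X' j)
  have hw : ∀ s, aeval w s = g (eval₂Hom κ X' s) := by
    intro s
    rw [aeval_def, ← coe_eval₂Hom, ← RingHom.comp_apply]
    congr 1
    apply ringHom_ext
    · intro z; simpa [κ] using (hg z).symm
    · intro i; simp [w]
  have h1 : aeval w ℓ = 1 := by
    rw [hw, key 1 ℓ (by simpa using hd)]
    rw [← map_one g]; congr 1
    apply val_injective
    rw [Away.val_mk, Localization.mk_eq_mk', val_one, IsLocalization.mk'_eq_iff_eq_mul]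
    simp
  refine ⟨w, h1, awayEval_unique _ _ hd _ fun n s hs ↦ ?_⟩
  rw [h1, one_pow, mul_one, hw, key n s hs]

/-- `Spec R` as a scheme over `ℂ`. -/
noncomputable abbrev specC (R : Type) [CommRing R] [Algebra ℂ R] : Over base :=
  Over.mk (specMap (algebraMap ℂ R))

/-- `Spec` of a `ℂ`-algebra homomorphism. -/
noncomputable abbrev specCMap (φ : R →ₐ[ℂ] R') : specC R' ⟶ specC R :=
  Over.homMk (specMap (φ : R →+* R')) (by
    simp only [Over.mk_left, Over.mk_hom]
    rw [← Spec.map_comp, ← CommRingCat.ofHom_comp, AlgHom.comp_algebraMap])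

lemma exists_specCMap (f : specC R' ⟶ specC R) : ∃ φ : R →ₐ[ℂ] R', f = specCMap φ := by
  obtain ⟨ψ, hψ⟩ := exists_specMap f.left
  have h := Over.w f
  simp only [Over.mk_hom, hψ] at h
  rw [← specMap_comp] at h
  refine ⟨⟨ψ, fun z ↦ congr($(specMap_injective h) z)⟩, ?_⟩
  ext1
  exact hψ

lemma specCMap_injective : Function.Injective (specCMap (R := R) (R' := R')) := by
  intro φ φ' h
  have h2 := specMap_injective (congrArg CommaMorphism.left h)
  ext z
  exact congr($(h2) z)

lemma specCMap_comp {R'' : Type} [CommRing R''] [Algebra ℂ R''] (φ : R →ₐ[ℂ] R')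
    (ψ : R' →ₐ[ℂ] R'') : specCMap ψ ≫ specCMap φ = specCMap (ψ.comp φ) := by
  ext1
  simp only [Over.comp_left, Over.homMk_left]
  rw [← specMap_comp]
  rfl

lemma specCMap_id : specCMap (AlgHom.id ℂ R) = 𝟙 _ := by
  ext1
  exact Spec.map_id _

/-- The open immersion of the affine chart `ℓ ≠ 0` of projective space. -/
noncomputable def awayChart {ℓ : MvPolynomial (Fin N) ℂ} {d : ℕ} (hd : ℓ ∈ grading N d)
    (h0 : 0 < d) : Spec (.of (Away (grading N) ℓ)) ⟶ (projSpace N).left :=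
  Proj.awayι (grading N) ℓ hd h0

instance {ℓ : MvPolynomial (Fin N) ℂ} {d : ℕ} (hd : ℓ ∈ grading N d) (h0 : 0 < d) :
    IsOpenImmersion (awayChart hd h0) :=
  inferInstanceAs (IsOpenImmersion (Proj.awayι (grading N) ℓ hd h0))

/-- The open subset `ℓ ≠ 0` of projective space. -/
noncomputable def projOpen (ℓ : MvPolynomial (Fin N) ℂ) : (projSpace N).left.Opens :=
  Proj.basicOpen (grading N) ℓ

lemma range_awayChart {ℓ : MvPolynomial (Fin N) ℂ} {d : ℕ} (hd : ℓ ∈ grading N d) (h0 : 0 < d) :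
    Set.range (awayChart hd h0) = projOpen ℓ :=
  congrArg (fun U : (Proj (grading N)).Opens ↦ (U : Set (Proj (grading N))))
      (Proj.opensRange_awayι (grading N) ℓ hd h0)

lemma awayChart_hom {ℓ : MvPolynomial (Fin N) ℂ} {d : ℕ} (hd : ℓ ∈ grading N d) (h0 : 0 < d) :
    awayChart hd h0 ≫ (projSpace N).hom =
      specMap ((fromZeroRingHom (grading N) (Submonoid.powers ℓ)).comp
        (algebraMap ℂ (grading N 0))) := by
  change Proj.awayι (grading N) ℓ hd h0 ≫ Proj.toSpecZero _ ≫ _ = _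
  rw [Proj.awayι_toSpecZero_assoc, ← Spec.map_comp, ← CommRingCat.ofHom_comp]

lemma specMap_awayMap_awayChart {ℓ ℓ' : MvPolynomial (Fin N) ℂ} {d d' : ℕ} (hd : ℓ ∈ grading N d)
    (h0 : 0 < d) (hd' : ℓ' ∈ grading N d') (h : ℓ * ℓ' ∈ grading N (d + d')) (h1 : 0 < d + d') :
    specMap (awayMap (grading N) hd' rfl) ≫ awayChart hd h0 = awayChart h h1 :=
  Proj.SpecMap_awayMap_awayι (grading N) hd h0 hd' rfl

lemma awayChart_preimage_projOpen {ℓ ℓ' : MvPolynomial (Fin N) ℂ} {d d' : ℕ}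
    (hd : ℓ ∈ grading N d) (h0 : 0 < d) (hd' : ℓ' ∈ grading N d') (h0' : 0 < d') :
    awayChart hd h0 ⁻¹ᵁ projOpen ℓ' = PrimeSpectrum.basicOpen (Away.isLocalizationElem hd hd') :=
  Proj.awayι_preimage_basicOpen (grading N) hd h0 hd' h0'

/-- The point of projective space with homogeneous coordinates `w`. -/
noncomputable def projPt (w : Fin N → R) {ℓ : MvPolynomial (Fin N) ℂ} (hℓ : ℓ ∈ grading N 1)
    (h : IsUnit (aeval w ℓ)) : specC R ⟶ projSpace N :=
  Over.homMk (specMap (awayEval w ℓ h) ≫ awayChart hℓ one_pos) (by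
    rw [Category.assoc, awayChart_hom, ← Spec.map_comp, ← CommRingCat.ofHom_comp]
    simp only [Over.mk_hom]
    congr 2
    ext z
    simp only [RingHom.comp_apply]
    have := awayEval_mk w h hℓ 0 (algebraMap ℂ (grading N 0) z : MvPolynomial (Fin N) ℂ)
      (by simpa using (algebraMap ℂ (grading N 0) z).2)
    rw [pow_zero, mul_one] at this
    have h2 : aeval w (algebraMap ℂ (grading N 0) z : MvPolynomial (Fin N) ℂ) =
      algebraMap ℂ R z := aeval_C w z
    rw [h2] at this
    rw [← this]
    congr 1)

lemma projPt_left (w : Fin N → R) {ℓ : MvPolynomial (Fin N) ℂ} (hℓ : ℓ ∈ grading N 1)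
    (h : IsUnit (aeval w ℓ)) : (projPt w hℓ h).left =
      specMap (awayEval w ℓ h) ≫ awayChart hℓ one_pos := rfl

lemma projPt_left_eq_mul (w : Fin N → R) {ℓ ℓ' p : MvPolynomial (Fin N) ℂ} (hℓ : ℓ ∈ grading N 1)
    (hℓ' : ℓ' ∈ grading N 1) (h : IsUnit (aeval w ℓ)) (hp : p = ℓ * ℓ')
    (h' : IsUnit (aeval w p)) (hpd : p ∈ grading N 2) :
    (projPt w hℓ h).left = specMap (awayEval w p h') ≫ awayChart hpd two_pos := by
  subst hp
  rw [projPt_left, ← awayEval_awayMap w h h' hℓ hℓ']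
  rw [specMap_comp, Category.assoc, specMap_awayMap_awayChart hℓ one_pos hℓ' (SetLike.mul_mem_graded hℓ hℓ')]

/-- Both points factor through the chart where the product ℓℓ' does not vanish. -/
lemma projPt_eq (w : Fin N → R) {ℓ ℓ' : MvPolynomial (Fin N) ℂ} (hℓ : ℓ ∈ grading N 1)
    (hℓ' : ℓ' ∈ grading N 1) (h : IsUnit (aeval w ℓ)) (h' : IsUnit (aeval w ℓ')) :
    projPt w hℓ h = projPt w hℓ' h' := by
  have h1 : IsUnit (aeval w (ℓ * ℓ')) := by simpa using ⟨h, h'⟩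
  ext1
  rw [projPt_left_eq_mul w hℓ hℓ' h rfl h1 (SetLike.mul_mem_graded hℓ hℓ'),
    projPt_left_eq_mul w hℓ' hℓ h' (mul_comm _ _) h1 (SetLike.mul_mem_graded hℓ hℓ')]

lemma isUnit_aeval_smul {ℓ : MvPolynomial (Fin N) ℂ} (hℓ : ℓ ∈ grading N 1) {c : R}
    (hc : IsUnit c) {w : Fin N → R} (h : IsUnit (aeval w ℓ)) : IsUnit (aeval (c • w) ℓ) := by
  rw [aeval_smul_of_isHomogeneous hℓ]
  exact (hc.pow _).mul h

lemma projPt_smul {c : R} (hc : IsUnit c) (w : Fin N → R) {ℓ ℓ' : MvPolynomial (Fin N) ℂ}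
    (hℓ : ℓ ∈ grading N 1) (hℓ' : ℓ' ∈ grading N 1) (h : IsUnit (aeval w ℓ))
    (h' : IsUnit (aeval (c • w) ℓ')) : projPt w hℓ h = projPt (c • w) hℓ' h' := by
  rw [projPt_eq (c • w) hℓ' hℓ h' (isUnit_aeval_smul hℓ hc h)]
  ext1
  rw [projPt_left, projPt_left, ← awayEval_smul c w h _ hℓ]

lemma aeval_comp_algHom (φ : R →ₐ[ℂ] R') (w : Fin N → R) (s : MvPolynomial (Fin N) ℂ) :
    aeval (φ ∘ w) s = φ (aeval w s) := by
  rw [← AlgHom.comp_apply]; congr 1; ext; simp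

lemma specCMap_projPt (φ : R →ₐ[ℂ] R') (w : Fin N → R) {ℓ : MvPolynomial (Fin N) ℂ}
    (hℓ : ℓ ∈ grading N 1) (h : IsUnit (aeval w ℓ)) :
    specCMap φ ≫ projPt w hℓ h =
      projPt (φ ∘ w) hℓ (by rw [aeval_comp_algHom]; exact h.map φ) := by
  ext1
  simp only [Over.comp_left, Over.homMk_left, projPt_left]
  rw [← Category.assoc, ← Spec.map_comp, ← CommRingCat.ofHom_comp,
    comp_awayEval φ w h (by rw [aeval_comp_algHom]; exact h.map φ) hℓ]

lemma exists_eq_projPt {ℓ : MvPolynomial (Fin N) ℂ} (hℓ : ℓ ∈ grading N 1)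
    (f : specC R ⟶ projSpace N)
    (hf : Set.range f.left ⊆ (projOpen ℓ : Set (projSpace N).left)) :
    ∃ w : Fin N → R, ∃ h1 : aeval w ℓ = 1, f = projPt w hℓ (h1 ▸ isUnit_one) := by
  rw [← range_awayChart hℓ one_pos] at hf
  let q : Spec (.of R) ⟶ Spec (.of (Away (grading N) ℓ)) :=
    IsOpenImmersion.lift (awayChart hℓ one_pos) f.left hf
  have hq : q ≫ awayChart hℓ one_pos = f.left := IsOpenImmersion.lift_fac _ _ _
  obtain ⟨ψ, hψ⟩ := Spec.map_surjective q
  obtain ⟨w, h1, hw⟩ := eq_awayEval (R := R) hℓ ψ.hom (by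
    have h := Over.w f
    rw [← hq, Category.assoc, awayChart_hom, ← hψ, ← Spec.map_comp] at h
    have := Spec.map_injective h
    exact fun z ↦ congr($(this).hom z))
  refine ⟨w, h1, ?_⟩
  ext1
  rw [projPt_left, ← hq, ← hψ, ← hw]
  rfl

lemma awayEval_isLocalizationElem_mul (w : Fin N → R) {ℓ ℓ' : MvPolynomial (Fin N) ℂ}
    (hℓ : ℓ ∈ grading N 1) (hℓ' : ℓ' ∈ grading N 1) (h : IsUnit (aeval w ℓ)) :
    awayEval w ℓ h (Away.isLocalizationElem hℓ hℓ') * aeval w ℓ = aeval w ℓ' := by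
  have := awayEval_mk w h hℓ 1 (ℓ' ^ 1) (by simpa using hℓ')
  rw [map_pow, pow_one (aeval w ℓ), pow_one (aeval w ℓ')] at this
  exact this

lemma projPt_preimage_projOpen (w : Fin N → R) {ℓ ℓ' : MvPolynomial (Fin N) ℂ}
    (hℓ : ℓ ∈ grading N 1) (hℓ' : ℓ' ∈ grading N 1) (h : IsUnit (aeval w ℓ)) :
    ((projPt w hℓ h).left ⁻¹ᵁ projOpen ℓ' : (Spec (.of R)).Opens) =
      PrimeSpectrum.basicOpen (aeval w ℓ') := by
  change (specMap (awayEval w ℓ h) ≫ awayChart hℓ one_pos) ⁻¹ᵁ _ = _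
  rw [Scheme.Hom.comp_preimage, awayChart_preimage_projOpen hℓ one_pos hℓ' one_pos]
  change PrimeSpectrum.basicOpen (awayEval w ℓ h _) = _
  ext x
  simp only [SetLike.mem_coe, PrimeSpectrum.mem_basicOpen, not_iff_not]
  rw [← awayEval_isLocalizationElem_mul w hℓ hℓ' h]
  exact ((x.asIdeal.mul_unit_mem_iff_mem h)).symm

/-- The preimage of ℓ' ≠ 0 is everything for the second point, hence for the first, so ℓ'(w) is
invertible. In this common chart the fractions X_j/ℓ' agree, and the unit is ℓ'(w')/ℓ'(w). -/
lemma projPt_inj {w w' : Fin N → R} {ℓ ℓ' : MvPolynomial (Fin N) ℂ} (hℓ : ℓ ∈ grading N 1)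
    (hℓ' : ℓ' ∈ grading N 1) (h : IsUnit (aeval w ℓ)) (h' : IsUnit (aeval w' ℓ'))
    (heq : projPt w hℓ h = projPt w' hℓ' h') : ∃ c : R, IsUnit c ∧ w' = c • w := by
  have h2 : IsUnit (aeval w ℓ') := by
    have e := projPt_preimage_projOpen w hℓ hℓ' h
    rw [heq, projPt_preimage_projOpen w' hℓ' hℓ' h'] at e
    have hiff : ∀ r : R, PrimeSpectrum.basicOpen r = ⊤ ↔ IsUnit r := fun r ↦ by
      have := PrimeSpectrum.iSup_basicOpen_eq_top_iff (ι := Unit) (f := fun _ ↦ r)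
      rwa [iSup_const, Set.range_const, Ideal.span_singleton_eq_top] at this
    rw [← hiff, ← e]
    exact (hiff _).mpr h'
  obtain ⟨a, ha⟩ := h2
  obtain ⟨b, hb⟩ := id h'
  refine ⟨↑a⁻¹ * b, (a⁻¹ * b).isUnit, ?_⟩
  have hu : IsUnit (aeval w ℓ') := ha ▸ a.isUnit
  rw [projPt_eq w hℓ hℓ' h hu] at heq
  have e := congrArg CommaMorphism.left heq
  change specMap (awayEval w ℓ' hu) ≫ awayChart hℓ' one_pos =
    specMap (awayEval w' ℓ' h') ≫ awayChart hℓ' one_pos at e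
  rw [cancel_mono] at e
  have e := specMap_injective e
  ext j
  have e1 := awayEval_mk w hu hℓ' 1 (X j) (by simpa using isHomogeneous_X ℂ j)
  have e2 := awayEval_mk w' h' hℓ' 1 (X j) (by simpa using isHomogeneous_X ℂ j)
  rw [e, aeval_X, pow_one] at e1
  rw [aeval_X, pow_one] at e2
  rw [Pi.smul_apply, smul_eq_mul, ← e1, ← e2, ← ha, ← hb]
  have hinv : (↑a⁻¹ : R) * ↑a = 1 := Units.inv_mul a
  generalize awayEval w' ℓ' h' _ = t
  linear_combination (-(t * b)) * hinv

end ProjPoints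
/-- A property local at the target may be checked on pullbacks to a jointly surjective family of
open immersions. -/
lemma of_forall_isPullback (P : MorphismProperty Scheme.{0}) [IsZariskiLocalAtTarget P]
    {X Y : Scheme.{0}} (f : X ⟶ Y) (H : ∀ y : Y, ∃ (U V : Scheme.{0}) (g : U ⟶ V) (iU : U ⟶ X)
      (iV : V ⟶ Y), IsOpenImmersion iV ∧ y ∈ Set.range iV ∧ IsPullback g iU iV f ∧ P g) : P f := by
  choose U V g iU iV hV hy hpb hg using H
  rw [IsZariskiLocalAtTarget.iff_of_iSup_eq_top (P := P) (fun y ↦ (iV y).opensRange)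
    (by rw [eq_top_iff]; exact fun y _ ↦ TopologicalSpace.Opens.mem_iSup.mpr ⟨y, hy y⟩)]
  intro y
  rw [MorphismProperty.arrow_mk_iso_iff P (morphismRestrictOpensRange f (iV y))]
  have e : pullback.snd f (iV y) = (hpb y).flip.isoPullback.inv ≫ g y := by simp
  rw [e]
  exact (MorphismProperty.cancel_left_of_respectsIso P _ _).mpr (hg y)

/-! ### Coordinate hyperplanes and charts of projective space -/

section Hyperplanes

open MvPolynomial HomogeneousLocalization

variable {R R' : Type} [CommRing R] [Algebra ℂ R] [CommRing R'] [Algebra ℂ R'] {N : ℕ}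

lemma restrictHom_eq_aeval (i : Fin (N + 1)) (s : MvPolynomial (Fin (N + 1)) ℂ) :
    restrictHom N i s = aeval (i.insertNth (α := fun _ => MvPolynomial (Fin N) ℂ) 0 X) s := rfl

lemma aeval_restrictHom (i : Fin (N + 1)) (w : Fin N → R) (s : MvPolynomial (Fin (N + 1)) ℂ) :
    aeval w (restrictHom N i s) = aeval (i.insertNth (α := fun _ ↦ R) 0 w) s := by
  rw [restrictHom_eq_aeval, ← AlgHom.comp_apply]
  congr 1
  ext j
  rw [AlgHom.comp_apply, aeval_X, aeval_X]
  refine Fin.succAboveCases i ?_ (fun j => ?_) j <;> simp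

lemma awayMap_restrictHom_surjective (i : Fin (N + 1)) {d : ℕ} {s : MvPolynomial (Fin (N + 1)) ℂ}
    (hs : s ∈ grading (N + 1) d) : Function.Surjective (Away.map (restrictHom N i) s) := by
  intro z
  obtain ⟨n, x, hx, rfl⟩ := Away.mk_surjective (grading N) ((restrictHom N i).map_mem hs) z
  have hx' : rename i.succAbove x ∈ grading (N + 1) (n • d) :=
    (mem_homogeneousSubmodule _ _).mpr
      (IsHomogeneous.rename_isHomogeneous ((mem_homogeneousSubmodule _ _).mp hx))
  refine ⟨Away.mk (grading (N + 1)) hs n (rename i.succAbove x) hx', ?_⟩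
  refine (Away.map_mk _ _ _ _ _ _).trans ?_
  congr 1
  exact restrictHom_rename N i x

lemma awayChart_comp_hyperplane (i : Fin (N + 1)) {d : ℕ} (h0 : 0 < d)
    {s : MvPolynomial (Fin (N + 1)) ℂ} (hs : s ∈ grading (N + 1) d)
    (hs' : restrictHom N i s ∈ grading N d) :
    awayChart hs' h0 ≫ (hyperplane N i).left =
      specMap (Away.map (restrictHom N i) s) ≫ awayChart hs h0 :=
  Proj.awayι_comp_map (restrictHom N i) (irrelevant_le_map_restrictHom N i) h0 s hs

instance (i : Fin (N + 1)) : IsClosedImmersion (hyperplane N i).left := by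
  refine of_forall_isPullback @IsClosedImmersion _ fun y ↦ ?_
  obtain ⟨d, s, hd, hs, hy⟩ : ∃ (d : ℕ) (s : MvPolynomial (Fin (N + 1)) ℂ),
      0 < d ∧ s ∈ grading (N + 1) d ∧ y ∈ projOpen s := by
    let s := (Proj.affineOpenCover (grading (N + 1))).idx y
    refine ⟨s.1, s.2, s.1.2, s.2.2, ?_⟩
    rw [← SetLike.mem_coe, ← range_awayChart s.2.2 s.1.2]
    exact (Proj.affineOpenCover (grading (N + 1))).covers y
  have hs' : restrictHom N i s ∈ grading N d := (restrictHom N i).map_mem hs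
  refine ⟨_, _, specMap (Away.map (restrictHom N i) s), awayChart hs' hd, awayChart hs hd,
    inferInstance, ?_, ?_, ?_⟩
  · rw [range_awayChart]; exact hy
  · refine IsOpenImmersion.isPullback _ _ _ _ (awayChart_comp_hyperplane i hd hs hs') ?_
    ext1
    change _ ⁻¹' (Set.range _) = Set.range _
    rw [range_awayChart, range_awayChart]
    rfl
  · exact IsClosedImmersion.spec_of_surjective _ (awayMap_restrictHom_surjective i hs)

lemma projPt_hyperplane (i : Fin (N + 1)) (w : Fin N → R) {ℓ : MvPolynomial (Fin (N + 1)) ℂ}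
    (hℓ : ℓ ∈ grading (N + 1) 1) (hℓ' : restrictHom N i ℓ ∈ grading N 1)
    (h : IsUnit (aeval w (restrictHom N i ℓ)))
    (h' : IsUnit (aeval (i.insertNth (α := fun _ ↦ R) 0 w) ℓ)) :
    projPt w hℓ' h ≫ hyperplane N i = projPt (i.insertNth (α := fun _ ↦ R) 0 w) hℓ h' := by
  ext1
  rw [Over.comp_left, projPt_left, projPt_left, Category.assoc, awayChart_comp_hyperplane i _ hℓ,
    ← Category.assoc, ← specMap_comp]
  congr 2
  refine awayEval_unique _ _ hℓ _ fun n s hs ↦ ?_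
  have hs' : restrictHom N i s ∈ grading N (n • 1) := (restrictHom N i).map_mem hs
  have := awayEval_mk w h hℓ' n (restrictHom N i s) hs'
  rw [RingHom.comp_apply, Away.map_mk, ← aeval_restrictHom, ← aeval_restrictHom, ← this]

/-- An ideal is determined by the ideals I above it. Here I contains the pulled back ideal K if and
only if the point modulo I lies on the hyperplane, that is, w_i ∈ I; I = K and I = (w_i) give the
two inclusions. -/
lemma ker_hyperplane_comap_projPt (i : Fin (N + 1)) (w : Fin (N + 1) → R)
    {ℓ : MvPolynomial (Fin (N + 1)) ℂ} (hℓ : ℓ ∈ grading (N + 1) 1) (h : IsUnit (aeval w ℓ)) :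
    (hyperplane N i).left.ker.comap (projPt w hℓ h).left = idl (Ideal.span {w i}) := by
  have hℓ' : restrictHom N i ℓ ∈ grading N 1 := (restrictHom N i).map_mem hℓ
  obtain ⟨K, hK⟩ := exists_eq_idl ((hyperplane N i).left.ker.comap (projPt w hℓ h).left)
  rw [hK]
  congr 1
  have key : ∀ I : Ideal R, K ≤ I ↔ w i ∈ I := by
    intro I
    let m : R →ₐ[ℂ] R ⧸ I := Ideal.Quotient.mkₐ ℂ I
    have hm : IsUnit (aeval (m ∘ w) ℓ) := by rw [aeval_comp_algHom]; exact h.map m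
    have e1 : K ≤ I ↔ ∃ g, g ≫ (hyperplane N i).left = (projPt (m ∘ w) hℓ hm).left := by
      rw [← ker_le_ker_iff, ← specCMap_projPt m w hℓ h, Over.comp_left, ← Scheme.IdealSheafData.map_ker,
        Scheme.IdealSheafData.le_map_iff_comap_le]
      change _ ↔ _ ≤ (specMap (Ideal.Quotient.mk I)).ker
      rw [hK, ← idl_eq_ker, idl_le_idl]
    rw [e1]
    have e2 : w i ∈ I ↔ m (w i) = 0 := (Ideal.Quotient.eq_zero_iff_mem).symm
    rw [e2]
    constructor
    · rintro ⟨g, hg⟩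
      let g' : specC (R ⧸ I) ⟶ projSpace N := Over.homMk g (by
        rw [← Over.w (hyperplane N i), ← Category.assoc, hg, Over.w])
      have hg' : g' ≫ hyperplane N i = projPt (m ∘ w) hℓ hm := by ext1; exact hg
      obtain ⟨w', h1, hw'⟩ := exists_eq_projPt hℓ' g' (by
        rintro _ ⟨x, rfl⟩
        have hx : (projPt (m ∘ w) hℓ hm).left x ∈ projOpen ℓ := by
          refine (projPt_preimage_projOpen (m ∘ w) hℓ hℓ hm).ge ?_
          exact fun hx ↦ (PrimeSpectrum.isPrime x).ne_top (Ideal.eq_top_of_isUnit_mem _ hx hm)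
        rw [← hg', Over.comp_left, Scheme.Hom.comp_apply] at hx
        exact hx)
      have h2 : IsUnit (aeval (i.insertNth (α := fun _ ↦ R ⧸ I) 0 w') ℓ) := by
        rw [← aeval_restrictHom, h1]; exact isUnit_one
      rw [hw', projPt_hyperplane i w' hℓ hℓ' _ h2] at hg'
      obtain ⟨c, hc, he⟩ := projPt_inj hℓ hℓ _ _ hg'
      have := congrFun he i
      simpa using this
    · intro h0
      have hins : i.insertNth (α := fun _ ↦ R ⧸ I) 0 (fun j ↦ m (w (i.succAbove j))) = m ∘ w := by
        ext j
        refine Fin.succAboveCases i ?_ (fun j => ?_) j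
        · simpa using h0.symm
        · simp
      have h2 : IsUnit (aeval (fun j ↦ m (w (i.succAbove j))) (restrictHom N i ℓ)) := by
        rw [aeval_restrictHom, hins]; exact hm
      refine ⟨(projPt _ hℓ' h2).left, ?_⟩
      rw [← Over.comp_left, projPt_hyperplane i _ hℓ hℓ' h2 (by rw [hins]; exact hm)]
      congr!
  apply le_antisymm
  · exact (key _).mpr (Ideal.mem_span_singleton_self _)
  · rw [Ideal.span_singleton_le_iff_mem]; exact (key _).mp le_rfl

/-- Criterion for `w` to be the universal point of the chart `ℓ ≠ 0`. -/
lemma awayEval_bijective {S : Type} [CommRing S] [Algebra ℂ S] {ℓ : MvPolynomial (Fin N) ℂ}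
    (hℓ : ℓ ∈ grading N 1) (w : Fin N → S) (h1 : aeval w ℓ = 1)
    (hext : ∀ φ ψ : S →+* S, φ.comp (algebraMap ℂ S) = algebraMap ℂ S →
      ψ.comp (algebraMap ℂ S) = algebraMap ℂ S → φ ∘ w = ψ ∘ w → φ = ψ)
    (hex : ∀ (R : Type) [CommRing R] [Algebra ℂ R] (z : Fin N → R), aeval z ℓ = 1 →
      ∃ φ : S →ₐ[ℂ] R, φ ∘ w = z) :
    Function.Bijective (awayEval w ℓ (h1 ▸ isUnit_one)) := by
  let κ : ℂ →+* Away (grading N) ℓ :=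
    (fromZeroRingHom (grading N) _).comp (algebraMap ℂ (grading N 0))
  let _ : Algebra ℂ (Away (grading N) ℓ) := κ.toAlgebra
  -- The identity of the coordinate ring of the chart has coordinates w₀; the homomorphism from S
  -- which sends w to w₀ is the inverse.
  obtain ⟨w₀, h₀, hw₀⟩ := eq_awayEval hℓ (RingHom.id (Away (grading N) ℓ)) (fun z ↦ rfl)
  obtain ⟨φ, hφ⟩ := hex _ w₀ h₀
  have hX : ∀ j, w₀ j = Away.mk (grading N) hℓ 1 (X j) (by simp [isHomogeneous_X]) := by
    intro j
    have := congr($hw₀ (Away.mk (grading N) hℓ 1 (X j) (by simp [isHomogeneous_X])))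
    rw [awayEval_mk_of_eq_one _ _ h₀, aeval_X] at this
    exact this.symm
  have e1 : (φ : S →+* _).comp (awayEval w ℓ (h1 ▸ isUnit_one)) = RingHom.id _ := by
    rw [comp_awayEval φ w _ (by rw [hφ, h₀]; exact isUnit_one) hℓ, hw₀]
    congr! 1
  have e2 : (awayEval w ℓ (h1 ▸ isUnit_one)).comp (φ : S →+* _) = RingHom.id _ := by
    apply hext
    · ext z
      simp only [RingHom.comp_apply]
      have h3 : (φ : S →+* _) (algebraMap ℂ S z) = κ z := φ.commutes z
      rw [h3]
      have hmem : (algebraMap ℂ (grading N 0) z : MvPolynomial _ ℂ) ∈ grading N (0 • 1) := by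
        rw [zero_smul]; exact (algebraMap ℂ (grading N 0) z).2
      have h4 : κ z = Away.mk (grading N) hℓ 0 (algebraMap ℂ (grading N 0) z : MvPolynomial _ ℂ)
          hmem := by
        apply val_injective
        refine Eq.trans ?_ (Away.val_mk _ _ _ _ _).symm
        change Localization.mk _ _ = Localization.mk _ _
        congr 1
      rw [h4]
      exact (awayEval_mk_of_eq_one _ _ h1 _ _ _ _).trans (aeval_C w z)
    · rfl
    · ext j
      have h5 : (φ : S →+* _) (w j) = w₀ j := congrFun hφ j
      simp only [Function.comp_apply, RingHom.comp_apply, RingHom.id_apply]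
      rw [h5, hX, awayEval_mk_of_eq_one _ _ h1, aeval_X]
  exact ⟨Function.LeftInverse.injective (g := φ) fun z ↦ congr($e1 z),
    Function.RightInverse.surjective (g := φ) fun z ↦ congr($e2 z)⟩

lemma isOpenImmersion_projPt {S : Type} [CommRing S] [Algebra ℂ S] {ℓ : MvPolynomial (Fin N) ℂ}
    (hℓ : ℓ ∈ grading N 1) (w : Fin N → S) (h : IsUnit (aeval w ℓ))
    (hb : Function.Bijective (awayEval w ℓ h)) :
    IsOpenImmersion (projPt w hℓ h).left ∧
      Set.range (projPt w hℓ h).left = projOpen ℓ := by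
  have : IsIso (specMap (awayEval w ℓ h)) := by
    have : IsIso (CommRingCat.ofHom (awayEval w ℓ h)) :=
      (ConcreteCategory.isIso_iff_bijective _).mpr hb
    infer_instance
  constructor
  · rw [projPt_left]; infer_instance
  · rw [projPt_left, ← range_awayChart hℓ one_pos]
    exact Function.Surjective.range_comp (specMap (awayEval w ℓ h)).surjective (awayChart hℓ one_pos)

end Hyperplanes
-- The affine charts z ≠ α(x + y) of the plane and of the nodal curve
section NodeCharts

open MvPolynomial HomogeneousLocalization

variable {R R' : Type} [CommRing R] [Algebra ℂ R] [CommRing R'] [Algebra ℂ R']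

/-- The linear form `z - α (x + y)`. -/
noncomputable def planeForm (α : ℂ) : MvPolynomial (Fin 3) ℂ := X 2 - C α * (X 0 + X 1)

lemma planeForm_mem (α : ℂ) : planeForm α ∈ grading 3 1 := by
  refine Submodule.sub_mem _ (isHomogeneous_X _ _) ?_
  rw [← smul_eq_C_mul]
  exact Submodule.smul_mem _ _ (Submodule.add_mem _ (isHomogeneous_X _ _) (isHomogeneous_X _ _))

lemma aeval_planeForm (α : ℂ) (w : Fin 3 → R) :
    aeval w (planeForm α) = w 2 - algebraMap ℂ R α * (w 0 + w 1) := by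
  simp [planeForm]

lemma isUnit_of_eq_one {M : Type*} [Monoid M] {a : M} (h : a = 1) : IsUnit a := h ▸ isUnit_one

/-- Homogeneous coordinates of the point with affine coordinates `x, y` in the chart
`z - α (x + y) ≠ 0` of the plane. -/
noncomputable def planeVec (α : ℂ) (x y : R) : Fin 3 → R :=
  ![x, y, 1 + algebraMap ℂ R α * (x + y)]

@[simp] lemma planeVec_zero (α : ℂ) (x y : R) : planeVec α x y 0 = x := rfl
@[simp] lemma planeVec_one (α : ℂ) (x y : R) : planeVec α x y 1 = y := rfl
@[simp] lemma planeVec_two (α : ℂ) (x y : R) :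
    planeVec α x y 2 = 1 + algebraMap ℂ R α * (x + y) := rfl

lemma aeval_planeVec (α β : ℂ) (x y : R) :
    aeval (planeVec α x y) (planeForm β) = 1 - algebraMap ℂ R (β - α) * (x + y) := by
  rw [aeval_planeForm]; simp [map_sub]; ring

lemma aeval_planeVec_self (α : ℂ) (x y : R) : aeval (planeVec α x y) (planeForm α) = 1 := by
  rw [aeval_planeVec]; simp

lemma algHom_comp_planeVec (φ : R →ₐ[ℂ] R') (α : ℂ) (x y : R) :
    φ ∘ planeVec α x y = planeVec α (φ x) (φ y) := by
  ext j; fin_cases j <;> simp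

/-- The chart `z - α (x + y) ≠ 0` of the plane. -/
noncomputable def planeChart (α : ℂ) : specC (MvPolynomial (Fin 2) ℂ) ⟶ projSpace 3 :=
  projPt (planeVec α (X 0) (X 1)) (planeForm_mem α) (isUnit_of_eq_one (aeval_planeVec_self α _ _))

/-- With z - α(x + y) normalised to 1, z is determined by x and y, and these are free coordinates.
-/
lemma planeChart_spec (α : ℂ) : IsOpenImmersion (planeChart α).left ∧
    Set.range (planeChart α).left = projOpen (planeForm α) := by
  refine isOpenImmersion_projPt _ _ _ (awayEval_bijective (planeForm_mem α) _
    (aeval_planeVec_self α _ _) ?_ ?_)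
  · intro φ ψ hφ hψ h
    apply ringHom_ext
    · exact fun z ↦ congr($hφ z).trans congr($hψ z).symm
    · intro i; fin_cases i
      · exact congrFun h 0
      · exact congrFun h 1
  · intro R _ _ z hz
    refine ⟨aeval ![z 0, z 1], ?_⟩
    rw [algHom_comp_planeVec]
    rw [aeval_planeForm] at hz
    ext j; fin_cases j
    · simp
    · simp
    · simp [← hz]

instance (α : ℂ) : IsOpenImmersion (planeChart α).left := (planeChart_spec α).1

/-- The coordinate ring of the affine node. -/
abbrev NodeRing : Type := MvPolynomial (Fin 2) ℂ ⧸ Ideal.span {(X 0 * X 1 : MvPolynomial (Fin 2) ℂ)}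

lemma nodeIdeal_comap_planeChart (α : ℂ) :
    nodeIdeal.comap (planeChart α).left = idl (Ideal.span {X 0 * X 1}) := by
  rw [nodeIdeal, comap_mul_of_isOpenImmersion, planeChart, ker_hyperplane_comap_projPt,
    ker_hyperplane_comap_projPt, ← idl_mul, Ideal.span_singleton_mul_span_singleton]
  rfl

/-- The embedding of the affine node in the plane. -/
noncomputable def nodeRingι : specC NodeRing ⟶ specC (MvPolynomial (Fin 2) ℂ) :=
  specCMap (Ideal.Quotient.mkₐ ℂ _)

instance : IsClosedImmersion nodeRingι.left :=
  IsClosedImmersion.spec_of_surjective _ Ideal.Quotient.mk_surjective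

lemma ker_nodeRingι : nodeRingι.left.ker = idl (Ideal.span {X 0 * X 1}) := (idl_eq_ker _).symm

/-- The embedding of the node in the plane. -/
noncomputable def nodeι : node ⟶ projSpace 3 := Over.homMk nodeIdeal.subschemeι rfl

instance : IsClosedImmersion nodeι.left :=
  inferInstanceAs (IsClosedImmersion nodeIdeal.subschemeι)

lemma ker_nodeι : nodeι.left.ker = nodeIdeal := nodeIdeal.ker_subschemeι

lemma nodeChart_aux (α : ℂ) : nodeι.left.ker ≤ (nodeRingι.left ≫ (planeChart α).left).ker := by
  rw [← Scheme.IdealSheafData.map_ker, Scheme.IdealSheafData.le_map_iff_comap_le, ker_nodeι,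
    nodeIdeal_comap_planeChart, ker_nodeRingι]

/-- The chart `z - α (x + y) ≠ 0` of the node. -/
noncomputable def nodeChart (α : ℂ) : specC NodeRing ⟶ node :=
  Over.homMk (IsClosedImmersion.lift nodeι.left (nodeRingι.left ≫ (planeChart α).left)
    (nodeChart_aux α)) (by
      rw [← Over.w nodeι, ← Category.assoc, IsClosedImmersion.lift_fac, Category.assoc, Over.w,
        Over.w])

lemma nodeChart_nodeι (α : ℂ) : nodeChart α ≫ nodeι = nodeRingι ≫ planeChart α := by
  ext1
  exact IsClosedImmersion.lift_fac _ _ _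

lemma isPullback_nodeChart (α : ℂ) :
    IsPullback nodeRingι.left (nodeChart α).left (planeChart α).left nodeι.left := by
  refine isPullback_of_isClosedImmersion _ _ _ _ ?_ ?_
  · exact congrArg CommaMorphism.left (nodeChart_nodeι α).symm
  · rw [ker_nodeι, nodeIdeal_comap_planeChart, ker_nodeRingι]

instance (α : ℂ) : IsOpenImmersion (nodeChart α).left :=
  MorphismProperty.of_isPullback (P := @IsOpenImmersion) (isPullback_nodeChart α) inferInstance

lemma mem_range_nodeChart_iff (α : ℂ) (p : node.left) :
    p ∈ Set.range (nodeChart α).left ↔ nodeι.left p ∈ projOpen (planeForm α) := by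
  rw [← SetLike.mem_coe, ← (planeChart_spec α).2]
  have e : (nodeChart α).left = (isPullback_nodeChart α).isoPullback.hom ≫
      pullback.snd (planeChart α).left nodeι.left := by simp
  have : Set.range (nodeChart α).left = Set.range (pullback.snd (planeChart α).left nodeι.left) := by
    rw [e]
    exact Function.Surjective.range_comp (isPullback_nodeChart α).isoPullback.hom.surjective
      (pullback.snd (planeChart α).left nodeι.left)
  rw [this, Scheme.Pullback.range_snd]
  rfl

lemma xAxis_comap_nodeChart (α : ℂ) : xAxis.comap (nodeChart α).left =
    idl (Ideal.span {Ideal.Quotient.mk _ (X 1)}) := by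
  change ((hyperplane 2 1).left.ker.comap nodeι.left).comap _ = _
  rw [← Scheme.IdealSheafData.comap_comp, ← Over.comp_left, nodeChart_nodeι, Over.comp_left,
    Scheme.IdealSheafData.comap_comp, planeChart, ker_hyperplane_comap_projPt]
  refine (comap_idl _ _).trans ?_
  rw [Ideal.map_span, Set.image_singleton]
  rfl

lemma yAxis_comap_nodeChart (α : ℂ) : yAxis.comap (nodeChart α).left =
    idl (Ideal.span {Ideal.Quotient.mk _ (X 0)}) := by
  change ((hyperplane 2 0).left.ker.comap nodeι.left).comap _ = _
  rw [← Scheme.IdealSheafData.comap_comp, ← Over.comp_left, nodeChart_nodeι, Over.comp_left,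
    Scheme.IdealSheafData.comap_comp, planeChart, ker_hyperplane_comap_projPt]
  refine (comap_idl _ _).trans ?_
  rw [Ideal.map_span, Set.image_singleton]
  rfl

/-- Points of projective space have a nonzero coordinate. -/
lemma exists_mem_projOpen_X {N : ℕ} (t : (projSpace N).left) : ∃ j, t ∈ projOpen (X j) := by
  by_contra! h
  let q : ProjectiveSpectrum (grading N) := t
  have hq : ∀ j, (X j : MvPolynomial (Fin N) ℂ) ∈ q.asHomogeneousIdeal := fun j ↦ by
    by_contra hj
    exact h j ((Proj.mem_basicOpen (grading N) (X j) t).mpr hj)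
  refine q.not_irrelevant_le ((HomogeneousIdeal.toIdeal_irrelevant_le _).mpr fun d hd s hs ↦ ?_)
  have hs' : s.IsHomogeneous d := hs
  rw [s.as_sum]
  refine Ideal.sum_mem _ fun m hm ↦ ?_
  have hmd := hs' (mem_support_iff.mp hm)
  obtain ⟨j, hj⟩ : ∃ j, m j ≠ 0 := by
    by_contra! h0
    have : m = 0 := Finsupp.ext h0
    rw [this] at hmd; simp at hmd; omega
  have : (X j : MvPolynomial (Fin N) ℂ) ∣ monomial m (coeff m s) := by
    rw [X_dvd_monomial]; exact Or.inr hj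
  exact Ideal.mem_of_dvd _ this (hq j)

/-- A pencil of linear forms: at a point where not all coefficients vanish, almost all members
do not vanish. -/
lemma finite_notMem_projOpen {N k : ℕ} (t : (projSpace N).left)
    (c : Fin k → MvPolynomial (Fin N) ℂ) (hc : ∃ j, t ∈ projOpen (c j)) :
    {α : ℂ | t ∉ projOpen (∑ j : Fin k, C (α ^ (j : ℕ)) * c j)}.Finite := by
  classical
  let q : ProjectiveSpectrum (grading N) := t
  have hmem : ∀ s, t ∈ projOpen s ↔ s ∉ q.asHomogeneousIdeal :=
    fun s ↦ Proj.mem_basicOpen (grading N) s t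
  let I : Ideal (MvPolynomial (Fin N) ℂ) := q.asHomogeneousIdeal.toIdeal
  have : I.IsPrime := q.isPrime
  let D := MvPolynomial (Fin N) ℂ ⧸ I
  -- At t the members of the pencil are the values of one polynomial over the domain attached to t;
  -- the excluded α are among its roots.
  let P : Polynomial D := ∑ j : Fin k, Polynomial.C (Ideal.Quotient.mk I (c j)) * Polynomial.X ^ (j : ℕ)
  have hP : P ≠ 0 := by
    obtain ⟨j, hj⟩ := hc
    intro h0
    have : P.coeff j = Ideal.Quotient.mk I (c j) := by
      simp only [P, Polynomial.finsetSum_coeff, Polynomial.coeff_C_mul, Polynomial.coeff_X_pow]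
      rw [Finset.sum_eq_single j]
      · simp
      · intro i _ hi
        rw [if_neg (fun h ↦ hi (Fin.ext h.symm)), mul_zero]
      · simp
    rw [h0, Polynomial.coeff_zero] at this
    exact (hmem _).mp hj (Ideal.Quotient.eq_zero_iff_mem.mp this.symm)
  have hinj : Function.Injective (algebraMap ℂ D) := (algebraMap ℂ D).injective
  refine Set.Finite.of_finite_image (f := algebraMap ℂ D)
    (Set.Finite.subset (P.roots.toFinset.finite_toSet) ?_) hinj.injOn
  rintro _ ⟨α, hα, rfl⟩
  have hα' : ∑ j : Fin k, C (α ^ (j : ℕ)) * c j ∈ I := by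
    by_contra h'
    exact hα ((hmem _).mpr h')
  rw [Finset.mem_coe, Multiset.mem_toFinset, Polynomial.mem_roots hP, Polynomial.IsRoot.def]
  have h2 := Ideal.Quotient.eq_zero_iff_mem.mpr hα'
  rw [← h2, map_sum, Polynomial.eval_finsetSum]
  refine Finset.sum_congr rfl fun j _ ↦ ?_
  rw [Polynomial.eval_mul, Polynomial.eval_C, Polynomial.eval_pow, Polynomial.eval_X, map_mul,
    ← map_pow, mul_comm]
  rfl

lemma range_nodeι_subset (p : node.left) :
    nodeι.left p ∉ projOpen (X 0) ∨ nodeι.left p ∉ projOpen (X 1) := by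
  have h : nodeι.left p ∈ nodeIdeal.support := by
    rw [← ker_nodeι]; exact Scheme.Hom.range_subset_ker_support _ ⟨p, rfl⟩
  have hr : ∀ i, ∀ t ∈ (hyperplane 2 i).left.ker.support, t ∉ projOpen (X i) := by
    intro i t ht
    rw [← SetLike.mem_coe, Scheme.Hom.support_ker,
      (IsClosedImmersion.isClosedEmbedding _).isClosed_range.closure_eq] at ht
    obtain ⟨u, rfl⟩ := ht
    intro hu
    have hu' : u ∈ projOpen (restrictHom 2 i (X i)) := hu
    have h0 : restrictHom 2 i (X i) = 0 := by
      rw [restrictHom_eq_aeval, aeval_X]; simp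
    rw [h0] at hu'
    exact (Proj.mem_basicOpen (grading 2) 0 u).mp hu' (Ideal.zero_mem _)
  rw [nodeIdeal, Scheme.IdealSheafData.support_mul] at h
  exact h.imp (hr 0 _) (hr 1 _)

/-- Almost all charts contain a given point of the node. -/
lemma finite_notMem_range_nodeChart (p : node.left) :
    {α : ℂ | p ∉ Set.range (nodeChart α).left}.Finite := by
  have h := finite_notMem_projOpen (nodeι.left p) ![X 2, -(X 0 + X 1)] ?_
  · convert h using 4 with α
    rw [mem_range_nodeChart_iff]
    have : planeForm α = ∑ j : Fin 2, C (α ^ (j : ℕ)) * (![X 2, -(X 0 + X 1)] : Fin 2 → _) j := by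
      simp [planeForm, Fin.sum_univ_two]; ring
    rw [this]
  -- If z and x + y both vanished at p, then all three coordinates would, because x or y vanishes at
  -- every point of C.
  · let q : ProjectiveSpectrum (grading 3) := nodeι.left p
    have hmem : ∀ s, nodeι.left p ∈ projOpen s ↔ s ∉ q.asHomogeneousIdeal :=
      fun s ↦ Proj.mem_basicOpen (grading 3) s _
    by_contra! h
    have h0 : nodeι.left p ∉ projOpen (X 2) := h 0
    have h1 : nodeι.left p ∉ projOpen (-(X 0 + X 1)) := h 1
    rw [hmem, not_not] at h0 h1
    have h1' := (Ideal.neg_mem_iff (I := q.asHomogeneousIdeal.toIdeal)).mp h1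
    have h01 : (X 0 : MvPolynomial (Fin 3) ℂ) ∈ q.asHomogeneousIdeal.toIdeal ∧
        (X 1 : MvPolynomial (Fin 3) ℂ) ∈ q.asHomogeneousIdeal.toIdeal := by
      rcases range_nodeι_subset p with h | h <;> rw [hmem, not_not] at h
      · exact ⟨h, (Ideal.add_mem_iff_right _ h).mp h1'⟩
      · exact ⟨(Ideal.add_mem_iff_left _ h).mp h1', h⟩
    obtain ⟨j, hj⟩ := exists_mem_projOpen_X (nodeι.left p)
    rw [hmem] at hj
    fin_cases j
    · exact hj h01.1
    · exact hj h01.2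
    · exact hj h0

instance (N : ℕ) : IsSeparated (projSpace N).hom := by
  change IsSeparated (Proj.toSpecZero (grading N) ≫ _)
  infer_instance

instance : IsSeparated node.hom := by
  change IsSeparated (nodeIdeal.subschemeι ≫ _)
  infer_instance

end NodeCharts
-- Base change and locality of families of subschemes
section Families

open Scheme

lemma isPullback_subschemeι_comap {X Y : Scheme.{0}} (I : Y.IdealSheafData) (f : X ⟶ Y) :
    IsPullback (I.comap f).subschemeι
      (IdealSheafData.subschemeMap _ _ f (I.le_map_comap f)) f I.subschemeι :=
  isPullback_of_isClosedImmersion _ _ _ _ (by simp) (by simp)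

lemma fiberProdMap_fst {X X' Y Y' : Over base} (f : X ⟶ X') (g : Y ⟶ Y') :
    fiberProdMap f g ≫ pullback.fst X'.hom Y'.hom = pullback.fst X.hom Y.hom ≫ f.left :=
  pullback.lift_fst _ _ _

lemma fiberProdMap_snd {X X' Y Y' : Over base} (f : X ⟶ X') (g : Y ⟶ Y') :
    fiberProdMap f g ≫ pullback.snd X'.hom Y'.hom = pullback.snd X.hom Y.hom ≫ g.left :=
  pullback.lift_snd _ _ _

lemma fiberProdMap_id_fst {X Y Y' : Over base} (g : Y ⟶ Y') :
    fiberProdMap (𝟙 X) g ≫ pullback.fst X.hom Y'.hom = pullback.fst X.hom Y.hom := by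
  rw [fiberProdMap_fst, Over.id_left, Category.comp_id]

lemma isPullback_fiberProdMap {X T T' : Over base} (f : T' ⟶ T) :
    IsPullback (fiberProdMap (𝟙 X) f) (pullback.snd X.hom T'.hom) (pullback.snd X.hom T.hom)
      f.left := by
  have h1 : IsPullback (pullback.snd X.hom T.hom) (pullback.fst X.hom T.hom) T.hom X.hom :=
    (IsPullback.of_hasPullback _ _).flip
  have h2 : IsPullback (pullback.snd X.hom T'.hom) (pullback.fst X.hom T'.hom) T'.hom X.hom :=
    (IsPullback.of_hasPullback _ _).flip
  have h : IsPullback (fiberProdMap (𝟙 X) f ≫ pullback.fst X.hom T.hom)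
      (pullback.snd X.hom T'.hom) X.hom (f.left ≫ T.hom) := by
    rw [fiberProdMap_id_fst, Over.w f]
    exact h2.flip
  exact IsPullback.of_right h (fiberProdMap_snd _ _) h1.flip

lemma isPullback_family {X T T' : Over base} (f : T' ⟶ T)
    (J : (fiberProd X T).left.IdealSheafData) :
    IsPullback (IdealSheafData.subschemeMap _ _ (fiberProdMap (𝟙 X) f) (J.le_map_comap _))
      ((J.comap (fiberProdMap (𝟙 X) f)).subschemeι ≫ pullback.snd X.hom T'.hom)
      (J.subschemeι ≫ pullback.snd X.hom T.hom) f.left :=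
  ((isPullback_subschemeι_comap J (fiberProdMap (𝟙 X) f)).paste_horiz
    (isPullback_fiberProdMap (X := X) f).flip).flip

lemma IsFamily.comap {n : ℕ} {X T T' : Over base} (f : T' ⟶ T)
    {J : (fiberProd X T).left.IdealSheafData} (h : IsFamily n J) :
    IsFamily n (J.comap (fiberProdMap (𝟙 X) f)) := by
  have hp := isPullback_family f J
  have := h.finite
  have := h.flat
  have := h.locallyOfFinitePresentation
  refine ⟨MorphismProperty.of_isPullback hp h.finite, MorphismProperty.of_isPullback hp h.flat,
    MorphismProperty.of_isPullback hp h.locallyOfFinitePresentation, fun t ↦ ?_⟩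
  rw [Scheme.Hom.finrank_of_isPullback _ _ _ _ hp, h.finrank_eq]

lemma isZariskiLocalAtTarget_of_hasAffineProperty {P : MorphismProperty Scheme.{0}} {Q}
    (_ : HasAffineProperty P Q) : IsZariskiLocalAtTarget P := inferInstance

lemma isZariskiLocalAtTarget_of_hasRingHomProperty {P : MorphismProperty Scheme.{0}}
    {Q : ∀ {R S : Type} [CommRing R] [CommRing S], (R →+* S) → Prop}
    (_ : HasRingHomProperty P Q) : IsZariskiLocalAtTarget P := inferInstance

instance : IsZariskiLocalAtTarget @IsFinite.{0} :=
  isZariskiLocalAtTarget_of_hasAffineProperty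
    IsFinite.instHasAffinePropertyAndIsAffineFiniteCarrierObjOppositeOpensCarrierCarrierCommRingCatPresheafOpOpensTopHomAppTop

instance : IsZariskiLocalAtTarget @Flat.{0} :=
  isZariskiLocalAtTarget_of_hasRingHomProperty (Q := RingHom.Flat) inferInstance

instance : IsZariskiLocalAtTarget @LocallyOfFinitePresentation.{0} :=
  isZariskiLocalAtTarget_of_hasRingHomProperty (Q := RingHom.FinitePresentation) inferInstance

lemma isFamily_of_cover {n : ℕ} {X T : Over base} (J : (fiberProd X T).left.IdealSheafData)
    (h : ∀ t : T.left, ∃ (T' : Over base) (f : T' ⟶ T), IsOpenImmersion f.left ∧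
      t ∈ Set.range f.left ∧ IsFamily n (J.comap (fiberProdMap (𝟙 X) f))) : IsFamily n J := by
  have aux : ∀ (P : MorphismProperty Scheme.{0}) [IsZariskiLocalAtTarget P],
      (∀ (T' : Over base) (J' : (fiberProd X T').left.IdealSheafData), IsFamily n J' →
        P (J'.subschemeι ≫ pullback.snd X.hom T'.hom)) →
      P (J.subschemeι ≫ pullback.snd X.hom T.hom) := by
    intro P _ hP
    refine of_forall_isPullback P _ fun t ↦ ?_
    obtain ⟨T', f, hf, ht, hJ⟩ := h t
    exact ⟨_, _, _, _, f.left, hf, ht, (isPullback_family f J).flip, hP _ _ hJ⟩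
  have h1 : IsFinite (J.subschemeι ≫ pullback.snd X.hom T.hom) := aux @IsFinite.{0} fun _ _ h ↦ h.finite
  have h2 : Flat (J.subschemeι ≫ pullback.snd X.hom T.hom) := aux @Flat.{0} fun _ _ h ↦ h.flat
  have h3 : LocallyOfFinitePresentation (J.subschemeι ≫ pullback.snd X.hom T.hom) :=
    aux @LocallyOfFinitePresentation.{0} fun _ _ h ↦ h.locallyOfFinitePresentation
  refine ⟨h1, h2, h3, fun t ↦ ?_⟩
  obtain ⟨T', f, hf, ⟨t', rfl⟩, hJ⟩ := h t
  rw [← hJ.finrank_eq t', Scheme.Hom.finrank_of_isPullback _ _ _ _ (isPullback_family f J)]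

lemma isFamily_ker {n : ℕ} {X T : Over base} {Z : Scheme.{0}} (i : Z ⟶ (fiberProd X T).left)
    [IsClosedImmersion i] (q : Z ⟶ T.left) (hq : i ≫ pullback.snd X.hom T.hom = q) [IsFinite q]
    [Flat q] [LocallyOfFinitePresentation q] (hn : ∀ t, Scheme.Hom.finrank q t = n) :
    IsFamily n i.ker := by
  have e : i.ker.subschemeι ≫ pullback.snd X.hom T.hom = inv i.toImage ≫ q := by
    rw [IsIso.eq_inv_comp, ← Category.assoc, ← hq]
    congr 1
    exact i.toImage_imageι
  refine ⟨?_, ?_, ?_, fun t ↦ ?_⟩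
  · rw [e]; infer_instance
  · rw [e]; infer_instance
  · rw [e]; infer_instance
  · rw [e, Scheme.Hom.finrank_comp_left_of_isIso, hn]

/-- The pullback of a family along a morphism of bases. -/
noncomputable abbrev pullFam {X T T' : Over base} (f : T' ⟶ T)
    (J : (fiberProd X T).left.IdealSheafData) : (fiberProd X T').left.IdealSheafData :=
  J.comap (fiberProdMap (𝟙 X) f)

lemma fiberProdMap_comp {X T T' T'' : Over base} (f : T' ⟶ T) (g : T'' ⟶ T') :
    fiberProdMap (𝟙 X) (g ≫ f) = fiberProdMap (𝟙 X) g ≫ fiberProdMap (𝟙 X) f := by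
  apply pullback.hom_ext
  · rw [Category.assoc, fiberProdMap_id_fst, fiberProdMap_id_fst, fiberProdMap_id_fst]
  · rw [Category.assoc, fiberProdMap_snd, fiberProdMap_snd, ← Category.assoc, fiberProdMap_snd,
      Category.assoc, Over.comp_left]

lemma pullFam_comp {X T T' T'' : Over base} (f : T' ⟶ T) (g : T'' ⟶ T')
    (J : (fiberProd X T).left.IdealSheafData) :
    pullFam (g ≫ f) J = pullFam g (pullFam f J) := by
  rw [pullFam, fiberProdMap_comp, IdealSheafData.comap_comp]

lemma pullFam_id {X T : Over base} (J : (fiberProd X T).left.IdealSheafData) :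
    pullFam (𝟙 T) J = J := by
  have : fiberProdMap (𝟙 X) (𝟙 T) = 𝟙 _ := by
    apply pullback.hom_ext
    · rw [fiberProdMap_id_fst, Category.id_comp]
    · rw [fiberProdMap_snd, Category.id_comp, Over.id_left, Category.comp_id]
  rw [pullFam, this, IdealSheafData.comap_id]

/-- Ideal sheaves agree if they agree on a cover by open immersions. -/
lemma idealSheaf_ext {X : Scheme.{0}} {I J : X.IdealSheafData}
    (h : ∀ x : X, ∃ (U : Scheme.{0}) (i : U ⟶ X), IsOpenImmersion i ∧ x ∈ Set.range i ∧
      I.comap i = J.comap i) : I = J := by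
  have key : ∀ x : X, ∃ W : X.affineOpens, x ∈ W.1 ∧ I.ideal W = J.ideal W := by
    intro x
    obtain ⟨U, i, hi, ⟨u, rfl⟩, e⟩ := h x
    obtain ⟨V, hV, hu, -⟩ := exists_isAffineOpen_mem_and_subset (x := u) (U := ⊤) trivial
    refine ⟨⟨i ''ᵁ V, hV.image_of_isOpenImmersion i⟩, ⟨u, hu, rfl⟩, ?_⟩
    have e1 := I.ideal_comap_of_isOpenImmersion i ⟨V, hV⟩
    have e2 := J.ideal_comap_of_isOpenImmersion i ⟨V, hV⟩
    rw [e, e2] at e1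
    exact (Ideal.comap_injective_of_surjective _
      (ConcreteCategory.bijective_of_isIso (i.appIso V).inv).2 e1).symm
  choose W hW hIJ using key
  exact IdealSheafData.ext_of_iSup_eq_top W
    (by rw [eq_top_iff]; exact fun x _ ↦ TopologicalSpace.Opens.mem_iSup.mpr ⟨x, hW x⟩) hIJ

instance {X T T' : Over base} (f : T' ⟶ T) [IsOpenImmersion f.left] :
    IsOpenImmersion (fiberProdMap (𝟙 X) f) :=
  MorphismProperty.of_isPullback (P := @IsOpenImmersion) (isPullback_fiberProdMap (X := X) f).flip
    inferInstance

lemma mem_range_fiberProdMap {X T T' : Over base} (f : T' ⟶ T) (z : (fiberProd X T).left) :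
    z ∈ Set.range (fiberProdMap (𝟙 X) f) ↔ pullback.snd X.hom T.hom z ∈ Set.range f.left := by
  have hp := (isPullback_fiberProdMap (X := X) f)
  have e : fiberProdMap (𝟙 X) f = hp.isoPullback.hom ≫ pullback.fst _ _ := by simp
  have : Set.range (fiberProdMap (𝟙 X) f) =
      Set.range (pullback.fst (pullback.snd X.hom T.hom) f.left) := by
    rw [e]
    exact Function.Surjective.range_comp hp.isoPullback.hom.surjective
      (pullback.fst (pullback.snd X.hom T.hom) f.left)
  rw [this, Scheme.Pullback.range_fst]
  rfl

lemma family_ext {X T : Over base} {I J : (fiberProd X T).left.IdealSheafData}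
    (h : ∀ t : T.left, ∃ (T' : Over base) (f : T' ⟶ T), IsOpenImmersion f.left ∧
      t ∈ Set.range f.left ∧ pullFam f I = pullFam f J) : I = J := by
  refine idealSheaf_ext fun z ↦ ?_
  obtain ⟨T', f, hf, ht, e⟩ := h (pullback.snd X.hom T.hom z)
  exact ⟨_, fiberProdMap (𝟙 X) f, inferInstance, (mem_range_fiberProdMap f z).mpr ht, e⟩

/-- Small affine neighbourhoods. -/
lemma exists_specC_nbhd {T : Over base} (t : T.left) (V : T.left.Opens) (hV : t ∈ V) :
    ∃ (R : Type) (_ : CommRing R) (_ : Algebra ℂ R) (i : specC R ⟶ T),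
      IsOpenImmersion i.left ∧ t ∈ Set.range i.left ∧ Set.range i.left ⊆ V := by
  obtain ⟨U, hU, ht, hUV⟩ := exists_isAffineOpen_mem_and_subset (x := t) (U := V) hV
  obtain ⟨κ, hκ⟩ := exists_specMap (R := ℂ) (S := Γ(T.left, U)) (hU.fromSpec ≫ T.hom)
  let _ : Algebra ℂ Γ(T.left, U) := κ.toAlgebra
  have hr : Set.range hU.fromSpec = U := hU.range_fromSpec
  refine ⟨Γ(T.left, U), inferInstance, inferInstance, Over.homMk hU.fromSpec hκ, ?_, ?_, ?_⟩
  · exact inferInstanceAs (IsOpenImmersion hU.fromSpec)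
  · change t ∈ Set.range hU.fromSpec
    rw [hr]; exact ht
  · change Set.range hU.fromSpec ⊆ _
    rw [hr]; exact hUV

/-- Morphisms of schemes agree if they agree locally. -/
lemma scheme_hom_ext {X Y : Scheme.{0}} {f g : X ⟶ Y}
    (h : ∀ x : X, ∃ (U : Scheme.{0}) (i : U ⟶ X), IsOpenImmersion i ∧ x ∈ Set.range i ∧
      i ≫ f = i ≫ g) : f = g := by
  choose U i hi hx e using h
  let 𝒰 : X.OpenCover := Scheme.openCoverOfIsOpenCover X (fun x ↦ (i x).opensRange) (by
    rw [TopologicalSpace.IsOpenCover, eq_top_iff]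
    exact fun x _ ↦ TopologicalSpace.Opens.mem_iSup.mpr ⟨x, hx x⟩)
  refine 𝒰.hom_ext _ _ fun (x : X) ↦ ?_
  change (i x).opensRange.ι ≫ _ = (i x).opensRange.ι ≫ _
  rw [← cancel_epi (i x).isoOpensRange.hom]
  simpa using e x

/-- Morphisms over `ℂ` agree if they agree locally. -/
lemma over_hom_ext {T X : Over base} {f g : T ⟶ X}
    (h : ∀ t : T.left, ∃ (T' : Over base) (i : T' ⟶ T), IsOpenImmersion i.left ∧
      t ∈ Set.range i.left ∧ i ≫ f = i ≫ g) : f = g := by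
  ext1
  refine scheme_hom_ext fun t ↦ ?_
  obtain ⟨T', i, hi, ht, e⟩ := h t
  exact ⟨_, i.left, hi, ht, congrArg CommaMorphism.left e⟩

end Families
-- Families over affine bases given by an algebra with two generators
section AffineFamilies

open Scheme MvPolynomial TensorProduct

/-- The morphism to a fibre product with given components. -/
noncomputable def prodLift {T X Y : Over base} (f : T ⟶ X) (g : T ⟶ Y) : T ⟶ fiberProd X Y :=
  Over.homMk (pullback.lift f.left g.left (by simp)) (by
    simp only [Over.mk_hom]
    rw [← Category.assoc, pullback.lift_fst, Over.w])

/-- The first projection. -/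
noncomputable def prodFst (X Y : Over base) : fiberProd X Y ⟶ X :=
  Over.homMk (pullback.fst X.hom Y.hom) rfl

/-- The second projection. -/
noncomputable def prodSnd (X Y : Over base) : fiberProd X Y ⟶ Y :=
  Over.homMk (pullback.snd X.hom Y.hom) pullback.condition.symm

@[simp]
lemma prodLift_fst {T X Y : Over base} (f : T ⟶ X) (g : T ⟶ Y) :
    prodLift f g ≫ prodFst X Y = f := by
  ext1; exact pullback.lift_fst _ _ _

@[simp]
lemma prodLift_snd {T X Y : Over base} (f : T ⟶ X) (g : T ⟶ Y) :
    prodLift f g ≫ prodSnd X Y = g := by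
  ext1; exact pullback.lift_snd _ _ _

@[simp]
lemma prodLift_fst_assoc {T X Y Z : Over base} (f : T ⟶ X) (g : T ⟶ Y) (k : X ⟶ Z) :
    prodLift f g ≫ prodFst X Y ≫ k = f ≫ k := by
  rw [← Category.assoc, prodLift_fst]

@[simp]
lemma prodLift_snd_assoc {T X Y Z : Over base} (f : T ⟶ X) (g : T ⟶ Y) (k : Y ⟶ Z) :
    prodLift f g ≫ prodSnd X Y ≫ k = g ≫ k := by
  rw [← Category.assoc, prodLift_snd]

lemma prod_hom_ext {T X Y : Over base} {f g : T ⟶ fiberProd X Y}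
    (h1 : f ≫ prodFst X Y = g ≫ prodFst X Y) (h2 : f ≫ prodSnd X Y = g ≫ prodSnd X Y) : f = g := by
  ext1
  exact pullback.hom_ext (congrArg CommaMorphism.left h1) (congrArg CommaMorphism.left h2)

lemma comp_prodLift {T' T X Y : Over base} (h : T' ⟶ T) (f : T ⟶ X) (g : T ⟶ Y) :
    h ≫ prodLift f g = prodLift (h ≫ f) (h ≫ g) :=
  prod_hom_ext (by simp) (by simp)

/-- The product of morphisms, over `ℂ`. -/
noncomputable def prodMap {X X' Y Y' : Over base} (f : X ⟶ X') (g : Y ⟶ Y') :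
    fiberProd X Y ⟶ fiberProd X' Y' :=
  prodLift (prodFst X Y ≫ f) (prodSnd X Y ≫ g)

lemma prodMap_left {X X' Y Y' : Over base} (f : X ⟶ X') (g : Y ⟶ Y') :
    (prodMap f g).left = fiberProdMap f g := by
  apply pullback.hom_ext
  · rw [fiberProdMap_fst]; exact pullback.lift_fst _ _ _
  · rw [fiberProdMap_snd]; exact pullback.lift_snd _ _ _

lemma prodLift_prodMap {T X X' Y Y' : Over base} (f : X ⟶ X') (g : Y ⟶ Y') (a : T ⟶ X)
    (b : T ⟶ Y) : prodLift a b ≫ prodMap f g = prodLift (a ≫ f) (b ≫ g) :=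
  prod_hom_ext (by simp [prodMap]) (by simp [prodMap])

section NodePt

variable {B B' : Type} [CommRing B] [Algebra ℂ B] [CommRing B'] [Algebra ℂ B']

/-- The homomorphism from the coordinate ring of the affine node given by two elements. -/
noncomputable def nodePtHom (x y : B) (h : x * y = 0) : NodeRing →ₐ[ℂ] B :=
  Ideal.Quotient.liftₐ _ (aeval ![x, y]) (by
    suffices Ideal.span {X 0 * X 1} ≤ RingHom.ker (aeval ![x, y] : _ →ₐ[ℂ] B) from
      fun z hz ↦ this hz
    rw [Ideal.span_singleton_le_iff_mem, RingHom.mem_ker]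
    simp [h])

@[simp] lemma nodePtHom_mk (x y : B) (h : x * y = 0) (z : MvPolynomial (Fin 2) ℂ) :
    nodePtHom x y h (Ideal.Quotient.mk _ z) = aeval ![x, y] z := rfl

lemma nodeRing_hom_ext {φ ψ : NodeRing →ₐ[ℂ] B}
    (h0 : φ (Ideal.Quotient.mk _ (X 0)) = ψ (Ideal.Quotient.mk _ (X 0)))
    (h1 : φ (Ideal.Quotient.mk _ (X 1)) = ψ (Ideal.Quotient.mk _ (X 1))) : φ = ψ := by
  apply Ideal.Quotient.algHom_ext
  apply MvPolynomial.algHom_ext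
  intro i
  fin_cases i
  · exact h0
  · exact h1

lemma exists_nodePtHom (φ : NodeRing →ₐ[ℂ] B) : ∃ x y, ∃ h : x * y = 0, φ = nodePtHom x y h := by
  refine ⟨φ (Ideal.Quotient.mk _ (X 0)), φ (Ideal.Quotient.mk _ (X 1)), ?_, ?_⟩
  · rw [← map_mul, ← map_mul, Ideal.Quotient.eq_zero_iff_mem.mpr (Ideal.mem_span_singleton_self _),
      map_zero]
  · apply nodeRing_hom_ext <;> simp

/-- The point with coordinates `x, y` in the chart `nodeChart α`. -/
noncomputable def nodePt (α : ℂ) (x y : B) (h : x * y = 0) : specC B ⟶ node :=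
  specCMap (nodePtHom x y h) ≫ nodeChart α

lemma specCMap_nodePt (α : ℂ) (x y : B) (h : x * y = 0) (φ : B →ₐ[ℂ] B') :
    specCMap φ ≫ nodePt α x y h =
      nodePt α (φ x) (φ y) (by rw [← map_mul, h, map_zero]) := by
  rw [nodePt, nodePt, ← Category.assoc, specCMap_comp]
  congr 2
  apply nodeRing_hom_ext <;> simp

instance (α : ℂ) : Mono (nodeChart α) :=
  (Over.forget base).mono_of_mono_map (inferInstanceAs (Mono (nodeChart α).left))

lemma nodePt_inj {α : ℂ} {x y x' y' : B} {h : x * y = 0} {h' : x' * y' = 0}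
    (e : nodePt α x y h = nodePt α x' y' h') : x = x' ∧ y = y' := by
  rw [nodePt, nodePt, cancel_mono] at e
  have e' := specCMap_injective e
  exact ⟨by simpa using congr($e' (Ideal.Quotient.mk _ (X 0))),
    by simpa using congr($e' (Ideal.Quotient.mk _ (X 1)))⟩

lemma exists_nodePt {α : ℂ} (f : specC B ⟶ node)
    (hf : Set.range f.left ⊆ Set.range (nodeChart α).left) :
    ∃ x y, ∃ h : x * y = 0, f = nodePt α x y h := by
  let g : specC B ⟶ specC NodeRing := Over.homMk (IsOpenImmersion.lift (nodeChart α).left f.left hf)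
    (by rw [← Over.w (nodeChart α), ← Category.assoc, IsOpenImmersion.lift_fac, Over.w])
  obtain ⟨φ, hφ⟩ := exists_specCMap g
  obtain ⟨x, y, h, rfl⟩ := exists_nodePtHom φ
  refine ⟨x, y, h, ?_⟩
  rw [nodePt, ← hφ]
  ext1
  exact (IsOpenImmersion.lift_fac _ _ _).symm

lemma range_nodePt (α : ℂ) (x y : B) (h : x * y = 0) :
    Set.range (nodePt α x y h).left ⊆ Set.range (nodeChart α).left := by
  rw [nodePt, Over.comp_left]
  rintro _ ⟨z, rfl⟩
  exact ⟨_, rfl⟩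

lemma nodePt_nodeι (α : ℂ) (x y : B) (h : x * y = 0) :
    nodePt α x y h ≫ nodeι =
      projPt (planeVec α x y) (planeForm_mem α) (isUnit_of_eq_one (aeval_planeVec_self α x y)) := by
  rw [nodePt, Category.assoc, nodeChart_nodeι, ← Category.assoc, nodeRingι, specCMap_comp,
    planeChart, specCMap_projPt]
  congr 1
  rw [algHom_comp_planeVec]
  simp

lemma nodePt_eq_nodePt {α β : ℂ} {x y x' y' : B} {h : x * y = 0} {h' : x' * y' = 0}
    (e : nodePt α x y h = nodePt β x' y' h') :
    IsUnit (1 - algebraMap ℂ B (β - α) * (x + y)) ∧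
    x' * (1 - algebraMap ℂ B (β - α) * (x + y)) = x ∧
    y' * (1 - algebraMap ℂ B (β - α) * (x + y)) = y := by
  have e1 := congr($e ≫ nodeι)
  rw [nodePt_nodeι, nodePt_nodeι] at e1
  obtain ⟨c, hc, hw⟩ := projPt_inj _ _ _ _ e1
  have h1 := aeval_planeVec_self β x' y'
  have h2 : c * (1 - algebraMap ℂ B (β - α) * (x + y)) = 1 := by
    rw [← aeval_planeVec, ← h1, hw, aeval_smul_of_isHomogeneous (planeForm_mem β), pow_one]
  have hx : x' = c * x := congrFun hw 0
  have hy : y' = c * y := congrFun hw 1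
  refine ⟨IsUnit.of_mul_eq_one c (by rw [mul_comm, h2]), ?_, ?_⟩
  · rw [hx]; linear_combination x * h2
  · rw [hy]; linear_combination y * h2

end NodePt

variable {R B B' : Type} [CommRing R] [Algebra ℂ R] [CommRing B] [Algebra ℂ B] [Algebra R B]
  [IsScalarTower ℂ R B] [CommRing B'] [Algebra ℂ B'] [Algebra R B'] [IsScalarTower ℂ R B']

variable (R B) in
/-- The structure morphism of an algebra. -/
noncomputable abbrev specStr : specC B ⟶ specC R := specCMap (IsScalarTower.toAlgHom ℂ R B)

variable (R) in
/-- The morphism from `Spec B` to the product of the node and `Spec R` given by `x, y`. -/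
noncomputable def famMap (α : ℂ) (x y : B) (h : x * y = 0) : specC B ⟶ fiberProd node (specC R) :=
  prodLift (nodePt α x y h) (specStr R B)

variable (R) in
/-- The ideal sheaf of the closed subscheme `Spec B` of the product of the node and `Spec R`. -/
noncomputable def famIdeal (α : ℂ) (x y : B) (h : x * y = 0) :
    (fiberProd node (specC R)).left.IdealSheafData := (famMap R α x y h).left.ker

lemma famMap_snd (α : ℂ) (x y : B) (h : x * y = 0) :
    (famMap R α x y h).left ≫ pullback.snd node.hom (specC R).hom = (specStr R B).left :=
  congrArg CommaMorphism.left (prodLift_snd (nodePt α x y h) (specStr R B))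

lemma famMap_fst (α : ℂ) (x y : B) (h : x * y = 0) :
    (famMap R α x y h).left ≫ pullback.fst node.hom (specC R).hom = (nodePt α x y h).left :=
  congrArg CommaMorphism.left (prodLift_fst (nodePt α x y h) (specStr R B))

/-- A homomorphism out of B is determined by its effect on R and on the generators x, y, and these
are read off the two projections. -/
lemma famMap_mono {α : ℂ} {x y : B} {h : x * y = 0} (hgen : Algebra.adjoin R {x, y} = ⊤) :
    Mono (famMap R α x y h).left := by
  refine ⟨fun {S} g₁ g₂ e ↦ scheme_hom_ext fun s ↦ ?_⟩
  obtain ⟨U, hU, hs, -⟩ := exists_isAffineOpen_mem_and_subset (x := s) (U := ⊤) trivial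
  refine ⟨_, hU.fromSpec, inferInstance, by rw [hU.range_fromSpec]; exact hs, ?_⟩
  obtain ⟨φ₁, h₁⟩ := exists_specMap (R := B) (S := Γ(S, U)) (hU.fromSpec ≫ g₁)
  obtain ⟨φ₂, h₂⟩ := exists_specMap (R := B) (S := Γ(S, U)) (hU.fromSpec ≫ g₂)
  have e' : specMap φ₁ ≫ (famMap R α x y h).left = specMap φ₂ ≫ (famMap R α x y h).left := by
    rw [← h₁, ← h₂, Category.assoc, Category.assoc, e]
  rw [h₁, h₂]
  congr 1
  have e1 := congr($e' ≫ pullback.fst node.hom (specC R).hom)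
  have e2 := congr($e' ≫ pullback.snd node.hom (specC R).hom)
  rw [Category.assoc, Category.assoc, famMap_fst, nodePt, Over.comp_left, ← Category.assoc,
    ← Category.assoc, cancel_mono] at e1
  rw [Category.assoc, Category.assoc, famMap_snd] at e2
  simp only [Over.homMk_left, ← specMap_comp] at e1 e2
  have e1 := specMap_injective e1
  have e2 := specMap_injective e2
  have hr : ∀ r : R, φ₁ (algebraMap R B r) = φ₂ (algebraMap R B r) := fun r ↦ congr($e2 r)
  have hx : φ₁ x = φ₂ x := by
    have := congr($e1 (Ideal.Quotient.mk _ (X 0)))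
    change φ₁ (aeval ![x, y] (X 0)) = φ₂ (aeval ![x, y] (X 0)) at this
    simpa using this
  have hy : φ₁ y = φ₂ y := by
    have := congr($e1 (Ideal.Quotient.mk _ (X 1)))
    change φ₁ (aeval ![x, y] (X 1)) = φ₂ (aeval ![x, y] (X 1)) at this
    simpa using this
  ext z
  have hz : z ∈ Algebra.adjoin R {x, y} := hgen ▸ Algebra.mem_top
  induction hz using Algebra.adjoin_induction with
  | mem w hw => rcases hw with rfl | rfl <;> assumption
  | algebraMap r => exact hr r
  | add a b _ _ ha hb => rw [map_add, map_add, ha, hb]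
  | mul a b _ _ ha hb => rw [map_mul, map_mul, ha, hb]

lemma isFinite_specStr [Module.Finite R B] : IsFinite (specStr R B).left :=
  (IsFinite.SpecMap_iff _).mpr (RingHom.finite_algebraMap.mpr ‹_›)

/-- The composite with the projection to Spec R is finite, so the morphism is finite; a finite
monomorphism is a closed immersion. -/
lemma isClosedImmersion_famMap [Module.Finite R B] {α : ℂ} {x y : B} {h : x * y = 0}
    (hgen : Algebra.adjoin R {x, y} = ⊤) : IsClosedImmersion (famMap R α x y h).left := by
  rw [IsClosedImmersion.iff_isFinite_and_mono]
  refine ⟨?_, famMap_mono hgen⟩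
  have : IsFinite ((famMap R α x y h).left ≫ pullback.snd node.hom (specC R).hom) := by
    rw [famMap_snd]; exact isFinite_specStr
  exact IsFinite.of_comp _ (pullback.snd node.hom (specC R).hom)

lemma isFamily_famIdeal {ι : Type*} [Fintype ι] (e : Module.Basis ι R B) {α : ℂ} {x y : B}
    {h : x * y = 0} (hgen : Algebra.adjoin R {x, y} = ⊤) :
    IsFamily (Fintype.card ι) (famIdeal R α x y h) := by
  have : Module.Finite R B := Module.Finite.of_basis e
  have : Module.Free R B := Module.Free.of_basis e
  have := isClosedImmersion_famMap (α := α) (h := h) hgen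
  have h1 : IsFinite (specStr R B).left := isFinite_specStr
  have h2 : Flat (specStr R B).left :=
    Flat.SpecMap_iff.mpr (RingHom.flat_algebraMap_iff.mpr inferInstance)
  have : Module.FinitePresentation R B := Module.finitePresentation_of_projective R B
  have : Algebra.FinitePresentation R B := .of_finitePresentation R B
  have h3 : LocallyOfFinitePresentation (specStr R B).left :=
    (LocallyOfFinitePresentation.SpecMap_iff _).mpr (RingHom.finitePresentation_algebraMap.mpr ‹_›)
  refine isFamily_ker _ (specStr R B).left (famMap_snd α x y h) fun t ↦ ?_
  have : Nontrivial R := PrimeSpectrum.nonempty_iff_nontrivial.mp ⟨t⟩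
  refine (Scheme.Hom.finrank_SpecMap_algebraMap R B t).trans ?_
  refine (congrFun (Module.rankAtStalk_eq_finrank_of_free (R := R) (M := B)) t).trans ?_
  exact Module.finrank_eq_card_basis e

lemma famIdeal_congr {α : ℂ} {x y : B} {h : x * y = 0} {x' y' : B'} {h' : x' * y' = 0}
    (e : B ≃ₐ[R] B') (hx : e x = x') (hy : e y = y') :
    famIdeal R α x y h = famIdeal R α x' y' h' := by
  subst hx hy
  let e' : B →ₐ[ℂ] B' := (e : B →ₐ[R] B').restrictScalars ℂ
  let e'' : B' →ₐ[ℂ] B := (e.symm : B' →ₐ[R] B).restrictScalars ℂ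
  have key : specCMap e' ≫ famMap R α x y h = famMap R α (e x) (e y) h' := by
    rw [famMap, comp_prodLift, specCMap_nodePt, specCMap_comp, famMap]
    congr 2
    ext r
    exact e.commutes r
  have hiso : IsIso (specCMap e') := by
    refine ⟨specCMap e'', ?_, ?_⟩
    · rw [specCMap_comp, ← specCMap_id]; congr 1; ext z; exact e.apply_symm_apply z
    · rw [specCMap_comp, ← specCMap_id]; congr 1; ext z; exact e.symm_apply_apply z
  have hiso' : IsIso (specCMap e').left := inferInstanceAs (IsIso ((Over.forget base).map (specCMap e')))
  rw [famIdeal, famIdeal, ← key, Over.comp_left, Scheme.Hom.ker_comp_of_isIso]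

/-- Closed immersions with the same ideal factor through each other. The second projection makes the
resulting isomorphism R-linear, the first one matches the points of the curve. -/
lemma exists_algEquiv_of_famIdeal_eq {α β : ℂ} {x y : B} {h : x * y = 0} {x' y' : B'}
    {h' : x' * y' = 0} (hc : IsClosedImmersion (famMap R α x y h).left)
    (hc' : IsClosedImmersion (famMap R β x' y' h').left)
    (heq : famIdeal R α x y h = famIdeal R β x' y' h') :
    ∃ e : B ≃ₐ[R] B', nodePt α (e x) (e y) (by rw [← map_mul, h, map_zero]) =
      nodePt β x' y' h' := by
  obtain ⟨g, hg⟩ := (ker_le_ker_iff _ _).mp heq.le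
  obtain ⟨g', hg'⟩ := (ker_le_ker_iff _ _).mp heq.ge
  obtain ⟨φ, rfl⟩ := exists_specMap (R := B) (S := B') g
  obtain ⟨ψ, rfl⟩ := exists_specMap (R := B') (S := B) g'
  have c1 : ψ.comp φ = RingHom.id B := by
    apply specMap_injective
    rw [specMap_comp, ← cancel_mono (famMap R α x y h).left, Category.assoc, hg, hg', specMap_id,
      Category.id_comp]
  have c2 : φ.comp ψ = RingHom.id B' := by
    apply specMap_injective
    rw [specMap_comp, ← cancel_mono (famMap R β x' y' h').left, Category.assoc, hg', hg, specMap_id,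
      Category.id_comp]
  have hr : φ.comp (algebraMap R B) = algebraMap R B' := by
    have e := congr($hg ≫ pullback.snd node.hom (specC R).hom)
    rw [Category.assoc, famMap_snd, famMap_snd] at e
    simp only [Over.homMk_left] at e
    rw [← specMap_comp] at e
    exact specMap_injective e
  let e : B ≃ₐ[R] B' := AlgEquiv.ofRingEquiv (f := RingEquiv.ofRingHom φ ψ c2 c1)
    (fun r ↦ congr($hr r))
  refine ⟨e, ?_⟩
  have := specCMap_nodePt α x y h ((e : B →ₐ[R] B').restrictScalars ℂ)
  refine this.symm.trans ?_
  ext1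
  have e1 := congr($hg ≫ pullback.fst node.hom (specC R).hom)
  rw [Category.assoc, famMap_fst, famMap_fst] at e1
  exact e1

/-- Affine families and base change. -/
lemma pullFam_famIdeal {R' : Type} [CommRing R'] [Algebra ℂ R'] [Algebra R R'] [IsScalarTower ℂ R R']
    {α : ℂ} {x y : B} {h : x * y = 0} (hc : IsClosedImmersion (famMap R α x y h).left) :
    pullFam (specStr R R') (famIdeal R α x y h) =
      famIdeal R' α ((1 : R') ⊗ₜ[R] x) ((1 : R') ⊗ₜ[R] y) (by simp [h]) := by
  let ι : B →ₐ[ℂ] R' ⊗[R] B :=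
    (Algebra.TensorProduct.includeRight : B →ₐ[R] R' ⊗[R] B).restrictScalars ℂ
  have hp : IsPullback (specCMap ι).left (specStr R' (R' ⊗[R] B)).left (specStr R B).left
      (specStr R R').left := by
    refine isPullback_SpecMap_of_isPushout _ _ _ _ ?_
    exact (CommRingCat.isPushout_tensorProduct R R' B).flip
  refine (ker_eq_of_isPullback (g := (specCMap ι).left)
    (i' := (famMap R' α ((1 : R') ⊗ₜ[R] x) ((1 : R') ⊗ₜ[R] y) (by simp [h])).left) ?_).symm
  refine IsPullback.of_right (h₁₂ := pullback.snd node.hom (specC R').hom)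
    (h₂₂ := pullback.snd node.hom (specC R).hom) (v₁₃ := (specStr R R').left) ?_ ?_
    (isPullback_fiberProdMap (specStr R R')).flip
  · rw [famMap_snd, famMap_snd]
    exact hp.flip
  · have key : famMap R' α ((1 : R') ⊗ₜ[R] x) ((1 : R') ⊗ₜ[R] y) (by simp [h]) ≫
        prodMap (𝟙 node) (specStr R R') = specCMap ι ≫ famMap R α x y h := by
      rw [famMap, famMap, prodLift_prodMap, comp_prodLift, specCMap_nodePt, specCMap_comp,
        specCMap_comp, Category.comp_id]
      congr 2
      ext r
      exact (Algebra.TensorProduct.includeRight : B →ₐ[R] R' ⊗[R] B).commutes r |>.symm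
    rw [← prodMap_left]
    exact congrArg CommaMorphism.left key

end AffineFamilies
-- The universal family over the affine hypersurface uv = 0
section ParamFamilies

open Scheme MvPolynomial TensorProduct

section Universal

variable {a b : ℕ}

variable (a b) in
/-- The coordinate ring of the chart of the Hilbert scheme. -/
abbrev ParamRing : Type := MvPolynomial (Fin 2 ⊕ Fin a ⊕ Fin b) ℂ ⧸
  Ideal.span {(X (Sum.inl 0) * X (Sum.inl 1) : MvPolynomial (Fin 2 ⊕ Fin a ⊕ Fin b) ℂ)}

variable (a b) in
/-- The universal parameters. -/
noncomputable def univParam : Param (ParamRing a b) a b where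
  u := Ideal.Quotient.mk _ (X (Sum.inl 0))
  v := Ideal.Quotient.mk _ (X (Sum.inl 1))
  c i := Ideal.Quotient.mk _ (X (Sum.inr (Sum.inl i)))
  f i := Ideal.Quotient.mk _ (X (Sum.inr (Sum.inr i)))
  huv := by
    rw [← map_mul, Ideal.Quotient.eq_zero_iff_mem]
    exact Ideal.mem_span_singleton_self _

variable {R R' : Type} [CommRing R] [Algebra ℂ R] [CommRing R'] [Algebra ℂ R']

/-- The values of the coordinates at given parameters. -/
def Param.vals (p : Param R a b) : Fin 2 ⊕ Fin a ⊕ Fin b → R := Sum.elim ![p.u, p.v] (Sum.elim p.c p.f)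

/-- The homomorphism which sends the universal parameters to given ones. -/
noncomputable def Param.hom (p : Param R a b) : ParamRing a b →ₐ[ℂ] R :=
  Ideal.Quotient.liftₐ _ (aeval p.vals) (by
    suffices Ideal.span {X (Sum.inl 0) * X (Sum.inl 1)} ≤
      RingHom.ker (aeval p.vals : _ →ₐ[ℂ] R) from fun z hz ↦ this hz
    rw [Ideal.span_singleton_le_iff_mem, RingHom.mem_ker]
    simp [Param.vals, p.huv])

lemma Param.hom_mk (p : Param R a b) (z : MvPolynomial (Fin 2 ⊕ Fin a ⊕ Fin b) ℂ) :
    p.hom (Ideal.Quotient.mk _ z) = aeval p.vals z := rfl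

lemma Param.map_hom (p : Param R a b) : (univParam a b).map (p.hom : ParamRing a b →+* R) = p := by
  have h : ∀ z, (p.hom : ParamRing a b →+* R) (Ideal.Quotient.mk _ z) = aeval p.vals z := fun _ ↦ rfl
  ext <;> simp only [Param.map, univParam, h, aeval_X] <;> rfl

lemma paramRing_hom_ext {φ ψ : ParamRing a b →ₐ[ℂ] R}
    (h : (univParam a b).map (φ : ParamRing a b →+* R) = (univParam a b).map (ψ : ParamRing a b →+* R)) :
    φ = ψ := by
  apply Ideal.Quotient.algHom_ext
  apply MvPolynomial.algHom_ext
  rintro (i | i | i)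
  · fin_cases i
    · exact congrArg Param.u h
    · exact congrArg Param.v h
  · exact congrFun (congrArg Param.c h) i
  · exact congrFun (congrArg Param.f h) i

end Universal

variable {R R' : Type} [CommRing R] [Algebra ℂ R] [CommRing R'] [Algebra ℂ R'] {a b : ℕ}

/-- The family with given parameters in the chart `nodeChart α`. -/
noncomputable def Param.fam (α : ℂ) (p : Param R a b) :
    (fiberProd node (specC R)).left.IdealSheafData :=
  famIdeal R α (NodeAlg.x p) (NodeAlg.y p) (NodeAlg.rel p).xy

lemma Param.isFamily_fam (α : ℂ) (p : Param R a b) {n : ℕ} (hn : a + 1 + b = n) :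
    IsFamily n (p.fam α) := by
  have := isFamily_famIdeal (NodeAlg.basis p) (α := α) (h := (NodeAlg.rel p).xy)
    (NodeAlg.adjoin_eq_top p)
  simp only [Fintype.card_sum, Fintype.card_fin] at this
  exact hn ▸ this

instance (p : Param R a b) : Module.Finite R (NodeAlg p) := Module.Finite.of_basis (NodeAlg.basis p)

lemma Param.isClosedImmersion_famMap (α : ℂ) (p : Param R a b) :
    IsClosedImmersion (famMap R α (NodeAlg.x p) (NodeAlg.y p) (NodeAlg.rel p).xy).left :=
  NodalHilbert.isClosedImmersion_famMap (NodeAlg.adjoin_eq_top p)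

lemma Param.Rel.famIdeal_eq {B : Type} [CommRing B] [Algebra ℂ B] [Algebra R B]
    [IsScalarTower ℂ R B] {p : Param R a b} {x y : B} (h : p.Rel x y)
    (hli : LinearIndependent R (nodeMonomial a b x y))
    (hsp : Submodule.span R (Set.range (nodeMonomial a b x y)) = ⊤) (α : ℂ) :
    famIdeal R α x y h.xy = p.fam α :=
  (famIdeal_congr (NodeAlg.equiv h hli hsp) (NodeAlg.lift_x h) (NodeAlg.lift_y h)).symm

lemma Param.pullFam_fam (α : ℂ) (p : Param R a b) (φ : R →ₐ[ℂ] R') :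
    pullFam (specCMap φ) (p.fam α) = (p.map (φ : R →+* R')).fam α := by
  algebraize [φ.toRingHom]
  have : IsScalarTower ℂ R R' := .of_algebraMap_eq fun r ↦ (φ.commutes r).symm
  have e : specCMap φ = specStr R R' := by congr 1
  obtain ⟨h1, h2⟩ := isBasis_baseChange (R' := R') (NodeAlg.linearIndependent p)
    (NodeAlg.span_eq_top p)
  rw [e, Param.fam, pullFam_famIdeal (p.isClosedImmersion_famMap α)]
  exact (NodeAlg.rel p).baseChange.famIdeal_eq h1 h2 α

/-- Equal ideals give an isomorphism of algebras which respects x and y, and x and y determine the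
parameters. -/
lemma Param.fam_injective (α : ℂ) {p p' : Param R a b} (h : p.fam α = p'.fam α) : p = p' := by
  obtain ⟨e, he⟩ := exists_algEquiv_of_famIdeal_eq (p.isClosedImmersion_famMap α)
    (p'.isClosedImmersion_famMap α) h
  obtain ⟨hx, hy⟩ := nodePt_inj he
  have h1 := (NodeAlg.rel p).map_algHom (e : NodeAlg p →ₐ[R] NodeAlg p')
  refine Param.Rel.unique (NodeAlg.linearIndependent p') ?_ (NodeAlg.rel p')
  rw [← hx, ← hy]
  exact h1

/-- The universal family over the chart. -/
noncomputable def chartFam (α : ℂ) (a b : ℕ) :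
    (fiberProd node (specC (ParamRing a b))).left.IdealSheafData := (univParam a b).fam α

lemma pullFam_chartFam (α : ℂ) (p : Param R a b) :
    pullFam (specCMap p.hom) (chartFam α a b) = p.fam α := by
  rw [chartFam, Param.pullFam_fam, Param.map_hom]

/-- Locally on T both morphisms are given by parameters, and these are determined by the family. -/
lemma chartFam_unique {α : ℂ} {T : Over base} {s s' : T ⟶ specC (ParamRing a b)}
    (h : pullFam s (chartFam α a b) = pullFam s' (chartFam α a b)) : s = s' := by
  refine over_hom_ext fun t ↦ ?_
  obtain ⟨R, _, _, i, hi, ht, -⟩ := exists_specC_nbhd t ⊤ trivial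
  refine ⟨_, i, hi, ht, ?_⟩
  obtain ⟨φ, hφ⟩ := exists_specCMap (i ≫ s)
  obtain ⟨φ', hφ'⟩ := exists_specCMap (i ≫ s')
  have e := congrArg (pullFam i) h
  rw [← pullFam_comp, ← pullFam_comp, hφ, hφ', chartFam, Param.pullFam_fam, Param.pullFam_fam] at e
  rw [hφ, hφ', paramRing_hom_ext (Param.fam_injective α e)]

/-- The points of the family lie in the chart `nodeChart α`. -/
def FamIn (α : ℂ) {T : Over base} (J : (fiberProd node T).left.IdealSheafData) (t : T.left) : Prop :=
  ∀ z ∈ J.support, pullback.snd node.hom T.hom z = t →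
    pullback.fst node.hom T.hom z ∈ Set.range (nodeChart α).left

lemma famIn_pullFam_iff {α : ℂ} {T T' : Over base} (f : T' ⟶ T)
    (J : (fiberProd node T).left.IdealSheafData) (t : T'.left) :
    FamIn α J (f.left t) → FamIn α (pullFam f J) t := by
  intro h z hz hzt
  rw [IdealSheafData.support_comap] at hz
  have h1 : pullback.fst node.hom T.hom (fiberProdMap (𝟙 node) f z) =
      pullback.fst node.hom T'.hom z := by
    rw [← Scheme.Hom.comp_apply, fiberProdMap_id_fst]
  rw [← h1]
  refine h _ hz ?_
  rw [← hzt, ← Scheme.Hom.comp_apply, ← Scheme.Hom.comp_apply, fiberProdMap_snd]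

lemma famIn_of_pullFam {α : ℂ} {T : Over base} {K : Type} [Field K] [Algebra ℂ K] (τ : specC K ⟶ T)
    (J : (fiberProd node T).left.IdealSheafData) (t : (specC K).left)
    (h : FamIn α (pullFam τ J) t) : FamIn α J (τ.left t) := by
  intro z hz hzt
  obtain ⟨z', rfl⟩ := (mem_range_fiberProdMap τ z).mpr ⟨t, hzt.symm⟩
  have h1 : pullback.fst node.hom T.hom (fiberProdMap (𝟙 node) τ z') =
      pullback.fst node.hom (specC K).hom z' := by
    rw [← Scheme.Hom.comp_apply, fiberProdMap_id_fst]
  rw [h1]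
  have : Subsingleton (specC K).left := inferInstanceAs (Subsingleton (PrimeSpectrum K))
  exact h z' (by rw [IdealSheafData.support_comap]; exact hz) (Subsingleton.elim _ _)

lemma famIn_famIdeal {B : Type} [CommRing B] [Algebra ℂ B] [Algebra R B]
    [IsScalarTower ℂ R B] {α : ℂ} {x y : B} {h : x * y = 0}
    (hc : IsClosedImmersion (famMap R α x y h).left) (t) : FamIn α (famIdeal R α x y h) t := by
  intro z hz _
  have hz' : z ∈ Set.range (famMap R α x y h).left := by
    have := (famMap R α x y h).left.support_ker
    have h2 : z ∈ closure (Set.range (famMap R α x y h).left) := by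
      rw [← this]; exact hz
    rwa [hc.isClosedEmbedding.isClosed_range.closure_eq] at h2
  obtain ⟨w, rfl⟩ := hz'
  rw [← Scheme.Hom.comp_apply, famMap_fst]
  exact range_nodePt α x y h ⟨w, rfl⟩

/-- The part of the family outside the chart is closed, and its image in T is closed because the
family is finite over T. -/
lemma exists_opens_famIn {α : ℂ} {n : ℕ} {T : Over base}
    {J : (fiberProd node T).left.IdealSheafData} (hJ : IsFamily n J) {t : T.left}
    (h : FamIn α J t) : ∃ V : T.left.Opens, t ∈ V ∧ ∀ s ∈ V, FamIn α J s := by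
  have := hJ.finite
  have hcl : IsClosedMap (J.subschemeι ≫ pullback.snd node.hom T.hom) := Scheme.Hom.isClosedMap _
  let D : Set J.subscheme := (J.subschemeι ≫ pullback.fst node.hom T.hom) ⁻¹'
    (Set.range (nodeChart α).left)ᶜ
  have hD : IsClosed D := IsClosed.preimage (Scheme.Hom.continuous _)
    (nodeChart α).left.isOpenEmbedding.isOpen_range.isClosed_compl
  refine ⟨⟨_, (hcl D hD).isOpen_compl⟩, ?_, ?_⟩
  · rintro ⟨w, hw, hwt⟩
    rw [Scheme.Hom.comp_apply] at hwt
    refine hw ?_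
    rw [Scheme.Hom.comp_apply]
    exact h _ (by rw [← SetLike.mem_coe, ← IdealSheafData.range_subschemeι]; exact ⟨w, rfl⟩) hwt
  · intro s hs z hz hzs
    rw [← SetLike.mem_coe, ← IdealSheafData.range_subschemeι] at hz
    obtain ⟨w, rfl⟩ := hz
    by_contra hcon
    refine hs ⟨w, ?_, ?_⟩
    · change ¬ _
      rw [Scheme.Hom.comp_apply]
      exact hcon
    · rw [Scheme.Hom.comp_apply]
      exact hzs

lemma idl_bot {A : Type} [CommRing A] : idl (⊥ : Ideal A) = ⊥ := by
  obtain ⟨I, hI⟩ := exists_eq_idl (⊥ : (Spec (.of A)).IdealSheafData)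
  rw [eq_bot_iff, hI, idl_le_idl]
  exact bot_le

/-- A family in the chart over an affine base is given by an algebra. -/
lemma exists_famIdeal {α : ℂ} {n : ℕ} {J : (fiberProd node (specC R)).left.IdealSheafData}
    (hJ : IsFamily n J) (h : ∀ t, FamIn α J t) :
    ∃ (B : Type) (_ : CommRing B) (_ : Algebra ℂ B) (_ : Algebra R B) (_ : IsScalarTower ℂ R B)
      (x y : B) (hxy : x * y = 0), Module.Finite R B ∧ Module.Flat R B ∧
        (∀ t, Module.rankAtStalk (R := R) B t = n) ∧ Algebra.adjoin R {x, y} = ⊤ ∧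
        J = famIdeal R α x y hxy := by
  have := hJ.finite
  have := hJ.flat
  let q := J.subschemeι ≫ pullback.snd node.hom (specC R).hom
  have : IsAffine (specC R).left := inferInstanceAs (IsAffine (Spec _))
  have : IsAffine J.subscheme := isAffine_of_isAffineHom q
  let B : Type := Γ(J.subscheme, ⊤)
  let i : Spec (.of B) ⟶ J.subscheme := J.subscheme.isoSpec.inv
  obtain ⟨ρ, hρ⟩ := exists_specMap (R := R) (S := B) (i ≫ q)
  let _ : Algebra R B := ρ.toAlgebra
  let _ : Algebra ℂ B := (ρ.comp (algebraMap ℂ R)).toAlgebra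
  have : IsScalarTower ℂ R B := .of_algebraMap_eq fun _ ↦ rfl
  have hq : i ≫ q = (specStr R B).left := hρ
  let g : specC B ⟶ fiberProd node (specC R) := Over.homMk (i ≫ J.subschemeι) (by
    have e := Over.w (prodSnd node (specC R))
    rw [← e]
    refine Eq.trans ?_ (Over.w (specStr R B))
    rw [← hq]
    simp [q, i, prodSnd])
  have hg2 : g ≫ prodSnd node (specC R) = specStr R B := by
    ext1
    rw [← hq]
    simp [g, q, prodSnd]
  obtain ⟨x, y, hxy, hx⟩ := exists_nodePt (α := α) (g ≫ prodFst node (specC R)) (by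
    rintro _ ⟨w, rfl⟩
    rw [Over.comp_left, Scheme.Hom.comp_apply]
    refine h _ (g.left w) ?_ rfl
    rw [← SetLike.mem_coe, ← IdealSheafData.range_subschemeι]
    exact ⟨i w, by simp [g]⟩)
  have hgm : g = famMap R α x y hxy := prod_hom_ext (by rw [hx, famMap, prodLift_fst])
    (by rw [hg2, famMap, prodLift_snd])
  have hgl : (famMap R α x y hxy).left = i ≫ J.subschemeι := by rw [← hgm]; rfl
  have hfin : IsFinite (specStr R B).left := by rw [← hq]; infer_instance
  have hflat : Flat (specStr R B).left := by rw [← hq]; infer_instance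
  have hB : Module.Finite R B := RingHom.finite_algebraMap.mp ((IsFinite.SpecMap_iff _).mp hfin)
  have hB' : Module.Flat R B := RingHom.flat_algebraMap_iff.mp (Flat.SpecMap_iff.mp hflat)
  have hc : IsClosedImmersion (famMap R α x y hxy).left := by rw [hgl]; infer_instance
  refine ⟨B, inferInstance, inferInstance, inferInstance, inferInstance, x, y, hxy, hB, hB',
    fun t ↦ ?_, ?_, ?_⟩
  · rw [← hJ.finrank_eq t, ← Scheme.Hom.finrank_SpecMap_algebraMap R B t]
    have := Scheme.Hom.finrank_comp_left_of_isIso i q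
    rw [← this]
    exact congrFun (by congr 1; exact hq.symm) _
  -- The closed immersion of Spec B factors through Spec S. So Spec B → Spec S is a closed immersion
  -- with zero kernel, hence an isomorphism, and S is all of B.
  · let S := Algebra.adjoin R {x, y}
    let x' : S := ⟨x, Algebra.subset_adjoin (by simp)⟩
    let y' : S := ⟨y, Algebra.subset_adjoin (by simp)⟩
    have hxy' : x' * y' = 0 := Subtype.ext hxy
    let ι : S →ₐ[ℂ] B := S.val.restrictScalars ℂ
    have key : specCMap ι ≫ famMap R α x' y' hxy' = famMap R α x y hxy := by
      rw [famMap, comp_prodLift, specCMap_nodePt, specCMap_comp, famMap]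
      rfl
    have : IsSeparated ((famMap R α x' y' hxy').left ≫ pullback.snd node.hom (specC R).hom) := by
      rw [famMap_snd]
      exact inferInstanceAs (IsSeparated (specMap _))
    have : IsSeparated (famMap R α x' y' hxy').left :=
      IsSeparated.of_comp _ (pullback.snd node.hom (specC R).hom)
    have : IsClosedImmersion ((specCMap ι).left ≫ (famMap R α x' y' hxy').left) := by
      rw [← Over.comp_left, key]; exact hc
    have h3 : IsClosedImmersion (specMap (ι : S →+* B)) :=
      IsClosedImmersion.of_comp (specCMap ι).left (famMap R α x' y' hxy').left
    have h4 : (specMap (ι : S →+* B)).ker = ⊥ := by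
      rw [ker_specMap, (RingHom.injective_iff_ker_eq_bot _).mp Subtype.val_injective, idl_bot]
    have h5 := (IsClosedImmersion.isIso_iff_ker_eq_bot).mpr h4
    have h6 := (isIso_SpecMap_iff.mp h5).2
    rw [eq_top_iff]
    rintro z -
    obtain ⟨w, rfl⟩ := h6 z
    exact w.2
  · rw [famIdeal, hgl, Scheme.Hom.ker_comp_of_isIso, IdealSheafData.ker_subschemeι]

end ParamFamilies
-- Spreading a monomial basis from a point to a neighbourhood
section Neighbourhoods

open Scheme TensorProduct

/-- A finite module spanned by given elements at a point is spanned by them near the point. -/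
lemma exists_smul_mem_span {R K M ι : Type*} [CommRing R] [Field K] [Algebra R K] [AddCommGroup M]
    [Module R M] [Module.Finite R M] (v : ι → M)
    (h : Submodule.span K (Set.range fun i ↦ (1 : K) ⊗ₜ[R] v i) = ⊤) :
    ∃ f : R, algebraMap R K f ≠ 0 ∧ ∀ m : M, f • m ∈ Submodule.span R (Set.range v) := by
  let N := Submodule.span R (Set.range v)
  -- Nakayama: M/N vanishes over K, hence at the prime which is the kernel of R → K; so an element
  -- outside this prime annihilates M/N.
  have h0 : Subsingleton (K ⊗[R] (M ⧸ N)) := by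
    have hz : ∀ t : K ⊗[R] M, N.mkQ.baseChange K t = 0 := by
      intro t
      have ht : t ∈ Submodule.span K (Set.range fun i ↦ (1 : K) ⊗ₜ[R] v i) := h ▸ Submodule.mem_top
      induction ht using Submodule.span_induction with
      | mem t ht =>
        obtain ⟨i, rfl⟩ := ht
        have : N.mkQ (v i) = 0 := by
          rw [Submodule.mkQ_apply, Submodule.Quotient.mk_eq_zero]
          exact Submodule.subset_span ⟨i, rfl⟩
        rw [LinearMap.baseChange_tmul, this, tmul_zero]
      | zero => rw [map_zero]
      | add a b _ _ ha hb => rw [map_add, ha, hb, add_zero]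
      | smul c a _ ha => rw [map_smul, ha, smul_zero]
    have hs : Function.Surjective (N.mkQ.baseChange K) :=
      LinearMap.lTensor_surjective K N.mkQ_surjective
    refine ⟨fun s t ↦ ?_⟩
    obtain ⟨s, rfl⟩ := hs s
    obtain ⟨t, rfl⟩ := hs t
    rw [hz, hz]
  obtain ⟨p, hpk⟩ : ∃ p : PrimeSpectrum R, p.asIdeal = RingHom.ker (algebraMap R K) :=
    ⟨⟨_, RingHom.ker_isPrime _⟩, rfl⟩
  have hp : p ∉ Module.support R (M ⧸ N) := by
    rw [Module.mem_support_iff_nontrivial_residueField_tensorProduct, not_nontrivial_iff_subsingleton]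
    let κ := p.asIdeal.ResidueField
    let g : κ →+* K := Ideal.ResidueField.lift p.asIdeal (algebraMap R K) (hpk ▸ le_rfl) (by
      intro r hr
      refine isUnit_iff_ne_zero.mpr fun h0 ↦ hr ?_
      rw [hpk]
      exact h0)
    algebraize [g]
    have : IsScalarTower R κ K := .of_algebraMap_eq fun r ↦ by
      exact (Ideal.ResidueField.lift_algebraMap ..).symm
    have e := AlgebraTensorModule.cancelBaseChange R κ K K (M ⧸ N)
    by_contra hcon
    rw [not_subsingleton_iff_nontrivial] at hcon
    have : Nontrivial (K ⊗[κ] (κ ⊗[R] (M ⧸ N))) := inferInstance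
    have := e.symm.nontrivial
    exact not_nontrivial_iff_subsingleton.mpr h0 this
  rw [Module.mem_support_iff_of_finite, SetLike.not_le_iff_exists] at hp
  obtain ⟨f, hf, hfp⟩ := hp
  refine ⟨f, fun h0 ↦ hfp (by rw [hpk]; exact h0), fun m ↦ ?_⟩
  have := Module.mem_annihilator.mp hf (Submodule.Quotient.mk m)
  rwa [← Submodule.Quotient.mk_smul, Submodule.Quotient.mk_eq_zero] at this

lemma span_tmul_eq_top {R R' M ι : Type*} [CommRing R] [CommRing R'] [Algebra R R'] [AddCommGroup M]
    [Module R M] (v : ι → M) {f : R} (hu : IsUnit (algebraMap R R' f))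
    (h : ∀ m : M, f • m ∈ Submodule.span R (Set.range v)) :
    Submodule.span R' (Set.range fun i ↦ (1 : R') ⊗ₜ[R] v i) = ⊤ := by
  obtain ⟨g, hg⟩ := hu.exists_left_inv
  have key : ∀ w ∈ Submodule.span R (Set.range v),
      (1 : R') ⊗ₜ[R] w ∈ Submodule.span R' (Set.range fun i ↦ (1 : R') ⊗ₜ[R] v i) := by
    intro w hw
    induction hw using Submodule.span_induction with
    | mem w hw =>
      obtain ⟨i, rfl⟩ := hw
      exact Submodule.subset_span ⟨i, rfl⟩
    | zero => rw [tmul_zero]; exact Submodule.zero_mem _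
    | add a b _ _ ha hb => rw [tmul_add]; exact Submodule.add_mem _ ha hb
    | smul c a _ ha =>
      rw [tmul_smul, ← algebraMap_smul R' c]
      exact Submodule.smul_mem _ _ ha
  rw [eq_top_iff]
  rintro t -
  induction t using TensorProduct.induction_on with
  | zero => exact Submodule.zero_mem _
  | add a b ha hb => exact Submodule.add_mem _ ha hb
  | tmul r m =>
    have e : r ⊗ₜ[R] m = (r * g) • ((1 : R') ⊗ₜ[R] (f • m)) := by
      rw [tmul_smul, ← algebraMap_smul R' f, smul_smul, mul_assoc, hg, mul_one, smul_tmul', smul_eq_mul,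
        mul_one]
    rw [e]
    exact Submodule.smul_mem _ _ (key _ (h m))

variable {R : Type} [CommRing R] [Algebra ℂ R] {a b : ℕ}

/-- The family is induced by the universal family of a chart. -/
def InChart (α : ℂ) (a b : ℕ) {T : Over base} (J : (fiberProd node T).left.IdealSheafData) : Prop :=
  ∃ s : T ⟶ specC (ParamRing a b), pullFam s (chartFam α a b) = J

lemma Param.inChart_fam (α : ℂ) (p : Param R a b) : InChart α a b (p.fam α) :=
  ⟨_, pullFam_chartFam α p⟩

lemma InChart.exists_param {α : ℂ} {J : (fiberProd node (specC R)).left.IdealSheafData}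
    (h : InChart α a b J) : ∃ p : Param R a b, J = p.fam α := by
  obtain ⟨s, rfl⟩ := h
  obtain ⟨φ, rfl⟩ := exists_specCMap s
  exact ⟨_, Param.pullFam_fam α _ φ⟩

lemma InChart.pullFam {α : ℂ} {T T' : Over base} {J : (fiberProd node T).left.IdealSheafData}
    (h : InChart α a b J) (f : T' ⟶ T) : InChart α a b (pullFam f J) := by
  obtain ⟨s, rfl⟩ := h
  exact ⟨f ≫ s, pullFam_comp _ _ _⟩

lemma exists_lift_of_isOpenImmersion {T U : Over base} {K : Type} [Field K] [Algebra ℂ K]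
    (i : U ⟶ T) [IsOpenImmersion i.left] (τ : specC K ⟶ T) {t : (specC K).left}
    (ht : τ.left t ∈ Set.range i.left) : ∃ τ' : specC K ⟶ U, τ' ≫ i = τ := by
  have : Subsingleton (specC K).left := inferInstanceAs (Subsingleton (PrimeSpectrum K))
  have hr : Set.range τ.left ⊆ Set.range i.left := by
    rintro _ ⟨w, rfl⟩; rwa [Subsingleton.elim w t]
  refine ⟨Over.homMk (IsOpenImmersion.lift i.left τ.left hr) ?_, ?_⟩
  · rw [← Over.w i, ← Category.assoc, IsOpenImmersion.lift_fac, Over.w]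
  · ext1; exact IsOpenImmersion.lift_fac _ _ _

/-- A family which is in a chart at a point is in the chart near the point. -/
theorem exists_nbhd_inChart {α : ℂ} {T : Over base} {J : (fiberProd node T).left.IdealSheafData}
    {n : ℕ} (hn : a + 1 + b = n) (hJ : IsFamily n J) {K : Type} [Field K] [Algebra ℂ K]
    (τ : specC K ⟶ T) (hτ : InChart α a b (pullFam τ J)) (t : (specC K).left) :
    ∃ (R : Type) (_ : CommRing R) (_ : Algebra ℂ R) (i : specC R ⟶ T), IsOpenImmersion i.left ∧
      τ.left t ∈ Set.range i.left ∧ InChart α a b (pullFam i J) := by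
  obtain ⟨p, hp⟩ := hτ.exists_param
  have h1 : FamIn α J (τ.left t) := by
    refine famIn_of_pullFam τ J t ?_
    rw [hp]
    exact famIn_famIdeal (p.isClosedImmersion_famMap α) _
  obtain ⟨V, htV, hV⟩ := exists_opens_famIn hJ h1
  obtain ⟨R, _, _, i, hi, hti, hiV⟩ := exists_specC_nbhd (τ.left t) V htV
  obtain ⟨τ', rfl⟩ := exists_lift_of_isOpenImmersion i τ hti
  obtain ⟨B, _, _, _, _, x, y, hxy, hB, hB', hrk, hgen, hi'⟩ := exists_famIdeal (hJ.comap i)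
    (α := α) (fun s ↦ famIn_pullFam_iff i J s (hV _ (hiV ⟨s, rfl⟩)))
  obtain ⟨φ, rfl⟩ := exists_specCMap τ'
  algebraize [φ.toRingHom]
  have : IsScalarTower ℂ R K := .of_algebraMap_eq fun r ↦ (φ.commutes r).symm
  have e0 : specCMap φ = specStr R K := by congr 1
  have hc := isClosedImmersion_famMap (α := α) (h := hxy) hgen
  have hi2 : NodalHilbert.pullFam i J = famIdeal R α x y hxy := hi'
  rw [pullFam_comp, hi2, e0, pullFam_famIdeal hc] at hp
  -- Over the point the family is the standard algebra, and its monomials span.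
  have hspan : Submodule.span K (Set.range fun j ↦ (1 : K) ⊗ₜ[R] nodeMonomial a b x y j) = ⊤ := by
    have hc' : IsClosedImmersion (famMap K α ((1 : K) ⊗ₜ[R] x) ((1 : K) ⊗ₜ[R] y)
      (by simp [hxy])).left := by
      refine isClosedImmersion_famMap ?_
      have := Algebra.TensorProduct.adjoin_one_tmul_image_eq_top (A := K) _ hgen
      rwa [Set.image_pair] at this
    obtain ⟨e, he⟩ := exists_algEquiv_of_famIdeal_eq hc' (p.isClosedImmersion_famMap α) hp
    obtain ⟨hx, hy⟩ := nodePt_inj he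
    have e1 : (fun j ↦ (1 : K) ⊗ₜ[R] nodeMonomial a b x y j) =
        e.symm.toLinearMap ∘ nodeMonomial a b (NodeAlg.x p) (NodeAlg.y p) := by
      funext j
      rw [← nodeMonomial_tmul, Function.comp_apply, AlgEquiv.toLinearMap_apply, nodeMonomial_map,
        ← hx, ← hy, AlgEquiv.symm_apply_apply, AlgEquiv.symm_apply_apply]
    rw [e1, Set.range_comp, ← Submodule.map_span, NodeAlg.span_eq_top p, Submodule.map_top,
      LinearMap.range_eq_top]
    exact e.symm.surjective
  obtain ⟨f, hf, hfm⟩ := exists_smul_mem_span _ hspan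
  let R' := Localization.Away f
  have hsp' : Submodule.span R' (Set.range (nodeMonomial a b ((1 : R') ⊗ₜ[R] x) ((1 : R') ⊗ₜ[R] y))) = ⊤ := by
    rw [show nodeMonomial a b ((1 : R') ⊗ₜ[R] x) ((1 : R') ⊗ₜ[R] y) = _ from
      funext fun j ↦ nodeMonomial_tmul x y j]
    exact span_tmul_eq_top _ (IsLocalization.Away.algebraMap_isUnit f) hfm
  -- The number of monomials is the rank n of the module, so they are independent as soon as they
  -- generate.
  have hli' : LinearIndependent R' (nodeMonomial a b ((1 : R') ⊗ₜ[R] x) ((1 : R') ⊗ₜ[R] y)) := by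
    rw [linearIndependent_iff_injective_fintypeLinearCombination]
    refine (Module.bijective_of_surjective_of_rankAtStalk_eq ?_ fun m hm ↦ ?_).1
    · rw [← LinearMap.range_eq_top, Fintype.range_linearCombination, hsp']
    · have : Nontrivial R' := ⟨1, 0, fun h1 ↦
        hm.ne_top (m.eq_top_iff_one.mpr (by rw [h1]; exact m.zero_mem))⟩
      rw [Module.rankAtStalk_baseChange, hrk, Module.rankAtStalk_eq_finrank_of_free,
        Pi.natCast_apply, Module.finrank_fintype_fun_eq_card]
      simpa using hn
  obtain ⟨q, hq⟩ := exists_param (R := R') (B := R' ⊗[R] B) (by simp [hxy]) hli' hsp'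
  have hopen : IsOpenImmersion (specStr R R').left := by
    exact inferInstanceAs (IsOpenImmersion (Spec.map (CommRingCat.ofHom (algebraMap R (Localization.Away f)))))
  refine ⟨R', inferInstance, inferInstance, specStr R R' ≫ i, ?_, ?_, ?_⟩
  · rw [Over.comp_left]; infer_instance
  · let ψ : R' →+* K := IsLocalization.Away.lift (S := R') f (g := algebraMap R K)
      (isUnit_iff_ne_zero.mpr hf)
    have e1 : ψ.comp (algebraMap R R') = algebraMap R K := IsLocalization.Away.lift_comp ..
    have e2 : (specCMap φ).left = specMap ψ ≫ (specStr R R').left := by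
      change specMap (algebraMap R K) = _
      rw [← e1, specMap_comp]
      rfl
    refine ⟨specMap ψ t, ?_⟩
    rw [Over.comp_left, Over.comp_left, ← Scheme.Hom.comp_apply, e2, Category.assoc]
  · rw [pullFam_comp, hi2, pullFam_famIdeal hc, hq.famIdeal_eq hli' hsp']
    exact q.inChart_fam α

end Neighbourhoods
-- The open locus where a family lies in a given chart
section ChartLocus

open Scheme TensorProduct

variable {R : Type} [CommRing R] [Algebra ℂ R] {a b : ℕ}

/-- An open cover by given open immersions. -/
noncomputable def openCoverOf {X : Scheme.{0}} {ι : Type*} (U : ι → Scheme.{0}) (f : ∀ i, U i ⟶ X)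
    [∀ i, IsOpenImmersion (f i)] (h : ∀ x, ∃ i, x ∈ Set.range (f i)) : X.OpenCover where
  I₀ := ι
  X := U
  f := f
  mem₀ := by
    rw [presieve₀_mem_precoverage_iff]
    exact ⟨h, inferInstance⟩

/-- Morphisms over `ℂ` glue. -/
lemma exists_glue_hom {T X : Over base} {ι : Type*} (U : ι → Over base) (i : ∀ k, U k ⟶ T)
    [∀ k, IsOpenImmersion (i k).left] (hcov : ∀ t, ∃ k, t ∈ Set.range (i k).left)
    (g : ∀ k, U k ⟶ X) (hg : ∀ k l (S : Over base) (c : S ⟶ U k) (d : S ⟶ U l),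
      IsOpenImmersion c.left → IsOpenImmersion d.left → c ≫ i k = d ≫ i l → c ≫ g k = d ≫ g l) :
    ∃ f : T ⟶ X, ∀ k, i k ≫ f = g k := by
  let 𝒰 := openCoverOf (fun k ↦ (U k).left) (fun k ↦ (i k).left) hcov
  have hc : ∀ k l : ι, pullback.fst (i k).left (i l).left ≫ (g k).left =
      pullback.snd (i k).left (i l).left ≫ (g l).left := by
    intro k l
    have e : ∀ (m : ι) (S : Scheme.{0}) (z : S ⟶ (U m).left) (w : S ⟶ T.left), z ≫ (i m).left = w →
        z ≫ (U m).hom = w ≫ T.hom := by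
      rintro m S z w rfl
      rw [Category.assoc, Over.w]
    let S : Over base := Over.mk ((pullback.fst (i k).left (i l).left ≫ (i k).left) ≫ T.hom)
    let c : S ⟶ U k := Over.homMk (pullback.fst (i k).left (i l).left) (e _ _ _ _ rfl)
    let d : S ⟶ U l := Over.homMk (pullback.snd (i k).left (i l).left)
      (e _ _ _ _ pullback.condition.symm)
    exact congrArg CommaMorphism.left (hg k l S c d
      (inferInstanceAs (IsOpenImmersion (pullback.fst (i k).left (i l).left)))
      (inferInstanceAs (IsOpenImmersion (pullback.snd (i k).left (i l).left)))
      (Over.OverMorphism.ext pullback.condition))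
  have hι : ∀ k, (i k).left ≫ 𝒰.glueMorphisms (fun k ↦ (g k).left) hc = (g k).left :=
    fun k ↦ 𝒰.ι_glueMorphisms _ hc k
  refine ⟨Over.homMk (𝒰.glueMorphisms (fun k ↦ (g k).left) hc) ?_, fun k ↦ ?_⟩
  · refine 𝒰.hom_ext _ _ fun (k : ι) ↦ ?_
    change (i k).left ≫ _ = (i k).left ≫ _
    rw [← Category.assoc, hι, Over.w, Over.w]
  · ext1; exact hι k

/-- An open subscheme, over `ℂ`. -/
noncomputable abbrev openSub {T : Over base} (U : T.left.Opens) : Over base :=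
  Over.mk (U.ι ≫ T.hom)

/-- The inclusion of an open subscheme. -/
noncomputable abbrev openSubι {T : Over base} (U : T.left.Opens) : openSub U ⟶ T :=
  Over.homMk U.ι rfl

instance {T : Over base} (U : T.left.Opens) : IsOpenImmersion (openSubι U).left :=
  inferInstanceAs (IsOpenImmersion U.ι)

lemma exists_over_lift {S T U : Over base} (i : U ⟶ T) [IsOpenImmersion i.left] (f : S ⟶ T)
    (h : Set.range f.left ⊆ Set.range i.left) : ∃ f' : S ⟶ U, f' ≫ i = f := by
  refine ⟨Over.homMk (IsOpenImmersion.lift i.left f.left h) ?_, ?_⟩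
  · rw [← Over.w i, ← Category.assoc, IsOpenImmersion.lift_fac, Over.w]
  · ext1; exact IsOpenImmersion.lift_fac _ _ _

lemma exists_residue_point {T : Over base} (t : T.left) :
    ∃ (K : Type) (_ : Field K) (_ : Algebra ℂ K) (τ : specC K ⟶ T), ∀ w, τ.left w = t := by
  obtain ⟨κ, hκ⟩ := exists_specMap (R := ℂ) (S := T.left.residueField t)
    (T.left.fromSpecResidueField t ≫ T.hom)
  let _ : Algebra ℂ (T.left.residueField t) := κ.toAlgebra
  exact ⟨T.left.residueField t, inferInstance, inferInstance,
    Over.homMk (T.left.fromSpecResidueField t) hκ,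
    fun w ↦ Scheme.fromSpecResidueField_apply t w⟩

/-- The support is finite, and each of its points misses only finitely many of the affine pieces.
For every other α the family is an algebra generated by x and y with xy = 0, and over a field this
has a monomial basis. -/
lemma finite_not_inChart {K : Type} [Field K] [Algebra ℂ K] {n : ℕ} (hn : 0 < n)
    {J : (fiberProd node (specC K)).left.IdealSheafData} (hJ : IsFamily n J) :
    {α : ℂ | ¬ ∃ a b, a + 1 + b = n ∧ InChart α a b J}.Finite := by
  have hss : Subsingleton (specC K).left := inferInstanceAs (Subsingleton (PrimeSpectrum K))
  let t : (specC K).left := (inferInstance : Nonempty (PrimeSpectrum K)).some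
  have hfin : (J.support : Set (fiberProd node (specC K)).left).Finite := by
    have := hJ.finite
    rw [← IdealSheafData.range_subschemeι]
    have h1 := Scheme.Hom.finite_preimage_singleton
      (J.subschemeι ≫ pullback.snd node.hom (specC K).hom) t
    have h2 : (J.subschemeι ≫ pullback.snd node.hom (specC K).hom) ⁻¹' {t} = Set.univ := by
      ext z
      simp only [Set.mem_preimage, Set.mem_singleton_iff, Set.mem_univ, iff_true]
      exact Subsingleton.elim (α := (specC K).left) _ _
    rw [h2] at h1
    rw [← Set.image_univ]
    exact h1.image _
  refine (hfin.biUnion fun z _ ↦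
    finite_notMem_range_nodeChart (pullback.fst node.hom (specC K).hom z)).subset ?_
  intro α hα
  by_contra hcon
  simp only [Set.mem_iUnion, not_exists, Set.mem_ofPred_eq, not_not] at hcon
  refine hα ?_
  obtain ⟨B, _, _, _, _, x, y, hxy, hB, -, hrk, hgen, rfl⟩ := exists_famIdeal hJ (α := α)
    (fun s z hz _ ↦ hcon z hz)
  have hr : Module.finrank K B = n := by
    rw [← hrk ⟨⊥, Ideal.isPrime_bot⟩, Module.rankAtStalk_eq_finrank_of_free]
    rfl
  have : Nontrivial B := Module.nontrivial_of_finrank_pos (R := K) (by omega)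
  obtain ⟨a, b, hab, hli, hsp⟩ := exists_nodeMonomial_basis hxy hgen
  obtain ⟨p, hp⟩ := exists_param hxy hli hsp
  exact ⟨a, b, by omega, by rw [hp.famIdeal_eq hli hsp]; exact p.inChart_fam α⟩

variable {T : Over base}

/-- The open subset of the base over which a family is in a given chart. -/
def chartLocus (α : ℂ) (a b : ℕ) (J : (fiberProd node T).left.IdealSheafData) : T.left.Opens :=
  ⟨{t | ∃ (U : Over base) (i : U ⟶ T), IsOpenImmersion i.left ∧ t ∈ Set.range i.left ∧
      InChart α a b (pullFam i J)}, by
    rw [isOpen_iff_forall_mem_open]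
    rintro t ⟨U, i, hi, ht, hJ⟩
    exact ⟨Set.range i.left, fun s hs ↦ ⟨U, i, hi, hs, hJ⟩, i.left.isOpenEmbedding.isOpen_range, ht⟩⟩

/-- Over this open subset the family is in the chart. -/
lemma inChart_chartLocus (α : ℂ) (a b : ℕ) (J : (fiberProd node T).left.IdealSheafData) :
    InChart α a b (pullFam (openSubι (chartLocus α a b J)) J) := by
  have h : ∀ t : (openSub (chartLocus α a b J)).left, ∃ (U : Over base)
      (i : U ⟶ openSub (chartLocus α a b J)), IsOpenImmersion i.left ∧ t ∈ Set.range i.left ∧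
        InChart α a b (pullFam i (pullFam (openSubι (chartLocus α a b J)) J)) := by
    intro t
    obtain ⟨U, i, hi, ht, hJ⟩ := t.2
    have hsub : Set.range i.left ⊆ Set.range (openSubι (chartLocus α a b J)).left := by
      intro s hs
      exact ⟨⟨s, U, i, hi, hs, hJ⟩, rfl⟩
    obtain ⟨i', hi'⟩ := exists_over_lift (openSubι (chartLocus α a b J)) i hsub
    have ho : IsOpenImmersion (i'.left ≫ (openSubι (chartLocus α a b J)).left) := by
      rw [← Over.comp_left, hi']; exact hi
    refine ⟨U, i', IsOpenImmersion.of_comp _ (openSubι (chartLocus α a b J)).left, ?_, ?_⟩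
    · obtain ⟨w, hw⟩ := ht
      refine ⟨w, ?_⟩
      apply (openSubι (chartLocus α a b J)).left.isOpenEmbedding.injective
      rw [← Scheme.Hom.comp_apply, ← Over.comp_left, hi', hw]
      rfl
    · rw [← pullFam_comp, hi']; exact hJ
  choose U i hi ht s hs using h
  -- The local morphisms to the chart are unique, so they agree on overlaps and glue.
  obtain ⟨f, hf⟩ := exists_glue_hom U i (fun t ↦ ⟨t, ht t⟩) s (by
    intro k l S c d _ _ e
    apply chartFam_unique (α := α)
    rw [pullFam_comp, pullFam_comp, hs, hs, ← pullFam_comp (i k) c, e, pullFam_comp (i l) d])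
  refine ⟨f, family_ext fun t ↦ ⟨U t, i t, hi t, ht t, ?_⟩⟩
  rw [← pullFam_comp, hf, hs]

/-- It suffices to pass to a residue field, from which `exists_nbhd_inChart` spreads the property to
a neighbourhood in T. -/
lemma mem_chartLocus_of_inChart {α : ℂ} {n : ℕ} (hn : a + 1 + b = n) {T' : Over base}
    {J : (fiberProd node T).left.IdealSheafData} (hJ : IsFamily n J) (f : T' ⟶ T)
    (h : InChart α a b (pullFam f J)) (t : T'.left) : f.left t ∈ chartLocus α a b J := by
  obtain ⟨K, _, _, τ, hτ⟩ := exists_residue_point t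
  let w : (specC K).left := (inferInstance : Nonempty (PrimeSpectrum K)).some
  obtain ⟨R, _, _, i, hi, ht, hR⟩ := exists_nbhd_inChart hn hJ (τ ≫ f)
    (by rw [pullFam_comp]; exact h.pullFam τ) w
  rw [Over.comp_left, Scheme.Hom.comp_apply, hτ] at ht
  exact ⟨_, i, hi, ht, hR⟩

lemma finite_notMem_chartLocus {n : ℕ} (hn : 0 < n) {J : (fiberProd node T).left.IdealSheafData}
    (hJ : IsFamily n J) (t : T.left) :
    {α : ℂ | ¬ ∃ a b, a + 1 + b = n ∧ t ∈ chartLocus α a b J}.Finite := by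
  obtain ⟨K, _, _, τ, hτ⟩ := exists_residue_point t
  let w : (specC K).left := (inferInstance : Nonempty (PrimeSpectrum K)).some
  refine (finite_not_inChart hn (hJ.comap τ)).subset ?_
  rintro α hα ⟨a, b, hab, h⟩
  refine hα ⟨a, b, hab, ?_⟩
  rw [← hτ w]
  exact mem_chartLocus_of_inChart hab hJ τ h w

end ChartLocus
-- Gluing of ideal sheaves
section GlueIdeals

open Scheme

variable {X : Scheme.{0}}

/-- Restriction of sections over affine opens. -/
noncomputable def res {U V : X.affineOpens} (h : V ≤ U) : Γ(X, U) →+* Γ(X, V) :=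
  (X.presheaf.map (homOfLE h).op).hom

lemma res_res {U V W : X.affineOpens} (h : V ≤ U) (h' : W ≤ V) (s : Γ(X, U)) :
    res h' (res h s) = res (h'.trans h) s := by
  rw [res, res, res, ← RingHom.comp_apply, ← CommRingCat.hom_comp, ← Functor.map_comp]
  rfl

lemma res_self {U : X.affineOpens} (s : Γ(X, U)) : res (le_refl U) s = s := by
  have : X.presheaf.map (𝟙 (Opposite.op U.1)) = 𝟙 _ := X.presheaf.map_id _
  exact congr($(this).hom s)

lemma mem_of_mem_map_res {V : X.affineOpens} {f : Γ(X, V)} {I : Ideal Γ(X, V)} {s : Γ(X, V)}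
    (h : res (X.affineBasicOpen_le f) s ∈ I.map (res (X.affineBasicOpen_le f))) :
    ∃ m : ℕ, f ^ m * s ∈ I := by
  have := V.2.isLocalization_basicOpen f
  obtain ⟨_, ⟨m, rfl⟩, hm⟩ := (IsLocalization.algebraMap_mem_map_algebraMap_iff (Submonoid.powers f)
    Γ(X, X.basicOpen f) I s).mp h
  exact ⟨m, hm⟩

lemma mem_of_locally {V : X.affineOpens} (I : Ideal Γ(X, V)) (s : Γ(X, V))
    (h : ∀ x ∈ V.1, ∃ r : Γ(X, V), x ∈ X.basicOpen r ∧
      res (X.affineBasicOpen_le r) s ∈ I.map (res (X.affineBasicOpen_le r))) : s ∈ I := by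
  let t : Set Γ(X, V) := {r | res (X.affineBasicOpen_le r) s ∈ I.map (res (X.affineBasicOpen_le r))}
  have ht : Ideal.span t = ⊤ := by
    rw [← V.2.self_le_iSup_basicOpen_iff]
    intro x hx
    obtain ⟨r, hr, hs⟩ := h x hx
    exact TopologicalSpace.Opens.mem_iSup.mpr ⟨⟨r, hs⟩, hr⟩
  refine Submodule.mem_of_span_eq_top_of_smul_pow_mem I t ht s fun r ↦ ?_
  exact mem_of_mem_map_res r.2

/-- Ideals over small affine opens glue to an ideal sheaf. -/
theorem exists_idealSheaf (S : X.affineOpens → Prop) (hS : ∀ ⦃W W'⦄, W' ≤ W → S W → S W')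
    (hcov : ∀ x : X, ∃ W, S W ∧ x ∈ W.1) (K : ∀ W : X.affineOpens, Ideal Γ(X, W))
    (hK : ∀ ⦃W W'⦄ (h : W' ≤ W), S W → (K W).map (res h) = K W') :
    ∃ J : X.IdealSheafData, ∀ W, S W → J.ideal W = K W := by
  -- Over any affine open, a section belongs to the ideal if it does so on all small affine opens
  -- inside. What needs proof is the compatibility with localisation.
  let A : ∀ V : X.affineOpens, Ideal Γ(X, V) := fun V ↦
    ⨅ (W : X.affineOpens) (_ : S W) (h : W ≤ V), (K W).comap (res h)
  have hA : ∀ {V : X.affineOpens} {s : Γ(X, V)}, s ∈ A V ↔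
      ∀ (W : X.affineOpens) (_ : S W) (h : W ≤ V), res h s ∈ K W := by
    intro V s
    simp [A]
  have hbasic : ∀ (V : X.affineOpens) (f : Γ(X, V)),
      (A V).map (res (X.affineBasicOpen_le f)) = A (X.affineBasicOpen f) := by
    intro V f
    apply le_antisymm
    · rw [Ideal.map_le_iff_le_comap]
      intro s hs
      rw [Ideal.mem_comap, hA]
      intro W hW h
      rw [res_res]
      exact hA.mp hs W hW _
    · intro g hg
      have hloc := V.2.isLocalization_basicOpen f
      obtain ⟨N, s, hs⟩ : ∃ (N : ℕ) (s : Γ(X, V)),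
          res (X.affineBasicOpen_le f) s = res (X.affineBasicOpen_le f) f ^ N * g := by
        obtain ⟨N, s, hs⟩ := IsLocalization.Away.surj (S := Γ(X, X.basicOpen f)) f g
        exact ⟨N, s, hs.symm.trans (mul_comm _ _)⟩
      have hu : IsUnit (res (X.affineBasicOpen_le f) f) :=
        IsLocalization.Away.algebraMap_isUnit (S := Γ(X, X.basicOpen f)) f
      have hspan : Ideal.span {r : Γ(X, V) | S (X.affineBasicOpen r)} = ⊤ := by
        rw [← V.2.self_le_iSup_basicOpen_iff]
        intro x hx
        obtain ⟨W, hW, hxW⟩ := hcov x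
        obtain ⟨r, hr, hxr⟩ := V.2.exists_basicOpen_le ⟨x, hxW⟩ hx
        exact TopologicalSpace.Opens.mem_iSup.mpr ⟨⟨r, hS (W' := X.affineBasicOpen r) hr hW⟩, hxr⟩
      obtain ⟨t, htS, ht⟩ := (Ideal.span_eq_top_iff_finite _).mp hspan
      -- On a small basic open given by r the condition on g says that s lies in K after inverting
      -- f; a power of f clears the denominator.
      have key : ∀ r ∈ t, ∃ m : ℕ, res (X.affineBasicOpen_le r) (f ^ m * s) ∈
          K (X.affineBasicOpen r) := by
        intro r hr
        have hSr := htS hr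
        let f' := res (X.affineBasicOpen_le r) f
        have hE : X.affineBasicOpen f' ≤ X.affineBasicOpen f := by
          change X.basicOpen f' ≤ X.basicOpen f
          have : X.basicOpen f' = _ := X.basicOpen_res f (homOfLE (X.affineBasicOpen_le r)).op
          rw [this]
          exact inf_le_right
        obtain ⟨m, hm⟩ := mem_of_mem_map_res (V := X.affineBasicOpen r) (f := f')
          (I := K (X.affineBasicOpen r)) (s := res (X.affineBasicOpen_le r) s) (by
            rw [hK _ hSr, res_res, ← res_res (X.affineBasicOpen_le f) hE, hs, map_mul]
            exact Ideal.mul_mem_left _ _ (hA.mp hg _ (hS (X.affineBasicOpen_le f') hSr) hE))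
        exact ⟨m, by rw [map_mul, map_pow]; exact hm⟩
      choose! m hm using key
      -- Finitely many of these basic opens cover V, so one power of f serves for all.
      let M := t.sup m
      have hs' : f ^ M * s ∈ A V := by
        rw [hA]
        intro W hW h
        refine mem_of_locally _ _ fun x hx ↦ ?_
        have hxt : x ∈ ⨆ r : (t : Set Γ(X, V)), X.basicOpen r.1 :=
          V.2.self_le_iSup_basicOpen_iff.mpr ht (h hx)
        obtain ⟨⟨r, hr⟩, hxr⟩ := TopologicalSpace.Opens.mem_iSup.mp hxt
        obtain ⟨q, hq, hxq⟩ := W.2.exists_basicOpen_le ⟨x, hxr⟩ hx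
        have hq' : X.affineBasicOpen q ≤ X.affineBasicOpen r := hq
        refine ⟨q, hxq, ?_⟩
        rw [hK _ hW, res_res, ← res_res (X.affineBasicOpen_le r) hq', ← hK hq' (htS hr)]
        refine Ideal.mem_map_of_mem _ ?_
        have e : f ^ M * s = f ^ (M - m r) * (f ^ m r * s) := by
          rw [← mul_assoc, ← pow_add, Nat.sub_add_cancel (Finset.le_sup hr)]
        rw [e, map_mul]
        exact Ideal.mul_mem_left _ _ (hm r hr)
      have h1 : res (X.affineBasicOpen_le f) (f ^ M * s) = res (X.affineBasicOpen_le f) f ^ (M + N) * g := by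
        rw [map_mul, map_pow, hs, pow_add, mul_assoc]
      have h2 := Ideal.mem_map_of_mem (res (X.affineBasicOpen_le f)) hs'
      rw [h1] at h2
      exact (Ideal.unit_mul_mem_iff_mem _ (hu.pow _)).mp h2
  refine ⟨⟨A, hbasic, _, rfl⟩, fun W hW ↦ le_antisymm (fun s hs ↦ ?_) fun s hs ↦ ?_⟩
  · have := hA.mp hs W hW le_rfl
    rwa [res_self] at this
  · refine hA.mpr fun W' hW' h ↦ ?_
    rw [← hK h hW]
    exact Ideal.mem_map_of_mem _ hs

lemma res_mem_iff (I : X.IdealSheafData) {V V' : X.affineOpens} (h : V = V')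
    (i : Opposite.op V.1 ⟶ Opposite.op V'.1) (s : Γ(X, V)) :
    (X.presheaf.map i).hom s ∈ I.ideal V' ↔ s ∈ I.ideal V := by
  subst h
  have : X.presheaf.map i = 𝟙 _ := X.presheaf.map_id _
  rw [this]
  rfl

open Classical in
/-- The ideals of sections given by an ideal sheaf on an open subscheme. -/
noncomputable def secIdeal {U : Scheme.{0}} (f : U ⟶ X) [IsOpenImmersion f] (I : U.IdealSheafData)
    (W : X.affineOpens) : Ideal Γ(X, W) :=
  if h : W.1 ≤ f.opensRange then
    (I.ideal ⟨f ⁻¹ᵁ W.1, W.2.preimage_of_isOpenImmersion f h⟩).comap (f.app W.1).hom else ⊤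

lemma secIdeal_of_le {U : Scheme.{0}} (f : U ⟶ X) [IsOpenImmersion f] (I : U.IdealSheafData)
    {W : X.affineOpens} (h : W.1 ≤ f.opensRange) : secIdeal f I W =
    (I.ideal ⟨f ⁻¹ᵁ W.1, W.2.preimage_of_isOpenImmersion f h⟩).comap (f.app W.1).hom := dif_pos h

lemma secIdeal_comap {S U : Scheme.{0}} (a : S ⟶ U) (f : U ⟶ X) [IsOpenImmersion a]
    [IsOpenImmersion f] (I : U.IdealSheafData) {W : X.affineOpens}
    (h : W.1 ≤ (a ≫ f).opensRange) : secIdeal (a ≫ f) (I.comap a) W = secIdeal f I W := by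
  have h' : W.1 ≤ f.opensRange := h.trans (by rintro _ ⟨w, rfl⟩; exact ⟨a w, by simp⟩)
  rw [secIdeal_of_le _ _ h, secIdeal_of_le _ _ h']
  ext s
  rw [Ideal.mem_comap, Ideal.mem_comap, IdealSheafData.ideal_comap_of_isOpenImmersion,
    Ideal.mem_comap]
  have hV : (f ⁻¹ᵁ W.1) = a ''ᵁ ((a ≫ f) ⁻¹ᵁ W.1) := by
    rw [Scheme.Hom.comp_preimage, a.image_preimage_eq_opensRange_inf, eq_comm, inf_eq_right]
    intro u hu
    obtain ⟨w, hw⟩ := h hu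
    refine ⟨w, f.isOpenEmbedding.injective ?_⟩
    rw [← hw, Scheme.Hom.comp_apply]
  have e : (a ≫ f).app W.1 ≫ (a.appIso ((a ≫ f) ⁻¹ᵁ W.1)).inv =
      f.app W.1 ≫ U.presheaf.map (homOfLE hV.ge).op := by
    rw [Scheme.Hom.comp_app]
    exact (Category.assoc _ _ _).trans (congrArg (fun z ↦ f.app W.1 ≫ z)
      (a.app_appIso_inv (f ⁻¹ᵁ W.1)))
  have e' : (a.appIso ((a ≫ f) ⁻¹ᵁ W.1)).inv.hom (((a ≫ f).app W.1).hom s) =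
      (U.presheaf.map (homOfLE hV.ge).op).hom ((f.app W.1).hom s) := congr($(e).hom s)
  rw [e']
  exact res_mem_iff I (V := ⟨f ⁻¹ᵁ W.1, W.2.preimage_of_isOpenImmersion f h'⟩)
    (V' := ⟨a ''ᵁ ((a ≫ f) ⁻¹ᵁ W.1),
      (W.2.preimage_of_isOpenImmersion (a ≫ f) h).image_of_isOpenImmersion a⟩)
    (Subtype.ext hV) _ _

lemma map_secIdeal {U : Scheme.{0}} (f : U ⟶ X) [IsOpenImmersion f] (I : U.IdealSheafData)
    {W W' : X.affineOpens} (h : W' ≤ W) (hW : W.1 ≤ f.opensRange) :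
    (secIdeal f I W).map (res h) = secIdeal f I W' := by
  have hW' : W'.1 ≤ f.opensRange := le_trans h hW
  rw [secIdeal_of_le _ _ hW, secIdeal_of_le _ _ hW']
  have := f.isIso_app W.1 hW
  have := f.isIso_app W'.1 hW'
  have b := ConcreteCategory.bijective_of_isIso (C := CommRingCat) (f.app W.1)
  have b' := ConcreteCategory.bijective_of_isIso (C := CommRingCat) (f.app W'.1)
  have hpre : f ⁻¹ᵁ W'.1 ≤ f ⁻¹ᵁ W.1 := fun x hx ↦ h hx
  have e : (f.app W'.1).hom.comp (res h) =
      (U.presheaf.map (homOfLE hpre).op).hom.comp (f.app W.1).hom := by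
    have := f.naturality (homOfLE h).op
    exact congrArg CommRingCat.Hom.hom this
  rw [← Ideal.comap_map_of_bijective (f.app W'.1).hom b' (I := Ideal.map (res h) _), Ideal.map_map, e,
    ← Ideal.map_map, Ideal.map_comap_of_surjective _ b.2]
  congr 1
  exact I.map_ideal (U := ⟨f ⁻¹ᵁ W'.1, W'.2.preimage_of_isOpenImmersion f hW'⟩)
    (V := ⟨f ⁻¹ᵁ W.1, W.2.preimage_of_isOpenImmersion f hW⟩) hpre

/-- Ideal sheaves glue along open covers. -/
theorem exists_glue_idealSheaf {ι : Type*} (U : ι → Scheme.{0}) (f : ∀ i, U i ⟶ X)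
    [∀ i, IsOpenImmersion (f i)] (hcov : ∀ x, ∃ i, x ∈ Set.range (f i))
    (J : ∀ i, (U i).IdealSheafData)
    (hJ : ∀ i j (S : Scheme.{0}) (a : S ⟶ U i) (b : S ⟶ U j), IsOpenImmersion a →
      IsOpenImmersion b → a ≫ f i = b ≫ f j → (J i).comap a = (J j).comap b) :
    ∃ I : X.IdealSheafData, ∀ i, I.comap (f i) = J i := by
  -- An index whose open does not contain W contributes the unit ideal. The other indices give equal
  -- ideals by the compatibility on overlaps, so the infimum is any one of them.
  let K : ∀ W : X.affineOpens, Ideal Γ(X, W) := fun W ↦ ⨅ i, secIdeal (f i) (J i) W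
  have hK : ∀ (W : X.affineOpens) i, W.1 ≤ (f i).opensRange → K W = secIdeal (f i) (J i) W := by
    intro W i hi
    refine le_antisymm (iInf_le _ i) (le_iInf fun j ↦ ?_)
    by_cases hj : W.1 ≤ (f j).opensRange
    · have hr : W.1 ≤ (pullback.fst (f i) (f j) ≫ f i).opensRange := by
        intro x hx
        obtain ⟨u, hu⟩ := hi hx
        obtain ⟨v, hv⟩ := hj hx
        obtain ⟨w, hw, -⟩ := Scheme.Pullback.exists_preimage_pullback u v (hu.trans hv.symm)
        refine ⟨w, ?_⟩
        rw [Scheme.Hom.comp_apply, hw, hu]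
      rw [← secIdeal_comap (pullback.fst (f i) (f j)) (f i) (J i) hr,
        hJ i j _ (pullback.fst (f i) (f j)) (pullback.snd (f i) (f j)) inferInstance inferInstance
          pullback.condition]
      rw [← secIdeal_comap (pullback.snd (f i) (f j)) (f j) (J j) (hr.trans_eq (by
        congr 1; exact pullback.condition))]
      apply le_of_eq
      congr 1
      exact pullback.condition
    · rw [secIdeal, secIdeal, dif_neg hj]
      exact le_top
  obtain ⟨I, hI⟩ := exists_idealSheaf (fun W ↦ ∃ i, W.1 ≤ (f i).opensRange)
    (fun W W' h ⟨i, hi⟩ ↦ ⟨i, le_trans h hi⟩) (fun x ↦ by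
      obtain ⟨i, hi⟩ := hcov x
      obtain ⟨W, hW, hx, hWi⟩ := exists_isAffineOpen_mem_and_subset (x := x) (U := (f i).opensRange) hi
      exact ⟨⟨W, hW⟩, ⟨i, hWi⟩, hx⟩) K (fun W W' h ⟨i, hi⟩ ↦ by
      rw [hK W i hi, hK W' i (le_trans h hi), map_secIdeal _ _ _ hi])
  refine ⟨I, fun i ↦ IdealSheafData.ext (funext fun V ↦ ?_)⟩
  have hV : (f i ''ᵁ V.1) ≤ (f i).opensRange := by
    rintro _ ⟨w, -, rfl⟩; exact ⟨w, rfl⟩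
  rw [IdealSheafData.ideal_comap_of_isOpenImmersion, hI _ ⟨i, hV⟩, hK _ i hV, secIdeal_of_le _ _ hV,
    Ideal.comap_comap, ← CommRingCat.hom_comp, Scheme.Hom.appIso_inv_app]
  ext s
  exact res_mem_iff (J i) (Subtype.ext ((f i).preimage_image_eq V.1).symm) _ s

end GlueIdeals
-- The Hilbert functor is a Zariski sheaf
section Representability

open Scheme Opposite

/-- A family over a scheme, together with a morphism of the scheme to `Spec ℂ`. -/
structure FamOver (n : ℕ) (T : Scheme.{0}) : Type where
  str : T ⟶ base
  fam : (fiberProd node (Over.mk str)).left.IdealSheafData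
  isFamily : IsFamily n fam

variable {n : ℕ}

/-- A morphism of schemes, over `ℂ`. -/
noncomputable abbrev overHom {S T : Scheme.{0}} {s : S ⟶ base} {t : T ⟶ base} (f : S ⟶ T)
    (h : f ≫ t = s) : Over.mk s ⟶ Over.mk t := Over.homMk f h

/-- The ideal sheaves live on products that depend on the structure morphism. Comparing them by
pullback along an identity avoids transport along an equality. -/
lemma FamOver.ext_of {T : Scheme.{0}} {A B : FamOver n T} (h : B.str = A.str)
    (hJ : pullFam (overHom (𝟙 T) (by rw [Category.id_comp, h]) : Over.mk A.str ⟶ Over.mk B.str) B.fam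
      = A.fam) : A = B := by
  obtain ⟨a, I, hI⟩ := A
  obtain ⟨b, J, hJ'⟩ := B
  simp only at h hJ
  subst h
  have : overHom (𝟙 T) (Category.id_comp b) = 𝟙 (Over.mk b) := rfl
  rw [this, pullFam_id] at hJ
  subst hJ
  rfl

lemma FamOver.pullFam_of_eq {T : Scheme.{0}} {A B : FamOver n T} (h : A = B) :
    pullFam (overHom (𝟙 T) (by rw [Category.id_comp, h]) : Over.mk A.str ⟶ Over.mk B.str) B.fam
      = A.fam := by
  subst h
  exact pullFam_id _

/-- The base change of a family. -/
noncomputable def FamOver.map {S T : Scheme.{0}} (f : S ⟶ T) (A : FamOver n T) : FamOver n S where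
  str := f ≫ A.str
  fam := pullFam (overHom f rfl) A.fam
  isFamily := A.isFamily.comap _

variable (n) in
/-- The Hilbert functor of the nodal curve. -/
noncomputable def hilbFunctor : Scheme.{0}ᵒᵖ ⥤ Type where
  obj T := FamOver n T.unop
  map f := TypeCat.ofHom (FamOver.map f.unop)
  map_id T := by
    ext A
    change FamOver.map (𝟙 _) A = A
    exact FamOver.ext_of (A := A.map (𝟙 _)) (B := A) (Category.id_comp _).symm rfl
  map_comp f g := by
    ext A
    change FamOver.map (g.unop ≫ f.unop) A = FamOver.map g.unop (FamOver.map f.unop A)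
    refine FamOver.ext_of (Category.assoc _ _ _).symm ?_
    refine (pullFam_comp _ _ _).symm.trans ((pullFam_comp _ _ _).symm.trans ?_)
    refine congrArg (fun z ↦ pullFam z A.fam) ?_
    ext1
    exact Category.id_comp (g.unop ≫ f.unop)

lemma exists_isHilbertScheme (h : (hilbFunctor n).IsRepresentable) :
    ∃ (H : Over base) (𝒵 : (fiberProd node H).left.IdealSheafData), IsHilbertScheme node n H 𝒵 := by
  obtain ⟨H, ⟨e⟩⟩ := h
  let A : FamOver n H := e.homEquiv (𝟙 H)
  have he : ∀ {T : Scheme.{0}} (f : T ⟶ H), e.homEquiv f = A.map f := by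
    intro T f
    have := e.homEquiv_comp f (𝟙 H)
    rw [Category.comp_id] at this
    exact this
  refine ⟨Over.mk A.str, A.fam, A.isFamily, fun T J hJ ↦ ?_⟩
  let B : FamOver n T.left := ⟨T.hom, J, hJ⟩
  obtain ⟨f, hf⟩ := e.homEquiv.surjective B
  rw [he] at hf
  have hs : f ≫ A.str = T.hom := congrArg FamOver.str hf
  have aux : ∀ (g : T.left ⟶ H) (hg : g ≫ A.str = T.hom), A.map g = B ↔
      J = pullFam (overHom g hg : Over.mk T.hom ⟶ Over.mk A.str) A.fam := by
    intro g hg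
    have key : pullFam (overHom (𝟙 T.left) (by rw [Category.id_comp]; exact hg) :
        Over.mk B.str ⟶ Over.mk (A.map g).str) (A.map g).fam =
        pullFam (overHom g hg : Over.mk T.hom ⟶ Over.mk A.str) A.fam := by
      refine (pullFam_comp _ _ A.fam).symm.trans ?_
      refine congrArg (fun z ↦ pullFam z A.fam) ?_
      ext1
      exact Category.id_comp g
    constructor
    · intro h
      have := FamOver.pullFam_of_eq h.symm
      exact this.symm.trans key
    · intro h
      refine (FamOver.ext_of (A := B) (B := A.map g) hg ?_).symm
      exact key.trans h.symm
  refine ⟨overHom f hs, (aux f hs).mp hf, fun g hg ↦ ?_⟩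
  have hg' : g.left ≫ A.str = T.hom := Over.w g
  have h1 := (aux g.left hg').mpr hg
  have h2 : g.left = f := e.homEquiv.injective (by rw [he, he, h1, hf])
  ext1
  exact h2

lemma FamOver.comap_lift_congr {S : Scheme.{0}} {A B : FamOver n S} (h : A = B)
    {q q' : S ⟶ node.left} (hq : q = q') (hA : q ≫ node.hom = 𝟙 S ≫ A.str)
    (hB : q' ≫ node.hom = 𝟙 S ≫ B.str) :
    A.fam.comap (pullback.lift q (𝟙 S) hA : S ⟶ (fiberProd node (Over.mk A.str)).left) =
      B.fam.comap (pullback.lift q' (𝟙 S) hB : S ⟶ (fiberProd node (Over.mk B.str)).left) := by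
  subst h hq
  rfl

/-- A morphism a to C × T is the graph of its first component followed by the base change along its
second component. Gluing ideal sheaves requires compatibility on open subschemes of C × U_i that
need not be products; this formula reduces it to the compatibility of the families. -/
lemma FamOver.comap_eq {S T : Scheme.{0}} (A : FamOver n T)
    (a : S ⟶ (fiberProd node (Over.mk A.str)).left)
    (h : (a ≫ pullback.fst node.hom A.str) ≫ node.hom =
      𝟙 S ≫ (A.map (a ≫ pullback.snd node.hom A.str)).str) :
    A.fam.comap a = (A.map (a ≫ pullback.snd node.hom A.str)).fam.comap
      (pullback.lift (a ≫ pullback.fst node.hom A.str) (𝟙 S) h :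
        S ⟶ (fiberProd node (Over.mk (A.map (a ≫ pullback.snd node.hom A.str)).str)).left) := by
  have e : (pullback.lift (a ≫ pullback.fst node.hom A.str) (𝟙 S) h :
        S ⟶ (fiberProd node (Over.mk (A.map (a ≫ pullback.snd node.hom A.str)).str)).left) ≫
      fiberProdMap (𝟙 node) (overHom (a ≫ pullback.snd node.hom A.str) rfl :
        Over.mk (A.map (a ≫ pullback.snd node.hom A.str)).str ⟶ Over.mk A.str) = a := by
    apply pullback.hom_ext
    · refine (Category.assoc _ _ _).trans ?_
      rw [fiberProdMap_id_fst]
      exact pullback.lift_fst _ _ _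
    · refine (Category.assoc _ _ _).trans ?_
      rw [fiberProdMap_snd]
      refine (pullback.lift_snd_assoc _ _ _ _).trans ?_
      exact Category.id_comp _
  conv_lhs => rw [← e]
  exact IdealSheafData.comap_comp _ _ _

/-- Families can be glued along an open cover. -/
lemma FamOver.existsUnique_glue {Y : Scheme.{0}} (𝓤 : OpenCover.{1} Y) (A : ∀ i, FamOver n (𝓤.X i))
    (hA : ∀ (i j : 𝓤.I₀) (P : Scheme.{0}) (a : P ⟶ 𝓤.X i) (b : P ⟶ 𝓤.X j),
      a ≫ 𝓤.f i = b ≫ 𝓤.f j → (A i).map a = (A j).map b) :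
    ∃! B : FamOver n Y, ∀ i, B.map (𝓤.f i) = A i := by
  let str : Y ⟶ base := 𝓤.glueMorphisms (fun i ↦ (A i).str) fun i j ↦
    congrArg FamOver.str (hA i j _ _ _ pullback.condition)
  have hstr : ∀ i, 𝓤.f i ≫ str = (A i).str := fun i ↦ 𝓤.ι_glueMorphisms _ _ i
  let g : ∀ i, Over.mk (A i).str ⟶ Over.mk str := fun i ↦ overHom (𝓤.f i) (hstr i)
  have hg : ∀ i, IsOpenImmersion (g i).left := fun i ↦ inferInstanceAs (IsOpenImmersion (𝓤.f i))
  have hcov : ∀ y : (Over.mk str).left, ∃ i, y ∈ Set.range (g i).left := fun y ↦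
    ⟨𝓤.idx y, 𝓤.covers y⟩
  obtain ⟨J, hJ⟩ := exists_glue_idealSheaf (fun i ↦ (fiberProd node (Over.mk (A i).str)).left)
    (fun i ↦ fiberProdMap (𝟙 node) (g i)) (fun z ↦ by
      obtain ⟨i, hi⟩ := hcov (pullback.snd node.hom str z)
      exact ⟨i, (mem_range_fiberProdMap (g i) z).mpr hi⟩) (fun i ↦ (A i).fam) (by
    intro i j S a b _ _ e
    have h1 : a ≫ pullback.fst node.hom (A i).str = b ≫ pullback.fst node.hom (A j).str := by
      have := congrArg (fun z ↦ z ≫ pullback.fst node.hom str) e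
      simp only [Category.assoc] at this
      have e1 := fiberProdMap_id_fst (X := node) (g i)
      have e2 := fiberProdMap_id_fst (X := node) (g j)
      exact ((congrArg (a ≫ ·) e1).symm.trans this).trans (congrArg (b ≫ ·) e2)
    have h2 : (a ≫ pullback.snd node.hom (A i).str) ≫ 𝓤.f i =
        (b ≫ pullback.snd node.hom (A j).str) ≫ 𝓤.f j := by
      have := congrArg (fun z ↦ z ≫ pullback.snd node.hom str) e
      simp only [Category.assoc] at this ⊢
      have e1 := fiberProdMap_snd (𝟙 node) (g i)
      have e2 := fiberProdMap_snd (𝟙 node) (g j)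
      exact ((congrArg (a ≫ ·) e1).symm.trans this).trans (congrArg (b ≫ ·) e2)
    have h3 : ∀ (i : 𝓤.I₀) (a : S ⟶ (fiberProd node (Over.mk (A i).str)).left),
        (a ≫ pullback.fst node.hom (A i).str) ≫ node.hom =
          𝟙 S ≫ ((A i).map (a ≫ pullback.snd node.hom (A i).str)).str := by
      intro i a
      rw [Category.id_comp, Category.assoc, pullback.condition, ← Category.assoc]
      rfl
    refine ((A i).comap_eq a (h3 i a)).trans ?_
    refine (FamOver.comap_lift_congr (hA i j S _ _ h2) h1 _ (h3 j b)).trans ?_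
    exact ((A j).comap_eq b (h3 j b)).symm)
  have hfam : IsFamily n J := isFamily_of_cover J fun y ↦ by
    obtain ⟨i, hi⟩ := hcov y
    exact ⟨_, g i, hg i, hi, by rw [hJ]; exact (A i).isFamily⟩
  refine ⟨⟨str, J, hfam⟩, ?_, ?_⟩
  · intro i
    exact FamOver.ext_of (A := FamOver.map (𝓤.f i) ⟨str, J, hfam⟩) (B := A i) (hstr i).symm
      (by
        have e1 : pullFam (g i) J = (A i).fam := hJ i
        rw [← e1, ← pullFam_comp]
        refine congrArg (fun z ↦ pullFam z J) ?_
        ext1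
        exact Category.id_comp _)
  · intro B hB
    have hB' : ∀ i, FamOver.map (𝓤.f i) B = A i := hB
    have hs : B.str = str := 𝓤.hom_ext _ _ fun i ↦ by
      rw [hstr]; exact congrArg FamOver.str (hB' i)
    refine FamOver.ext_of (A := B) (B := ⟨str, J, hfam⟩) hs.symm ?_
    refine family_ext fun y ↦ ?_
    obtain ⟨i, hi⟩ := hcov y
    have hi2 : IsOpenImmersion (𝓤.f i) := inferInstance
    refine ⟨_, overHom (𝓤.f i) rfl, hi2, hi, ?_⟩
    have e2 := FamOver.pullFam_of_eq (hB' i)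
    refine Eq.trans ?_ e2
    have e1 : pullFam (g i) J = (A i).fam := hJ i
    rw [← e1, ← pullFam_comp, ← pullFam_comp]
    refine congrArg (fun z ↦ pullFam z J) ?_
    ext1
    exact (Category.comp_id _).trans (Category.id_comp _).symm

theorem hilbFunctor_isSheaf : Presieve.IsSheaf zariskiTopology (hilbFunctor n) := by
  rw [zariskiTopology, Scheme.grothendieckTopology,
    Precoverage.isSheaf_toGrothendieck_iff_of_isStableUnderBaseChange]
  rintro Y S hS x hx
  obtain ⟨(𝓤 : OpenCover Y), rfl⟩ := exists_cover_of_mem_pretopology hS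
  let A : ∀ i, FamOver n (𝓤.X i) := fun i ↦ x (𝓤.f i) (.mk i)
  have hA : ∀ (i j : 𝓤.I₀) (P : Scheme.{0}) (a : P ⟶ 𝓤.X i) (b : P ⟶ 𝓤.X j),
      a ≫ 𝓤.f i = b ≫ 𝓤.f j → (A i).map a = (A j).map b :=
    fun i j P a b e ↦ hx a b (.mk i) (.mk j) e
  obtain ⟨B, hB, hB'⟩ := FamOver.existsUnique_glue 𝓤 A hA
  refine ⟨B, ?_, fun B' h ↦ hB' B' fun i ↦ h (𝓤.f i) (.mk i)⟩
  rintro Z e ⟨i⟩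
  exact hB i

end Representability
-- Charts of the Hilbert functor and representability for n > 0
section Representability

open Scheme Opposite

variable {n : ℕ}

lemma FamOver.map_eq_iff {S T : Scheme.{0}} (f : S ⟶ T) (A : FamOver n T) (B : FamOver n S) :
    A.map f = B ↔ ∃ h : f ≫ A.str = B.str,
      pullFam (overHom f h : Over.mk B.str ⟶ Over.mk A.str) A.fam = B.fam := by
  constructor
  · rintro rfl
    exact ⟨rfl, rfl⟩
  · rintro ⟨h, hJ⟩
    obtain ⟨b, J, hb⟩ := B
    simp only at h hJ
    subst h hJ
    rfl

variable (n) in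
/-- The transformation given by a family. -/
noncomputable def famHom {T : Scheme.{0}} (A : FamOver n T) : yoneda.obj T ⟶ hilbFunctor n :=
  yonedaEquiv.symm A

variable (n) in
/-- The family over a chart. -/
noncomputable def chartFamOver (q : {q : ℂ × ℕ × ℕ // q.2.1 + 1 + q.2.2 = n}) :
    FamOver n (specC (ParamRing q.1.2.1 q.1.2.2)).left :=
  ⟨(specC (ParamRing q.1.2.1 q.1.2.2)).hom, chartFam q.1.1 q.1.2.1 q.1.2.2,
    (univParam q.1.2.1 q.1.2.2).isFamily_fam q.1.1 q.2⟩

/-- The fibre product with a family over Y is the open locus of Y where the family is in the chart: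
over it the morphism to the chart exists and is unique, and a base change that is in the chart
factors through it. -/
lemma isOpenImmersion_famHom_chartFamOver (q : {q : ℂ × ℕ × ℕ // q.2.1 + 1 + q.2.2 = n}) :
    IsOpenImmersion.presheaf (famHom n (chartFamOver n q)) := by
  obtain ⟨⟨α, a, b⟩, hq⟩ := q
  simp only at hq
  apply MorphismProperty.relative.of_exists
  intro Y g
  obtain ⟨A, rfl⟩ : ∃ A : FamOver n Y, g = famHom n A :=
    ⟨yonedaEquiv g, (yonedaEquiv.symm_apply_apply g).symm⟩
  obtain ⟨s, hs⟩ := inChart_chartLocus α a b A.fam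
  refine ⟨(openSub (chartLocus α a b A.fam)).left, yoneda.map s.left,
    (openSubι (chartLocus α a b A.fam)).left, ?_, inferInstance⟩
  apply IsPullback.of_forall_isPullback_app
  intro Z
  obtain ⟨Z, rfl⟩ : ∃ Z', Z = op Z' := ⟨_, rfl⟩
  refine (Types.isPullback_iff _ _ _ _).mpr ⟨?_, ?_, ?_⟩
  · ext c
    change Z ⟶ (openSub (chartLocus α a b A.fam)).left at c
    change (chartFamOver n ⟨⟨α, a, b⟩, hq⟩).map (c ≫ s.left) =
      A.map (c ≫ (openSubι (chartLocus α a b A.fam)).left)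
    refine (FamOver.map_eq_iff _ _ _).mpr ⟨?_, ?_⟩
    · change (c ≫ s.left) ≫ (specC _).hom = (c ≫ (openSubι _).left) ≫ (Over.mk A.str).hom
      rw [Category.assoc, Category.assoc, Over.w, Over.w]
    · change pullFam _ _ = pullFam _ _
      let c' : Over.mk ((A.map (c ≫ (openSubι (chartLocus α a b A.fam)).left)).str) ⟶
          openSub (chartLocus α a b A.fam) := Over.homMk c (by
        change c ≫ _ = (c ≫ (openSubι _).left) ≫ (Over.mk A.str).hom
        rw [Category.assoc, Over.w])
      have h1 := congrArg (pullFam c') hs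
      rw [← pullFam_comp, ← pullFam_comp] at h1
      exact h1
  · rintro (x y : Z ⟶ (openSub (chartLocus α a b A.fam)).left) ⟨-, h⟩
    change x ≫ (openSubι (chartLocus α a b A.fam)).left =
      y ≫ (openSubι (chartLocus α a b A.fam)).left at h
    exact (cancel_mono _).mp h
  · intro f h e
    change Z ⟶ (specC (ParamRing a b)).left at f
    change Z ⟶ Y at h
    change (chartFamOver n ⟨⟨α, a, b⟩, hq⟩).map f = A.map h at e
    obtain ⟨hstr, hJ⟩ := (FamOver.map_eq_iff _ _ _).mp e
    have hJ' : pullFam (overHom h rfl : Over.mk (h ≫ A.str) ⟶ Over.mk A.str) A.fam =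
      pullFam (overHom f hstr : Over.mk (h ≫ A.str) ⟶ specC (ParamRing a b)) (chartFam α a b) :=
      hJ.symm
    obtain ⟨h', hh'⟩ := exists_over_lift (openSubι (chartLocus α a b A.fam))
      (overHom h rfl : Over.mk (h ≫ A.str) ⟶ Over.mk A.str) (by
        rintro _ ⟨z, rfl⟩
        have := mem_chartLocus_of_inChart hq A.isFamily
          (overHom h rfl : Over.mk (h ≫ A.str) ⟶ Over.mk A.str) ⟨_, hJ'.symm⟩ z
        exact ⟨⟨_, this⟩, rfl⟩)
    refine ⟨h'.left, ?_, congrArg CommaMorphism.left hh'⟩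
    have : h' ≫ s = (overHom f hstr : Over.mk (h ≫ A.str) ⟶ specC (ParamRing a b)) := by
      refine chartFam_unique (α := α) ?_
      rw [← hJ', pullFam_comp, hs, ← pullFam_comp, hh']
    exact congrArg CommaMorphism.left this

/-- At each point only finitely many α fail, and ℂ is infinite, so every point has a neighbourhood
where the family is in some chart. -/
lemma isLocallySurjective_famHom_chartFamOver (hn : 0 < n) :
    Presheaf.IsLocallySurjective zariskiTopology
      (Sigma.desc fun q ↦ famHom n (chartFamOver n q)) where
  imageSieve_mem {Y} A := by
    change FamOver n Y at A
    have hq : ∀ t : Y, ∃ q : {q : ℂ × ℕ × ℕ // q.2.1 + 1 + q.2.2 = n},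
        t ∈ chartLocus q.1.1 q.1.2.1 q.1.2.2 A.fam := by
      intro t
      obtain ⟨α, hα⟩ := (finite_notMem_chartLocus hn A.isFamily t).infinite_compl.nonempty
      simp only [Set.mem_compl_iff, Set.mem_ofPred_eq, not_not] at hα
      obtain ⟨a, b, hab, ht⟩ := hα
      exact ⟨⟨⟨α, a, b⟩, hab⟩, ht⟩
    choose q hq using hq
    let 𝓤 := openCoverOf
      (fun t ↦ (openSub (chartLocus (q t).1.1 (q t).1.2.1 (q t).1.2.2 A.fam)).left)
      (fun t ↦ (openSubι (chartLocus (q t).1.1 (q t).1.2.1 (q t).1.2.2 A.fam)).left)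
      (fun t : Y ↦ ⟨t, ⟨t, hq t⟩, rfl⟩)
    refine zariskiTopology.superset_covering ?_ 𝓤.mem_grothendieckTopology
    rw [Sieve.ofArrows, Sieve.generate_le_iff]
    rintro Z _ ⟨t⟩
    obtain ⟨s, hs⟩ := inChart_chartLocus (q t).1.1 (q t).1.2.1 (q t).1.2.2 A.fam
    refine ⟨(Sigma.ι (fun q : {q : ℂ × ℕ × ℕ // q.2.1 + 1 + q.2.2 = n} ↦
      yoneda.obj (specC (ParamRing q.1.2.1 q.1.2.2)).left) (q t)).app (op _) s.left, ?_⟩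
    have h1 := congrArg (fun z ↦ z.app (op (openSub (chartLocus (q t).1.1 (q t).1.2.1 (q t).1.2.2 A.fam)).left) s.left)
      (Sigma.ι_desc (fun q ↦ famHom n (chartFamOver n q)) (q t))
    refine h1.trans ?_
    refine (FamOver.map_eq_iff _ _ _).mpr ⟨(Over.w s).trans (Over.w (openSubι _)).symm, ?_⟩
    exact hs

/-- A Zariski sheaf which is covered by representable open subfunctors is representable. -/
lemma hilbFunctor_isRepresentable (hn : 0 < n) : (hilbFunctor n).IsRepresentable := by
  have := isLocallySurjective_famHom_chartFamOver hn
  exact LocalRepresentability.isRepresentable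
    (F := ⟨hilbFunctor n, (isSheaf_iff_isSheaf_of_type _ _).mpr hilbFunctor_isSheaf⟩)
    (f := fun q ↦ famHom n (chartFamOver n q)) isOpenImmersion_famHom_chartFamOver

theorem exists_isHilbertScheme_of_pos (hn : 0 < n) :
    ∃ (H : Over base) (𝒵 : (fiberProd node H).left.IdealSheafData), IsHilbertScheme node n H 𝒵 :=
  exists_isHilbertScheme (hilbFunctor_isRepresentable hn)

end Representability
-- The binary forms of a family
section Forms

set_option linter.unusedSectionVars false

open Polynomial

variable {R R' : Type} [CommRing R] [Algebra ℂ R] [CommRing R'] [Algebra ℂ R'] {a b a' b' k : ℕ}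

/-! ### The forms of a parameter -/

lemma Param.coeff_fx_succ (p : Param R a b) (i : ℕ) : p.fx.coeff (i + 1) = p.P.coeff i := by
  rw [Param.fx, coeff_sub, coeff_X_mul, coeff_C_succ, sub_zero]

lemma Param.coeff_fx_zero (p : Param R a b) : p.fx.coeff 0 = -(p.u * p.Q.coeff 0) := by
  simp [Param.fx, mul_coeff_zero]

lemma Param.coeff_ex_of_le (p : Param R a b) {i : ℕ} (hi : i ≤ a) :
    p.ex.coeff i = p.P.coeff (a - i) := by
  rw [p.coeff_ex (by omega), show a + 1 - i = (a - i) + 1 by omega, p.coeff_fx_succ]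

lemma Param.coeff_ex_succ (p : Param R a b) : p.ex.coeff (a + 1) = -(p.u * p.Q.coeff 0) := by
  rw [p.coeff_ex le_rfl, Nat.sub_self, p.coeff_fx_zero]

lemma Param.coeff_ex_zero (p : Param R a b) : p.ex.coeff 0 = 1 := by
  rw [p.coeff_ex_of_le (Nat.zero_le a), Nat.sub_zero, coeff_monicPoly_self]

lemma Param.natDegree_ex_le (p : Param R a b) : p.ex.natDegree ≤ a + 1 :=
  natDegree_le_iff_coeff_eq_zero.mpr fun _ h ↦ p.coeff_ex_of_lt h

lemma Param.P_coeff_zero (p : Param R a b) : p.P.coeff 0 = p.ex.coeff a := by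
  rw [p.coeff_ex_of_le le_rfl, Nat.sub_self]

/-- A parameter is determined by its two forms and by `u` and `v`. -/
lemma Param.ext_of_ex {p p' : Param R a b} (hu : p.u = p'.u) (hv : p.v = p'.v) (hx : p.ex = p'.ex)
    (hy : p.swap.ex = p'.swap.ex) : p = p' := by
  have key : ∀ {a b : ℕ} {p p' : Param R a b}, p.ex = p'.ex → p.c = p'.c := by
    intro a b p p' h
    ext i
    have h1 : ∀ p : Param R a b, p.ex.coeff (a - i) = p.c i := fun p ↦ by
      rw [p.coeff_ex_of_le (Nat.sub_le _ _), Nat.sub_sub_self i.2.le, coeff_monicPoly]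
    rw [← h1, ← h1, h]
  exact Param.ext hu hv (key hx) (key hy)

/-- The parameter with given forms. -/
noncomputable def Param.ofForms (a b : ℕ) (u v : R) (huv : u * v = 0) (E F : R[X]) : Param R a b where
  u := u
  v := v
  c i := E.coeff (a - i)
  f i := F.coeff (b - i)
  huv := huv

/-- The coefficients up to degree a are those of P in reverse order and are free apart from the
constant term 1. Only the top coefficient is constrained, to -u Q(0), and Q(0) is the coefficient of
degree b of F. -/
lemma Param.ex_ofForms {u v : R} {huv : u * v = 0} {E F : R[X]} (hE : E.natDegree ≤ a + 1)
    (hE0 : E.coeff 0 = 1) (hF0 : F.coeff 0 = 1) (h : E.coeff (a + 1) = -(u * F.coeff b)) :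
    (Param.ofForms a b u v huv E F).ex = E := by
  have hP : ∀ i ≤ a, (Param.ofForms a b u v huv E F).P.coeff i = E.coeff (a - i) := by
    intro i hi
    rcases hi.lt_or_eq with hi | rfl
    · exact coeff_monicPoly _ ⟨i, hi⟩
    · rw [coeff_monicPoly_self, Nat.sub_self, hE0]
  have hQ : (Param.ofForms a b u v huv E F).Q.coeff 0 = F.coeff b := by
    rcases Nat.eq_zero_or_pos b with rfl | hb
    · rw [coeff_monicPoly_self, hF0]
    · exact coeff_monicPoly _ ⟨0, hb⟩
  ext i
  rcases lt_trichotomy i (a + 1) with hi | rfl | hi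
  · rw [Param.coeff_ex_of_le _ (by omega), hP _ (Nat.sub_le _ _), Nat.sub_sub_self (by omega)]
  · rw [Param.coeff_ex_succ, hQ, h]; rfl
  · rw [Param.coeff_ex_of_lt _ hi, coeff_eq_zero_of_natDegree_lt (hE.trans_lt hi)]

lemma Param.swap_ofForms {u v : R} {huv : u * v = 0} {E F : R[X]} :
    (Param.ofForms a b u v huv E F).swap =
      Param.ofForms b a v u (by rw [mul_comm, huv]) F E := rfl

lemma coeff_taylor_of_natDegree_le {E : R[X]} (h : E.natDegree ≤ k) (r : R) :
    (taylor r E).coeff k = E.coeff k := by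
  rcases h.lt_or_eq with h | rfl
  · rw [coeff_eq_zero_of_natDegree_lt h, coeff_eq_zero_of_natDegree_lt (by rwa [natDegree_taylor])]
  · exact coeff_taylor_natDegree r E

/-- The form of degree `k` attached to the first axis, dehomogenized: its roots describe the
points on this axis. -/
noncomputable def Param.xpoly (α : ℂ) (p : Param R a b) : R[X] := taylor (-algebraMap ℂ R α) p.ex

lemma Param.xpoly_map (α : ℂ) (p : Param R a b) (φ : R →ₐ[ℂ] R') :
    (p.map (φ : R →+* R')).xpoly α = (p.xpoly α).map (φ : R →+* R') := by
  rw [Param.xpoly, Param.xpoly, p.ex_map, map_taylor]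
  simp

/-- det(1 - T x) has constant term 1, which the translation moves to α. This value fixes the form
among its unit multiples and puts the corresponding point in the chart of `evalForm`. -/
lemma Param.eval_xpoly (α : ℂ) (p : Param R a b) : (p.xpoly α).eval (algebraMap ℂ R α) = 1 := by
  rw [Param.xpoly, taylor_eval, add_neg_cancel, ← coeff_zero_eq_eval_zero, p.coeff_ex_zero]

lemma Param.natDegree_xpoly (α : ℂ) (p : Param R a b) : (p.xpoly α).natDegree = p.ex.natDegree :=
  natDegree_taylor _ _

/-- The coefficients of a polynomial, as homogeneous coordinates. -/
def coeffVec (k : ℕ) (E : R[X]) : Fin (k + 1) → R := fun j ↦ E.coeff (j.rev : ℕ)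

lemma coeffVec_zero (E : R[X]) : coeffVec k E 0 = E.coeff k := by simp [coeffVec]

lemma coeffVec_C_mul (c : R) (E : R[X]) : coeffVec k (E * C c) = c • coeffVec k E := by
  ext j; simp [coeffVec, mul_comm]

lemma coeffVec_map (φ : R →ₐ[ℂ] R') (E : R[X]) :
    φ ∘ coeffVec k E = coeffVec k (E.map (φ : R →+* R')) := by
  ext j; simp [coeffVec]

lemma coeffVec_injective {E F : R[X]} (hE : E.natDegree ≤ k) (hF : F.natDegree ≤ k)
    (h : coeffVec k E = coeffVec k F) : E = F := by
  ext i
  rcases le_or_gt i k with hi | hi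
  · have := congrFun h (⟨i, by omega⟩ : Fin (k + 1)).rev
    simpa [coeffVec] using this
  · rw [coeff_eq_zero_of_natDegree_lt (hE.trans_lt hi), coeff_eq_zero_of_natDegree_lt (hF.trans_lt hi)]

lemma exists_coeffVec (w : Fin (k + 1) → R) : ∃ E : R[X], E.natDegree ≤ k ∧ coeffVec k E = w := by
  refine ⟨∑ j : Fin (k + 1), C (w j.rev) * X ^ (j : ℕ), ?_, ?_⟩
  · exact natDegree_sum_le_of_forall_le _ _ fun j _ ↦
      (natDegree_C_mul_X_pow_le _ _).trans (Nat.lt_succ_iff.mp j.2)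
  · ext j
    simp only [coeffVec, finsetSum_coeff, coeff_C_mul, coeff_X_pow]
    rw [Finset.sum_eq_single j.rev]
    · simp
    · intro i _ hi
      rw [if_neg (fun h ↦ hi (Fin.ext h.symm)), mul_zero]
    · simp

/-- The linear form whose value on the coefficients of a polynomial is its value at `α`. -/
noncomputable def evalForm (k : ℕ) (α : ℂ) : MvPolynomial (Fin (k + 1)) ℂ :=
  ∑ j : Fin (k + 1), MvPolynomial.C (α ^ (j : ℕ)) * MvPolynomial.X j.rev

lemma evalForm_mem (k : ℕ) (α : ℂ) : evalForm k α ∈ grading (k + 1) 1 := by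
  refine Submodule.sum_mem _ fun j _ ↦ ?_
  rw [← MvPolynomial.smul_eq_C_mul]
  exact Submodule.smul_mem _ _ (MvPolynomial.isHomogeneous_X _ _)

lemma aeval_evalForm {E : R[X]} (hE : E.natDegree ≤ k) (α : ℂ) :
    MvPolynomial.aeval (coeffVec k E) (evalForm k α) = E.eval (algebraMap ℂ R α) := by
  rw [eval_eq_sum_range' (Nat.lt_succ_of_le hE), Finset.sum_range]
  simp [evalForm, coeffVec, mul_comm]

lemma finite_notMem_projOpen_evalForm (k : ℕ) (t : (projSpace (k + 1)).left) :
    {α : ℂ | t ∉ projOpen (evalForm k α)}.Finite := by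
  obtain ⟨j, hj⟩ := exists_mem_projOpen_X t
  exact finite_notMem_projOpen t (fun j : Fin (k + 1) ↦ MvPolynomial.X j.rev)
    ⟨j.rev, by rwa [Fin.rev_rev]⟩

/-- The point of projective space given by the coefficients of a polynomial. -/
noncomputable def polyPt (k : ℕ) (E : R[X]) (α : ℂ) (hE : E.natDegree ≤ k)
    (h : E.eval (algebraMap ℂ R α) = 1) : specC R ⟶ projSpace (k + 1) :=
  projPt (coeffVec k E) (evalForm_mem k α)
    (isUnit_of_eq_one ((aeval_evalForm hE α).trans h))

lemma specCMap_polyPt (φ : R →ₐ[ℂ] R') {E : R[X]} {α : ℂ} (hE : E.natDegree ≤ k)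
    (h : E.eval (algebraMap ℂ R α) = 1) :
    specCMap φ ≫ polyPt k E α hE h = polyPt k (E.map (φ : R →+* R')) α
      (natDegree_map_le.trans hE) (by
        have := congrArg φ h
        rw [map_one] at this
        rw [← this, ← φ.commutes]
        exact (eval_map_apply (φ : R →+* R') _)) := by
  rw [polyPt, specCMap_projPt, polyPt]
  congr 1
  exact coeffVec_map φ E

lemma polyPt_congr {E F : R[X]} {α β : ℂ} {hE : E.natDegree ≤ k} {hF : F.natDegree ≤ k}
    {h : E.eval (algebraMap ℂ R α) = 1} {h' : F.eval (algebraMap ℂ R β) = 1} {c : R} (hc : IsUnit c)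
    (e : F * C c = E) : polyPt k E α hE h = polyPt k F β hF h' := by
  subst e
  rw [polyPt, polyPt]
  have h2 : IsUnit (MvPolynomial.aeval (c • coeffVec k F) (evalForm k α)) := by
    rw [← coeffVec_C_mul, aeval_evalForm hE, h]; exact isUnit_one
  rw [projPt_smul hc (coeffVec k F) (evalForm_mem k β) (evalForm_mem k α) _ h2]
  congr 1
  exact coeffVec_C_mul c F

/-- Homogeneous coordinates agree up to a unit, and the value 1 at α forces the unit to be 1. -/
lemma polyPt_inj {E F : R[X]} {α : ℂ} {hE : E.natDegree ≤ k} {hF : F.natDegree ≤ k}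
    {h : E.eval (algebraMap ℂ R α) = 1} {h' : F.eval (algebraMap ℂ R α) = 1}
    (e : polyPt k E α hE h = polyPt k F α hF h') : E = F := by
  obtain ⟨c, -, hc⟩ := projPt_inj _ _ _ _ e
  rw [← coeffVec_C_mul] at hc
  have h1 := coeffVec_injective hF ((natDegree_mul_C_le _ _).trans hE) hc
  rw [h1, eval_mul, h, eval_C, one_mul] at h'
  rw [h1, h', C_1, mul_one]

lemma exists_eq_polyPt {α : ℂ} (f : specC R ⟶ projSpace (k + 1))
    (hf : Set.range f.left ⊆ (projOpen (evalForm k α) : Set (projSpace (k + 1)).left)) :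
    ∃ (E : R[X]) (hE : E.natDegree ≤ k) (h : E.eval (algebraMap ℂ R α) = 1),
      f = polyPt k E α hE h := by
  obtain ⟨w, h1, rfl⟩ := exists_eq_projPt (evalForm_mem k α) f hf
  obtain ⟨E, hE, rfl⟩ := exists_coeffVec w
  exact ⟨E, hE, (aeval_evalForm hE α).symm.trans h1, rfl⟩

lemma ker_hyperplane_comap_polyPt {E : R[X]} {α : ℂ} (hE : E.natDegree ≤ k)
    (h : E.eval (algebraMap ℂ R α) = 1) :
    (hyperplane k 0).left.ker.comap (polyPt k E α hE h).left = idl (Ideal.span {E.coeff k}) := by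
  rw [polyPt, ker_hyperplane_comap_projPt, coeffVec_zero]

/-! ### Comparison of the forms of equal families -/

/-- The forms of equal families agree up to a unit. -/
lemma Param.exists_xpoly_eq {p : Param R a b} {p' : Param R a' b'} {α β : ℂ}
    (h : p.fam α = p'.fam β) :
    (∃ c, IsUnit c ∧ p'.xpoly β * C c = p.xpoly α) ∧
      ∃ c, IsUnit c ∧ p'.swap.xpoly β * C c = p.swap.xpoly α := by
  obtain ⟨e, he⟩ := exists_algEquiv_of_famIdeal_eq (p.isClosedImmersion_famMap α)
    (p'.isClosedImmersion_famMap β) h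
  obtain ⟨hu, hx, hy⟩ := nodePt_eq_nodePt he
  have hr := (NodeAlg.rel p).map_algHom (e : NodeAlg p →ₐ[R] NodeAlg p')
  have hb : LinearIndependent R (nodeMonomial a b (e (NodeAlg.x p)) (e (NodeAlg.y p))) ∧
      Submodule.span R (Set.range (nodeMonomial a b (e (NodeAlg.x p)) (e (NodeAlg.y p)))) = ⊤ := by
    have h1 : nodeMonomial a b (e (NodeAlg.x p)) (e (NodeAlg.y p)) =
        e ∘ nodeMonomial a b (NodeAlg.x p) (NodeAlg.y p) :=
      funext fun i ↦ (nodeMonomial_map (e : NodeAlg p →ₐ[R] NodeAlg p') _ _ i).symm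
    rw [h1]
    refine ⟨(NodeAlg.linearIndependent p).map' e.toLinearMap (LinearMap.ker_eq_bot.mpr e.injective),
      ?_⟩
    rw [Set.range_comp]
    refine (Submodule.span_image e.toLinearMap).trans ?_
    rw [NodeAlg.span_eq_top, Submodule.map_top, LinearMap.range_eq_top]
    exact e.surjective
  -- The translations by -β and by β - α compose to the one by -α, so the dependence on the chart
  -- disappears except for the unit c.
  have key : ∀ {a b a' b' : ℕ} {p : Param R a b} {p' : Param R a' b'} {c : R},
      p'.ex * C c = p.ex.comp (X + C (algebraMap ℂ R (β - α))) →
      p'.xpoly β * C c = p.xpoly α := by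
    intro a b a' b' p p' c h
    have := congrArg (taylor (-algebraMap ℂ R β)) h
    rw [taylor_mul, taylor_C, ← taylor_apply, taylor_taylor] at this
    rw [Param.xpoly, this, Param.xpoly]
    have e1 : -algebraMap ℂ R β + algebraMap ℂ R (β - α) = -algebraMap ℂ R α := by
      rw [map_sub]; ring
    rw [e1]
  have hs : ∀ z : NodeAlg p', algebraMap ℂ (NodeAlg p') (β - α) * z = algebraMap ℂ R (β - α) • z := by
    intro z
    rw [IsScalarTower.algebraMap_apply ℂ R, ← Algebra.smul_def]
  rw [hs] at hu hx hy
  constructor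
  · obtain ⟨c, hc, hc'⟩ := hr.ex_shift (NodeAlg.rel p') hb.1 hb.2 (NodeAlg.linearIndependent p')
      (NodeAlg.span_eq_top p') _ hu hx
    exact ⟨c, hc, key hc'⟩
  · rw [add_comm] at hu hy
    obtain ⟨c, hc, hc'⟩ := hr.swap.ex_shift (NodeAlg.rel p').swap
      (linearIndependent_nodeMonomial_swap hb.1) ((nodeMonomial_swap_range (R := R) _ _).symm.trans hb.2)
      (linearIndependent_nodeMonomial_swap (NodeAlg.linearIndependent p'))
      ((nodeMonomial_swap_range (R := R) _ _).symm.trans (NodeAlg.span_eq_top p')) _ hu hy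
    exact ⟨c, hc, key hc'⟩

/-- If `v` is a unit, the family is also given by a parameter with other exponents. -/
lemma Param.exists_fam_eq_of_isUnit_v (p : Param R (a + 1) b) (hv : IsUnit p.v) (α : ℂ) :
    ∃ p' : Param R a (b + 1), p'.fam α = p.fam α := by
  have hsp := (NodeAlg.rel p).span_eq_top_of_isUnit (NodeAlg.adjoin_eq_top p) hv
  have hli := linearIndependent_of_span_eq_top (NodeAlg.basis p) (by simp; omega) hsp
  obtain ⟨p', hp'⟩ := exists_param (NodeAlg.rel p).xy hli hsp
  exact ⟨p', (hp'.famIdeal_eq hli hsp α).symm⟩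

end Forms
-- Charts of the Hilbert scheme
section HilbertCharts

variable {n : ℕ} {H : Over base} {𝒵 : (fiberProd node H).left.IdealSheafData}
  {R R' : Type} [CommRing R] [Algebra ℂ R] [CommRing R'] [Algebra ℂ R'] {a b a' b' : ℕ}

lemma IsHilbertScheme.hom_ext (hH : IsHilbertScheme node n H 𝒵) {T : Over base} {f g : T ⟶ H}
    (h : pullFam f 𝒵 = pullFam g 𝒵) : f = g :=
  (hH.existsUnique T _ (hH.isFamily.comap g)).unique h.symm rfl

/-- The morphism to the Hilbert scheme given by a parameter. -/
noncomputable def IsHilbertScheme.pt (hH : IsHilbertScheme node n H 𝒵) (α : ℂ) (p : Param R a b)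
    (hab : a + 1 + b = n) : specC R ⟶ H :=
  (hH.existsUnique _ _ (p.isFamily_fam α hab)).exists.choose

variable (hH : IsHilbertScheme node n H 𝒵)

lemma IsHilbertScheme.pullFam_pt (α : ℂ) (p : Param R a b) (hab : a + 1 + b = n) :
    pullFam (hH.pt α p hab) 𝒵 = p.fam α :=
  (hH.existsUnique _ _ (p.isFamily_fam α hab)).exists.choose_spec.symm

lemma IsHilbertScheme.eq_pt_iff {α : ℂ} {p : Param R a b} {hab : a + 1 + b = n} {f : specC R ⟶ H} :
    f = hH.pt α p hab ↔ pullFam f 𝒵 = p.fam α := by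
  refine ⟨fun h ↦ h ▸ hH.pullFam_pt α p hab, fun h ↦ hH.hom_ext ?_⟩
  rw [h, hH.pullFam_pt]

lemma IsHilbertScheme.pt_eq_pt_iff {α α' : ℂ} {p : Param R a b} {hab : a + 1 + b = n}
    {p' : Param R a' b'} {hab' : a' + 1 + b' = n} :
    hH.pt α p hab = hH.pt α' p' hab' ↔ p.fam α = p'.fam α' := by
  rw [hH.eq_pt_iff, hH.pullFam_pt]

lemma IsHilbertScheme.specCMap_pt (α : ℂ) (p : Param R a b) (hab : a + 1 + b = n)
    (φ : R →ₐ[ℂ] R') :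
    specCMap φ ≫ hH.pt α p hab = hH.pt α (p.map (φ : R →+* R')) hab := by
  rw [hH.eq_pt_iff, pullFam_comp, hH.pullFam_pt, Param.pullFam_fam]

lemma IsHilbertScheme.specCMap_hom_pt (α : ℂ) (p : Param R a b) (hab : a + 1 + b = n) :
    specCMap p.hom ≫ hH.pt α (univParam a b) hab = hH.pt α p hab := by
  rw [hH.specCMap_pt, Param.map_hom]

/-- Over the locus the universal family of H is induced by a morphism s back to the chart. It is
inverse to the morphism from the chart, since both composites induce the right families. -/
lemma IsHilbertScheme.isOpenImmersion_pt_and_range (α : ℂ) (hab : a + 1 + b = n) :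
    IsOpenImmersion (hH.pt α (univParam a b) hab).left ∧
      Set.range (hH.pt α (univParam a b) hab).left = chartLocus α a b 𝒵 := by
  have hf := hH.pullFam_pt α (univParam a b) hab
  obtain ⟨s, hs⟩ := inChart_chartLocus α a b 𝒵
  obtain ⟨c, hc⟩ := exists_over_lift (openSubι (chartLocus α a b 𝒵)) (hH.pt α (univParam a b) hab) (by
    rintro _ ⟨z, rfl⟩
    exact ⟨⟨_, mem_chartLocus_of_inChart hab hH.isFamily _
      (hf ▸ (univParam a b).inChart_fam α) z⟩, rfl⟩)
  have h1 : c ≫ s = 𝟙 _ := by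
    refine chartFam_unique (α := α) ?_
    rw [pullFam_comp, hs, ← pullFam_comp, hc, hf, pullFam_id]
    rfl
  have h2 : s ≫ hH.pt α (univParam a b) hab = openSubι (chartLocus α a b 𝒵) := by
    refine hH.hom_ext ?_
    rw [pullFam_comp, hf, ← hs]
    rfl
  have h3 : s ≫ c = 𝟙 _ := by
    ext1
    rw [← cancel_mono (openSubι (chartLocus α a b 𝒵)).left, ← Over.comp_left, ← Over.comp_left,
      Category.assoc, hc, h2, Category.id_comp]
  have hiso : IsIso c := ⟨s, h1, h3⟩
  have hiso' : IsIso c.left := inferInstanceAs (IsIso ((Over.forget base).map c))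
  rw [← hc]
  refine ⟨inferInstanceAs (IsOpenImmersion (c.left ≫ (openSubι _).left)), ?_⟩
  ext t
  constructor
  · rintro ⟨z, rfl⟩
    exact (c.left z).2
  · intro ht
    refine ⟨s.left ⟨t, ht⟩, ?_⟩
    rw [hc]
    have := congr($(congrArg CommaMorphism.left h2) ⟨t, ht⟩)
    exact this

lemma IsHilbertScheme.isOpenImmersion_pt (α : ℂ) (hab : a + 1 + b = n) :
    IsOpenImmersion (hH.pt α (univParam a b) hab).left := (hH.isOpenImmersion_pt_and_range α hab).1

lemma IsHilbertScheme.exists_eq_pt {α : ℂ} (hab : a + 1 + b = n) (f : specC R ⟶ H)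
    (hf : Set.range f.left ⊆ (chartLocus α a b 𝒵 : Set H.left)) :
    ∃ p : Param R a b, f = hH.pt α p hab := by
  have := hH.isOpenImmersion_pt α hab
  obtain ⟨f', hf'⟩ := exists_over_lift (hH.pt α (univParam a b) hab) f
    ((hH.isOpenImmersion_pt_and_range α hab).2 ▸ hf)
  obtain ⟨φ, rfl⟩ := exists_specCMap f'
  rw [hH.specCMap_pt] at hf'
  exact ⟨_, hf'.symm⟩

lemma IsHilbertScheme.exists_nbhd_eq_pt {α : ℂ} (hab : a + 1 + b = n) {T : Over base} (f : T ⟶ H)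
    {t : T.left} (ht : f.left t ∈ chartLocus α a b 𝒵) (V : T.left.Opens) (hV : t ∈ V) :
    ∃ (R : Type) (_ : CommRing R) (_ : Algebra ℂ R) (i : specC R ⟶ T), IsOpenImmersion i.left ∧
      t ∈ Set.range i.left ∧ Set.range i.left ⊆ V ∧ ∃ p : Param R a b, i ≫ f = hH.pt α p hab := by
  obtain ⟨R, _, _, i, hi, hti, hV'⟩ := exists_specC_nbhd t
    (V ⊓ f.left ⁻¹ᵁ chartLocus α a b 𝒵) ⟨hV, ht⟩
  refine ⟨R, _, _, i, hi, hti, hV'.trans fun _ h ↦ h.1, hH.exists_eq_pt hab _ ?_⟩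
  rintro _ ⟨z, rfl⟩
  exact (hV' ⟨z, rfl⟩).2

end HilbertCharts
-- Lengths of a subscheme along the two axes
section Lengths

open Polynomial

set_option linter.unusedSectionVars false

/-! ### Lengths on the two axes -/

variable {a b : ℕ}

lemma finrank_quotient_restrictScalars {B : Type*} [CommRing B] [Algebra ℂ B] [Module.Finite ℂ B]
    (I : Ideal B) : Module.finrank ℂ (B ⧸ I) + Module.finrank ℂ (I.restrictScalars ℂ) =
      Module.finrank ℂ B := by
  rw [← (I.restrictScalars ℂ).finrank_quotient_add_finrank]
  rfl

/-- For v = 0 the relation y Q(y) = 0 expresses y^(b+1) by lower positive powers of y, so y, …, y^b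
is a basis of the ideal (y). -/
lemma Param.Rel.finrank_quotient_y {B : Type*} [CommRing B] [Algebra ℂ B] {p : Param ℂ a b} {x y : B}
    (h : p.Rel x y) (hli : LinearIndependent ℂ (nodeMonomial a b x y))
    (hsp : Submodule.span ℂ (Set.range (nodeMonomial a b x y)) = ⊤) (hv : p.v = 0) :
    Module.finrank ℂ (B ⧸ Ideal.span {y}) = a + 1 := by
  let e := Module.Basis.mk hli hsp.ge
  have : Module.Finite ℂ B := Module.Finite.of_basis e
  have hB : Module.finrank ℂ B = a + 1 + b := by
    rw [Module.finrank_eq_card_basis e]; simp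
  have hyb : y ^ (b + 1) ∈ Submodule.span ℂ (Set.range fun j : Fin b ↦ y ^ (j + 1 : ℕ)) := by
    have h1 := h.hy
    rw [hv, zero_smul, aeval_monicPoly, mul_add, ← pow_succ', Finset.mul_sum] at h1
    rw [eq_neg_of_add_eq_zero_left h1]
    refine Submodule.neg_mem _ (Submodule.sum_mem _ fun j _ ↦ ?_)
    rw [mul_smul_comm, ← pow_succ']
    exact Submodule.smul_mem _ _ (Submodule.subset_span ⟨j, rfl⟩)
  have hspan : (Ideal.span {y}).restrictScalars ℂ =
      Submodule.span ℂ (Set.range fun j : Fin b ↦ y ^ (j + 1 : ℕ)) := by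
    apply le_antisymm
    · intro z hz
      obtain ⟨w, rfl⟩ := Ideal.mem_span_singleton'.mp hz
      have hw : w ∈ Submodule.span ℂ (Set.range (nodeMonomial a b x y)) := hsp ▸ trivial
      induction hw using Submodule.span_induction with
      | zero => rw [zero_mul]; exact Submodule.zero_mem _
      | add w w' _ _ hw hw' =>
        rw [add_mul]
        exact Submodule.add_mem _ (hw (Ideal.mul_mem_left _ _ (Ideal.mem_span_singleton_self y)))
          (hw' (Ideal.mul_mem_left _ _ (Ideal.mem_span_singleton_self y)))
      | smul c w _ hw =>
        rw [smul_mul_assoc]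
        exact Submodule.smul_mem _ _ (hw (Ideal.mul_mem_left _ _ (Ideal.mem_span_singleton_self y)))
      | mem w hw =>
        obtain ⟨(i | j), rfl⟩ := hw
        · obtain ⟨i, hi⟩ := i
          rcases i with _ | i
          · simp only [nodeMonomial, Sum.elim_inl, pow_zero, one_mul]
            rcases b with _ | b
            · simpa using hyb
            · exact Submodule.subset_span ⟨0, by simp⟩
          · simp only [nodeMonomial, Sum.elim_inl, pow_succ, mul_assoc, h.xy, mul_zero]
            exact Submodule.zero_mem _
        · simp only [nodeMonomial, Sum.elim_inr, ← pow_succ]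
          rcases (Nat.succ_le_of_lt j.2).lt_or_eq with hj | hj
          · exact Submodule.subset_span ⟨⟨j + 1, hj⟩, rfl⟩
          · rwa [show (j : ℕ) + 1 + 1 = b + 1 from congrArg (· + 1) hj]
    · rw [Submodule.span_le]
      rintro _ ⟨j, rfl⟩
      exact Ideal.mem_span_singleton.mpr (dvd_pow_self y (Nat.succ_ne_zero _))
  have hfin : Module.finrank ℂ ((Ideal.span {y}).restrictScalars ℂ) = b := by
    rw [hspan]
    have hl : LinearIndependent ℂ fun j : Fin b ↦ y ^ (j + 1 : ℕ) :=
      hli.comp Sum.inr Sum.inr_injective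
    rw [finrank_span_eq_card hl, Fintype.card_fin]
  have := finrank_quotient_restrictScalars (Ideal.span {y})
  omega

/-- The ideals (x) and (y) are comaximal with product zero, so they are complementary subspaces. -/
lemma finrank_quotient_add_finrank_quotient {B : Type*} [CommRing B] [Algebra ℂ B]
    [Module.Finite ℂ B] {x y : B} (h : x * y = 0) (h1 : Ideal.span {x} ⊔ Ideal.span {y} = ⊤) :
    Module.finrank ℂ (B ⧸ Ideal.span {x}) + Module.finrank ℂ (B ⧸ Ideal.span {y}) =
      Module.finrank ℂ B := by
  have h2 : Ideal.span {x} ⊓ Ideal.span {y} = ⊥ := by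
    rw [← Ideal.mul_eq_inf_of_coprime h1, Ideal.span_singleton_mul_span_singleton, h]
    simp
  have h3 := Submodule.finrank_sup_add_finrank_inf_eq ((Ideal.span {x}).restrictScalars ℂ)
    ((Ideal.span {y}).restrictScalars ℂ)
  have h4 : (Ideal.span {x}).restrictScalars ℂ ⊔ (Ideal.span {y}).restrictScalars ℂ = ⊤ := by
    have : (Ideal.span {x} ⊔ Ideal.span {y}).restrictScalars ℂ = ⊤ := by rw [h1]; rfl
    rw [← this]
    exact (Submodule.restrictScalars_sup ..).symm
  have h5 : (Ideal.span {x}).restrictScalars ℂ ⊓ (Ideal.span {y}).restrictScalars ℂ = ⊥ := by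
    have : (Ideal.span {x} ⊓ Ideal.span {y}).restrictScalars ℂ = ⊥ := by rw [h2]; rfl
    exact this
  rw [h4, h5, finrank_top, finrank_bot, add_zero] at h3
  have := finrank_quotient_restrictScalars (Ideal.span {x})
  have := finrank_quotient_restrictScalars (Ideal.span {y})
  omega

/-- Modulo z and w the relation reads 0 = q Q(0), and this scalar is invertible. -/
lemma sup_span_eq_top_of_smul_eq {B : Type*} [CommRing B] [Algebra ℂ B] {z w : B} {q : ℂ}
    {P Q : ℂ[X]} (h : z * aeval z P = q • aeval w Q) (hq : q * Q.coeff 0 ≠ 0) :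
    Ideal.span {z} ⊔ Ideal.span {w} = ⊤ := by
  rw [Ideal.eq_top_iff_one]
  have h1 : aeval w Q = w * aeval w Q.divX + algebraMap ℂ _ (Q.coeff 0) := by
    have := congrArg (aeval w) (divX_mul_X_add Q).symm
    rwa [map_add, map_mul, aeval_X, aeval_C, mul_comm] at this
  have h2 : algebraMap ℂ B (q * Q.coeff 0) = z * aeval z P +
      w * (-(algebraMap ℂ _ q) * aeval w Q.divX) := by
    rw [h, h1, Algebra.smul_def, map_mul]; ring
  have h3 : algebraMap ℂ B (q * Q.coeff 0) ∈ Ideal.span {z} ⊔ Ideal.span {w} := by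
    rw [h2]
    exact Submodule.add_mem_sup (Ideal.mul_mem_right _ _ (Ideal.mem_span_singleton_self z))
      (Ideal.mul_mem_right _ _ (Ideal.mem_span_singleton_self w))
  have h4 := Ideal.mul_mem_left _ (algebraMap ℂ B (q * Q.coeff 0)⁻¹) h3
  rwa [← map_mul, inv_mul_cancel₀ hq, map_one] at h4

/-- The axes are disjoint on the subscheme if and only if it does not contain the node. -/
lemma Param.span_x_sup_span_y_eq_top_iff (p : Param ℂ a b) :
    Ideal.span {NodeAlg.x p} ⊔ Ideal.span {NodeAlg.y p} = ⊤ ↔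
      p.v * p.P.coeff 0 ≠ 0 ∨ p.u * p.Q.coeff 0 ≠ 0 := by
  constructor
  · contrapose!
    rintro ⟨hv, hu⟩ htop
    -- When both constants vanish, the origin satisfies the relations; it gives a homomorphism to ℂ
    -- whose kernel contains x and y.
    have h0 : p.Rel (0 : ℂ) 0 := ⟨by simp, by simpa [← coeff_zero_eq_eval_zero] using hu.symm,
      by simpa [← coeff_zero_eq_eval_zero] using hv.symm⟩
    have hle : Ideal.span {NodeAlg.x p} ⊔ Ideal.span {NodeAlg.y p} ≤
        RingHom.ker (NodeAlg.lift h0) := by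
      rw [sup_le_iff, Ideal.span_singleton_le_iff_mem, Ideal.span_singleton_le_iff_mem,
        RingHom.mem_ker, RingHom.mem_ker]
      exact ⟨NodeAlg.lift_x h0, NodeAlg.lift_y h0⟩
    rw [htop, top_le_iff] at hle
    exact RingHom.ker_ne_top _ hle
  · rintro (h | h)
    · rw [sup_comm]
      exact sup_span_eq_top_of_smul_eq (NodeAlg.rel p).hy h
    · exact sup_span_eq_top_of_smul_eq (NodeAlg.rel p).hx h

lemma Param.finrank_quotients (p : Param ℂ a b)
    (h : Ideal.span {NodeAlg.x p} ⊔ Ideal.span {NodeAlg.y p} = ⊤) :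
    Module.finrank ℂ (NodeAlg p ⧸ Ideal.span {NodeAlg.x p}) +
      Module.finrank ℂ (NodeAlg p ⧸ Ideal.span {NodeAlg.y p}) = a + 1 + b := by
  have : Module.Finite ℂ (NodeAlg p) := Module.Finite.of_basis (NodeAlg.basis p)
  rw [finrank_quotient_add_finrank_quotient (NodeAlg.rel p).xy h,
    Module.finrank_eq_card_basis (NodeAlg.basis p)]
  simp

lemma Param.finrank_quotient_y (p : Param ℂ a b) (hv : p.v = 0) :
    Module.finrank ℂ (NodeAlg p ⧸ Ideal.span {NodeAlg.y p}) = a + 1 :=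
  (NodeAlg.rel p).finrank_quotient_y (NodeAlg.linearIndependent p) (NodeAlg.span_eq_top p) hv

lemma Param.finrank_quotient_x (p : Param ℂ a b) (hu : p.u = 0) :
    Module.finrank ℂ (NodeAlg p ⧸ Ideal.span {NodeAlg.x p}) = b + 1 :=
  (NodeAlg.rel p).swap.finrank_quotient_y
    (linearIndependent_nodeMonomial_swap (NodeAlg.linearIndependent p))
    ((nodeMonomial_swap_range _ _).symm.trans (NodeAlg.span_eq_top p)) hu

/-- The numerical conditions which define the generic locus, in terms of the parameters. -/
lemma Param.generic_iff (p : Param ℂ a b) {n k : ℕ} (hab : a + 1 + b = n) :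
    (Ideal.span {NodeAlg.x p} ⊔ Ideal.span {NodeAlg.y p} = ⊤ ∧
      Module.finrank ℂ (NodeAlg p ⧸ Ideal.span {NodeAlg.y p}) = k ∧
      Module.finrank ℂ (NodeAlg p ⧸ Ideal.span {NodeAlg.x p}) = n - k) ↔
    (p.v * p.P.coeff 0 ≠ 0 ∧ a = k) ∨ (p.u * p.Q.coeff 0 ≠ 0 ∧ a + 1 = k) := by
  have hc : ∀ h : Ideal.span {NodeAlg.x p} ⊔ Ideal.span {NodeAlg.y p} = ⊤, _ := p.finrank_quotients
  rw [p.span_x_sup_span_y_eq_top_iff] at hc ⊢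
  -- Since uv = 0, a nonzero parameter kills the other one, which makes one of the lengths known;
  -- the second length follows from the total n.
  have h1 : p.v * p.P.coeff 0 ≠ 0 →
      Module.finrank ℂ (NodeAlg p ⧸ Ideal.span {NodeAlg.x p}) = b + 1 := fun h ↦
    p.finrank_quotient_x ((mul_eq_zero.mp p.huv).resolve_right (left_ne_zero_of_mul h))
  have h2 : p.u * p.Q.coeff 0 ≠ 0 →
      Module.finrank ℂ (NodeAlg p ⧸ Ideal.span {NodeAlg.y p}) = a + 1 := fun h ↦
    p.finrank_quotient_y ((mul_eq_zero.mp p.huv).resolve_left (left_ne_zero_of_mul h))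
  constructor
  · rintro ⟨h | h, h3, h4⟩
    · have := hc (.inl h); have := h1 h
      exact .inl ⟨h, by omega⟩
    · have := h2 h
      exact .inr ⟨h, by omega⟩
  · rintro (⟨h, h3⟩ | ⟨h, h3⟩)
    · have := hc (.inl h); have := h1 h
      exact ⟨.inl h, by omega, by omega⟩
    · have := hc (.inr h); have := h2 h
      exact ⟨.inr h, by omega, by omega⟩

end Lengths
-- The generic locus in terms of parameters
section GenericPoints

open Scheme

set_option linter.unusedSectionVars false

variable {a b n k : ℕ}

/-- The point `Spec ℂ`. -/
lemma specC_hom_complex : (specC ℂ).hom = 𝟙 base := by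
  change specMap (algebraMap ℂ ℂ) = _
  exact specMap_id

lemma isIso_specC_complex_hom : IsIso (specC ℂ).hom := by
  have h : specMap (algebraMap ℂ ℂ) = 𝟙 base := specMap_id
  change IsIso (specMap (algebraMap ℂ ℂ))
  rw [h]
  infer_instance

/-- The identification of the terminal object of the schemes over `ℂ` with `Spec ℂ`. -/
noncomputable def complexPt : Over.mk (𝟙 base) ⟶ specC ℂ :=
  Over.homMk (𝟙 base) (by rw [specC_hom_complex]; exact Category.comp_id _)

instance : IsIso complexPt := by
  have : IsIso ((Over.forget base).map complexPt) := inferInstanceAs (IsIso (𝟙 base))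
  exact isIso_of_reflects_iso complexPt (Over.forget base)

/-- The first projection of X × Spec ℂ is an isomorphism, and the slice is its inverse followed by
the base change along z. -/
lemma comap_slice {X H : Over base} (z : specC ℂ ⟶ H) (𝒵 : (fiberProd X H).left.IdealSheafData) :
    𝒵.comap (slice X (complexPt ≫ z)) =
      (pullFam z 𝒵).map (pullback.fst X.hom (specC ℂ).hom) := by
  have hiso : IsIso (pullback.fst X.hom (specC ℂ).hom) := by
    have := isIso_specC_complex_hom
    infer_instance
  have h1 : slice X (complexPt ≫ z) =
      inv (pullback.fst X.hom (specC ℂ).hom) ≫ fiberProdMap (𝟙 X) z := by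
    rw [IsIso.eq_inv_comp]
    apply pullback.hom_ext
    · rw [Category.assoc, fiberProdMap_id_fst, slice, pullback.lift_fst, Category.comp_id]
    · rw [Category.assoc, fiberProdMap_snd, slice, pullback.lift_snd, ← Category.assoc,
        pullback.condition, Over.comp_left, Category.assoc, specC_hom_complex]
      refine congrArg (pullback.snd X.hom (𝟙 base) ≫ ·) ?_
      exact (Category.id_comp _).trans (Category.id_comp _)
  rw [h1, IdealSheafData.comap_comp]
  apply le_antisymm
  · rw [← IdealSheafData.le_map_iff_comap_le, ← IdealSheafData.map_comp, IsIso.hom_inv_id,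
      IdealSheafData.map_id]
  · conv_rhs => rw [← IdealSheafData.map_id (IdealSheafData.comap _ _),
      ← IsIso.inv_hom_id (pullback.fst X.hom (specC ℂ).hom), IdealSheafData.map_comp]
    exact IdealSheafData.map_mono _ (IdealSheafData.le_map_comap _ _)

/-- The embedding of a subscheme in the chart of the node. -/
lemma comap_slice_fam {H : Over base} {z : specC ℂ ⟶ H} {𝒵 : (fiberProd node H).left.IdealSheafData}
    {α : ℂ} {p : Param ℂ a b} (h : pullFam z 𝒵 = p.fam α) :
    𝒵.comap (slice node (complexPt ≫ z)) =
      (nodePt α (NodeAlg.x p) (NodeAlg.y p) (NodeAlg.rel p).xy).left.ker := by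
  rw [comap_slice, h, Param.fam, famIdeal, IdealSheafData.map_ker, famMap_fst]

lemma isClosedImmersion_nodePt (α : ℂ) (p : Param ℂ a b) :
    IsClosedImmersion (nodePt α (NodeAlg.x p) (NodeAlg.y p) (NodeAlg.rel p).xy).left := by
  have := p.isClosedImmersion_famMap α
  have hiso : IsIso (pullback.fst node.hom (specC ℂ).hom) := by
    have := isIso_specC_complex_hom
    infer_instance
  rw [← famMap_fst (R := ℂ)]
  infer_instance

lemma xAxis_comap_nodePt {B : Type} [CommRing B] [Algebra ℂ B] (α : ℂ) (x y : B) (h : x * y = 0) :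
    xAxis.comap (nodePt α x y h).left = idl (Ideal.span {y}) := by
  rw [nodePt, Over.comp_left, IdealSheafData.comap_comp, xAxis_comap_nodeChart]
  refine (comap_idl _ _).trans ?_
  rw [Ideal.map_span, Set.image_singleton]
  congr 3
  exact (nodePtHom_mk x y h _).trans (by simp)

lemma yAxis_comap_nodePt {B : Type} [CommRing B] [Algebra ℂ B] (α : ℂ) (x y : B) (h : x * y = 0) :
    yAxis.comap (nodePt α x y h).left = idl (Ideal.span {x}) := by
  rw [nodePt, Over.comp_left, IdealSheafData.comap_comp, yAxis_comap_nodeChart]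
  refine (comap_idl _ _).trans ?_
  rw [Ideal.map_span, Set.image_singleton]
  congr 3
  exact (nodePtHom_mk x y h _).trans (by simp)

lemma length_map_idl {B : Type} [CommRing B] [Algebra ℂ B] [Module.Finite ℂ B] {X : Over base}
    (i : specC B ⟶ X) [IsClosedImmersion i.left] (I : Ideal B) :
    length X ((idl I).map i.left) = Module.finrank ℂ (B ⧸ I) := by
  let j : specC (B ⧸ I) ⟶ X := specCMap (Ideal.Quotient.mkₐ ℂ I) ≫ i
  have h0 : IsClosedImmersion (specCMap (Ideal.Quotient.mkₐ ℂ I)).left :=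
    IsClosedImmersion.spec_of_surjective _ Ideal.Quotient.mk_surjective
  have h1 : IsClosedImmersion j.left := inferInstanceAs (IsClosedImmersion (_ ≫ i.left))
  have h2 : (idl I).map i.left = j.left.ker := by
    rw [idl_eq_ker, IdealSheafData.map_ker]; rfl
  have e : j.left.ker.subschemeι ≫ X.hom = inv j.left.toImage ≫ (specC (B ⧸ I)).hom := by
    rw [IsIso.eq_inv_comp, ← Category.assoc, ← Over.w j]
    congr 1
    exact j.left.toImage_imageι
  have hf : IsFinite (specMap (algebraMap ℂ (B ⧸ I))) :=
    (IsFinite.SpecMap_iff _).mpr (RingHom.finite_algebraMap.mpr inferInstance)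
  have hf' : Flat (specMap (algebraMap ℂ (B ⧸ I))) :=
    Flat.SpecMap_iff.mpr (RingHom.flat_algebraMap_iff.mpr inferInstance)
  have key : ∀ t : base, Scheme.Hom.finrank (j.left.ker.subschemeι ≫ X.hom) t =
      Module.finrank ℂ (B ⧸ I) := by
    intro t
    have e1 : j.left.ker.subschemeι ≫ X.hom =
      inv j.left.toImage ≫ specMap (algebraMap ℂ (B ⧸ I)) := e
    rw [e1, Scheme.Hom.finrank_comp_left_of_isIso]
    refine (Scheme.Hom.finrank_SpecMap_algebraMap ℂ (B ⧸ I) _).trans ?_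
    exact congrFun (Module.rankAtStalk_eq_finrank_of_free (R := ℂ) (M := B ⧸ I)) _
  rw [length, h2]
  exact key _

lemma map_eq_top_iff {X Y : Scheme.{0}} (f : X ⟶ Y) (I : X.IdealSheafData) [QuasiCompact f] :
    I.map f = ⊤ ↔ I = ⊤ := by
  rw [← top_le_iff, IdealSheafData.le_map_iff_comap_le, IdealSheafData.comap_top, top_le_iff]

variable {H : Over base} {𝒵 : (fiberProd node H).left.IdealSheafData}

/-- Generic points in a chart. -/
lemma generic_iff_of_fam {z : specC ℂ ⟶ H} {α : ℂ} {p : Param ℂ a b} (hab : a + 1 + b = n)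
    (h : pullFam z 𝒵 = p.fam α) :
    (𝒵.comap (slice node (complexPt ≫ z)) ⊔ xAxis ⊔ yAxis = ⊤ ∧
      length node (𝒵.comap (slice node (complexPt ≫ z)) ⊔ xAxis) = k ∧
      length node (𝒵.comap (slice node (complexPt ≫ z)) ⊔ yAxis) = n - k) ↔
    (p.v * p.P.coeff 0 ≠ 0 ∧ a = k) ∨ (p.u * p.Q.coeff 0 ≠ 0 ∧ a + 1 = k) := by
  have hc := isClosedImmersion_nodePt α p
  have : Module.Finite ℂ (NodeAlg p) := Module.Finite.of_basis (NodeAlg.basis p)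
  rw [← p.generic_iff hab, comap_slice_fam h, sup_assoc, ← map_comap_of_isClosedImmersion,
    ← map_comap_of_isClosedImmersion, ← map_comap_of_isClosedImmersion, map_eq_top_iff,
    IdealSheafData.comap_sup,
    xAxis_comap_nodePt, yAxis_comap_nodePt, length_map_idl, length_map_idl, ← idl_sup,
    ← idl_top, idl_injective.eq_iff, sup_comm]

end GenericPoints
-- The two branches u = 0 and v = 0 of a chart
section ComponentCharts

open Scheme MvPolynomial

set_option linter.unusedSectionVars false

variable {a b n k : ℕ}

/-! ### The coordinate rings of the components in the charts -/

section Line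

variable {R R' : Type} [CommRing R] [Algebra ℂ R] [CommRing R'] [Algebra ℂ R']

/-- The parameter `u` for `s = true`, and `v` for `s = false`. -/
def Param.coord (s : Bool) (p : Param R a b) : R := cond s p.u p.v

/-- The function whose nonvanishing on `u = 0`, resp. `v = 0`, means that the subscheme does not
contain the node. -/
noncomputable def Param.gen (s : Bool) (p : Param R a b) : R :=
  cond s (p.v * p.P.coeff 0) (p.u * p.Q.coeff 0)

lemma Param.coord_map (s : Bool) (p : Param R a b) (φ : R →+* R') :
    (p.map φ).coord s = φ (p.coord s) := by cases s <;> rfl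

lemma Param.gen_map (s : Bool) (p : Param R a b) (φ : R →+* R') :
    (p.map φ).gen s = φ (p.gen s) := by
  cases s <;> simp [Param.gen, p.P_map, p.Q_map]

variable (a b) in
/-- A polynomial ring. -/
abbrev LineRing : Type := MvPolynomial (Unit ⊕ Fin a ⊕ Fin b) ℂ

variable (a b) in
/-- The universal parameter with `u = 0`, resp. `v = 0`. -/
noncomputable def lineParam (s : Bool) : Param (LineRing a b) a b where
  u := cond s 0 (X (.inl ()))
  v := cond s (X (.inl ())) 0
  c i := X (.inr (.inl i))
  f i := X (.inr (.inr i))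
  huv := by cases s <;> simp

lemma lineParam_coord (s : Bool) : (lineParam a b s).coord s = 0 := by cases s <;> rfl

lemma exists_lineParam_map (s : Bool) (p : Param R a b) (h : p.coord s = 0) :
    ∃ φ : LineRing a b →ₐ[ℂ] R, (lineParam a b s).map (φ : LineRing a b →+* R) = p := by
  refine ⟨aeval (Sum.elim (fun _ ↦ cond s p.v p.u) (Sum.elim p.c p.f)), ?_⟩
  cases s <;> simp only [Param.coord, cond_true, cond_false] at h <;>
    ext <;> simp [lineParam, h]

lemma exists_comp_hom_lineParam (s : Bool) (ψ : ParamRing a b →ₐ[ℂ] R)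
    (h : ψ ((univParam a b).coord s) = 0) :
    ∃ φ : LineRing a b →ₐ[ℂ] R, φ.comp (lineParam a b s).hom = ψ := by
  obtain ⟨φ, hφ⟩ := exists_lineParam_map s ((univParam a b).map (ψ : ParamRing a b →+* R))
    (by rw [Param.coord_map]; exact h)
  refine ⟨φ, paramRing_hom_ext (Eq.trans ?_ hφ)⟩
  conv_rhs => rw [← (lineParam a b s).map_hom]
  rfl

lemma exists_algHom_ker_eq {A : Type} [CommRing A] [Algebra ℂ A] (I : Ideal A) :
    ∃ (S : Type) (_ : CommRing S) (_ : Algebra ℂ S) (ψ : A →ₐ[ℂ] S), RingHom.ker ψ = I :=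
  ⟨A ⧸ I, inferInstance, inferInstance, Ideal.Quotient.mkₐ ℂ I, Ideal.mk_ker⟩

/-- Parameters whose coordinate vanishes factor through `LineRing`. Applied to the quotient by the
coordinate, this shows that the kernel is not larger than the ideal it generates. -/
lemma ker_hom_lineParam (s : Bool) :
    RingHom.ker (lineParam a b s).hom = Ideal.span {(univParam a b).coord s} := by
  have hmap := (lineParam a b s).map_hom
  apply le_antisymm
  · intro z hz
    obtain ⟨S, _, _, ψ, hψ⟩ := exists_algHom_ker_eq (Ideal.span {(univParam a b).coord s})
    obtain ⟨φ, hφ⟩ := exists_comp_hom_lineParam s ψ (by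
      rw [← RingHom.mem_ker, hψ]; exact Ideal.mem_span_singleton_self _)
    have h1 : φ ((lineParam a b s).hom z) = ψ z := congr($hφ z)
    rw [(RingHom.mem_ker).mp hz, map_zero] at h1
    rw [← hψ]
    exact h1.symm
  · rw [Ideal.span_singleton_le_iff_mem, RingHom.mem_ker]
    have := (univParam a b).coord_map s ((lineParam a b s).hom : ParamRing a b →+* LineRing a b)
    rw [hmap, lineParam_coord] at this
    exact this.symm

lemma hom_lineParam_surjective (s : Bool) : Function.Surjective (lineParam a b s).hom := by
  rw [← AlgHom.range_eq_top, eq_top_iff, ← MvPolynomial.adjoin_range_X, Algebra.adjoin_le_iff]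
  have hmap := (lineParam a b s).map_hom
  have hv : ∀ q : Fin 2 ⊕ Fin a ⊕ Fin b, (lineParam a b s).hom (Ideal.Quotient.mk _ (X q)) =
      (lineParam a b s).vals q := fun q ↦ by rw [Param.hom_mk, aeval_X]
  rintro _ ⟨(_ | i | i), rfl⟩
  · cases s
    · exact ⟨_, hv (.inl 0)⟩
    · exact ⟨_, hv (.inl 1)⟩
  · exact ⟨_, hv (.inr (.inl i))⟩
  · exact ⟨_, hv (.inr (.inr i))⟩

lemma isPrime_span_coord (s : Bool) : (Ideal.span {(univParam a b).coord s}).IsPrime := by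
  rw [← ker_hom_lineParam]
  exact RingHom.ker_isPrime _

lemma P_coeff_zero_lineParam_ne (s : Bool) : (lineParam a b s).P.coeff 0 ≠ 0 := by
  rcases Nat.eq_zero_or_pos a with rfl | ha
  · rw [coeff_monicPoly_self]; exact one_ne_zero
  · rw [coeff_monicPoly _ ⟨0, ha⟩]; exact X_ne_zero _

lemma Q_coeff_zero_lineParam_ne (s : Bool) : (lineParam a b s).Q.coeff 0 ≠ 0 := by
  rcases Nat.eq_zero_or_pos b with rfl | ha
  · rw [coeff_monicPoly_self]; exact one_ne_zero
  · rw [coeff_monicPoly _ ⟨0, ha⟩]; exact X_ne_zero _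

lemma lineParam_gen_ne_zero (s : Bool) : (lineParam a b s).gen s ≠ 0 := by
  cases s
  · exact mul_ne_zero (X_ne_zero _) (Q_coeff_zero_lineParam_ne _)
  · exact mul_ne_zero (X_ne_zero _) (P_coeff_zero_lineParam_ne _)

/-- The point of the chart given by complex parameters. -/
noncomputable def Param.spec (p : Param ℂ a b) : PrimeSpectrum (ParamRing a b) :=
  ⟨RingHom.ker p.hom, RingHom.ker_isPrime _⟩

/-- The complex points of the line `u = 0`, resp. `v = 0`, where `v P(0) ≠ 0`, resp.
`u Q(0) ≠ 0`. -/
def genericPoints (a b : ℕ) (s : Bool) : Set (PrimeSpectrum (ParamRing a b)) :=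
  {q | ∃ p : Param ℂ a b, p.gen s ≠ 0 ∧ q = p.spec}

lemma Param.coord_eq_zero_of_gen (s : Bool) {K : Type} [Field K] [Algebra ℂ K] {p : Param K a b}
    (h : p.gen s ≠ 0) : p.coord s = 0 := by
  cases s
  · exact (mul_eq_zero.mp p.huv).resolve_left (left_ne_zero_of_mul h)
  · exact (mul_eq_zero.mp p.huv).resolve_right (left_ne_zero_of_mul h)

lemma Param.hom_coord {R : Type} [CommRing R] [Algebra ℂ R] (p : Param R a b) (s : Bool) :
    p.hom ((univParam a b).coord s) = p.coord s := by
  have := (univParam a b).coord_map s (p.hom : ParamRing a b →+* R)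
  rw [p.map_hom] at this
  exact this.symm

/-- If z vanishes at the generic points, then z times `gen` vanishes at every complex point of the
affine space Spec `LineRing`, hence is zero there. As `gen` is a nonzero element of a domain, z
vanishes on the whole branch. -/
lemma closure_genericPoints (s : Bool) :
    closure (genericPoints a b s) = PrimeSpectrum.zeroLocus {(univParam a b).coord s} := by
  apply subset_antisymm
  · refine closure_minimal ?_ (PrimeSpectrum.isClosed_zeroLocus _)
    rintro _ ⟨p, hp, rfl⟩
    rw [PrimeSpectrum.mem_zeroLocus, Set.singleton_subset_iff, SetLike.mem_coe, Param.spec,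
      RingHom.mem_ker, p.hom_coord]
    exact Param.coord_eq_zero_of_gen s hp
  · rw [← PrimeSpectrum.zeroLocus_vanishingIdeal_eq_closure, ← PrimeSpectrum.zeroLocus_span]
    refine PrimeSpectrum.zeroLocus_anti_mono_ideal fun z hz ↦ ?_
    rw [PrimeSpectrum.mem_vanishingIdeal] at hz
    rw [← ker_hom_lineParam, RingHom.mem_ker]
    refine (mul_eq_zero.mp ?_).resolve_right (lineParam_gen_ne_zero (a := a) (b := b) s)
    refine MvPolynomial.funext fun w ↦ ?_
    let ψ : LineRing a b →ₐ[ℂ] ℂ := aeval w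
    let p : Param ℂ a b := (lineParam a b s).map (ψ : LineRing a b →+* ℂ)
    have hp : p.hom = ψ.comp (lineParam a b s).hom := by
      apply paramRing_hom_ext
      rw [p.map_hom]
      conv_lhs => rw [show p = (lineParam a b s).map (ψ : LineRing a b →+* ℂ) from rfl,
        ← (lineParam a b s).map_hom]
      rfl
    have hg : p.gen s = ψ ((lineParam a b s).gen s) := (lineParam a b s).gen_map s _
    have e : ∀ z, eval w z = ψ z := fun z ↦ rfl
    rw [map_mul, map_zero, e, e, ← hg]
    by_cases h0 : p.gen s = 0
    · rw [h0, mul_zero]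
    · have h1 : p.hom z = 0 := hz p.spec ⟨p, h0, rfl⟩
      rw [hp, AlgHom.comp_apply] at h1
      rw [h1, zero_mul]

end Line

end ComponentCharts
-- The components in the charts of the Hilbert scheme
section ComponentCharts

open Scheme TopologicalSpace

set_option linter.unusedSectionVars false

variable {a b n k : ℕ} {H : Over base} {𝒵 : (fiberProd node H).left.IdealSheafData}
  (hH : IsHilbertScheme node n H 𝒵)

/-- The shift between the exponent `a` of a chart and the length on the first axis. -/
def sideShift (s : Bool) : ℕ := cond s 0 1

lemma specCMap_hom_closedPoint (p : Param ℂ a b) (t : (specC ℂ).left) :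
    (specCMap p.hom).left t = p.spec := by
  have ht : t = (⊥ : PrimeSpectrum ℂ) := Subsingleton.elim (α := PrimeSpectrum ℂ) _ _
  subst ht
  refine PrimeSpectrum.ext ?_
  change Ideal.comap _ ⊥ = _
  rw [← RingHom.ker_eq_comap_bot]
  rfl

lemma Param.generic_iff_exists (p : Param ℂ a b) :
    ((p.v * p.P.coeff 0 ≠ 0 ∧ a = k) ∨ (p.u * p.Q.coeff 0 ≠ 0 ∧ a + 1 = k)) ↔
      ∃ s, a + sideShift s = k ∧ p.gen s ≠ 0 := by
  constructor
  · rintro (⟨h, h'⟩ | ⟨h, h'⟩)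
    · exact ⟨true, h', h⟩
    · exact ⟨false, h', h⟩
  · rintro ⟨_ | _, h', h⟩
    · exact .inr ⟨h, h'⟩
    · exact .inl ⟨h, h'⟩

lemma IsHilbertScheme.mem_genericLocus_iff (α : ℂ) (hab : a + 1 + b = n)
    (q : PrimeSpectrum (ParamRing a b)) :
    (hH.pt α (univParam a b) hab).left q ∈ genericLocus n k H 𝒵 ↔
      ∃ s, a + sideShift s = k ∧ q ∈ genericPoints a b s := by
  have hopen := hH.isOpenImmersion_pt α hab
  constructor
  · rintro ⟨z, hz, hgen⟩
    let z' : specC ℂ ⟶ H := inv complexPt ≫ z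
    have hzz : z = complexPt ≫ z' := by simp [z']
    have hr : ∀ t, z'.left t = (hH.pt α (univParam a b) hab).left q := by
      intro t
      have ht : t = complexPt.left (IsLocalRing.closedPoint ℂ) :=
        Subsingleton.elim (α := PrimeSpectrum ℂ) _ _
      rw [ht, ← hz, hzz]
      rfl
    obtain ⟨p, hp⟩ := hH.exists_eq_pt hab z' (by
      rintro _ ⟨t, rfl⟩
      rw [hr, ← (hH.isOpenImmersion_pt_and_range α hab).2]
      exact ⟨q, rfl⟩)
    rw [hzz, generic_iff_of_fam hab (hH.eq_pt_iff.mp hp), p.generic_iff_exists] at hgen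
    obtain ⟨s, hs, hs'⟩ := hgen
    refine ⟨s, hs, p, hs', ?_⟩
    rw [← specCMap_hom_closedPoint p (IsLocalRing.closedPoint ℂ)]
    apply (hH.pt α (univParam a b) hab).left.isOpenEmbedding.injective
    rw [← hr (IsLocalRing.closedPoint ℂ), hp, ← hH.specCMap_hom_pt]
    rfl
  · rintro ⟨s, hs, p, hs', rfl⟩
    refine ⟨complexPt ≫ hH.pt α p hab, ?_,
      (generic_iff_of_fam hab (hH.pullFam_pt α p hab)).mpr (p.generic_iff_exists.mpr ⟨s, hs, hs'⟩)⟩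
    rw [← specCMap_hom_closedPoint p (complexPt.left (IsLocalRing.closedPoint ℂ)),
      ← hH.specCMap_hom_pt]
    rfl

lemma IsHilbertScheme.preimage_closure_genericLocus (α : ℂ) (hab : a + 1 + b = n) :
    ((hH.pt α (univParam a b) hab).left ⁻¹' closure (genericLocus n k H 𝒵) :
      Set (PrimeSpectrum (ParamRing a b))) =
      closure {q | ∃ s, a + sideShift s = k ∧ q ∈ genericPoints a b s} := by
  have hopen := hH.isOpenImmersion_pt α hab
  have h := (hH.pt α (univParam a b) hab).left.isOpenEmbedding.isOpenMap.preimage_closure_eq_closure_preimage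
    (hH.pt α (univParam a b) hab).left.continuous (genericLocus n k H 𝒵)
  refine h.trans (congrArg closure ?_)
  ext q
  exact hH.mem_genericLocus_iff α hab q

/-- The exponent a and the index k determine s, so only one of the two branches contributes. -/
lemma IsHilbertScheme.preimage_closure_genericLocus_of_eq (α : ℂ) (hab : a + 1 + b = n) {s : Bool}
    (hs : a + sideShift s = k) :
    ((hH.pt α (univParam a b) hab).left ⁻¹' closure (genericLocus n k H 𝒵) :
      Set (PrimeSpectrum (ParamRing a b))) =
      PrimeSpectrum.zeroLocus {(univParam a b).coord s} := by
  rw [hH.preimage_closure_genericLocus, ← closure_genericPoints]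
  congr 1
  ext q
  constructor
  · rintro ⟨s', hs', h⟩
    have : s' = s := by revert s s'; simp [sideShift]; omega
    exact this ▸ h
  · exact fun h ↦ ⟨s, hs, h⟩

lemma comap_componentIdeal {U : Scheme.{0}} (f : U ⟶ H.left) [IsOpenImmersion f]
    (J : U.IdealSheafData) (hJ : J.radical = J)
    (h : f ⁻¹' closure (genericLocus n k H 𝒵) = J.support) :
    (componentIdeal n k H 𝒵).comap f = J := by
  rw [componentIdeal, vanishingIdeal_comap_of_isOpenImmersion, ← hJ,
    ← IdealSheafData.vanishingIdeal_support]
  congr 1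
  ext1
  exact h

/-- The ideal generated by u, or by v, is prime. So it is already the ideal of the reduced structure
on the branch. -/
lemma IsHilbertScheme.componentIdeal_comap_univ (α : ℂ) (hab : a + 1 + b = n) {s : Bool}
    (hs : a + sideShift s = k) :
    (componentIdeal n k H 𝒵).comap (hH.pt α (univParam a b) hab).left =
      idl (Ideal.span {(univParam a b).coord s}) := by
  have hopen := hH.isOpenImmersion_pt α hab
  refine comap_componentIdeal _ _ ?_ ?_
  · rw [radical_idl, (isPrime_span_coord s).radical]
  · rw [coe_support_idl, PrimeSpectrum.zeroLocus_span]
    exact hH.preimage_closure_genericLocus_of_eq α hab hs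

lemma IsHilbertScheme.componentIdeal_comap_univ_of_ne (α : ℂ) (hab : a + 1 + b = n)
    (hs : ∀ s, a + sideShift s ≠ k) :
    (componentIdeal n k H 𝒵).comap (hH.pt α (univParam a b) hab).left = ⊤ := by
  have hopen := hH.isOpenImmersion_pt α hab
  refine comap_componentIdeal _ _ ?_ ?_
  · rw [← idl_top, radical_idl, Ideal.radical_top]
  · refine (hH.preimage_closure_genericLocus α hab).trans ?_
    simp [hs]
    rfl

variable {R : Type} [CommRing R] [Algebra ℂ R]

lemma IsHilbertScheme.componentIdeal_comap_pt (α : ℂ) (p : Param R a b) (hab : a + 1 + b = n)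
    {s : Bool} (hs : a + sideShift s = k) :
    (componentIdeal n k H 𝒵).comap (hH.pt α p hab).left = idl (Ideal.span {p.coord s}) := by
  rw [← hH.specCMap_hom_pt, Over.comp_left, IdealSheafData.comap_comp,
    hH.componentIdeal_comap_univ α hab hs]
  refine (comap_idl _ _).trans ?_
  rw [Ideal.map_span, Set.image_singleton]
  congr 3
  exact p.hom_coord s

lemma IsHilbertScheme.componentIdeal_comap_pt_of_ne (α : ℂ) (p : Param R a b)
    (hab : a + 1 + b = n) (hs : ∀ s, a + sideShift s ≠ k) :
    (componentIdeal n k H 𝒵).comap (hH.pt α p hab).left = ⊤ := by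
  rw [← hH.specCMap_hom_pt, Over.comp_left, IdealSheafData.comap_comp,
    hH.componentIdeal_comap_univ_of_ne α hab hs, IdealSheafData.comap_top]

end ComponentCharts
-- Irreducible components and empty intersections
section Irreducible

open Scheme TopologicalSpace

set_option linter.unusedSectionVars false

variable {a b n k : ℕ} {H : Over base} {𝒵 : (fiberProd node H).left.IdealSheafData}

lemma IsHilbertScheme.exists_mem_chartLocus (hH : IsHilbertScheme node n H 𝒵)
    (hn : 0 < n) (x y : H.left) :
    ∃ α, (∃ a b, a + 1 + b = n ∧ x ∈ chartLocus α a b 𝒵) ∧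
      ∃ a b, a + 1 + b = n ∧ y ∈ chartLocus α a b 𝒵 := by
  have h := ((finite_notMem_chartLocus hn hH.isFamily x).union
    (finite_notMem_chartLocus hn hH.isFamily y)).infinite_compl.nonempty
  obtain ⟨α, hα⟩ := h
  rw [Set.mem_compl_iff, Set.mem_union, not_or, Set.mem_ofPred_eq, Set.mem_ofPred_eq, not_not,
    not_not] at hα
  exact ⟨α, hα⟩

/-- The intersection of the closure of the generic locus with a chart. -/
lemma IsHilbertScheme.exists_image_chart (hH : IsHilbertScheme node n H 𝒵)
    {α : ℂ} (hab : a + 1 + b = n) {x : H.left}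
    (hx : x ∈ closure (genericLocus n k H 𝒵)) (h : x ∈ chartLocus α a b 𝒵) :
    ∃ s, a + sideShift s = k ∧
      IsPreirreducible (closure (genericLocus n k H 𝒵) ∩ chartLocus α a b 𝒵) := by
  have hopen := hH.isOpenImmersion_pt α hab
  have hr := (hH.isOpenImmersion_pt_and_range α hab).2
  obtain ⟨q, rfl⟩ : x ∈ Set.range (hH.pt α (univParam a b) hab).left := hr ▸ h
  have hs : ∃ s, a + sideShift s = k := by
    by_contra! hs
    have h1 := hH.preimage_closure_genericLocus (k := k) α hab
    have h2 : (q : PrimeSpectrum (ParamRing a b)) ∈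
      closure {q | ∃ s, a + sideShift s = k ∧ q ∈ genericPoints a b s} := h1 ▸ hx
    simp [hs] at h2
    exact h2
  obtain ⟨s, hs⟩ := hs
  refine ⟨s, hs, ?_⟩
  rw [← hr, ← Set.image_preimage_eq_inter_range]
  refine IsPreirreducible.image ?_ _ (hH.pt α (univParam a b) hab).left.continuous.continuousOn
  have h1 := hH.preimage_closure_genericLocus_of_eq α hab hs
  have h2 := ((PrimeSpectrum.isIrreducible_zeroLocus_iff_of_radical _
    (isPrime_span_coord (a := a) (b := b) s).isRadical).mpr (isPrime_span_coord s)).2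
  rw [PrimeSpectrum.zeroLocus_span, ← h1] at h2
  exact h2

lemma IsHilbertScheme.pt_mem_genericLocus (hH : IsHilbertScheme node n H 𝒵)
    (α : ℂ) (hab : a + 1 + b = n) {s : Bool}
    (hs : a + sideShift s = k) {p : Param ℂ a b} (hp : p.gen s ≠ 0) (t : (specC ℂ).left) :
    (hH.pt α p hab).left t ∈ genericLocus n k H 𝒵 ∩ chartLocus α a b 𝒵 := by
  rw [← hH.specCMap_hom_pt]
  have e : (specCMap p.hom ≫ hH.pt α (univParam a b) hab).left t =
      (hH.pt α (univParam a b) hab).left p.spec := by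
    rw [← specCMap_hom_closedPoint p t]; rfl
  rw [e]
  refine ⟨(hH.mem_genericLocus_iff α hab _).mpr ⟨s, hs, p, hp, rfl⟩, ?_⟩
  rw [SetLike.mem_coe, ← SetLike.mem_coe, ← (hH.isOpenImmersion_pt_and_range α hab).2]
  exact ⟨_, rfl⟩

/-- Only the exponents a = k, with branch u = 0, and a = k - 1, with branch v = 0, occur. When the
two exponents differ, a point with v invertible lies in both charts. -/
lemma IsHilbertScheme.exists_mem_inter_chartLocus (hH : IsHilbertScheme node n H 𝒵)
    (α : ℂ) {a' b' : ℕ} (hab : a + 1 + b = n)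
    (hab' : a' + 1 + b' = n) {s s' : Bool} (hs : a + sideShift s = k) (hs' : a' + sideShift s' = k) :
    ((closure (genericLocus n k H 𝒵) ∩ chartLocus α a b 𝒵) ∩ chartLocus α a' b' 𝒵).Nonempty := by
  have key : ∀ {a b a' b' : ℕ} (hab : a + 1 + b = n) (hab' : a' + 1 + b' = n),
      a + sideShift true = k → a' + sideShift false = k →
      ((closure (genericLocus n k H 𝒵) ∩ chartLocus α a b 𝒵) ∩ chartLocus α a' b' 𝒵).Nonempty := by
    intro a b a' b' hab hab' h h'
    obtain rfl : a = a' + 1 := by simp only [sideShift, cond_true, cond_false] at h h'; omega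
    obtain rfl : b' = b + 1 := by omega
    -- Here u = 0 and v P(0) = 1: the point is generic, and v is a unit, so the family also has
    -- exponents a' and b + 1.
    let p : Param ℂ (a' + 1) b := ⟨0, 1, fun _ ↦ 1, fun _ ↦ 1, by simp⟩
    obtain ⟨p', hp'⟩ := p.exists_fam_eq_of_isUnit_v isUnit_one α
    have hg : p.gen true ≠ 0 := by
      have : p.P.coeff 0 = 1 := coeff_monicPoly _ ⟨0, Nat.succ_pos _⟩
      simp [Param.gen, this, p]
    have h1 := hH.pt_mem_genericLocus α hab h hg (IsLocalRing.closedPoint ℂ)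
    refine ⟨_, ⟨subset_closure h1.1, h1.2⟩, ?_⟩
    rw [hH.pt_eq_pt_iff (p := p) (p' := p') (hab := hab) (hab' := hab') |>.mpr hp'.symm,
      ← (hH.isOpenImmersion_pt_and_range α hab').2, ← hH.specCMap_hom_pt α p' hab']
    exact ⟨_, rfl⟩
  have aux : ∀ {a b : ℕ} {s : Bool}, a + 1 + b = n → a + sideShift s = k →
      ∃ p : Param ℂ a b, p.gen s ≠ 0 := by
    intro a b s _ _
    have h := (PrimeSpectrum.isIrreducible_zeroLocus_iff_of_radical _
      (isPrime_span_coord (a := a) (b := b) s).isRadical).mpr (isPrime_span_coord s)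
    have h1 := h.1
    rw [PrimeSpectrum.zeroLocus_span, ← closure_genericPoints, closure_nonempty_iff] at h1
    obtain ⟨_, p, hp, -⟩ := h1
    exact ⟨p, hp⟩
  rcases s with _ | _ <;> rcases s' with _ | _
  · obtain rfl : a = a' := by simp only [sideShift, cond_false] at hs hs'; omega
    obtain rfl : b = b' := by omega
    obtain ⟨p, hp⟩ := aux hab hs
    have h1 := hH.pt_mem_genericLocus α hab hs hp (IsLocalRing.closedPoint ℂ)
    exact ⟨_, ⟨subset_closure h1.1, h1.2⟩, h1.2⟩
  · obtain ⟨x, ⟨h1, h2⟩, h3⟩ := key hab' hab hs' hs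
    exact ⟨x, ⟨h1, h3⟩, h2⟩
  · exact key hab hab' hs hs'
  · obtain rfl : a = a' := by simp only [sideShift, cond_true] at hs hs'; omega
    obtain rfl : b = b' := by omega
    obtain ⟨p, hp⟩ := aux hab hs
    have h1 := hH.pt_mem_genericLocus α hab hs hp (IsLocalRing.closedPoint ℂ)
    exact ⟨_, ⟨subset_closure h1.1, h1.2⟩, h1.2⟩

/-- Any two points lie in charts with a common α. In each chart the closure is an irreducible
branch, and the branches for a common α overlap, so any two nonempty open subsets of the closure
meet. -/
theorem IsHilbertScheme.isIrreducible_closure_genericLocus (hH : IsHilbertScheme node n H 𝒵)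
    (hn : 0 < n) (hk : k ≤ n) :
    IsIrreducible (closure (genericLocus n k H 𝒵)) := by
  constructor
  · rcases hk.lt_or_eq with hk | rfl
    · obtain ⟨x, ⟨hx, -⟩, -⟩ := hH.exists_mem_inter_chartLocus 0 (a := k) (b := n - 1 - k)
        (a' := k) (b' := n - 1 - k) (by omega) (by omega) (s := true) (s' := true) rfl rfl
      exact ⟨x, hx⟩
    · obtain ⟨x, ⟨hx, -⟩, -⟩ := hH.exists_mem_inter_chartLocus 0 (k := k) (a := k - 1) (b := 0)
        (a' := k - 1) (b' := 0) (by omega) (by omega) (s := false) (s' := false)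
        (by simp [sideShift]; omega) (by simp [sideShift]; omega)
      exact ⟨x, hx⟩
  · rintro u v hu hv ⟨x, hx, hxu⟩ ⟨y, hy, hyv⟩
    obtain ⟨α, ⟨a, b, hab, hxα⟩, a', b', hab', hyα⟩ := hH.exists_mem_chartLocus hn x y
    obtain ⟨s, hs, hirr⟩ := hH.exists_image_chart hab hx hxα
    obtain ⟨s', hs', hirr'⟩ := hH.exists_image_chart hab' hy hyα
    -- The first branch is irreducible and meets the second chart, so u has a point there; then u
    -- and v meet inside the second branch.
    obtain ⟨z, ⟨⟨hz, hzx⟩, hzu⟩, hzy⟩ := by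
      have := hirr u (chartLocus α a' b' 𝒵) hu (chartLocus α a' b' 𝒵).isOpen ⟨x, ⟨hx, hxα⟩, hxu⟩
        (hH.exists_mem_inter_chartLocus α hab hab' hs hs')
      simpa only [← Set.inter_assoc] using this
    obtain ⟨w, ⟨hw, -⟩, hwu, hwv⟩ := hirr' u v hu hv ⟨z, ⟨hz, hzy⟩, hzu⟩ ⟨y, ⟨hy, hyα⟩, hyv⟩
    exact ⟨w, hw, hwu, hwv⟩

/-- In a chart H is the union of the branches u = 0 and v = 0, and neither contains the other. An
irreducible set which contains one branch coincides with it in the chart, and it lies in the closure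
of its trace on the chart. -/
theorem IsHilbertScheme.closure_genericLocus_mem_irreducibleComponents (hH : IsHilbertScheme node n H 𝒵)
    (hn : 0 < n) (hk : k ≤ n) :
    closure (genericLocus n k H 𝒵) ∈ irreducibleComponents H.left := by
  have hirr := hH.isIrreducible_closure_genericLocus hn hk
  refine ⟨hirr, fun t ht hle ↦ ?_⟩
  obtain ⟨x, hx⟩ := hirr.1
  obtain ⟨α, ⟨a, b, hab, hxα⟩, -⟩ := hH.exists_mem_chartLocus hn x x
  obtain ⟨s, hs, -⟩ := hH.exists_image_chart hab hx hxα
  have hopen := hH.isOpenImmersion_pt α hab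
  have hr := (hH.isOpenImmersion_pt_and_range α hab).2
  have hZ := hH.preimage_closure_genericLocus_of_eq α hab hs
  let T : Set (PrimeSpectrum (ParamRing a b)) := (hH.pt α (univParam a b) hab).left ⁻¹' t
  have hT : IsPreirreducible T := ht.2.preimage (hH.pt α (univParam a b) hab).left.isOpenEmbedding
  have hVT : PrimeSpectrum.zeroLocus {(univParam a b).coord s} ⊆ T := by
    rw [← hZ]; exact Set.preimage_mono hle
  have hcov : T ⊆ PrimeSpectrum.zeroLocus {(univParam a b).coord s} ∪
      PrimeSpectrum.zeroLocus {(univParam a b).coord (!s)} := by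
    rw [← PrimeSpectrum.zeroLocus_singleton_mul]
    have : (univParam a b).coord s * (univParam a b).coord (!s) = 0 := by
      cases s
      · exact (mul_comm _ _).trans (univParam a b).huv
      · exact (univParam a b).huv
    rw [this, PrimeSpectrum.zeroLocus_singleton_zero]
    exact Set.subset_univ _
  have hTs : T ⊆ PrimeSpectrum.zeroLocus {(univParam a b).coord s} := by
    refine (isPreirreducible_iff_isClosed_union_isClosed.mp hT _ _
      (PrimeSpectrum.isClosed_zeroLocus _) (PrimeSpectrum.isClosed_zeroLocus _) hcov).resolve_right
      fun h ↦ ?_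
    -- The generic point of one branch would lie on the other branch, which fails because the other
    -- coordinate is a variable of `LineRing`.
    have h1 := hVT.trans h (show (⟨Ideal.span {(univParam a b).coord s}, isPrime_span_coord s⟩ :
      PrimeSpectrum (ParamRing a b)) ∈ _ from Ideal.subset_span)
    have h2 : (univParam a b).coord (!s) ∈ Ideal.span {(univParam a b).coord s} :=
      h1 (Set.mem_singleton _)
    rw [← ker_hom_lineParam, RingHom.mem_ker, Param.hom_coord] at h2
    cases s
    · exact MvPolynomial.X_ne_zero _ h2
    · exact MvPolynomial.X_ne_zero _ h2
  refine (subset_closure_inter_of_isPreirreducible_of_isOpen ht.2 (chartLocus α a b 𝒵).isOpen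
    ⟨x, hle hx, hxα⟩).trans (closure_minimal ?_ isClosed_closure)
  rintro _ ⟨hy, hyα⟩
  rw [← hr] at hyα
  obtain ⟨q, rfl⟩ := hyα
  have : (q : PrimeSpectrum (ParamRing a b)) ∈
      ((hH.pt α (univParam a b) hab).left ⁻¹' closure (genericLocus n k H 𝒵) :
        Set (PrimeSpectrum (ParamRing a b))) := by
    rw [hZ]; exact hTs hy
  exact this

/-- A chart with exponent a meets only the components of index a and a + 1, so on every chart one of
the two ideals is the unit ideal. -/
theorem IsHilbertScheme.isEmpty_intersection (hH : IsHilbertScheme node n H 𝒵)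
    {l : ℕ} (hkl : k + 1 < l) (hl : l ≤ n) :
    IsEmpty (intersection n k H 𝒵 l).left := by
  have h : componentIdeal n k H 𝒵 ⊔ componentIdeal n l H 𝒵 = ⊤ := by
    refine idealSheaf_ext fun x ↦ ?_
    obtain ⟨α, ⟨a, b, hab, hx⟩, -⟩ := hH.exists_mem_chartLocus (by omega) x x
    have hopen := hH.isOpenImmersion_pt α hab
    refine ⟨_, (hH.pt α (univParam a b) hab).left, hopen, ?_, ?_⟩
    · rw [(hH.isOpenImmersion_pt_and_range α hab).2]; exact hx
    · rw [IdealSheafData.comap_sup, IdealSheafData.comap_top]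
      by_cases hs : ∃ s, a + sideShift s = k
      · rw [hH.componentIdeal_comap_univ_of_ne (k := l), sup_top_eq]
        obtain ⟨s, hs⟩ := hs
        rintro s' hs'
        cases s <;> cases s' <;> simp only [sideShift, cond_true, cond_false] at hs hs' <;> omega
      · push Not at hs
        rw [hH.componentIdeal_comap_univ_of_ne α hab hs, top_sup_eq]
  change IsEmpty (componentIdeal n k H 𝒵 ⊔ componentIdeal n l H 𝒵).subscheme
  rw [h]
  infer_instance

end Irreducible
-- Effective Cartier divisors in affine charts
section Cartier

open Scheme TopologicalSpace

variable {R R' : Type} [CommRing R] [CommRing R']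

/-- The ideals of an ideal sheaf are computed on affine charts. -/
lemma exists_comap_eq_idl {X : Scheme.{0}} (i : Spec (.of R) ⟶ X) [IsOpenImmersion i]
    (U : X.affineOpens) (hU : Set.range i = (U.1 : Set X)) :
    ∃ e : R ≃+* Γ(X, U.1), ∀ I : X.IdealSheafData,
      I.comap i = idl ((I.ideal U).comap (e : R →+* Γ(X, U.1))) := by
  let W : (Spec (.of R)).affineOpens := ⟨⊤, isAffineOpen_top _⟩
  obtain rfl : U = ⟨i ''ᵁ ⊤, W.2.image_of_isOpenImmersion i⟩ := by
    refine Subtype.ext (Opens.ext ?_)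
    rw [← hU]
    simp
  refine ⟨((Scheme.ΓSpecIso (.of R)).symm ≪≫ (i.appIso ⊤).symm).commRingCatIsoToRingEquiv,
    fun I ↦ ?_⟩
  obtain ⟨J, hJ⟩ := exists_eq_idl (I.comap i)
  have h := I.ideal_comap_of_isOpenImmersion i W
  have h1 : (idl J).ideal W = J.comap (Scheme.ΓSpecIso (.of R)).hom.hom := by
    rw [idl]
    exact IdealSheafData.equivOfIsAffine.apply_symm_apply _
  rw [hJ, h1] at h
  rw [hJ]
  congr 1
  have h2 := congrArg (Ideal.comap (Scheme.ΓSpecIso (.of R)).inv.hom) h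
  rw [Ideal.comap_comap, ← CommRingCat.hom_comp, Iso.inv_hom_id] at h2
  refine Eq.trans (Eq.trans ?_ h2) ?_
  · exact (Ideal.comap_id J).symm
  · rw [Ideal.comap_comap]
    rfl

lemma Ideal.comap_equiv_eq_span_iff (e : R ≃+* R') (I : Ideal R') (f : R) :
    I.comap (e : R →+* R') = Ideal.span {f} ↔ I = Ideal.span {e f} := by
  have h : (Ideal.span {e f}).comap (e : R →+* R') = Ideal.span {f} := by
    have := Ideal.comap_map_of_bijective (e : R →+* R') e.bijective (I := Ideal.span {f})
    rwa [Ideal.map_span, Set.image_singleton] at this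
  rw [← h]
  exact (Ideal.comap_injective_of_surjective (e : R →+* R') e.surjective).eq_iff

lemma isEffectiveCartier_of_cover {X : Scheme.{0}} {I : X.IdealSheafData}
    (h : ∀ x : X, ∃ (R : Type) (_ : CommRing R) (i : Spec (.of R) ⟶ X), IsOpenImmersion i ∧
      x ∈ Set.range i ∧ ∃ g ∈ nonZeroDivisors R, I.comap i = idl (Ideal.span {g})) :
    IsEffectiveCartier I := by
  intro x
  obtain ⟨R, _, i, hi, hx, g, hg, hI⟩ := h x
  let U : X.affineOpens := ⟨i.opensRange, isAffineOpen_opensRange i⟩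
  obtain ⟨e, he⟩ := exists_comap_eq_idl i U rfl
  refine ⟨U, hx, e g, ?_, ?_⟩
  · rw [← MulEquivClass.map_nonZeroDivisors e]
    exact ⟨g, hg, rfl⟩
  · rw [← Ideal.comap_equiv_eq_span_iff]
    exact idl_injective ((he I).symm.trans hI)

variable {T S : Over base}

lemma IsEffectiveCartier.exists_nbhd {I : T.left.IdealSheafData} (h : IsEffectiveCartier I)
    (t : T.left) : ∃ (R : Type) (_ : CommRing R) (_ : Algebra ℂ R) (i : specC R ⟶ T),
      IsOpenImmersion i.left ∧ t ∈ Set.range i.left ∧ ∃ g ∈ nonZeroDivisors R,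
        I.comap i.left = idl (Ideal.span {g}) := by
  obtain ⟨⟨U, hU⟩, ht, f, hf, hI⟩ := h t
  obtain ⟨κ, hκ⟩ := exists_specMap (R := ℂ) (S := Γ(T.left, U)) (hU.fromSpec ≫ T.hom)
  let _ : Algebra ℂ Γ(T.left, U) := κ.toAlgebra
  have hr : Set.range hU.fromSpec = U := hU.range_fromSpec
  have hi : IsOpenImmersion hU.fromSpec := hU.isOpenImmersion_fromSpec
  obtain ⟨e, he⟩ := @exists_comap_eq_idl Γ(T.left, U) _ T.left hU.fromSpec hi ⟨U, hU⟩ hr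
  refine ⟨Γ(T.left, U), inferInstance, inferInstance, Over.homMk hU.fromSpec hκ,
    inferInstanceAs (IsOpenImmersion hU.fromSpec), ?_, e.symm f, ?_, ?_⟩
  · change t ∈ Set.range hU.fromSpec
    rw [hr]; exact ht
  · rw [← MulEquivClass.map_nonZeroDivisors e.symm]
    exact ⟨f, hf, rfl⟩
  · refine (he I).trans (congrArg idl ?_)
    rw [Ideal.comap_equiv_eq_span_iff, hI, RingEquiv.apply_symm_apply]

/-- Open immersions are flat, and regular elements stay regular under flat base change. -/
lemma mem_nonZeroDivisors_of_isOpenImmersion [Algebra ℂ R] [Algebra ℂ R'] (φ : R →ₐ[ℂ] R')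
    (h : IsOpenImmersion (specCMap φ).left) {g : R} (hg : g ∈ nonZeroDivisors R) :
    φ g ∈ nonZeroDivisors R' := by
  have h1 : IsOpenImmersion (specMap (φ : R →+* R')) := h
  have h2 : Flat (specMap (φ : R →+* R')) := inferInstance
  have h3 := Flat.SpecMap_iff.mp h2
  let _ : Algebra R R' := (φ : R →+* R').toAlgebra
  have h4 : Module.Flat R R' := h3
  rw [← isRegular_iff_mem_nonZeroDivisors, ← isLeftRegular_iff_isRegular] at hg ⊢
  exact IsSMulRegular.of_flat (S := R') hg

lemma specCMap_left_comap_idl [Algebra ℂ R] [Algebra ℂ R'] (φ : R →ₐ[ℂ] R') (I : Ideal R) :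
    (idl I).comap (specCMap φ).left = idl (I.map φ) := comap_idl _ _

lemma exists_specC_nbhd_lift [Algebra ℂ R] (c : S ⟶ T) (i : specC R ⟶ T) [IsOpenImmersion i.left]
    (s : S.left) (hs : c.left s ∈ Set.range i.left) (V : S.left.Opens) (hV : s ∈ V) :
    ∃ (R' : Type) (_ : CommRing R') (_ : Algebra ℂ R') (j : specC R' ⟶ S) (φ : R →ₐ[ℂ] R'),
      IsOpenImmersion j.left ∧ s ∈ Set.range j.left ∧ Set.range j.left ⊆ V ∧
        specCMap φ ≫ i = j ≫ c := by
  obtain ⟨R', _, _, j, hj, hsj, hV'⟩ := exists_specC_nbhd s (V ⊓ c.left ⁻¹ᵁ i.left.opensRange)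
    ⟨hV, hs⟩
  obtain ⟨d, hd⟩ := exists_over_lift i (j ≫ c) (by
    rintro _ ⟨z, rfl⟩
    exact (hV' ⟨z, rfl⟩).2)
  obtain ⟨φ, rfl⟩ := exists_specCMap d
  exact ⟨R', _, _, j, φ, hj, hsj, hV'.trans fun _ h ↦ h.1, hd⟩

/-- Effective Cartier divisors restrict to effective Cartier divisors on open subschemes. -/
lemma IsEffectiveCartier.comap_of_isOpenImmersion {I : T.left.IdealSheafData}
    (h : IsEffectiveCartier I) (c : S ⟶ T) [IsOpenImmersion c.left] :
    IsEffectiveCartier (I.comap c.left) := by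
  refine isEffectiveCartier_of_cover fun s ↦ ?_
  obtain ⟨R, _, _, i, hi, ht, g, hg, hI⟩ := h.exists_nbhd (c.left s)
  obtain ⟨R', _, _, j, φ, hj, hsj, -, e⟩ := exists_specC_nbhd_lift c i s ht ⊤ trivial
  have e' : (specCMap φ).left ≫ i.left = j.left ≫ c.left := congrArg CommaMorphism.left e
  have hφ : IsOpenImmersion (specCMap φ).left := by
    have : IsOpenImmersion ((specCMap φ).left ≫ i.left) := e' ▸ inferInstance
    exact IsOpenImmersion.of_comp _ i.left
  refine ⟨R', _, j.left, hj, hsj, φ g, mem_nonZeroDivisors_of_isOpenImmersion φ hφ hg, ?_⟩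
  rw [← IdealSheafData.comap_comp, ← e', IdealSheafData.comap_comp, hI]
  refine (specCMap_left_comap_idl φ _).trans ?_
  rw [Ideal.map_span, Set.image_singleton]

end Cartier

/-! ### The ideal of the centre of the blowup -/

section Center

open Scheme

/-- The ideal sheaf of the product of two closed subschemes. -/
lemma ker_fiberProdMap {X X' Y Y' : Over base} (f : X ⟶ X') (g : Y ⟶ Y')
    [IsClosedImmersion f.left] [IsClosedImmersion g.left] :
    (fiberProdMap f g).ker = f.left.ker.comap (pullback.fst X'.hom Y'.hom) ⊔
      g.left.ker.comap (pullback.snd X'.hom Y'.hom) := by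
  have hbot : ∀ {X Y : Scheme.{0}} (i : X ⟶ Y) [IsClosedImmersion i], i.ker.comap i = ⊥ :=
    fun i _ ↦ (comap_ker_eq_bot_iff i i).mpr ⟨𝟙 _, Category.id_comp _⟩
  set I := f.left.ker.comap (pullback.fst X'.hom Y'.hom) ⊔
    g.left.ker.comap (pullback.snd X'.hom Y'.hom) with hI
  apply le_antisymm
  · have h0 : I.comap I.subschemeι = ⊥ := by
      have := hbot I.subschemeι
      rwa [IdealSheafData.ker_subschemeι] at this
    have h1 : f.left.ker.comap (I.subschemeι ≫ pullback.fst X'.hom Y'.hom) = ⊥ := by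
      rw [IdealSheafData.comap_comp, eq_bot_iff, ← h0]
      exact IdealSheafData.comap_mono _ le_sup_left
    have h2 : g.left.ker.comap (I.subschemeι ≫ pullback.snd X'.hom Y'.hom) = ⊥ := by
      rw [IdealSheafData.comap_comp, eq_bot_iff, ← h0]
      exact IdealSheafData.comap_mono _ le_sup_right
    obtain ⟨p, hp⟩ := (comap_ker_eq_bot_iff _ _).mp h1
    obtain ⟨q, hq⟩ := (comap_ker_eq_bot_iff _ _).mp h2
    have e : p ≫ X.hom = q ≫ Y.hom := by
      rw [← Over.w f, ← Over.w g, reassoc_of% hp, reassoc_of% hq, pullback.condition]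
    have e2 : I.subschemeι = pullback.lift p q e ≫ fiberProdMap f g := by
      apply pullback.hom_ext
      · rw [Category.assoc, pullback.lift_fst, pullback.lift_fst_assoc, hp]
      · rw [Category.assoc, pullback.lift_snd, pullback.lift_snd_assoc, hq]
    conv_rhs => rw [← I.ker_subschemeι, e2]
    exact Hom.le_ker_comp _ _
  · rw [← IdealSheafData.map_bot, IdealSheafData.le_map_iff_comap_le, hI,
      IdealSheafData.comap_sup, ← IdealSheafData.comap_comp, ← IdealSheafData.comap_comp,
      pullback.lift_fst, pullback.lift_snd, IdealSheafData.comap_comp, IdealSheafData.comap_comp,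
      hbot, hbot, IdealSheafData.comap_bot, IdealSheafData.comap_bot, sup_bot_eq]

lemma center_comap_prodLift {T : Over base} {k l : ℕ} (f : T ⟶ projSpace (k + 1))
    (g : T ⟶ projSpace (l + 1)) :
    (center k l).comap (prodLift f g).left =
      (hyperplane k 0).left.ker.comap f.left ⊔ (hyperplane l 0).left.ker.comap g.left := by
  rw [center, ker_fiberProdMap, IdealSheafData.comap_sup, ← IdealSheafData.comap_comp,
    ← IdealSheafData.comap_comp]
  congr 2
  · exact congrArg CommaMorphism.left (prodLift_fst f g)
  · exact congrArg CommaMorphism.left (prodLift_snd f g)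

end Center
-- The morphism to projective space defined by a binary form
section FormMap

open Scheme Polynomial

set_option linter.unusedSectionVars false

variable {R R' : Type} [CommRing R] [Algebra ℂ R] [CommRing R'] [Algebra ℂ R'] {a b a' b' n k : ℕ}
  {H : Over base} {𝒵 : (fiberProd node H).left.IdealSheafData} {T S : Over base}

lemma IsHilbertScheme.exists_nbhd (hH : IsHilbertScheme node n H 𝒵) (hn : 0 < n) (f : T ⟶ H)
    (t : T.left) : ∃ (α : ℂ) (a b : ℕ) (hab : a + 1 + b = n)
      (R : Type) (_ : CommRing R) (_ : Algebra ℂ R) (i : specC R ⟶ T), IsOpenImmersion i.left ∧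
      t ∈ Set.range i.left ∧ ∃ p : Param R a b, i ≫ f = hH.pt α p hab := by
  obtain ⟨α, ⟨a, b, hab, ht⟩, -⟩ := hH.exists_mem_chartLocus hn (f.left t) (f.left t)
  obtain ⟨R, _, _, i, hi, hti, -, p, hp⟩ := hH.exists_nbhd_eq_pt hab f ht ⊤ trivial
  exact ⟨α, a, b, hab, R, _, _, i, hi, hti, p, hp⟩

/-- The binary form describing the part of a subscheme on the component `y = 0` for `s = true`,
on `x = 0` for `s = false`. -/
noncomputable def Param.form (s : Bool) (α : ℂ) (p : Param R a b) : R[X] :=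
  cond s (p.xpoly α) (p.swap.xpoly α)

lemma Param.form_map (s : Bool) (α : ℂ) (p : Param R a b) (φ : R →ₐ[ℂ] R') :
    (p.map (φ : R →+* R')).form s α = (p.form s α).map (φ : R →+* R') := by
  cases s
  · exact p.swap.xpoly_map α φ
  · exact p.xpoly_map α φ

lemma Param.eval_form (s : Bool) (α : ℂ) (p : Param R a b) :
    (p.form s α).eval (algebraMap ℂ R α) = 1 := by
  cases s
  · exact p.swap.eval_xpoly α
  · exact p.eval_xpoly α

lemma Param.exists_form_eq {p : Param R a b} {p' : Param R a' b'} {α β : ℂ}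
    (h : p.fam α = p'.fam β) (s : Bool) : ∃ c, IsUnit c ∧ p'.form s β * C c = p.form s α := by
  cases s
  · exact (Param.exists_xpoly_eq h).2
  · exact (Param.exists_xpoly_eq h).1

lemma polyPt_form_eq {s : Bool} {α β : ℂ} {p : Param R a b} {p' : Param R a' b'}
    (e : p.fam α = p'.fam β)
    (h : (p.form s α).natDegree ≤ k) (h' : (p'.form s β).natDegree ≤ k) :
    polyPt k (p.form s α) α h (p.eval_form s α) =
      polyPt k (p'.form s β) β h' (p'.eval_form s β) := by
  obtain ⟨c, hc, e⟩ := Param.exists_form_eq e s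
  exact polyPt_congr hc e

lemma specCMap_polyPt_form {s : Bool} {α : ℂ} {p : Param R a b} (φ : R →ₐ[ℂ] R')
    (h : (p.form s α).natDegree ≤ k) (h' : ((p.map (φ : R →+* R')).form s α).natDegree ≤ k) :
    specCMap φ ≫ polyPt k (p.form s α) α h (p.eval_form s α) =
      polyPt k ((p.map (φ : R →+* R')).form s α) α h' (Param.eval_form _ _ _) := by
  rw [specCMap_polyPt]
  congr 1
  exact (p.form_map s α φ).symm

/-- The morphism to projective space given by the binary forms of a family of subschemes. -/
lemma IsHilbertScheme.exists_formMap (hH : IsHilbertScheme node n H 𝒵) (hn : 0 < n) (f : T ⟶ H)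
    (s : Bool) (k : ℕ)
    (hk : ∀ {R : Type} [CommRing R] [Algebra ℂ R] (i : specC R ⟶ T) {α : ℂ} {a b : ℕ}
      {hab : a + 1 + b = n} {p : Param R a b}, i ≫ f = hH.pt α p hab →
        (p.form s α).natDegree ≤ k) :
    ∃ g : T ⟶ projSpace (k + 1), ∀ {R : Type} [CommRing R] [Algebra ℂ R] (i : specC R ⟶ T) {α : ℂ}
      {a b : ℕ} {hab : a + 1 + b = n} {p : Param R a b} (h : i ≫ f = hH.pt α p hab),
        i ≫ g = polyPt k (p.form s α) α (hk i h) (p.eval_form s α) := by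
  -- On a common refinement the two parameters describe the same family, so their forms agree up to
  -- a unit and define the same point.
  have key : ∀ {R R' R'' : Type} [CommRing R] [Algebra ℂ R] [CommRing R'] [Algebra ℂ R']
      [CommRing R''] [Algebra ℂ R''] (i : specC R ⟶ T) (i' : specC R' ⟶ T) {α α' : ℂ}
      {a b a' b' : ℕ} {hab : a + 1 + b = n} {hab' : a' + 1 + b' = n} {p : Param R a b}
      {p' : Param R' a' b'} (h : i ≫ f = hH.pt α p hab) (h' : i' ≫ f = hH.pt α' p' hab')
      (c : specC R'' ⟶ specC R) (c' : specC R'' ⟶ specC R'), c ≫ i = c' ≫ i' →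
      c ≫ polyPt k (p.form s α) α (hk i h) (p.eval_form s α) =
        c' ≫ polyPt k (p'.form s α') α' (hk i' h') (p'.eval_form s α') := by
    intro R R' R'' _ _ _ _ _ _ i i' α α' a b a' b' hab hab' p p' h h' c c' e
    obtain ⟨φ, rfl⟩ := exists_specCMap c
    obtain ⟨φ', rfl⟩ := exists_specCMap c'
    have h1 : (specCMap φ ≫ i) ≫ f = hH.pt α (p.map (φ : R →+* R'')) hab := by
      rw [Category.assoc, h, hH.specCMap_pt]
    have h2 : (specCMap φ' ≫ i') ≫ f = hH.pt α' (p'.map (φ' : R' →+* R'')) hab' := by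
      rw [Category.assoc, h', hH.specCMap_pt]
    rw [specCMap_polyPt_form φ _ (hk _ h1), specCMap_polyPt_form φ' _ (hk _ h2)]
    refine polyPt_form_eq ((hH.pt_eq_pt_iff (hab := hab) (hab' := hab')).mp ?_) _ _
    rw [← h1, ← h2, e]
  choose α a b hab R hR hA i hi ht p hp using fun t ↦ hH.exists_nbhd hn f t
  obtain ⟨g, hg⟩ := exists_glue_hom (fun t ↦ specC (R t)) i (fun t ↦ ⟨t, ht t⟩)
    (fun t ↦ polyPt k ((p t).form s (α t)) (α t) (hk (i t) (hp t)) ((p t).eval_form s (α t))) (by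
      intro t t' S c d _ _ e
      refine over_hom_ext fun z ↦ ?_
      obtain ⟨R'', _, _, j, hj, hz, -⟩ := exists_specC_nbhd z ⊤ trivial
      refine ⟨_, j, hj, hz, ?_⟩
      rw [← Category.assoc, ← Category.assoc]
      refine key _ _ (hp t) (hp t') _ _ ?_
      rw [Category.assoc, e, Category.assoc])
  refine ⟨g, fun {R'} _ _ i' {_} {_ _ _} {p'} h' ↦ over_hom_ext fun z ↦ ?_⟩
  obtain ⟨R'', _, _, j, φ, hj, hz, -, e⟩ := exists_specC_nbhd_lift i' (i (i'.left z)) z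
    (ht (i'.left z)) ⊤ trivial
  refine ⟨_, j, hj, hz, ?_⟩
  rw [← Category.assoc, ← e, Category.assoc, hg]
  exact key _ _ (hp _) h' _ _ e

end FormMap

/-! ### Points of a component and the degrees of their forms -/

section ComponentPoints

open Scheme Polynomial

set_option linter.unusedSectionVars false

variable {R R' : Type} [CommRing R] [Algebra ℂ R] [CommRing R'] [Algebra ℂ R'] {a b a' b' n k : ℕ}
  {H : Over base} {𝒵 : (fiberProd node H).left.IdealSheafData} {T S : Over base}

variable (n k H 𝒵) in
/-- The inclusion of a component in the Hilbert scheme. -/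
noncomputable def componentι : component n k H 𝒵 ⟶ H :=
  Over.homMk (componentIdeal n k H 𝒵).subschemeι rfl

instance : IsClosedImmersion (componentι n k H 𝒵).left :=
  inferInstanceAs (IsClosedImmersion (componentIdeal n k H 𝒵).subschemeι)

lemma exists_over_lift_of_ker {X Y Z : Over base} (i : X ⟶ Y) [IsClosedImmersion i.left] (f : Z ⟶ Y) :
    i.left.ker.comap f.left = ⊥ ↔ ∃ g, g ≫ i = f := by
  rw [comap_ker_eq_bot_iff]
  constructor
  · rintro ⟨g, hg⟩
    exact ⟨Over.homMk g (by rw [← Over.w i, reassoc_of% hg, Over.w]), Over.OverMorphism.ext hg⟩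
  · rintro ⟨g, rfl⟩
    exact ⟨g.left, rfl⟩

lemma over_mono_of_left {X Y : Over base} (i : X ⟶ Y) [Mono i.left] {f g : T ⟶ X}
    (h : f ≫ i = g ≫ i) : f = g :=
  Over.OverMorphism.ext ((cancel_mono i.left).mp (congrArg CommaMorphism.left h))

lemma ker_componentι : (componentι n k H 𝒵).left.ker = componentIdeal n k H 𝒵 :=
  (componentIdeal n k H 𝒵).ker_subschemeι

lemma idl_eq_bot_iff {I : Ideal R} : idl I = ⊥ ↔ I = ⊥ := by
  rw [← idl_bot, idl_injective.eq_iff]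

/-- A family with a parameter belongs to the component of index `k`. -/
lemma IsHilbertScheme.exists_lift_component (hH : IsHilbertScheme node n H 𝒵) (α : ℂ)
    {p : Param R a b} (hab : a + 1 + b = n) {s : Bool} (hs : a + sideShift s = k)
    (hp : p.coord s = 0) : ∃ m : specC R ⟶ component n k H 𝒵,
      m ≫ componentι n k H 𝒵 = hH.pt α p hab := by
  rw [← exists_over_lift_of_ker, ker_componentι, hH.componentIdeal_comap_pt α p hab hs, hp]
  exact idl_eq_bot_iff.mpr (by simp)

/-- A point of the component kills its ideal, which in the chart is generated by one coordinate or
is the unit ideal. In the latter case the ring is zero, hence the first alternative. -/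
lemma IsHilbertScheme.exists_side (hH : IsHilbertScheme node n H 𝒵)
    (i : specC R ⟶ component n k H 𝒵) {α : ℂ} {p : Param R a b} {hab : a + 1 + b = n}
    (h : i ≫ componentι n k H 𝒵 = hH.pt α p hab) :
    Subsingleton R ∨ ∃ s, a + sideShift s = k ∧ p.coord s = 0 := by
  have h1 := (exists_over_lift_of_ker _ _).mpr ⟨i, h⟩
  rw [ker_componentι] at h1
  by_cases hs : ∃ s, a + sideShift s = k
  · obtain ⟨s, hs⟩ := hs
    rw [hH.componentIdeal_comap_pt α p hab hs] at h1
    have h2 := idl_eq_bot_iff.mp h1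
    exact .inr ⟨s, hs, by simpa using h2⟩
  · left
    push Not at hs
    rw [hH.componentIdeal_comap_pt_of_ne α p hab hs] at h1
    have h2 : (⊤ : Ideal R) = ⊥ := idl_eq_bot_iff.mp (idl_top.trans h1)
    exact (Submodule.subsingleton_iff R).mp (subsingleton_of_bot_eq_top h2.symm)

/-- The coefficient of degree a + 1 is -u Q(0), so on the branch u = 0, where k = a, the degree
drops by one. -/
lemma Param.natDegree_ex_le_of_coord {p : Param R a b} {s : Bool} (hs : a + sideShift s = k)
    (hp : p.coord s = 0) : p.ex.natDegree ≤ k := by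
  subst hs
  cases s
  · exact p.natDegree_ex_le
  · refine natDegree_le_iff_coeff_eq_zero.mpr fun i hi ↦ ?_
    rcases eq_or_lt_of_le (Nat.succ_le_of_lt hi) with rfl | hi
    · change p.ex.coeff (a + 1) = 0
      rw [p.coeff_ex_succ, show p.u = 0 from hp, zero_mul, neg_zero]
    · exact p.coeff_ex_of_lt hi

/-- The index of the component, seen from the component `y = 0` or `x = 0` of the curve. -/
def sideDegree (n k : ℕ) (t : Bool) : ℕ := cond t k (n - k)

lemma Param.natDegree_form_le {p : Param R a b} {s : Bool} (hab : a + 1 + b = n)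
    (hs : a + sideShift s = k) (hp : p.coord s = 0) (t : Bool) (α : ℂ) :
    (p.form t α).natDegree ≤ sideDegree n k t := by
  cases t
  · refine (p.swap.natDegree_xpoly α).trans_le ?_
    refine Param.natDegree_ex_le_of_coord (s := !s) ?_ (?_ : p.swap.coord (!s) = 0)
    · cases s <;> simp [sideShift, sideDegree] at hs ⊢ <;> omega
    · cases s <;> exact hp
  · exact (p.natDegree_xpoly α).trans_le (Param.natDegree_ex_le_of_coord hs hp)

lemma IsHilbertScheme.natDegree_form_le (hH : IsHilbertScheme node n H 𝒵)
    (i : specC R ⟶ component n k H 𝒵) {α : ℂ} {p : Param R a b} {hab : a + 1 + b = n}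
    (h : i ≫ componentι n k H 𝒵 = hH.pt α p hab) (t : Bool) :
    (p.form t α).natDegree ≤ sideDegree n k t := by
  obtain h | ⟨s, hs, hp⟩ := hH.exists_side i h
  · rw [Subsingleton.elim (p.form t α) 0, natDegree_zero]
    exact Nat.zero_le _
  · exact Param.natDegree_form_le hab hs hp t α

end ComponentPoints
-- The form map: exceptional divisor and uniqueness of lifts
section Blowup

open Scheme Polynomial

set_option linter.unusedSectionVars false

variable {R R' : Type} [CommRing R] [Algebra ℂ R] [CommRing R'] [Algebra ℂ R'] {a b a' b' n k : ℕ}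
  {H : Over base} {𝒵 : (fiberProd node H).left.IdealSheafData} {T S : Over base}

/-- The function which cuts out the exceptional divisor. -/
noncomputable def Param.lead (s : Bool) (p : Param R a b) : R := cond s (p.P.coeff 0) (p.Q.coeff 0)

/-- Translation of the variable does not change a top coefficient, so both are read off `ex`: for u
= 0 they are P(0) and -v P(0), and the branch v = 0 is symmetric. -/
lemma Param.coeff_form {p : Param R a b} {s : Bool} (hab : a + 1 + b = n)
    (hs : a + sideShift s = k) (hp : p.coord s = 0) (α : ℂ) :
    (p.form s α).coeff (sideDegree n k s) = p.lead s ∧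
      (p.form (!s) α).coeff (sideDegree n k !s) = -(p.coord (!s) * p.lead s) := by
  have key : ∀ {a b : ℕ} {p : Param R a b}, p.u = 0 →
      (p.xpoly α).coeff a = p.P.coeff 0 ∧
        (p.swap.xpoly α).coeff (b + 1) = -(p.v * p.P.coeff 0) := by
    intro a b p hp
    constructor
    · have h : p.ex.natDegree ≤ a := Param.natDegree_ex_le_of_coord (s := true) rfl hp
      rw [p.P_coeff_zero, Param.xpoly, coeff_taylor_of_natDegree_le h]
    · rw [Param.xpoly, coeff_taylor_of_natDegree_le p.swap.natDegree_ex_le, p.swap.coeff_ex_succ]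
      rfl
  subst hs
  subst hab
  cases s
  · have h := key (p := p.swap) hp
    have e : sideDegree (a + 1 + b) (a + sideShift false) false = b := by
      simp [sideDegree, sideShift]
    rw [e]
    exact h
  · have h := key (p := p) hp
    have e : sideDegree (a + 1 + b) (a + sideShift true) false = b + 1 := by
      simp [sideDegree, sideShift]; omega
    rw [Bool.not_true, e]
    exact h

/-- One top coefficient is a multiple of the other, so the centre pulls back to a principal ideal on
the component. -/
lemma Param.span_coeff_form {p : Param R a b} {s : Bool} (hab : a + 1 + b = n)
    (hs : a + sideShift s = k) (hp : p.coord s = 0) (α : ℂ) :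
    Ideal.span {(p.form true α).coeff k} ⊔ Ideal.span {(p.form false α).coeff (n - k)} =
      Ideal.span {p.lead s} := by
  obtain ⟨h1, h2⟩ := Param.coeff_form hab hs hp α
  have h3 : Ideal.span {(p.form s α).coeff (sideDegree n k s)} ⊔
      Ideal.span {(p.form (!s) α).coeff (sideDegree n k !s)} = Ideal.span {p.lead s} := by
    rw [h1, h2, sup_eq_left, Ideal.span_singleton_le_iff_mem]
    exact neg_mem (Ideal.mul_mem_left _ _ (Ideal.mem_span_singleton_self _))
  cases s
  · rw [sup_comm]; exact h3
  · exact h3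

lemma mem_nonZeroDivisors_of_span_eq {g h : R} (hg : g ∈ nonZeroDivisors R)
    (e : Ideal.span {h} = Ideal.span {g}) : h ∈ nonZeroDivisors R := by
  obtain ⟨c, hc⟩ := Ideal.mem_span_singleton'.mp (e ▸ Ideal.mem_span_singleton_self g :
    g ∈ Ideal.span {h})
  rw [← hc] at hg
  exact (mul_mem_nonZeroDivisors.mp hg).2

/-- The forms determine P and Q. The parameter which is not zero on the branch is recovered from the
second top coefficient by cancelling the regular element `lead`. -/
lemma Param.eq_of_forms {p p' : Param R a b} {s : Bool} (hab : a + 1 + b = n)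
    (hs : a + sideShift s = k) (hp : p.coord s = 0) (hp' : p'.coord s = 0) {α : ℂ}
    (e : ∀ t, p.form t α = p'.form t α) (hl : p.lead s ∈ nonZeroDivisors R) : p = p' := by
  obtain ⟨h1, h2⟩ := Param.coeff_form hab hs hp α
  obtain ⟨h3, h4⟩ := Param.coeff_form hab hs hp' α
  rw [← e, h1] at h3
  rw [← e, h2, ← h3, neg_inj] at h4
  have h5 := (mul_cancel_right_mem_nonZeroDivisors hl).mp h4
  refine Param.ext_of_ex ?_ ?_ (taylor_injective _ (e true)) (taylor_injective _ (e false))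
  · cases s
    · exact h5
    · exact hp.trans hp'.symm
  · cases s
    · exact hp.trans hp'.symm
    · exact h5

lemma IsHilbertScheme.natDegree_form_true_le (hH : IsHilbertScheme node n H 𝒵)
    (i : specC R ⟶ component n k H 𝒵) {α : ℂ} {p : Param R a b} {hab : a + 1 + b = n}
    (h : i ≫ componentι n k H 𝒵 = hH.pt α p hab) : (p.form true α).natDegree ≤ k :=
  hH.natDegree_form_le i h true

lemma IsHilbertScheme.natDegree_form_false_le (hH : IsHilbertScheme node n H 𝒵)
    (i : specC R ⟶ component n k H 𝒵) {α : ℂ} {p : Param R a b} {hab : a + 1 + b = n}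
    (h : i ≫ componentι n k H 𝒵 = hH.pt α p hab) : (p.form false α).natDegree ≤ n - k :=
  hH.natDegree_form_le i h false

/-- The morphism from a component to a product of projective spaces which is given by the two
binary forms of a subscheme. -/
def IsHilbertScheme.IsFormMap (hH : IsHilbertScheme node n H 𝒵) (k : ℕ)
    (π : component n k H 𝒵 ⟶ fiberProd (projSpace (k + 1)) (projSpace (n - k + 1))) : Prop :=
  ∀ {R : Type} [CommRing R] [Algebra ℂ R] (i : specC R ⟶ component n k H 𝒵) {α : ℂ} {a b : ℕ}
    {hab : a + 1 + b = n} {p : Param R a b} (h : i ≫ componentι n k H 𝒵 = hH.pt α p hab),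
      i ≫ π = prodLift
        (polyPt k (p.form true α) α (hH.natDegree_form_true_le i h) (p.eval_form _ _))
        (polyPt (n - k) (p.form false α) α (hH.natDegree_form_false_le i h) (p.eval_form _ _))

lemma IsHilbertScheme.exists_isFormMap (hH : IsHilbertScheme node n H 𝒵) (hn : 0 < n) (k : ℕ) :
    ∃ π, hH.IsFormMap k π := by
  obtain ⟨x, hx⟩ := hH.exists_formMap hn (componentι n k H 𝒵) true k
    fun i _ _ _ _ _ h ↦ hH.natDegree_form_true_le i h
  obtain ⟨y, hy⟩ := hH.exists_formMap hn (componentι n k H 𝒵) false (n - k)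
    fun i _ _ _ _ _ h ↦ hH.natDegree_form_false_le i h
  refine ⟨prodLift x y, fun i _ _ _ _ _ h ↦ ?_⟩
  rw [comp_prodLift, hx i h, hy i h]

lemma prodLift_inj {X Y : Over base} {f f' : T ⟶ X} {g g' : T ⟶ Y}
    (h : prodLift f g = prodLift f' g') : f = f' ∧ g = g' := by
  constructor
  · rw [← prodLift_fst f g, h, prodLift_fst]
  · rw [← prodLift_snd f g, h, prodLift_snd]

lemma center_comap_polyPt {l : ℕ} {E F : R[X]} {α : ℂ} (hE : E.natDegree ≤ k) (hF : F.natDegree ≤ l)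
    (h : E.eval (algebraMap ℂ R α) = 1) (h' : F.eval (algebraMap ℂ R α) = 1) :
    (center k l).comap (prodLift (polyPt k E α hE h) (polyPt l F α hF h')).left =
      idl (Ideal.span {E.coeff k} ⊔ Ideal.span {F.coeff l}) := by
  rw [center_comap_prodLift, ker_hyperplane_comap_polyPt, ker_hyperplane_comap_polyPt, idl_sup]

lemma isPullback_of_ker_eq {X Y Y' Z : Scheme.{0}} {j : Z ⟶ X} {m : Z ⟶ Y'} {f : X ⟶ Y}
    {i : Y' ⟶ Y} [IsClosedImmersion i] [IsClosedImmersion j] (h : j ≫ f = m ≫ i)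
    (hker : j.ker = i.ker.comap f) : IsPullback j m f i := by
  have key : ∀ {W : Scheme.{0}} (p : W ⟶ X) (q : W ⟶ Y'), p ≫ f = q ≫ i → ∃ r, r ≫ j = p := by
    intro W p q e
    rw [← comap_ker_eq_bot_iff, hker, ← IdealSheafData.comap_comp, e, comap_ker_eq_bot_iff]
    exact ⟨q, rfl⟩
  refine ⟨⟨h⟩, ⟨PullbackCone.IsLimit.mk _ (fun s ↦ (key s.fst s.snd s.condition).choose)
    (fun s ↦ (key s.fst s.snd s.condition).choose_spec) (fun s ↦ ?_) fun s m hm _ ↦ ?_⟩⟩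
  · rw [← cancel_mono i, Category.assoc, ← h, reassoc_of%
      (key s.fst s.snd s.condition).choose_spec, s.condition]
  · rw [← cancel_mono j, hm, (key s.fst s.snd s.condition).choose_spec]

section FormMap

variable {hH : IsHilbertScheme node n H 𝒵}
  {π : component n k H 𝒵 ⟶ fiberProd (projSpace (k + 1)) (projSpace (n - k + 1))}

lemma IsHilbertScheme.IsFormMap.center_comap (hπ : hH.IsFormMap k π)
    {i : specC R ⟶ component n k H 𝒵} {α : ℂ} {hab : a + 1 + b = n} {p : Param R a b}
    (h : i ≫ componentι n k H 𝒵 = hH.pt α p hab) {s : Bool} (hs : a + sideShift s = k)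
    (hp : p.coord s = 0) :
    (center k (n - k)).comap (i ≫ π).left = idl (Ideal.span {p.lead s}) := by
  rw [hπ i h, center_comap_polyPt, Param.span_coeff_form hab hs hp]

lemma IsHilbertScheme.IsFormMap.form_eq (hπ : hH.IsFormMap k π)
    {i i' : specC R ⟶ component n k H 𝒵} {α : ℂ} {hab : a + 1 + b = n} {hab' : a' + 1 + b' = n}
    {p : Param R a b} {p' : Param R a' b'} (h : i ≫ componentι n k H 𝒵 = hH.pt α p hab)
    (h' : i' ≫ componentι n k H 𝒵 = hH.pt α p' hab') (e : i ≫ π = i' ≫ π) (t : Bool) :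
    p.form t α = p'.form t α := by
  rw [hπ i h, hπ i' h'] at e
  obtain ⟨e1, e2⟩ := prodLift_inj e
  cases t
  · exact polyPt_inj e2
  · exact polyPt_inj e1

lemma IsHilbertScheme.IsFormMap.eq_of_same (hπ : hH.IsFormMap k π)
    {i i' : specC R ⟶ component n k H 𝒵} {α : ℂ} {hab : a + 1 + b = n}
    {p p' : Param R a b} (h : i ≫ componentι n k H 𝒵 = hH.pt α p hab)
    (h' : i' ≫ componentι n k H 𝒵 = hH.pt α p' hab) (e : i ≫ π = i' ≫ π)
    {g : R} (hg : g ∈ nonZeroDivisors R)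
    (hI : (center k (n - k)).comap (i ≫ π).left = idl (Ideal.span {g})) : i = i' := by
  refine over_mono_of_left (componentι n k H 𝒵) ?_
  rw [h, h']
  congr 1
  rcases hH.exists_side i h with _ | ⟨s, hs, hp⟩
  · ext <;> exact Subsingleton.elim _ _
  rcases hH.exists_side i' h' with _ | ⟨s', hs', hp'⟩
  · ext <;> exact Subsingleton.elim _ _
  obtain rfl : s = s' := by
    cases s <;> cases s' <;> simp only [sideShift, cond_true, cond_false] at hs hs' <;>
      first | rfl | omega
  refine Param.eq_of_forms hab hs hp hp' (hπ.form_eq h h' e) ?_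
  rw [hπ.center_comap h hs hp] at hI
  exact mem_nonZeroDivisors_of_span_eq hg (idl_injective hI)

/-- The same forms come from exponent k on the branch u = 0 and from exponent k - 1 on the branch v
= 0. Comparison of the top coefficients and cancellation show that v of the first times u of the
second is 1. So v is invertible, and the first family can be rewritten with the exponents of the
second. -/
lemma IsHilbertScheme.IsFormMap.eq_of_sides (hπ : hH.IsFormMap k π)
    {i i' : specC R ⟶ component n k H 𝒵} {α : ℂ} {hab : a + 1 + b = n} {hab' : a' + 1 + b' = n}
    {p : Param R a b} {p' : Param R a' b'} (h : i ≫ componentι n k H 𝒵 = hH.pt α p hab)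
    (h' : i' ≫ componentι n k H 𝒵 = hH.pt α p' hab') (e : i ≫ π = i' ≫ π)
    {g : R} (hg : g ∈ nonZeroDivisors R)
    (hI : (center k (n - k)).comap (i ≫ π).left = idl (Ideal.span {g}))
    (hs : a + sideShift true = k) (hp : p.coord true = 0)
    (hs' : a' + sideShift false = k) (hp' : p'.coord false = 0) : i = i' := by
  obtain rfl : a = a' + 1 := by simp only [sideShift, cond_true, cond_false] at hs hs'; omega
  obtain rfl : b' = b + 1 := by omega
  obtain ⟨h1, h2⟩ := Param.coeff_form hab hs hp α
  obtain ⟨h3, h4⟩ := Param.coeff_form hab' hs' hp' α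
  rw [← hπ.form_eq h h' e] at h3 h4
  have hl : p.lead true ∈ nonZeroDivisors R := by
    rw [hπ.center_comap h hs hp] at hI
    exact mem_nonZeroDivisors_of_span_eq hg (idl_injective hI)
  have hv : IsUnit p.v := by
    have h5 : (p'.u * p.v) * p.lead true = 1 * p.lead true := by
      have e1 : p.lead true = -(p'.u * p'.lead false) := h1.symm.trans h4
      have e2 : p'.lead false = -(p.v * p.lead true) := h3.symm.trans h2
      rw [e2] at e1
      linear_combination -e1
    exact IsUnit.of_mul_eq_one _ ((mul_comm _ _).trans
      ((mul_cancel_right_mem_nonZeroDivisors hl).mp h5))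
  obtain ⟨q, hq⟩ := p.exists_fam_eq_of_isUnit_v hv α
  refine hπ.eq_of_same (h.trans ?_) h' e hg hI (p := q)
  exact hH.pt_eq_pt_iff.mpr hq.symm

lemma IsHilbertScheme.IsFormMap.eq_of_comp_eq (hπ : hH.IsFormMap k π)
    {i i' : specC R ⟶ component n k H 𝒵} {α : ℂ} {hab : a + 1 + b = n} {hab' : a' + 1 + b' = n}
    {p : Param R a b} {p' : Param R a' b'} (h : i ≫ componentι n k H 𝒵 = hH.pt α p hab)
    (h' : i' ≫ componentι n k H 𝒵 = hH.pt α p' hab') (e : i ≫ π = i' ≫ π)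
    {g : R} (hg : g ∈ nonZeroDivisors R)
    (hI : (center k (n - k)).comap (i ≫ π).left = idl (Ideal.span {g})) : i = i' := by
  by_cases ha : a = a'
  · obtain rfl := ha
    obtain rfl : b = b' := by omega
    exact hπ.eq_of_same h h' e hg hI
  have hsub : Subsingleton R → i = i' := by
    intro _
    have : IsEmpty (specC R).left := inferInstanceAs (IsEmpty (PrimeSpectrum R))
    exact over_hom_ext fun t ↦ isEmptyElim t
  rcases hH.exists_side i h with hR | ⟨s, hs, hp⟩
  · exact hsub hR
  rcases hH.exists_side i' h' with hR | ⟨s', hs', hp'⟩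
  · exact hsub hR
  cases s <;> cases s'
  · simp only [sideShift, cond_false] at hs hs'; omega
  · exact (hπ.eq_of_sides h' h e.symm hg (e ▸ hI) hs' hp' hs hp).symm
  · exact hπ.eq_of_sides h h' e hg hI hs hp hs' hp'
  · simp only [sideShift, cond_true] at hs hs'; omega

/-- Near each point both lifts are given by parameters for a common α, and the generator of the
divisor stays regular on smaller opens; there `eq_of_comp_eq` applies. -/
lemma IsHilbertScheme.IsFormMap.hom_ext (hπ : hH.IsFormMap k π) (hn : 0 < n)
    {g g' : T ⟶ component n k H 𝒵} (e : g ≫ π = g' ≫ π)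
    (hC : IsEffectiveCartier ((center k (n - k)).comap (g ≫ π).left)) : g = g' := by
  refine over_hom_ext fun t ↦ ?_
  obtain ⟨α, ⟨a, b, hab, h⟩, a', b', hab', h'⟩ := hH.exists_mem_chartLocus hn
    ((g ≫ componentι n k H 𝒵).left t) ((g' ≫ componentι n k H 𝒵).left t)
  obtain ⟨R, _, _, i, hi, ⟨z, rfl⟩, r, hr, hI⟩ := hC.exists_nbhd t
  obtain ⟨R₁, _, _, i₁, hi₁, ⟨z₁, rfl⟩, -, p₁, hp₁⟩ :=
    hH.exists_nbhd_eq_pt hab (i ≫ g ≫ componentι n k H 𝒵) h ⊤ trivial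
  obtain ⟨R₂, _, _, i₂, hi₂, ⟨z₂, rfl⟩, -, p₂, hp₂⟩ :=
    hH.exists_nbhd_eq_pt hab' (i₁ ≫ i ≫ g' ≫ componentι n k H 𝒵) h' ⊤ trivial
  obtain ⟨φ, rfl⟩ := exists_specCMap i₁
  obtain ⟨ψ, rfl⟩ := exists_specCMap i₂
  refine ⟨_, specCMap ψ ≫ specCMap φ ≫ i, ?_, ⟨z₂, rfl⟩, ?_⟩
  · exact inferInstanceAs (IsOpenImmersion ((specCMap ψ).left ≫ (specCMap φ).left ≫ i.left))
  refine hπ.eq_of_comp_eq (α := α) (hab := hab) (hab' := hab') (p := p₁.map (ψ : R₁ →+* R₂))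
    (p' := p₂) ?_ ?_ ?_ (mem_nonZeroDivisors_of_isOpenImmersion ψ hi₂
      (mem_nonZeroDivisors_of_isOpenImmersion φ hi₁ hr)) ?_
  · rw [← hH.specCMap_pt, ← hp₁]
    simp only [Category.assoc]
  · rw [← hp₂]
    simp only [Category.assoc]
  · simp only [Category.assoc, e]
  · have e1 : ((specCMap ψ ≫ specCMap φ ≫ i) ≫ g) ≫ π =
        specCMap ψ ≫ specCMap φ ≫ i ≫ g ≫ π := by simp only [Category.assoc]
    rw [e1, Over.comp_left, Over.comp_left, Over.comp_left, IdealSheafData.comap_comp,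
      IdealSheafData.comap_comp, IdealSheafData.comap_comp, hI]
    refine (congrArg (fun z ↦ z.comap (specCMap ψ).left) (specCMap_left_comap_idl φ _)).trans ?_
    refine (specCMap_left_comap_idl ψ _).trans ?_
    rw [Ideal.map_span, Ideal.map_span, Set.image_singleton, Set.image_singleton]

/-- In a chart the component is the spectrum of a polynomial ring, and the ideal of the centre is
generated by P(0) or Q(0), which is a variable or 1. -/
lemma IsHilbertScheme.IsFormMap.isEffectiveCartier (hπ : hH.IsFormMap k π) (hn : 0 < n) :
    IsEffectiveCartier ((center k (n - k)).comap π.left) := by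
  refine isEffectiveCartier_of_cover fun x ↦ ?_
  obtain ⟨α, ⟨a, b, hab, hx⟩, -⟩ := hH.exists_mem_chartLocus hn
    ((componentι n k H 𝒵).left x) ((componentι n k H 𝒵).left x)
  have hopen := hH.isOpenImmersion_pt α hab
  have hx0 := hx
  rw [← SetLike.mem_coe, ← (hH.isOpenImmersion_pt_and_range α hab).2] at hx
  have hxc : (componentι n k H 𝒵).left x ∈ closure (genericLocus n k H 𝒵) := by
    have h1 : (componentι n k H 𝒵).left x ∈ Set.range (componentIdeal n k H 𝒵).subschemeι := ⟨x, rfl⟩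
    rw [IdealSheafData.range_subschemeι] at h1
    simpa [componentIdeal] using h1
  obtain ⟨s, hs, -⟩ := hH.exists_image_chart hab hxc hx0
  obtain ⟨m, hm⟩ := hH.exists_lift_component α (p := lineParam a b s) hab hs (lineParam_coord s)
  have hmo : IsOpenImmersion m.left ∧ x ∈ Set.range m.left := by
    have hsurj : IsClosedImmersion (specCMap (lineParam a b s).hom).left :=
      IsClosedImmersion.spec_of_surjective _ (hom_lineParam_surjective s)
    have hpb : IsPullback (specCMap (lineParam a b s).hom).left m.left
        (hH.pt α (univParam a b) hab).left (componentι n k H 𝒵).left := by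
      apply isPullback_of_ker_eq
      · rw [← Over.comp_left, ← Over.comp_left, hm, hH.specCMap_hom_pt]
      · rw [ker_componentι, hH.componentIdeal_comap_univ α hab hs, ← ker_hom_lineParam]
        exact ker_specMap _
    refine ⟨MorphismProperty.of_isPullback (P := @IsOpenImmersion) hpb hopen, ?_⟩
    obtain ⟨y, hy⟩ := hx
    obtain ⟨z, -, hz⟩ := Scheme.exists_preimage_of_isPullback hpb y x hy
    exact ⟨z, hz⟩
  obtain ⟨hmo, hxm⟩ := hmo
  refine ⟨_, _, m.left, hmo, hxm, (lineParam a b s).lead s, ?_, ?_⟩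
  · rw [mem_nonZeroDivisors_iff_ne_zero]
    cases s
    · exact Q_coeff_zero_lineParam_ne false
    · exact P_coeff_zero_lineParam_ne true
  · rw [← IdealSheafData.comap_comp, ← Over.comp_left]
    exact hπ.center_comap hm hs (lineParam_coord s)

end FormMap
end Blowup
-- Existence of lifts and the universal property of the blowup
section BlowupLift

open Scheme Polynomial

set_option linter.unusedSectionVars false

variable {R R' : Type} [CommRing R] [Algebra ℂ R] [CommRing R'] [Algebra ℂ R'] {a b a' b' n k : ℕ}
  {H : Over base} {𝒵 : (fiberProd node H).left.IdealSheafData} {T S : Over base}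

lemma taylor_taylor_neg (r : R) (E : R[X]) : taylor (-r) (taylor r E) = E := by
  rw [taylor_taylor, neg_add_cancel, taylor_zero]

/-- Undoing the translation makes the constant terms 1. With u = 0 the constraints on the top
coefficients become the degree bound for E and the equation between the top coefficients of E and F.
-/
lemma exists_param_of_forms {E F : R[X]} (hE : E.natDegree ≤ a) (hF : F.natDegree ≤ b + 1) {α : ℂ}
    (h : E.eval (algebraMap ℂ R α) = 1) (h' : F.eval (algebraMap ℂ R α) = 1) {r : R}
    (hr : F.coeff (b + 1) = -(r * E.coeff a)) :
    ∃ p : Param R a b, p.u = 0 ∧ p.v = r ∧ p.form true α = E ∧ p.form false α = F := by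
  set z := algebraMap ℂ R α
  have hE' : (taylor z E).natDegree ≤ a := (natDegree_taylor _ _).trans_le hE
  have hF' : (taylor z F).natDegree ≤ b + 1 := (natDegree_taylor _ _).trans_le hF
  have h0 : (taylor z E).coeff 0 = 1 := by rw [taylor_coeff_zero, h]
  have h0' : (taylor z F).coeff 0 = 1 := by rw [taylor_coeff_zero, h']
  refine ⟨Param.ofForms a b 0 r (zero_mul _) (taylor z E) (taylor z F), rfl, rfl, ?_, ?_⟩
  · change taylor (-z) _ = _
    rw [Param.ex_ofForms (hE'.trans (Nat.le_succ _)) h0 h0', taylor_taylor_neg]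
    rw [zero_mul, neg_zero]
    exact coeff_eq_zero_of_natDegree_lt (Nat.lt_succ_of_le hE')
  · change taylor (-z) _ = _
    rw [Param.swap_ofForms, Param.ex_ofForms hF' h0' h0, taylor_taylor_neg]
    rw [coeff_taylor_of_natDegree_le hF, coeff_taylor_of_natDegree_le hE, hr]

lemma Param.form_swap (s : Bool) (α : ℂ) (p : Param R a b) :
    p.swap.form s α = p.form (!s) α := by
  have h : p.swap.swap = p := rfl
  cases s
  · simp only [Param.form, h, Bool.not_false, cond_false, cond_true]
  · simp only [Param.form, Bool.not_true, cond_false, cond_true]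

/-- If e is invertible, -f/e is the parameter v on the branch u = 0; if f is invertible, the axes
are exchanged. The degree bound of the other form must be positive because it is one more than an
exponent. -/
lemma exists_param_of_isUnit {l : ℕ} (hn : k + l = n) {E F : R[X]} (hE : E.natDegree ≤ k)
    (hF : F.natDegree ≤ l) {α : ℂ} (h : E.eval (algebraMap ℂ R α) = 1)
    (h' : F.eval (algebraMap ℂ R α) = 1) {e f g : R} (he : E.coeff k = e * g)
    (hf : F.coeff l = f * g) (hu : (IsUnit e ∧ 0 < l) ∨ (IsUnit f ∧ 0 < k)) :
    ∃ (a b : ℕ) (_ : a + 1 + b = n) (p : Param R a b) (s : Bool), a + sideShift s = k ∧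
      p.coord s = 0 ∧ p.form true α = E ∧ p.form false α = F := by
  have key : ∀ {e f g : R} {a b : ℕ} {E F : R[X]}, E.coeff a = e * g → F.coeff (b + 1) = f * g →
      IsUnit e → ∃ r, F.coeff (b + 1) = -(r * E.coeff a) := by
    intro e f g a b E F he hf hu
    obtain ⟨c, hc⟩ := hu.exists_left_inv
    refine ⟨-(f * c), ?_⟩
    rw [he, hf]
    linear_combination (-(f * g)) * hc
  rcases hu with ⟨hu, hl⟩ | ⟨hu, hk⟩
  · obtain ⟨b, rfl⟩ : ∃ b, l = b + 1 := ⟨l - 1, by omega⟩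
    obtain ⟨r, hr⟩ := key he hf hu
    obtain ⟨p, hp, -, h1, h2⟩ := exists_param_of_forms hE hF h h' hr
    exact ⟨k, b, by omega, p, true, rfl, hp, h1, h2⟩
  · obtain ⟨a, rfl⟩ : ∃ a, k = a + 1 := ⟨k - 1, by omega⟩
    obtain ⟨r, hr⟩ := key hf he hu
    obtain ⟨p, hp, -, h1, h2⟩ := exists_param_of_forms hF hE h' h hr
    exact ⟨a, l, by omega, p.swap, false, rfl, hp,
      (p.form_swap true α).trans h2, (p.form_swap false α).trans h1⟩

section FormMap

variable {hH : IsHilbertScheme node n H 𝒵}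
  {π : component n k H 𝒵 ⟶ fiberProd (projSpace (k + 1)) (projSpace (n - k + 1))}

lemma IsHilbertScheme.IsFormMap.comp_eq (hπ : hH.IsFormMap k π) {i : specC R ⟶ component n k H 𝒵}
    {α : ℂ} {hab : a + 1 + b = n} {p : Param R a b} (h : i ≫ componentι n k H 𝒵 = hH.pt α p hab)
    {E F : R[X]} {hE : E.natDegree ≤ k} {hF : F.natDegree ≤ n - k}
    {h1 : E.eval (algebraMap ℂ R α) = 1} {h2 : F.eval (algebraMap ℂ R α) = 1}
    (e1 : p.form true α = E) (e2 : p.form false α = F) :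
    i ≫ π = prodLift (polyPt k E α hE h1) (polyPt (n - k) F α hF h2) := by
  subst e1 e2
  exact hπ i h

lemma exists_nbhd_polyPt {l : ℕ} (f : T ⟶ fiberProd (projSpace (k + 1)) (projSpace (l + 1)))
    (t : T.left) : ∃ (R : Type) (_ : CommRing R) (_ : Algebra ℂ R) (i : specC R ⟶ T),
      IsOpenImmersion i.left ∧ t ∈ Set.range i.left ∧ ∃ (α : ℂ) (E F : R[X])
        (hE : E.natDegree ≤ k) (hF : F.natDegree ≤ l) (h1 : E.eval (algebraMap ℂ R α) = 1)
        (h2 : F.eval (algebraMap ℂ R α) = 1),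
        i ≫ f = prodLift (polyPt k E α hE h1) (polyPt l F α hF h2) := by
  obtain ⟨α, hα⟩ := ((finite_notMem_projOpen_evalForm k ((f ≫ prodFst _ _).left t)).union
    (finite_notMem_projOpen_evalForm l ((f ≫ prodSnd _ _).left t))).infinite_compl.nonempty
  rw [Set.mem_compl_iff, Set.mem_union, not_or, Set.mem_ofPred_eq, Set.mem_ofPred_eq, not_not,
    not_not] at hα
  obtain ⟨R, _, _, i, hi, ht, hV⟩ := exists_specC_nbhd t
    ((f ≫ prodFst _ _).left ⁻¹ᵁ projOpen (evalForm k α) ⊓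
      (f ≫ prodSnd _ _).left ⁻¹ᵁ projOpen (evalForm l α)) hα
  obtain ⟨E, hE, h1, e1⟩ := exists_eq_polyPt (α := α) (i ≫ f ≫ prodFst _ _) (by
    rintro _ ⟨z, rfl⟩
    exact (hV ⟨z, rfl⟩).1)
  obtain ⟨F, hF, h2, e2⟩ := exists_eq_polyPt (α := α) (i ≫ f ≫ prodSnd _ _) (by
    rintro _ ⟨z, rfl⟩
    exact (hV ⟨z, rfl⟩).2)
  refine ⟨R, _, _, i, hi, ht, α, E, F, hE, hF, h1, h2, prod_hom_ext ?_ ?_⟩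
  · rw [prodLift_fst, ← e1, Category.assoc]
  · rw [prodLift_snd, ← e2, Category.assoc]

lemma specCMap_prodLift_polyPt {l : ℕ} {E F : R[X]} {α : ℂ} {hE : E.natDegree ≤ k}
    {hF : F.natDegree ≤ l} {h1 : E.eval (algebraMap ℂ R α) = 1}
    {h2 : F.eval (algebraMap ℂ R α) = 1} (φ : R →ₐ[ℂ] R') :
    ∃ (h1' : (E.map (φ : R →+* R')).eval (algebraMap ℂ R' α) = 1)
      (h2' : (F.map (φ : R →+* R')).eval (algebraMap ℂ R' α) = 1),
      specCMap φ ≫ prodLift (polyPt k E α hE h1) (polyPt l F α hF h2) =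
        prodLift (polyPt k (E.map (φ : R →+* R')) α (natDegree_map_le.trans hE) h1')
          (polyPt l (F.map (φ : R →+* R')) α (natDegree_map_le.trans hF) h2') := by
  have key : ∀ {E : R[X]}, E.eval (algebraMap ℂ R α) = 1 →
      (E.map (φ : R →+* R')).eval (algebraMap ℂ R' α) = 1 := by
    intro E h
    have := congrArg φ h
    rwa [map_one, ← AlgHom.coe_toRingHom, ← eval_map_apply, AlgHom.coe_toRingHom,
      AlgHom.commutes] at this
  refine ⟨key h1, key h2, ?_⟩
  rw [comp_prodLift, specCMap_polyPt, specCMap_polyPt]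

/-- Writing g as a combination of e and f and cancelling the regular element g gives 1 as a
combination of the cofactors. -/
lemma exists_dvd_of_span_eq {e f g : R} (hg : g ∈ nonZeroDivisors R)
    (h : Ideal.span {e} ⊔ Ideal.span {f} = Ideal.span {g}) :
    ∃ e' f', e = e' * g ∧ f = f' * g ∧ Ideal.span {e'} ⊔ Ideal.span {f'} = ⊤ := by
  obtain ⟨e', he⟩ := Ideal.mem_span_singleton'.mp
    (h ▸ Ideal.mem_sup_left (Ideal.mem_span_singleton_self e) : e ∈ Ideal.span {g})
  obtain ⟨f', hf⟩ := Ideal.mem_span_singleton'.mp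
    (h ▸ Ideal.mem_sup_right (Ideal.mem_span_singleton_self f) : f ∈ Ideal.span {g})
  refine ⟨e', f', he.symm, hf.symm, ?_⟩
  have h1 : g ∈ Ideal.span {e} ⊔ Ideal.span {f} := h ▸ Ideal.mem_span_singleton_self g
  obtain ⟨x, hx, y, hy, hxy⟩ := Submodule.mem_sup.mp h1
  obtain ⟨x, rfl⟩ := Ideal.mem_span_singleton'.mp hx
  obtain ⟨y, rfl⟩ := Ideal.mem_span_singleton'.mp hy
  have h2 : x * e' + y * f' = 1 := by
    refine (mul_cancel_right_mem_nonZeroDivisors hg).mp ?_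
    rw [← he, ← hf] at hxy
    linear_combination hxy
  rw [Ideal.eq_top_iff_one, ← h2]
  exact Submodule.add_mem_sup (Ideal.mul_mem_left _ _ (Ideal.mem_span_singleton_self _))
    (Ideal.mul_mem_left _ _ (Ideal.mem_span_singleton_self _))

lemma exists_specCMap_nbhd_isUnit {e : R} (z : (specC R).left)
    (hz : e ∉ (show PrimeSpectrum R from z).asIdeal) :
    ∃ (R' : Type) (_ : CommRing R') (_ : Algebra ℂ R') (φ : R →ₐ[ℂ] R'),
      IsOpenImmersion (specCMap φ).left ∧ z ∈ Set.range (specCMap φ).left ∧ IsUnit (φ e) := by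
  have h1 : IsOpenImmersion (specMap (algebraMap R (Localization.Away e))) :=
    inferInstanceAs (IsOpenImmersion (Spec.map (CommRingCat.ofHom (algebraMap R (Localization.Away e)))))
  refine ⟨Localization.Away e, inferInstance, inferInstance,
    IsScalarTower.toAlgHom ℂ R (Localization.Away e), h1, ?_, IsLocalization.Away.algebraMap_isUnit e⟩
  have := PrimeSpectrum.localization_away_comap_range (Localization.Away e) e
  exact this.symm ▸ (show (show PrimeSpectrum R from z) ∈ PrimeSpectrum.basicOpen e from hz)

/-- Dividing the two top coefficients by the local equation of the divisor leaves comaximal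
cofactors. At each point one of them is invertible, and near the point the forms are those of a
family in the component. -/
lemma IsHilbertScheme.IsFormMap.exists_nbhd_lift (hπ : hH.IsFormMap k π) (hn : 0 < n) (hk : k ≤ n)
    (f : T ⟶ fiberProd (projSpace (k + 1)) (projSpace (n - k + 1)))
    (hC : IsEffectiveCartier ((center k (n - k)).comap f.left)) (t : T.left) :
    ∃ (R : Type) (_ : CommRing R) (_ : Algebra ℂ R) (i : specC R ⟶ T), IsOpenImmersion i.left ∧
      t ∈ Set.range i.left ∧ ∃ m : specC R ⟶ component n k H 𝒵, m ≫ π = i ≫ f := by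
  obtain ⟨R, _, _, i, hi, ⟨z, rfl⟩, g, hg, hI⟩ := hC.exists_nbhd t
  obtain ⟨R₁, _, _, i₁, hi₁, ⟨z₁, rfl⟩, α, E, F, hE, hF, h1, h2, e⟩ := exists_nbhd_polyPt (i ≫ f) z
  obtain ⟨φ, rfl⟩ := exists_specCMap i₁
  have hspan : Ideal.span {E.coeff k} ⊔ Ideal.span {F.coeff (n - k)} = Ideal.span {φ g} := by
    have h3 := congrArg (fun z ↦ (center k (n - k)).comap z) (congrArg CommaMorphism.left e)
    refine idl_injective (((center_comap_polyPt hE hF h1 h2).symm.trans h3.symm).trans ?_)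
    change (center k (n - k)).comap (specCMap φ ≫ i ≫ f).left = _
    rw [Over.comp_left, Over.comp_left, IdealSheafData.comap_comp, IdealSheafData.comap_comp, hI]
    refine (specCMap_left_comap_idl φ _).trans ?_
    rw [Ideal.map_span, Set.image_singleton]
  obtain ⟨e', f', he, hf, htop⟩ := exists_dvd_of_span_eq
    (mem_nonZeroDivisors_of_isOpenImmersion φ hi₁ hg) hspan
  let q : PrimeSpectrum R₁ := z₁
  -- For k = n or k = 0 only one cofactor is admissible. It is a unit then, because a form of degree
  -- at most 0 with value 1 is the constant 1.
  have hu : ∃ r : R₁, r ∉ q.asIdeal ∧ ((r = e' ∧ 0 < n - k) ∨ (r = f' ∧ 0 < k)) := by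
    by_contra! hu
    apply q.2.ne_top
    rw [eq_top_iff, ← htop, sup_le_iff, Ideal.span_singleton_le_iff_mem,
      Ideal.span_singleton_le_iff_mem]
    have hone : ∀ {E : R₁[X]} {l : ℕ}, E.natDegree ≤ l → E.eval (algebraMap ℂ R₁ α) = 1 →
        l = 0 → E.coeff l = 1 := by
      rintro E l hE h rfl
      rw [eq_C_of_natDegree_le_zero hE, eval_C] at h
      exact h
    have hq : ∀ {r : R₁}, r * φ g = 1 → r ∉ q.asIdeal := fun h h' ↦
      q.2.ne_top ((Ideal.eq_top_iff_one _).mpr (h ▸ Ideal.mul_mem_right _ _ h'))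
    constructor
    · by_contra h
      have h3 := (hu e' h).1 rfl
      have h4 := hone hF h2 (Nat.le_zero.mp h3)
      exact (hu f' (hq (hf.symm.trans h4))).2 rfl |>.not_gt (by omega)
    · by_contra h
      have h3 := (hu f' h).2 rfl
      have h4 := hone hE h1 (Nat.le_zero.mp h3)
      exact (hu e' (hq (he.symm.trans h4))).1 rfl |>.not_gt (by omega)
  obtain ⟨r, hr, hu⟩ := hu
  obtain ⟨R₂, _, _, ψ, hψ, ⟨z₂, rfl⟩, hru⟩ := exists_specCMap_nbhd_isUnit z₁ hr
  obtain ⟨h1', h2', e2⟩ := specCMap_prodLift_polyPt (hE := hE) (hF := hF) (h1 := h1) (h2 := h2) ψ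
  obtain ⟨a, b, hab, p, s, hs, hp, ep, eq⟩ := exists_param_of_isUnit (Nat.add_sub_of_le hk)
    (natDegree_map_le.trans hE) (natDegree_map_le.trans hF) h1' h2' (e := ψ e') (f := ψ f')
    (g := ψ (φ g)) (by rw [coeff_map, he]; exact map_mul ψ _ _)
    (by rw [coeff_map, hf]; exact map_mul ψ _ _) (by
      rcases hu with ⟨rfl, h⟩ | ⟨rfl, h⟩
      · exact .inl ⟨hru, h⟩
      · exact .inr ⟨hru, h⟩)
  obtain ⟨m, hm⟩ := hH.exists_lift_component α hab hs hp
  refine ⟨R₂, _, _, specCMap ψ ≫ specCMap φ ≫ i, ?_, ⟨z₂, rfl⟩, m, ?_⟩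
  · exact inferInstanceAs (IsOpenImmersion ((specCMap ψ).left ≫ (specCMap φ).left ≫ i.left))
  · rw [Category.assoc, Category.assoc, e, e2]
    exact hπ.comp_eq hm ep eq

/-- Any morphism f becomes a morphism over ℂ by composition. Local lifts exist, and they are unique
on every open subscheme because the divisor stays Cartier there, so they glue to one lift. -/
lemma IsHilbertScheme.IsFormMap.isBlowup (hπ : hH.IsFormMap k π) (hn : 0 < n) (hk : k ≤ n) :
    IsBlowup π.left (center k (n - k)) := by
  refine ⟨hπ.isEffectiveCartier hn, fun T f hC ↦ ?_⟩
  let T' : Over base := Over.mk (f ≫ (fiberProd (projSpace (k + 1)) (projSpace (n - k + 1))).hom)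
  let f' : T' ⟶ fiberProd (projSpace (k + 1)) (projSpace (n - k + 1)) := Over.homMk f rfl
  have hC' : IsEffectiveCartier ((center k (n - k)).comap f'.left) := hC
  choose R hR hA i hi ht m hm using fun t : T'.left ↦ hπ.exists_nbhd_lift hn hk f' hC' t
  obtain ⟨g, hg⟩ := exists_glue_hom (fun t ↦ specC (R t)) i (fun t ↦ ⟨t, ht t⟩) m (by
    intro t t' S c d hc _ e
    refine hπ.hom_ext hn ?_ ?_
    · rw [Category.assoc, hm, Category.assoc, hm, ← Category.assoc, e, Category.assoc]
    · have e1 : (c ≫ m t) ≫ π = (c ≫ i t) ≫ f' := by rw [Category.assoc, hm, Category.assoc]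
      have hci : IsOpenImmersion (c ≫ i t).left :=
        inferInstanceAs (IsOpenImmersion (c.left ≫ (i t).left))
      rw [e1, Over.comp_left, IdealSheafData.comap_comp]
      exact hC'.comap_of_isOpenImmersion (c ≫ i t))
  have hgπ : g ≫ π = f' := over_hom_ext fun t ↦ ⟨_, i t, hi t, ht t, by
    rw [← Category.assoc, hg, hm]⟩
  refine ⟨g.left, congrArg CommaMorphism.left hgπ, fun g' hg' ↦ ?_⟩
  let G : T' ⟶ component n k H 𝒵 := Over.homMk g' (by
    rw [← Over.w π, ← Category.assoc, hg']
    rfl)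
  have hG : G ≫ π = f' := Over.OverMorphism.ext hg'
  exact congrArg CommaMorphism.left
    (hπ.hom_ext hn (hG.trans hgπ.symm) (hG ▸ hC') : G = g)

end FormMap

theorem IsHilbertScheme.exists_isBlowup (hH : IsHilbertScheme node n H 𝒵) (hn : 0 < n)
    (hk : k ≤ n) : ∃ π : component n k H 𝒵 ⟶ fiberProd (projSpace (k + 1)) (projSpace (n - k + 1)),
      IsBlowup π.left (center k (n - k)) := by
  obtain ⟨π, hπ⟩ := hH.exists_isFormMap hn k
  exact ⟨π, hπ.isBlowup hn hk⟩

end BlowupLift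
-- The intersection of two neighbouring components
section Intersection

open Scheme Polynomial

set_option linter.unusedSectionVars false

variable {R R' : Type} [CommRing R] [Algebra ℂ R] [CommRing R'] [Algebra ℂ R'] {a b n k l : ℕ}
  {H : Over base} {𝒵 : (fiberProd node H).left.IdealSheafData} {T S : Over base}

variable (n k H 𝒵) in
/-- The inclusion of the intersection of two components in the Hilbert scheme. -/
noncomputable def intersectionι (l : ℕ) : intersection n k H 𝒵 l ⟶ H :=
  Over.homMk (componentIdeal n k H 𝒵 ⊔ componentIdeal n l H 𝒵).subschemeι rfl

instance : IsClosedImmersion (intersectionι n k H 𝒵 l).left :=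
  inferInstanceAs (IsClosedImmersion (componentIdeal n k H 𝒵 ⊔ componentIdeal n l H 𝒵).subschemeι)

lemma ker_intersectionι : (intersectionι n k H 𝒵 l).left.ker =
    componentIdeal n k H 𝒵 ⊔ componentIdeal n l H 𝒵 :=
  (componentIdeal n k H 𝒵 ⊔ componentIdeal n l H 𝒵).ker_subschemeι

lemma subsingleton_of_idl_top_eq_bot (h : (⊤ : (Spec (.of R)).IdealSheafData) = ⊥) :
    Subsingleton R := by
  have h2 : (⊤ : Ideal R) = ⊥ := idl_eq_bot_iff.mp (idl_top.trans h)
  exact (Submodule.subsingleton_iff R).mp (subsingleton_of_bot_eq_top h2.symm)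

/-- The points of the intersection of two neighbouring components. -/
lemma IsHilbertScheme.exists_lift_intersection (hH : IsHilbertScheme node n H 𝒵) (α : ℂ)
    {p : Param R k b} (hab : k + 1 + b = n) (hu : p.u = 0) (hv : p.v = 0) :
    ∃ m : specC R ⟶ intersection n k H 𝒵 (k + 1),
      m ≫ intersectionι n k H 𝒵 (k + 1) = hH.pt α p hab := by
  rw [← exists_over_lift_of_ker, ker_intersectionι, IdealSheafData.comap_sup,
    hH.componentIdeal_comap_pt α p hab (s := true) (k := k) rfl,
    hH.componentIdeal_comap_pt α p hab (s := false) (k := k + 1) rfl]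
  change idl (Ideal.span {p.u}) ⊔ idl (Ideal.span {p.v}) = ⊥
  rw [hu, hv, sup_idem]
  exact idl_eq_bot_iff.mpr (by simp)

/-- Both components meet the chart with exponent a only for a = k, where their ideals are generated
by u and by v. -/
lemma IsHilbertScheme.eq_zero_of_intersection (hH : IsHilbertScheme node n H 𝒵)
    (i : specC R ⟶ intersection n k H 𝒵 (k + 1)) {α : ℂ} {p : Param R a b} {hab : a + 1 + b = n}
    (h : i ≫ intersectionι n k H 𝒵 (k + 1) = hH.pt α p hab) :
    Subsingleton R ∨ a = k ∧ p.u = 0 ∧ p.v = 0 := by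
  have h1 := (exists_over_lift_of_ker _ _).mpr ⟨i, h⟩
  rw [ker_intersectionι, IdealSheafData.comap_sup] at h1
  by_cases ha : a = k
  · subst ha
    rw [hH.componentIdeal_comap_pt α p hab (s := true) (k := a) rfl,
      hH.componentIdeal_comap_pt α p hab (s := false) (k := a + 1) rfl] at h1
    rw [← idl_sup] at h1
    have h2 := sup_eq_bot_iff.mp (idl_eq_bot_iff.mp h1)
    refine .inr ⟨rfl, ?_, ?_⟩
    · exact Ideal.span_singleton_eq_bot.mp h2.1
    · exact Ideal.span_singleton_eq_bot.mp h2.2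
  · left
    apply subsingleton_of_idl_top_eq_bot
    rw [← h1]
    symm
    by_cases hs : ∀ s, a + sideShift s ≠ k
    · rw [hH.componentIdeal_comap_pt_of_ne α p hab hs, top_sup_eq]
    · rw [hH.componentIdeal_comap_pt_of_ne α p hab (k := k + 1), sup_top_eq]
      push Not at hs
      obtain ⟨s, hs⟩ := hs
      intro s' hs'
      cases s <;> cases s' <;> simp only [sideShift, cond_true, cond_false] at hs hs' <;> omega

lemma IsHilbertScheme.natDegree_form_true_le_of_intersection (hH : IsHilbertScheme node n H 𝒵)
    (i : specC R ⟶ intersection n k H 𝒵 (k + 1)) {α : ℂ} {p : Param R a b} {hab : a + 1 + b = n}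
    (h : i ≫ intersectionι n k H 𝒵 (k + 1) = hH.pt α p hab) : (p.form true α).natDegree ≤ k := by
  obtain h | ⟨rfl, hu, -⟩ := hH.eq_zero_of_intersection i h
  · rw [Subsingleton.elim (p.form true α) 0, natDegree_zero]
    exact Nat.zero_le _
  · exact Param.natDegree_form_le (s := true) hab rfl hu true α

lemma IsHilbertScheme.natDegree_form_false_le_of_intersection (hH : IsHilbertScheme node n H 𝒵)
    {m : ℕ} (hm : k + 1 + m = n)
    (i : specC R ⟶ intersection n k H 𝒵 (k + 1)) {α : ℂ} {p : Param R a b} {hab : a + 1 + b = n}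
    (h : i ≫ intersectionι n k H 𝒵 (k + 1) = hH.pt α p hab) : (p.form false α).natDegree ≤ m := by
  obtain h | ⟨rfl, -, hv⟩ := hH.eq_zero_of_intersection i h
  · rw [Subsingleton.elim (p.form false α) 0, natDegree_zero]
    exact Nat.zero_le _
  · have := Param.natDegree_form_le (s := false) hab rfl hv false α
    refine this.trans ?_
    simp [sideDegree, sideShift]; omega

/-- With u = v = 0 the two forms have degrees at most k and m and satisfy no further relation, and
they determine the parameters. So they identify the intersection with ℙ^k × ℙ^m. -/
theorem IsHilbertScheme.nonempty_intersection_iso (hH : IsHilbertScheme node n H 𝒵) {m : ℕ}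
    (hm : k + 1 + m = n) : Nonempty
      (intersection n k H 𝒵 (k + 1) ≅ fiberProd (projSpace (m + 1)) (projSpace (k + 1))) := by
  have hn : 0 < n := by omega
  obtain ⟨x, hx⟩ := hH.exists_formMap hn (intersectionι n k H 𝒵 (k + 1)) true k
    fun i _ _ _ _ _ h ↦ hH.natDegree_form_true_le_of_intersection i h
  obtain ⟨y, hy⟩ := hH.exists_formMap hn (intersectionι n k H 𝒵 (k + 1)) false m
    fun i _ _ _ _ _ h ↦ hH.natDegree_form_false_le_of_intersection hm i h
  have hmono : ∀ {T : Over base} {g g' : T ⟶ intersection n k H 𝒵 (k + 1)},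
      g ≫ x = g' ≫ x → g ≫ y = g' ≫ y → g = g' := by
    intro T g g' ex ey
    refine over_hom_ext fun t ↦ ?_
    obtain ⟨α, ⟨a, b, hab, h⟩, a', b', hab', h'⟩ := hH.exists_mem_chartLocus hn
      ((g ≫ intersectionι n k H 𝒵 (k + 1)).left t) ((g' ≫ intersectionι n k H 𝒵 (k + 1)).left t)
    obtain ⟨R₁, _, _, i₁, hi₁, ⟨z₁, rfl⟩, -, p₁, hp₁⟩ :=
      hH.exists_nbhd_eq_pt hab (g ≫ intersectionι n k H 𝒵 (k + 1)) h ⊤ trivial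
    obtain ⟨R₂, _, _, i₂, hi₂, ⟨z₂, rfl⟩, -, p', hp'⟩ :=
      hH.exists_nbhd_eq_pt hab' (i₁ ≫ g' ≫ intersectionι n k H 𝒵 (k + 1)) h' ⊤ trivial
    obtain ⟨ψ, rfl⟩ := exists_specCMap i₂
    refine ⟨_, specCMap ψ ≫ i₁,
      inferInstanceAs (IsOpenImmersion ((specCMap ψ).left ≫ i₁.left)), ⟨z₂, rfl⟩, ?_⟩
    have e1 : ((specCMap ψ ≫ i₁) ≫ g) ≫ intersectionι n k H 𝒵 (k + 1) =
        hH.pt α (p₁.map (ψ : R₁ →+* R₂)) hab := by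
      rw [← hH.specCMap_pt, ← hp₁]
      simp only [Category.assoc]
    have e2 : ((specCMap ψ ≫ i₁) ≫ g') ≫ intersectionι n k H 𝒵 (k + 1) = hH.pt α p' hab' := by
      rw [← hp']
      simp only [Category.assoc]
    generalize p₁.map (ψ : R₁ →+* R₂) = p at e1
    have fx : p.form true α = p'.form true α := by
      have e : ((specCMap ψ ≫ i₁) ≫ g) ≫ x = ((specCMap ψ ≫ i₁) ≫ g') ≫ x := by
        simp only [Category.assoc, ex]
      rw [hx _ e1, hx _ e2] at e
      exact polyPt_inj e
    have fy : p.form false α = p'.form false α := by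
      have e : ((specCMap ψ ≫ i₁) ≫ g) ≫ y = ((specCMap ψ ≫ i₁) ≫ g') ≫ y := by
        simp only [Category.assoc, ey]
      rw [hy _ e1, hy _ e2] at e
      exact polyPt_inj e
    have hsub : Subsingleton R₂ → (specCMap ψ ≫ i₁) ≫ g = (specCMap ψ ≫ i₁) ≫ g' := by
      intro _
      have : IsEmpty (specC R₂).left := inferInstanceAs (IsEmpty (PrimeSpectrum R₂))
      exact over_hom_ext fun t ↦ isEmptyElim t
    rcases hH.eq_zero_of_intersection _ e1 with hR | ⟨ha, hu, hv⟩
    · exact hsub hR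
    rcases hH.eq_zero_of_intersection _ e2 with hR | ⟨ha', hu', hv'⟩
    · exact hsub hR
    obtain rfl : a = a' := by omega
    obtain rfl : b = b' := by omega
    refine over_mono_of_left (intersectionι n k H 𝒵 (k + 1)) ?_
    rw [e1, e2]
    congr 1
    exact Param.ext_of_ex (hu.trans hu'.symm) (hv.trans hv'.symm) (taylor_injective _ fx)
      (taylor_injective _ fy)
  have hlift : ∀ t : (fiberProd (projSpace (k + 1)) (projSpace (m + 1))).left,
      ∃ (R : Type) (_ : CommRing R) (_ : Algebra ℂ R)
        (i : specC R ⟶ fiberProd (projSpace (k + 1)) (projSpace (m + 1))),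
        IsOpenImmersion i.left ∧ t ∈ Set.range i.left ∧
        ∃ j : specC R ⟶ intersection n k H 𝒵 (k + 1), j ≫ prodLift x y = i := by
    intro t
    obtain ⟨R, _, _, i, hi, ht, α, E, F, hE, hF, h1, h2, e⟩ := exists_nbhd_polyPt (𝟙 _) t
    obtain ⟨p, hu, hv, rfl, rfl⟩ := exists_param_of_forms hE (hF.trans (Nat.le_succ _)) h1 h2
      (r := 0) (by
        rw [zero_mul, neg_zero]
        exact coeff_eq_zero_of_natDegree_lt (Nat.lt_succ_of_le hF))
    obtain ⟨j, hj⟩ := hH.exists_lift_intersection α hm hu hv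
    refine ⟨R, _, _, i, hi, ht, j, ?_⟩
    rw [← Category.comp_id i, e, comp_prodLift, hx j hj, hy j hj]
  choose R hR hA i hi ht j hj using hlift
  obtain ⟨s, hs⟩ := exists_glue_hom (fun t ↦ specC (R t)) i (fun t ↦ ⟨t, ht t⟩) j (by
    intro t t' S c d _ _ e
    have e' : (c ≫ j t) ≫ prodLift x y = (d ≫ j t') ≫ prodLift x y := by
      rw [Category.assoc, Category.assoc, hj, hj, e]
    rw [comp_prodLift, comp_prodLift] at e'
    exact hmono (prodLift_inj e').1 (prodLift_inj e').2)
  have hs1 : s ≫ prodLift x y = 𝟙 _ := over_hom_ext fun t ↦ ⟨_, i t, hi t, ht t, by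
    rw [← Category.assoc, hs, hj, Category.comp_id]⟩
  have hs2 : prodLift x y ≫ s = 𝟙 _ := by
    have e : (prodLift x y ≫ s) ≫ prodLift x y = 𝟙 _ ≫ prodLift x y := by
      rw [Category.assoc, hs1, Category.comp_id, Category.id_comp]
    rw [comp_prodLift, comp_prodLift] at e
    exact hmono (prodLift_inj e).1 (prodLift_inj e).2
  -- The second isomorphism exchanges the two factors, since the forms give ℙ^k first.
  refine ⟨⟨prodLift x y, s, hs2, hs1⟩ ≪≫ ⟨prodLift (prodSnd _ _) (prodFst _ _),
    prodLift (prodSnd _ _) (prodFst _ _), ?_, ?_⟩⟩ <;>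
  · apply prod_hom_ext <;> simp [prodLift_fst, prodLift_snd]

end Intersection
-- The case n = 0
section Empty

open Scheme

variable {T X H : Over base} {𝒵 : (fiberProd node H).left.IdealSheafData}

lemma isPullback_of_isEmpty {W X Y Z : Scheme.{0}} (f : W ⟶ X) (g : W ⟶ Y) (h : X ⟶ Z) (i : Y ⟶ Z)
    [IsEmpty W] [IsEmpty X] : IsPullback f g h i := by
  have hw : f ≫ h = g ≫ i := (isInitialOfIsEmpty (X := W)).hom_ext _ _
  have : IsEmpty (pullback h i : Scheme.{0}) := Function.isEmpty (pullback.fst h i)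
  exact IsPullback.of_iso_pullback ⟨hw⟩ (asIso (pullback.lift f g hw))
    (pullback.lift_fst _ _ _) (pullback.lift_snd _ _ _)

/-- A morphism from the empty scheme is a base change of Spec 0 → Spec ℂ, which is finite of rank 0.
-/
lemma finrank_eq_zero_of_isEmpty {W S : Scheme.{0}} (f : W ⟶ S) [IsEmpty W] (g : S ⟶ base) (t : S) :
    IsFinite f ∧ Scheme.Hom.finrank f t = 0 := by
  have hE : IsEmpty (Spec (.of PUnit.{1})) := inferInstanceAs (IsEmpty (PrimeSpectrum PUnit))
  have hW : IsEmpty (∅ : Scheme.{0}) := inferInstance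
  let q : Spec (.of PUnit.{1}) ⟶ base := specMap (algebraMap ℂ PUnit)
  have hfin : IsFinite q := by
    refine (IsFinite.SpecMap_iff _).mpr ?_
    exact RingHom.finite_algebraMap.mpr inferInstance
  have hflat : Flat q := inferInstance
  have hpb := isPullback_of_isEmpty (isInitialOfIsEmpty.to _) f q g
  refine ⟨MorphismProperty.of_isPullback (P := @IsFinite) hpb hfin, ?_⟩
  rw [Scheme.Hom.finrank_of_isPullback _ _ _ _ hpb]
  refine (Scheme.Hom.finrank_SpecMap_algebraMap ℂ PUnit _).trans ?_
  rw [Module.rankAtStalk_eq_zero_of_subsingleton]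
  rfl

lemma isFamily_top : IsFamily 0 (⊤ : (fiberProd X T).left.IdealSheafData) where
  finite := by
    by_cases h : Nonempty T.left
    · exact (finrank_eq_zero_of_isEmpty _ T.hom h.some).1
    · rw [not_nonempty_iff] at h
      infer_instance
  flat := inferInstance
  locallyOfFinitePresentation := inferInstance
  finrank_eq t := (finrank_eq_zero_of_isEmpty _ T.hom t).2

/-- A point of the subscheme would make the rank at its image at least 1. -/
lemma IsFamily.eq_top {J : (fiberProd X T).left.IdealSheafData} (h : IsFamily 0 J) : J = ⊤ := by
  have h1 := h.finite
  have h2 := h.flat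
  rw [← J.ker_subschemeι, Hom.ker_eq_top_iff_isEmpty]
  refine ⟨fun z ↦ ?_⟩
  have h3 := Scheme.Hom.one_le_finrank_map (J.subschemeι ≫ pullback.snd X.hom T.hom) z
  rw [h.finrank_eq] at h3
  exact absurd h3 (by norm_num)

theorem exists_isHilbertScheme_zero :
    ∃ (H : Over base) (𝒵 : (fiberProd node H).left.IdealSheafData), IsHilbertScheme node 0 H 𝒵 :=
  ⟨Over.mk (𝟙 base), ⊤, isFamily_top, fun T _ hJ ↦ ⟨Over.mkIdTerminal.from T,
    hJ.eq_top.trans (IdealSheafData.comap_top _).symm, fun _ _ ↦ Over.mkIdTerminal.hom_ext _ _⟩⟩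

/-- The Hilbert scheme of zero points is a point. -/
noncomputable def IsHilbertScheme.isTerminal (hH : IsHilbertScheme node 0 H 𝒵) : IsTerminal H :=
  IsTerminal.ofUniqueHom (fun T ↦ (hH.existsUnique T ⊤ isFamily_top).exists.choose) fun T f ↦
    (hH.existsUnique T ⊤ isFamily_top).unique
      (by rw [hH.isFamily.eq_top, IdealSheafData.comap_top])
      (hH.existsUnique T ⊤ isFamily_top).exists.choose_spec

noncomputable def isTerminalSpecC : IsTerminal (specC ℂ) :=
  Over.mkIdTerminal.ofIso (asIso complexPt)

lemma IsHilbertScheme.genericLocus_zero (hH : IsHilbertScheme node 0 H 𝒵) :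
    genericLocus 0 0 H 𝒵 = Set.univ := by
  have hlen : length node ⊤ = 0 := (finrank_eq_zero_of_isEmpty _ (𝟙 base) _).2
  let z : Over.mk (𝟙 base) ⟶ H := hH.isTerminal.from _
  have hz : IsIso z := isIso_of_isTerminal Over.mkIdTerminal hH.isTerminal z
  have hz' : IsIso z.left := inferInstanceAs (IsIso ((Over.forget base).map z))
  refine Set.eq_univ_of_forall fun x ↦ ⟨z, ?_, ?_, ?_, ?_⟩
  · obtain ⟨y, rfl⟩ := z.left.surjective x
    congr 1
    exact Subsingleton.elim (α := PrimeSpectrum ℂ) _ _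
  all_goals rw [hH.isFamily.eq_top, IdealSheafData.comap_top, top_sup_eq]
  · exact top_sup_eq _
  · exact hlen
  · exact hlen

lemma IsHilbertScheme.componentIdeal_zero (hH : IsHilbertScheme node 0 H 𝒵) :
    componentIdeal 0 0 H 𝒵 = ⊥ := by
  let z : specC ℂ ⟶ H := hH.isTerminal.from _
  have hz : IsIso z := isIso_of_isTerminal isTerminalSpecC hH.isTerminal z
  have hz' : IsIso z.left := inferInstanceAs (IsIso ((Over.forget base).map z))
  have h : (componentIdeal 0 0 H 𝒵).comap z.left = idl ⊥ := by
    refine comap_componentIdeal z.left (idl ⊥ : (Spec (.of ℂ)).IdealSheafData) ?_ ?_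
    · rw [radical_idl, Ideal.IsRadical.radical (Ideal.isPrime_bot.isRadical)]
    · rw [hH.genericLocus_zero, closure_univ, Set.preimage_univ]
      refine Eq.symm ((coe_support_idl _).trans ?_)
      simp
      rfl
  rw [← IdealSheafData.comap_id (componentIdeal 0 0 H 𝒵), ← IsIso.inv_hom_id z.left,
    IdealSheafData.comap_comp]
  refine (congrArg (fun J ↦ IdealSheafData.comap J (inv z.left)) (h.trans idl_bot)).trans ?_
  exact IdealSheafData.comap_bot _

noncomputable def IsHilbertScheme.isTerminal_component (hH : IsHilbertScheme node 0 H 𝒵) :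
    IsTerminal (component 0 0 H 𝒵) :=
  IsTerminal.ofUniqueHom (fun T ↦ ((exists_over_lift_of_ker (componentι 0 0 H 𝒵)
      (hH.isTerminal.from T)).mp (by
        rw [ker_componentι, hH.componentIdeal_zero, IdealSheafData.comap_bot])).choose)
    fun _ _ ↦ over_mono_of_left (componentι 0 0 H 𝒵) (hH.isTerminal.hom_ext _ _)

/-- Points are locally given by forms of degree at most 0 with value 1; such a form is 1, so there
is exactly one point over every base. -/
noncomputable def isTerminalProdProjSpace :
    IsTerminal (fiberProd (projSpace (0 + 1)) (projSpace (0 + 1))) := by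
  have hone : ∀ {R : Type} [CommRing R] [Algebra ℂ R] {E : Polynomial R} {α : ℂ},
      E.natDegree ≤ 0 → E.eval (algebraMap ℂ R α) = 1 → E = 1 := by
    intro R _ _ E α hE h
    rw [Polynomial.eq_C_of_natDegree_le_zero hE, Polynomial.eval_C] at h
    rw [Polynomial.eq_C_of_natDegree_le_zero hE, h, Polynomial.C_1]
  let P : specC ℂ ⟶ projSpace (0 + 1) := polyPt 0 1 0 (by simp) (by simp)
  refine IsTerminal.ofUniqueHom (fun T ↦ isTerminalSpecC.from T ≫ prodLift P P) fun T f ↦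
    over_hom_ext fun t ↦ ?_
  obtain ⟨R, _, _, i, hi, ht, α, E, F, hE, hF, h1, h2, e⟩ := exists_nbhd_polyPt f t
  refine ⟨_, i, hi, ht, e.trans ?_⟩
  obtain ⟨φ, hφ⟩ := exists_specCMap (i ≫ isTerminalSpecC.from T)
  obtain rfl := hone hE h1
  obtain rfl := hone hF h2
  rw [← Category.assoc, hφ, comp_prodLift]
  have key : specCMap φ ≫ P = polyPt 0 1 α hE h1 := by
    rw [specCMap_polyPt]
    exact polyPt_congr isUnit_one (by simp)
  rw [key]

lemma isEffectiveCartier_top {X : Scheme.{0}} : IsEffectiveCartier (⊤ : X.IdealSheafData) := by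
  intro x
  obtain ⟨U, hU, hx, -⟩ := exists_isAffineOpen_mem_and_subset (x := x) (U := ⊤) trivial
  exact ⟨⟨U, hU⟩, hx, 1, one_mem _, by simp⟩

/-- Component and product are both the point and the centre is empty, so the blowup is an
isomorphism. -/
theorem IsHilbertScheme.exists_isBlowup_zero (hH : IsHilbertScheme node 0 H 𝒵) :
    ∃ π : component 0 0 H 𝒵 ⟶ fiberProd (projSpace (0 + 1)) (projSpace (0 - 0 + 1)),
      IsBlowup π.left (center 0 (0 - 0)) := by
  let π : component 0 0 H 𝒵 ⟶ fiberProd (projSpace (0 + 1)) (projSpace (0 + 1)) :=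
    isTerminalProdProjSpace.from _
  have hπ : IsIso π := isIso_of_isTerminal hH.isTerminal_component isTerminalProdProjSpace π
  have hπ' : IsIso π.left := inferInstanceAs (IsIso ((Over.forget base).map π))
  refine ⟨π, ?_, fun T f _ ↦ ⟨f ≫ inv π.left, by simp, fun g hg ↦ by simp [← hg]⟩⟩
  have h : center 0 (0 - 0) = ⊤ := by
    have h0 : IsEmpty (projSpace 0).left := ⟨fun t ↦ by
      obtain ⟨j, -⟩ := exists_mem_projOpen_X t
      exact j.elim0⟩
    rw [center, Hom.ker_eq_top_iff_isEmpty]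
    exact Function.isEmpty (pullback.fst (projSpace 0).hom (projSpace (0 - 0)).hom)
  rw [h, IdealSheafData.comap_top]
  exact isEffectiveCartier_top

theorem IsHilbertScheme.closure_genericLocus_zero (hH : IsHilbertScheme node 0 H 𝒵) :
    closure (genericLocus 0 0 H 𝒵) ∈ irreducibleComponents H.left := by
  let z : specC ℂ ⟶ H := hH.isTerminal.from _
  have hz : IsIso z := isIso_of_isTerminal isTerminalSpecC hH.isTerminal z
  have hz' : IsIso z.left := inferInstanceAs (IsIso ((Over.forget base).map z))
  have hx : (Set.univ : Set H.left) = {z.left (⊥ : PrimeSpectrum ℂ)} := by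
    refine (Set.eq_singleton_iff_unique_mem.mpr ⟨trivial, fun x _ ↦ ?_⟩)
    obtain ⟨y, rfl⟩ := z.left.surjective x
    congr 1
    exact Subsingleton.elim (α := PrimeSpectrum ℂ) _ _
  rw [hH.genericLocus_zero, closure_univ]
  refine ⟨?_, fun _ _ _ ↦ Set.subset_univ _⟩
  rw [hx]
  exact isIrreducible_singleton

end Empty
end NodalHilbert

/-! ### The theorem -/

open NodalHilbert in
theorem mainTheorem5 (n : ℕ) :
    (∃ (H : Over base) (𝒵 : (fiberProd node H).left.IdealSheafData), IsHilbertScheme node n H 𝒵) ∧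
    ∀ (H : Over base) (𝒵 : (fiberProd node H).left.IdealSheafData), IsHilbertScheme node n H 𝒵 →
      (∀ k ≤ n,
        closure (genericLocus n k H 𝒵) ∈ irreducibleComponents H.left ∧
        ∃ π : component n k H 𝒵 ⟶ fiberProd (projSpace (k + 1)) (projSpace (n - k + 1)),
          IsBlowup π.left (center k (n - k))) ∧
      (∀ k < n, Nonempty
        (intersection n k H 𝒵 (k + 1) ≅ fiberProd (projSpace (n - k)) (projSpace (k + 1)))) ∧
      (∀ k l, k + 1 < l → l ≤ n → IsEmpty (intersection n k H 𝒵 l).left) := by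
  -- The charts need a + 1 + b = n, so none exists for the empty subscheme, and n = 0 is treated
  -- directly.
  rcases n.eq_zero_or_pos with rfl | hn
  · refine ⟨exists_isHilbertScheme_zero, fun H 𝒵 hH ↦ ⟨fun k hk ↦ ?_, fun k hk ↦ ?_, ?_⟩⟩
    · obtain rfl := Nat.le_zero.mp hk
      exact ⟨hH.closure_genericLocus_zero, hH.exists_isBlowup_zero⟩
    · exact absurd hk k.not_lt_zero
    · intro k l hkl hl
      omega
  · refine ⟨exists_isHilbertScheme_of_pos hn, fun H 𝒵 hH ↦ ⟨fun k hk ↦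
      ⟨hH.closure_genericLocus_mem_irreducibleComponents hn hk, hH.exists_isBlowup hn hk⟩,
      fun k hk ↦ ?_, fun k l ↦ hH.isEmpty_intersection⟩⟩
    have h := hH.nonempty_intersection_iso (m := n - k - 1) (k := k) (by omega)
    rwa [Nat.sub_add_cancel (by omega : 1 ≤ n - k)] at h
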